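/- **Setting.** Let $M$ be a Riemannian manifold on which a connected Lie group $\mathsf{G}$ acts smoothly, transitively, by isometries and almost effectively (the elements acting trivially on $M$ form a discrete subgroup). Let $o\in M$, let $\mathsf{K}$ be the isotropy group of $o$, so that $M=\mathsf{G}/\mathsf{K}$, and let $\mathfrak{g}=\mathfrak{k}\oplus\mathfrak{p}$ be a reductive decomposition: $\mathfrak{k}$ is the Lie algebra of $\mathsf{K}$ and $\operatorname{Ad}(\mathsf{K})\mathfrak{p}=\mathfrak{p}$. Subscripts $\mathfrak{k}$ and $\mathfrak{p}$ denote the corresponding projections. For $X\in\mathfrak{g}$ let $X^*_p=\frac{d}{dt}\big|_{t=0}\operatorname{Exp}(tX)\cdot p$ be its fundamental vector field on $M$, and identify $\mathfrak{p}$ with $T_oM$ by $X\mapsto X^*_o$, which gives an inner product on $\mathfrak{p}$. Assume that $M=\mathsf{G}/\mathsf{K}$ is naturally reductive with respect to this decomposition: $$\langle [Z,X]_{\mathfrak{p}},Y\rangle+\langle X,[Z,Y]_{\mathfrak{p}}\rangle=0\qquad\text{for all }X,Y,Z\in\mathfrak{p}.$$ Let $\nabla$ be the Levi-Civita connection of $M$,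 and let $\nabla^c$ be the canonical connection, that is, the $\mathsf{G}$-invariant affine connection on $M$ with $(\nabla^c_{X^*}Y^*)_o=-([X,Y]_{\mathfrak{p}})^*_o$ for $X,Y\in\mathfrak{p}$. Let $R$ and $R^c$ be their curvature tensors, and let $D=\nabla-\nabla^c$ be the difference tensor. A subspace $V\subseteq T_xM$ is *invariant* under $D$ if $D_VV\subseteq V$, and invariant under $R$ (resp. $R^c$) if $R(V,V)V\subseteq V$ (resp. $R^c(V,V)V\subseteq V$). An immersion $f\colon\Sigma\to M$ of a connected manifold, endowed with the induced metric, is *totally geodesic* if it maps geodesics of $\Sigma$ to geodesics of $M$; it is *complete* if $\Sigma$ is complete; it is *$D$-invariant* if $f_*(T_p\Sigma)\subseteq T_{f(p)}M$ is invariant under $D$ for every $p\in\Sigma$; and it is *compatible* if the map $p\mapsto (f(p),f_*(T_p\Sigma))$ is injective. A Lie subalgebra $\mathfrak{s}\subseteq\mathfrak{g}$ is *canonically embedded* if $\mathfrak{s}=(\mathfrak{s}\cap\mathfrak{k})\oplus(\mathfrak{s}\cap\mathfrak{p})$. Lie subgroups are immersed, not necessarily closed. **Theorem.** Let $\mathfrak{v}\subseteq\mathfrak{p}\equiv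 T_oM$ be a vector subspace. The following conditions are equivalent: * (i) The subspace $\mathfrak{v}$ is invariant under $R$ and $D$. * (ii) The subspace $\mathfrak{v}$ is invariant under $R^c$ and $D$. * (iii) There exists a connected Lie subgroup $\mathsf{S}\subseteq\mathsf{G}$ whose Lie algebra $\mathfrak{s}$ is canonically embedded in $\mathfrak{g}$ and such that $T_o(\mathsf{S}\cdot o)=\mathfrak{v}$. * (iv) There exists a connected, injectively immersed, complete, $D$-invariant totally geodesic submanifold $\Sigma$ of $M$ such that $o\in\Sigma$ and $T_o\Sigma=\mathfrak{v}$. Furthermore, if any of these conditions holds, then, writing $[\mathfrak{v},\mathfrak{v}]$ for the linear span of the brackets of elements of $\mathfrak{v}$: * (1) $[\mathfrak{v},\mathfrak{v}]+\mathfrak{v}=[\mathfrak{v},\mathfrak{v}]_{\mathfrak{k}}\oplus\mathfrak{v}$, there is a connected Lie subgroup $\mathsf{S}$ of $\mathsf{G}$ with Lie algebra $\mathfrak{s}=[\mathfrak{v},\mathfrak{v}]+\mathfrak{v}$, and every such $\mathsf{S}$ satisfies the conditions of (iii). * (2) For $\mathsf{S}$ as in (1), the complete totally geodesic submanifold $\Sigma$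 through $o$ with tangent space $\mathfrak{v}$ is $\Sigma=\mathsf{S}\cdot o$: if $f\colon\Sigma\to M$ is any connected, complete, compatible totally geodesic immersion such that $f(p)=o$ and $f_*(T_p\Sigma)=\mathfrak{v}$ for some $p\in\Sigma$, then $f$ is injective, $f(\Sigma)=\mathsf{S}\cdot o$, and the orbit map $\mathsf{S}\to M$, $s\mapsto s\cdot o$, is of the form $f\circ h$ with $h\colon\mathsf{S}\to\Sigma$ smooth. -/

import Mathlib

open scoped Manifold ContDiff Bundle
open Bundle VectorField
set_option linter.unusedSectionVars false

section
variable {E : Type*} [NormedAddCommGroup E] [NormedSpace ℝ E] [FiniteDimensional ℝ E]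
  {M : Type*} [TopologicalSpace M] [ChartedSpace E M] [IsManifold 𝓘(ℝ, E) ∞ M]
  [RiemannianBundle (fun x : M ↦ TangentSpace 𝓘(ℝ, E) x)]
  [IsContMDiffRiemannianBundle 𝓘(ℝ, E) ∞ E (fun x : M ↦ TangentSpace 𝓘(ℝ, E) x)]

theorem mdifferentiableAt_inner_tangent {X Y : Π x : M, TangentSpace 𝓘(ℝ, E) x} {x : M}
    (hX : MDiffAt (T% X) x) (hY : MDiffAt (T% Y) x) :
    MDiffAt (fun y ↦ (inner ℝ (X y) (Y y) : ℝ)) x := by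
  refine MDifferentiableAt.inner_bundle (IB := 𝓘(ℝ, E)) (F := E)
    (E := fun x : M ↦ TangentSpace 𝓘(ℝ, E) x) (b := id) (v := X) (w := Y) ?_ ?_
  · exact hX
  · exact hY

/-- The right-hand side of the Koszul formula, `2 ⟨∇_X Y, Z⟩` at `x`. -/
noncomputable def koszul (X Y Z : Π x : M, TangentSpace 𝓘(ℝ, E) x) (x : M) : ℝ :=
  d% (fun y ↦ (inner ℝ (Y y) (Z y) : ℝ)) x (X x) + d% (fun y ↦ (inner ℝ (X y) (Z y) : ℝ)) x (Y x)
    - d% (fun y ↦ (inner ℝ (X y) (Y y) : ℝ)) x (Z x)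
    + inner ℝ (mlieBracket 𝓘(ℝ, E) X Y x) (Z x) - inner ℝ (mlieBracket 𝓘(ℝ, E) X Z x) (Y x)
    - inner ℝ (mlieBracket 𝓘(ℝ, E) Y Z x) (X x)

theorem koszul_tensorial_left (Y Z : Π x : M, TangentSpace 𝓘(ℝ, E) x) (x : M)
    (hY : MDiffAt (T% Y) x) (hZ : MDiffAt (T% Z) x) :
    TensorialAt 𝓘(ℝ, E) E (fun X ↦ koszul X Y Z x) x where
  smul {f X} hf hX := by
    simp only [koszul, Pi.smul_apply', inner_smul_left, inner_smul_right, conj_trivial]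
    rw [mvfderiv_fun_mul hf (mdifferentiableAt_inner_tangent hX hZ),
      mvfderiv_fun_mul hf (mdifferentiableAt_inner_tangent hX hY),
      mlieBracket_smul_left hf hX, mlieBracket_smul_left hf hX]
    simp [inner_add_left, inner_smul_left]
    ring
  add {X X'} hX hX' := by
    simp only [koszul, Pi.add_apply, inner_add_left, inner_add_right, map_add]
    rw [mvfderiv_fun_add (mdifferentiableAt_inner_tangent hX hZ)
        (mdifferentiableAt_inner_tangent hX' hZ),
      mvfderiv_fun_add (mdifferentiableAt_inner_tangent hX hY)
        (mdifferentiableAt_inner_tangent hX' hY),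
      mlieBracket_add_left hX hX', mlieBracket_add_left hX hX']
    simp [inner_add_left]
    ring

theorem koszul_tensorial_right (X Y : Π x : M, TangentSpace 𝓘(ℝ, E) x) (x : M)
    (hX : MDiffAt (T% X) x) (hY : MDiffAt (T% Y) x) :
    TensorialAt 𝓘(ℝ, E) E (fun Z ↦ koszul X Y Z x) x where
  smul {f Z} hf hZ := by
    simp only [koszul, Pi.smul_apply', inner_smul_right]
    rw [mvfderiv_fun_mul hf (mdifferentiableAt_inner_tangent hX hZ),
      mvfderiv_fun_mul hf (mdifferentiableAt_inner_tangent hY hZ),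
      mlieBracket_smul_right hf hZ, mlieBracket_smul_right hf hZ]
    simp [inner_add_left, inner_smul_left]
    rw [real_inner_comm (X x) (Z x), real_inner_comm (Y x) (Z x)]
    ring
  add {Z Z'} hZ hZ' := by
    simp only [koszul, Pi.add_apply, inner_add_right, map_add]
    rw [mvfderiv_fun_add (mdifferentiableAt_inner_tangent hX hZ)
        (mdifferentiableAt_inner_tangent hX hZ'),
      mvfderiv_fun_add (mdifferentiableAt_inner_tangent hY hZ)
        (mdifferentiableAt_inner_tangent hY hZ'),
      mlieBracket_add_right hZ hZ', mlieBracket_add_right hZ hZ']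
    simp [inner_add_left]
    ring

theorem koszul_smul_mid (X Y Z : Π x : M, TangentSpace 𝓘(ℝ, E) x) (f : M → ℝ) (x : M)
    (hf : MDiffAt f x) (hX : MDiffAt (T% X) x) (hY : MDiffAt (T% Y) x) (hZ : MDiffAt (T% Z) x) :
    koszul X (f • Y) Z x = f x * koszul X Y Z x + 2 * (d% f x (X x) * inner ℝ (Y x) (Z x)) := by
  simp only [koszul, Pi.smul_apply', inner_smul_left, inner_smul_right, conj_trivial]
  rw [mvfderiv_fun_mul hf (mdifferentiableAt_inner_tangent hY hZ),
    mvfderiv_fun_mul hf (mdifferentiableAt_inner_tangent hX hY),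
    mlieBracket_smul_right hf hY, mlieBracket_smul_left hf hY]
  simp [inner_add_left, inner_smul_left]
  rw [real_inner_comm (X x) (Y x)]
  ring

theorem koszul_add_mid (X Y Y' Z : Π x : M, TangentSpace 𝓘(ℝ, E) x) (x : M)
    (hX : MDiffAt (T% X) x) (hY : MDiffAt (T% Y) x) (hY' : MDiffAt (T% Y') x)
    (hZ : MDiffAt (T% Z) x) :
    koszul X (Y + Y') Z x = koszul X Y Z x + koszul X Y' Z x := by
  simp only [koszul, Pi.add_apply, inner_add_left, inner_add_right, map_add]
  rw [mvfderiv_fun_add (mdifferentiableAt_inner_tangent hY hZ)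
      (mdifferentiableAt_inner_tangent hY' hZ),
    mvfderiv_fun_add (mdifferentiableAt_inner_tangent hX hY)
      (mdifferentiableAt_inner_tangent hX hY'),
    mlieBracket_add_right hY hY', mlieBracket_add_left hY hY']
  simp [inner_add_left]
  ring

theorem koszul_sub_swap (X Y Z : Π x : M, TangentSpace 𝓘(ℝ, E) x) (x : M) :
    koszul X Y Z x - koszul Y X Z x = 2 * inner ℝ (mlieBracket 𝓘(ℝ, E) X Y x) (Z x) := by
  have h : (fun y ↦ (inner ℝ (X y) (Y y) : ℝ)) = fun y ↦ inner ℝ (Y y) (X y) := by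
    ext y; exact real_inner_comm _ _
  simp only [koszul, h]
  rw [mlieBracket_swap_apply (V := Y) (W := X), inner_neg_left]
  ring

theorem koszul_add_swap (X Y Z : Π x : M, TangentSpace 𝓘(ℝ, E) x) (x : M) :
    koszul X Y Z x + koszul X Z Y x = 2 * d% (fun y ↦ (inner ℝ (Y y) (Z y) : ℝ)) x (X x) := by
  have h : (fun y ↦ (inner ℝ (Y y) (Z y) : ℝ)) = fun y ↦ inner ℝ (Z y) (Y y) := by
    ext y; exact real_inner_comm _ _
  simp only [koszul, h]
  rw [mlieBracket_swap_apply (V := Z) (W := Y), inner_neg_left]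
  ring

open scoped Classical in
/-- The Koszul formula as a map on vector fields: `koszulMap Y x v` is the vector `∇_v Y`. -/
noncomputable def koszulMap (Y : Π x : M, TangentSpace 𝓘(ℝ, E) x) (x : M) :
    TangentSpace 𝓘(ℝ, E) x →L[ℝ] TangentSpace 𝓘(ℝ, E) x :=
  if hY : MDiffAt (T% Y) x then
    haveI : FiniteDimensional ℝ (TangentSpace 𝓘(ℝ, E) x) := inferInstanceAs (FiniteDimensional ℝ E)
    let B := TensorialAt.mkHom₂ (fun X Z ↦ koszul X Y Z x) x
      (fun Z hZ ↦ koszul_tensorial_left Y Z x hY hZ)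
      (fun X hX ↦ koszul_tensorial_right X Y x hX hY)
    (1 / 2 : ℝ) • ∑ i, (B.flip (stdOrthonormalBasis ℝ (TangentSpace 𝓘(ℝ, E) x) i)).smulRight
      (stdOrthonormalBasis ℝ (TangentSpace 𝓘(ℝ, E) x) i)
  else 0

theorem inner_koszulMap (X Y Z : Π x : M, TangentSpace 𝓘(ℝ, E) x) (x : M)
    (hX : MDiffAt (T% X) x) (hY : MDiffAt (T% Y) x) (hZ : MDiffAt (T% Z) x) :
    inner ℝ (koszulMap Y x (X x)) (Z x) = (1 / 2) * koszul X Y Z x := by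
  have : FiniteDimensional ℝ (TangentSpace 𝓘(ℝ, E) x) := inferInstanceAs (FiniteDimensional ℝ E)
  rw [koszulMap, dif_pos hY]
  set B := TensorialAt.mkHom₂ (fun X Z ↦ koszul X Y Z x) x
      (fun Z hZ ↦ koszul_tensorial_left Y Z x hY hZ)
      (fun X hX ↦ koszul_tensorial_right X Y x hX hY) with hB
  have hBXZ : B (X x) (Z x) = koszul X Y Z x := TensorialAt.mkHom₂_apply _ _ hX hZ
  have hsum : B (X x) (Z x) = ∑ i, B (X x) (stdOrthonormalBasis ℝ (TangentSpace 𝓘(ℝ, E) x) i) *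
      inner ℝ (stdOrthonormalBasis ℝ (TangentSpace 𝓘(ℝ, E) x) i) (Z x) := by
    conv_lhs => rw [← (stdOrthonormalBasis ℝ (TangentSpace 𝓘(ℝ, E) x)).sum_repr' (Z x)]
    simp [map_sum, mul_comm]
  rw [← hBXZ, hsum]
  simp [sum_inner, inner_smul_left, Finset.mul_sum]

/-- A covariant derivative `∇` on the tangent bundle of a Riemannian manifold is a Levi-Civita
connection if it is torsion-free and compatible with the metric. -/
structure IsLeviCivita
    (cov : CovariantDerivative 𝓘(ℝ, E) E (fun x : M ↦ TangentSpace 𝓘(ℝ, E) x)) : Prop where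
  torsion_eq_zero : cov.torsion = 0
  metric : ∀ (X Y Z : Π x : M, TangentSpace 𝓘(ℝ, E) x) (x : M),
    MDiffAt (T% X) x → MDiffAt (T% Y) x → MDiffAt (T% Z) x →
    d% (fun y ↦ (inner ℝ (Y y) (Z y) : ℝ)) x (X x) =
      inner ℝ (cov Y x (X x)) (Z x) + inner ℝ (Y x) (cov Z x (X x))

theorem ext_inner_extend {x : M} {v w : TangentSpace 𝓘(ℝ, E) x}
    (h : ∀ Z : Π x : M, TangentSpace 𝓘(ℝ, E) x, MDiffAt (T% Z) x →
      (inner ℝ v (Z x) : ℝ) = inner ℝ w (Z x)) : v = w := by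
  refine ext_inner_right ℝ fun u ↦ ?_
  have := h (FiberBundle.extend E u) (FiberBundle.mdifferentiableAt_extend ..)
  simpa using this

/-- The Levi-Civita connection, constructed from the Koszul formula. -/
noncomputable def leviCivita (E : Type*) [NormedAddCommGroup E] [NormedSpace ℝ E]
    [FiniteDimensional ℝ E]
    (M : Type*) [TopologicalSpace M] [ChartedSpace E M] [IsManifold 𝓘(ℝ, E) ∞ M]
    [RiemannianBundle (fun x : M ↦ TangentSpace 𝓘(ℝ, E) x)]
    [IsContMDiffRiemannianBundle 𝓘(ℝ, E) ∞ E (fun x : M ↦ TangentSpace 𝓘(ℝ, E) x)] :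
    CovariantDerivative 𝓘(ℝ, E) E (fun x : M ↦ TangentSpace 𝓘(ℝ, E) x) where
  toFun := koszulMap
  isCovariantDerivativeOnUniv :=
    { add := by
        intro Y Y' x hY hY' _
        ext1 v
        refine ext_inner_extend fun Z hZ ↦ ?_
        obtain ⟨X, hX, rfl⟩ : ∃ X : Π x : M, TangentSpace 𝓘(ℝ, E) x,
            MDiffAt (T% X) x ∧ X x = v :=
          ⟨FiberBundle.extend E v, FiberBundle.mdifferentiableAt_extend .., by simp⟩
        rw [inner_koszulMap X _ Z x hX (mdifferentiableAt_add_section hY hY') hZ,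
          koszul_add_mid X Y Y' Z x hX hY hY' hZ, add_apply,
          inner_add_left, inner_koszulMap X Y Z x hX hY hZ, inner_koszulMap X Y' Z x hX hY' hZ]
        ring
      leibniz := by
        intro Y f x hY hf _
        ext1 v
        refine ext_inner_extend fun Z hZ ↦ ?_
        obtain ⟨X, hX, rfl⟩ : ∃ X : Π x : M, TangentSpace 𝓘(ℝ, E) x,
            MDiffAt (T% X) x ∧ X x = v :=
          ⟨FiberBundle.extend E v, FiberBundle.mdifferentiableAt_extend .., by simp⟩
        rw [inner_koszulMap X _ Z x hX (hf.smul_section hY) hZ,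
          koszul_smul_mid X Y Z f x hf hX hY hZ, add_apply,
          inner_add_left, smul_apply, inner_smul_left,
          inner_koszulMap X Y Z x hX hY hZ, ContinuousLinearMap.smulRight_apply,
          inner_smul_left]
        simp
        ring }

theorem isLeviCivita_leviCivita : IsLeviCivita (leviCivita E M) := by
  have hcov : ∀ (X Y Z : Π x : M, TangentSpace 𝓘(ℝ, E) x) (x : M),
      MDiffAt (T% X) x → MDiffAt (T% Y) x → MDiffAt (T% Z) x →
      inner ℝ (leviCivita E M Y x (X x)) (Z x) = (1 / 2) * koszul X Y Z x := inner_koszulMap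
  refine ⟨?_, ?_⟩
  · rw [CovariantDerivative.torsion_eq_zero_iff]
    intro X Y x hX hY
    refine ext_inner_extend fun Z hZ ↦ ?_
    rw [inner_sub_left, hcov X Y Z x hX hY hZ, hcov Y X Z x hY hX hZ]
    linarith [koszul_sub_swap X Y Z x]
  · intro X Y Z x hX hY hZ
    rw [hcov X Y Z x hX hY hZ, real_inner_comm, hcov X Z Y x hX hZ hY]
    linarith [koszul_add_swap X Y Z x]

end

section Curvature

variable {E : Type*} [NormedAddCommGroup E] [NormedSpace ℝ E] [FiniteDimensional ℝ E]
  {M : Type*} [TopologicalSpace M] [ChartedSpace E M] [IsManifold 𝓘(ℝ, E) ∞ M]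

/-- The curvature `R(X, Y)Z = ∇_X ∇_Y Z - ∇_Y ∇_X Z - ∇_[X, Y] Z` of a connection. -/
noncomputable def curvature (cov : CovariantDerivative 𝓘(ℝ, E) E (fun x : M ↦ TangentSpace 𝓘(ℝ, E) x))
    (X Y Z : Π x : M, TangentSpace 𝓘(ℝ, E) x) (x : M) : TangentSpace 𝓘(ℝ, E) x :=
  cov (fun y ↦ cov Z y (Y y)) x (X x) - cov (fun y ↦ cov Z y (X y)) x (Y x)
    - cov Z x (mlieBracket 𝓘(ℝ, E) X Y x)

/-- `V ⊆ T_x M` is invariant under the curvature tensor: `R(V, V)V ⊆ V`. Vectors in `V` are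
represented by smooth vector fields through them. -/
def IsCurvatureInvariant
    (cov : CovariantDerivative 𝓘(ℝ, E) E (fun x : M ↦ TangentSpace 𝓘(ℝ, E) x))
    (x : M) (V : Submodule ℝ (TangentSpace 𝓘(ℝ, E) x)) : Prop :=
  ∀ X Y Z : Π x : M, TangentSpace 𝓘(ℝ, E) x,
    CMDiff ∞ (T% X) → CMDiff ∞ (T% Y) → CMDiff ∞ (T% Z) →
    X x ∈ V → Y x ∈ V → Z x ∈ V → curvature cov X Y Z x ∈ V

end Curvature

section Geodesics

variable {E : Type*} [NormedAddCommGroup E] [NormedSpace ℝ E]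
  {N : Type*} [TopologicalSpace N] [ChartedSpace E N]

/-- The coordinate expression, in the preferred chart at `x₀`, of a family of forms on the tangent
spaces of `N`, evaluated at the point with coordinates `y` and on the coordinate vectors `a, b`. -/
noncomputable def chartMetric
    (g : Π x : N, TangentSpace 𝓘(ℝ, E) x → TangentSpace 𝓘(ℝ, E) x → ℝ) (x₀ : N) (y a b : E) : ℝ :=
  g ((extChartAt 𝓘(ℝ, E) x₀).symm y)
    (mfderiv 𝓘(ℝ, E) 𝓘(ℝ, E) (extChartAt 𝓘(ℝ, E) x₀).symm y a)
    (mfderiv 𝓘(ℝ, E) 𝓘(ℝ, E) (extChartAt 𝓘(ℝ, E) x₀).symm y b)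

/-- `γ` is a geodesic of the Riemannian metric `g` on the open set `J` of times: it is smooth there
and, in coordinates `u = φ ∘ γ`, it satisfies the geodesic equation, in the form of the
Euler-Lagrange equation `d/dt g_u(u', w) = (1/2) ∂_w g_u(u', u')` (for all coordinate vectors `w`)
of the energy functional. -/
def IsGeodesicOn (g : Π x : N, TangentSpace 𝓘(ℝ, E) x → TangentSpace 𝓘(ℝ, E) x → ℝ)
    (γ : ℝ → N) (J : Set ℝ) : Prop :=
  ContMDiffOn 𝓘(ℝ, ℝ) 𝓘(ℝ, E) ∞ γ J ∧
    ∀ t ∈ J, ∀ w : E,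
      letI u : ℝ → E := fun s ↦ extChartAt 𝓘(ℝ, E) (γ t) (γ s)
      HasDerivAt (fun s ↦ chartMetric g (γ t) (u s) (deriv u s) w)
        ((1 / 2) * fderiv ℝ (fun y ↦ chartMetric g (γ t) y (deriv u t) (deriv u t)) (u t) w) t

/-- Geodesic completeness: every tangent vector is the initial velocity of a geodesic which is
defined for all times. -/
def IsGeodesicallyComplete
    (g : Π x : N, TangentSpace 𝓘(ℝ, E) x → TangentSpace 𝓘(ℝ, E) x → ℝ) : Prop :=
  ∀ (x : N) (v : TangentSpace 𝓘(ℝ, E) x), ∃ γ : ℝ → N, IsGeodesicOn g γ Set.univ ∧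
    (⟨γ 0, mfderiv 𝓘(ℝ, ℝ) 𝓘(ℝ, E) γ 0 (1 : ℝ)⟩ : TangentBundle 𝓘(ℝ, E) N) = ⟨x, v⟩

end Geodesics

/-- An immersed submanifold of `M`: a manifold together with a (not necessarily injective)
immersion into `M`. -/
structure ImmersedSubmanifold.{w, v} (E : Type w) [NormedAddCommGroup E] [NormedSpace ℝ E]
    (M : Type v) [TopologicalSpace M] [ChartedSpace E M] where
  /-- The underlying manifold. -/
  Carrier : Type v
  /-- Its dimension. -/
  dim : ℕ
  [top : TopologicalSpace Carrier]
  [t2 : T2Space Carrier]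
  [secondCountable : SecondCountableTopology Carrier]
  [charted : ChartedSpace (EuclideanSpace ℝ (Fin dim)) Carrier]
  [isManifold : IsManifold (𝓡 dim) ∞ Carrier]
  /-- The immersion. -/
  toFun : Carrier → M
  contMDiff : ContMDiff (𝓡 dim) 𝓘(ℝ, E) ∞ toFun
  injective_mfderiv : ∀ p, Function.Injective (mfderiv (𝓡 dim) 𝓘(ℝ, E) toFun p)

namespace ImmersedSubmanifold

attribute [instance] top t2 secondCountable charted isManifold

variable {E : Type*} [NormedAddCommGroup E] [NormedSpace ℝ E] [FiniteDimensional ℝ E]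
  {M : Type*} [TopologicalSpace M] [ChartedSpace E M]

/-- The tangent space of the submanifold at the parameter `p`, as a subspace of `T_{f p} M`. -/
noncomputable def tangentSpace (S : ImmersedSubmanifold E M) (p : S.Carrier) :
    Submodule ℝ (TangentSpace 𝓘(ℝ, E) (S.toFun p)) :=
  (mfderiv (𝓡 S.dim) 𝓘(ℝ, E) S.toFun p).toLinearMap.range

/-- The map `p ↦ (f p, f_* T_p Σ)` into the Grassmann bundle of `TM`. -/
noncomputable def gaussMap (S : ImmersedSubmanifold E M) (p : S.Carrier) :
    Σ x : M, Submodule ℝ (TangentSpace 𝓘(ℝ, E) x) :=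
  ⟨S.toFun p, S.tangentSpace p⟩

/-- The immersion is compatible: at points of self-intersection the tangent spaces differ. -/
def IsCompatible (S : ImmersedSubmanifold E M) : Prop :=
  Function.Injective S.gaussMap

section Riemannian

variable [IsManifold 𝓘(ℝ, E) ∞ M]
  [RiemannianBundle (fun x : M ↦ TangentSpace 𝓘(ℝ, E) x)]
  [IsContMDiffRiemannianBundle 𝓘(ℝ, E) ∞ E (fun x : M ↦ TangentSpace 𝓘(ℝ, E) x)]

/-- The Riemannian metric on the submanifold induced by the immersion. -/
noncomputable def inducedMetric (S : ImmersedSubmanifold E M) (p : S.Carrier)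
    (u v : TangentSpace (𝓡 S.dim) p) : ℝ :=
  inner ℝ (mfderiv (𝓡 S.dim) 𝓘(ℝ, E) S.toFun p u) (mfderiv (𝓡 S.dim) 𝓘(ℝ, E) S.toFun p v)

/-- With its induced metric, the submanifold is complete. -/
def IsComplete (S : ImmersedSubmanifold E M) : Prop :=
  IsGeodesicallyComplete S.inducedMetric

/-- The immersion is totally geodesic: it maps geodesics of the submanifold (with its induced
metric) to geodesics of the ambient manifold. -/
def IsTotallyGeodesic (S : ImmersedSubmanifold E M) : Prop :=
  ∀ (γ : ℝ → S.Carrier) (J : Set ℝ), IsOpen J → J.OrdConnected →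
    IsGeodesicOn S.inducedMetric γ J →
    IsGeodesicOn (fun (x : M) (u v : TangentSpace 𝓘(ℝ, E) x) ↦ (inner ℝ u v : ℝ)) (S.toFun ∘ γ) J

end Riemannian

end ImmersedSubmanifold

/-- A Lie subgroup of `G`: a Lie group together with an injective immersive homomorphism to `G`. -/
structure LieSubgroup.{w, u} (E : Type w) [NormedAddCommGroup E] [NormedSpace ℝ E]
    (G : Type u) [TopologicalSpace G] [ChartedSpace E G] [Group G] where
  /-- The underlying group. -/
  Carrier : Type u
  /-- Its dimension. -/
  dim : ℕ
  [group : Group Carrier]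
  [top : TopologicalSpace Carrier]
  [charted : ChartedSpace (EuclideanSpace ℝ (Fin dim)) Carrier]
  [lieGroup : LieGroup (𝓡 dim) ∞ Carrier]
  /-- The inclusion. -/
  incl : Carrier →* G
  injective : Function.Injective incl
  contMDiff : ContMDiff (𝓡 dim) 𝓘(ℝ, E) ∞ incl
  injective_mfderiv : ∀ s, Function.Injective (mfderiv (𝓡 dim) 𝓘(ℝ, E) incl s)

section LieGroups

variable {E : Type*} [NormedAddCommGroup E] [NormedSpace ℝ E]
  {G : Type*} [TopologicalSpace G] [ChartedSpace E G] [Group G]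

attribute [instance] LieSubgroup.group LieSubgroup.top LieSubgroup.charted LieSubgroup.lieGroup

/-- The Lie algebra of a Lie subgroup, as a subspace of the Lie algebra of `G`. -/
noncomputable def LieSubgroup.lieAlgebra (S : LieSubgroup E G) :
    Submodule ℝ (GroupLieAlgebra 𝓘(ℝ, E) G) :=
  (mfderiv (𝓡 S.dim) 𝓘(ℝ, E) S.incl (1 : S.Carrier) :
    TangentSpace (𝓡 S.dim) (1 : S.Carrier) →L[ℝ] TangentSpace 𝓘(ℝ, E) (1 : G)).toLinearMap.range

/-- The Lie algebra of a closed subgroup `K` of `G`: the initial velocities `X` of the smooth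
one-parameter subgroups `t ↦ Exp(tX)` that stay in `K`. -/
def lieAlgebraOfClosedSubgroup (K : Subgroup G) : Set (GroupLieAlgebra 𝓘(ℝ, E) G) :=
  {X | ∃ γ : ℝ → G, ContMDiff 𝓘(ℝ, ℝ) 𝓘(ℝ, E) ∞ γ ∧ (∀ s t, γ (s + t) = γ s * γ t) ∧
    (mfderiv 𝓘(ℝ, ℝ) 𝓘(ℝ, E) γ 0 (1 : ℝ) : E) = X ∧ ∀ t, γ t ∈ K}

/-- The adjoint representation: `Ad k` is the differential at the identity of `g ↦ k g k⁻¹`. -/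
noncomputable def Ad (k : G) : GroupLieAlgebra 𝓘(ℝ, E) G →L[ℝ] GroupLieAlgebra 𝓘(ℝ, E) G :=
  (mfderiv 𝓘(ℝ, E) 𝓘(ℝ, E) (fun g : G ↦ k * g * k⁻¹) 1 :
    TangentSpace 𝓘(ℝ, E) (1 : G) →L[ℝ] TangentSpace 𝓘(ℝ, E) (1 : G))

/-- The subspace `[𝔳, 𝔳]` spanned by the brackets of elements of `𝔳`. -/
noncomputable def bracketSpan (𝔳 : Submodule ℝ (GroupLieAlgebra 𝓘(ℝ, E) G)) :
    Submodule ℝ (GroupLieAlgebra 𝓘(ℝ, E) G) :=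
  Submodule.span ℝ {Z | ∃ X ∈ 𝔳, ∃ Y ∈ 𝔳, ⁅X, Y⁆ = Z}

end LieGroups

section Homogeneous

variable {EG : Type*} [NormedAddCommGroup EG] [NormedSpace ℝ EG]
  {G : Type*} [TopologicalSpace G] [ChartedSpace EG G] [Group G]
  {EM : Type*} [NormedAddCommGroup EM] [NormedSpace ℝ EM]
  {M : Type*} [TopologicalSpace M] [ChartedSpace EM M] [MulAction G M]

/-- The linear map `X ↦ X^*_p = d/dt|₀ (Exp(tX) • p)` from the Lie algebra of `G` to `T_p M`, that
is, the differential at the identity of the orbit map `g ↦ g • p`. -/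
noncomputable def fundamentalMap (EG : Type*) [NormedAddCommGroup EG] [NormedSpace ℝ EG]
    (G : Type*) [TopologicalSpace G] [ChartedSpace EG G] [Group G]
    {EM : Type*} [NormedAddCommGroup EM] [NormedSpace ℝ EM]
    {M : Type*} [TopologicalSpace M] [ChartedSpace EM M] [MulAction G M] (p : M) :
    GroupLieAlgebra 𝓘(ℝ, EG) G →L[ℝ] TangentSpace 𝓘(ℝ, EM) p :=
  (mfderiv 𝓘(ℝ, EG) 𝓘(ℝ, EM) (fun g : G ↦ g • p) 1 :
    TangentSpace 𝓘(ℝ, EG) (1 : G) →L[ℝ] TangentSpace 𝓘(ℝ, EM) p)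

/-- The fundamental vector field `X^*` of `X`. -/
noncomputable def fundamentalField (X : GroupLieAlgebra 𝓘(ℝ, EG) G) (p : M) :
    TangentSpace 𝓘(ℝ, EM) p :=
  fundamentalMap EG G p X

/-- The tangent space at `o` of the orbit `S • o` of a Lie subgroup: the image of the differential
at the identity of the orbit map `s ↦ s • o` of `S`. -/
noncomputable def LieSubgroup.orbitTangentSpace (S : LieSubgroup EG G) (o : M) :
    Submodule ℝ (TangentSpace 𝓘(ℝ, EM) o) :=
  (mfderiv (𝓡 S.dim) 𝓘(ℝ, EM) (fun s : S.Carrier ↦ S.incl s • o) 1 :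
    TangentSpace (𝓡 S.dim) (1 : S.Carrier) →L[ℝ] TangentSpace 𝓘(ℝ, EM) o).toLinearMap.range

/-- A reductive decomposition `𝔤 = 𝔨 ⊕ 𝔭` of the Lie algebra of `G`, where `𝔨` is the Lie algebra
of the isotropy group `K` of `o` and `𝔭` is an `Ad(K)`-invariant complement. -/
structure ReductiveDecomposition (EG : Type*) [NormedAddCommGroup EG] [NormedSpace ℝ EG]
    (G : Type*) [TopologicalSpace G] [ChartedSpace EG G] [Group G]
    {M : Type*} [MulAction G M] (o : M) where
  /-- The isotropy subalgebra. -/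
  𝔨 : Submodule ℝ (GroupLieAlgebra 𝓘(ℝ, EG) G)
  /-- The reductive complement. -/
  𝔭 : Submodule ℝ (GroupLieAlgebra 𝓘(ℝ, EG) G)
  coe_𝔨 : (𝔨 : Set (GroupLieAlgebra 𝓘(ℝ, EG) G)) =
    lieAlgebraOfClosedSubgroup (MulAction.stabilizer G o)
  isCompl : IsCompl 𝔨 𝔭
  map_Ad : ∀ k ∈ MulAction.stabilizer G o, 𝔭.map (Ad k).toLinearMap = 𝔭

namespace ReductiveDecomposition

variable {o : M} (d : ReductiveDecomposition EG G o)

/-- The projection `X ↦ X_𝔨` along `𝔭`. -/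
noncomputable def proj𝔨 : GroupLieAlgebra 𝓘(ℝ, EG) G →ₗ[ℝ] GroupLieAlgebra 𝓘(ℝ, EG) G :=
  d.𝔨.projection d.𝔭 d.isCompl

/-- The projection `X ↦ X_𝔭` along `𝔨`. -/
noncomputable def proj𝔭 : GroupLieAlgebra 𝓘(ℝ, EG) G →ₗ[ℝ] GroupLieAlgebra 𝓘(ℝ, EG) G :=
  d.𝔭.projection d.𝔨 d.isCompl.symm

/-- The subspace `𝔰` splits: `𝔰 = (𝔰 ∩ 𝔨) ⊕ (𝔰 ∩ 𝔭)`. -/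
def IsCanonicallyEmbedded (𝔰 : Submodule ℝ (GroupLieAlgebra 𝓘(ℝ, EG) G)) : Prop :=
  𝔰 = (𝔰 ⊓ d.𝔨) ⊔ (𝔰 ⊓ d.𝔭)

variable [FiniteDimensional ℝ EM] [IsManifold 𝓘(ℝ, EM) ∞ M]

/-- The canonical connection of the reductive decomposition: the `G`-invariant connection with
`(∇_{X^*} Y^*)_o = -([X, Y]_𝔭)^*_o` for `X, Y ∈ 𝔭`. Invariance means that `∇` is compatible with
the differentials of the maps `x ↦ g • x`; here `τ` is the push-forward of `σ` by `g`. -/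
structure IsCanonicalConnection
    (cov : CovariantDerivative 𝓘(ℝ, EM) EM (fun x : M ↦ TangentSpace 𝓘(ℝ, EM) x)) : Prop where
  invariant : ∀ (g : G) (σ τ : Π x : M, TangentSpace 𝓘(ℝ, EM) x),
    (∀ y, τ (g • y) = mfderiv 𝓘(ℝ, EM) 𝓘(ℝ, EM) (fun x : M ↦ g • x) y (σ y)) →
    ∀ (x : M) (v : TangentSpace 𝓘(ℝ, EM) x), MDiffAt (T% σ) x →
      cov τ (g • x) (mfderiv 𝓘(ℝ, EM) 𝓘(ℝ, EM) (fun x : M ↦ g • x) x v) =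
        mfderiv 𝓘(ℝ, EM) 𝓘(ℝ, EM) (fun x : M ↦ g • x) x (cov σ x v)
  apply_fundamentalField : ∀ X ∈ d.𝔭, ∀ Y ∈ d.𝔭,
    cov (fundamentalField Y) o (fundamentalField X o) = - fundamentalField (d.proj𝔭 ⁅X, Y⁆) o

variable [RiemannianBundle (fun x : M ↦ TangentSpace 𝓘(ℝ, EM) x)]

/-- The decomposition is naturally reductive: the bilinear map `U` given by
`2 ⟨U(X, Y), Z⟩ = ⟨[Z, X]_𝔭, Y⟩ + ⟨X, [Z, Y]_𝔭⟩` vanishes, where the inner product of `𝔭` is the one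
of `T_o M` under the identification `X ↦ X^*_o`. -/
def IsNaturallyReductive (d : ReductiveDecomposition EG G o) (EM : Type*)
    [NormedAddCommGroup EM] [NormedSpace ℝ EM] [ChartedSpace EM M]
    [RiemannianBundle (fun x : M ↦ TangentSpace 𝓘(ℝ, EM) x)] : Prop :=
  ∀ X ∈ d.𝔭, ∀ Y ∈ d.𝔭, ∀ Z ∈ d.𝔭,
    (inner ℝ (fundamentalField (d.proj𝔭 ⁅Z, X⁆) o : TangentSpace 𝓘(ℝ, EM) o)
        (fundamentalField Y o) : ℝ) +
      inner ℝ (fundamentalField X o : TangentSpace 𝓘(ℝ, EM) o)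
        (fundamentalField (d.proj𝔭 ⁅Z, Y⁆) o) = 0

variable [IsContMDiffRiemannianBundle 𝓘(ℝ, EM) ∞ EM (fun x : M ↦ TangentSpace 𝓘(ℝ, EM) x)]

instance : Nonempty (CovariantDerivative 𝓘(ℝ, EM) EM (fun x : M ↦ TangentSpace 𝓘(ℝ, EM) x)) :=
  ⟨leviCivita EM M⟩

/-- The canonical connection `∇^c`. Its values on differentiable vector fields are uniquely
determined by its characterization. -/
noncomputable def canonicalConnection :
    CovariantDerivative 𝓘(ℝ, EM) EM (fun x : M ↦ TangentSpace 𝓘(ℝ, EM) x) :=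
  Classical.epsilon d.IsCanonicalConnection

/-- The difference tensor `D = ∇ - ∇^c`, as a bilinear map `(u, v) ↦ D_u v` on `T_x M`. -/
noncomputable def differenceTensor (x : M) (u v : TangentSpace 𝓘(ℝ, EM) x) :
    TangentSpace 𝓘(ℝ, EM) x :=
  (leviCivita EM M).difference d.canonicalConnection x v u

/-- `V ⊆ T_x M` is invariant under `D`: `D_V V ⊆ V`. -/
def IsDInvariant (x : M) (V : Submodule ℝ (TangentSpace 𝓘(ℝ, EM) x)) : Prop :=
  ∀ u ∈ V, ∀ v ∈ V, d.differenceTensor x u v ∈ V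

end ReductiveDecomposition

end Homogeneous

/-!
Fix the base point `o`. A vector field on `M` is the same as an equivariant function on `G` with
values in `T_o M ≅ 𝔭` (`hat`), and an invariant connection differentiates such functions along
left-invariant fields and adds a bilinear map `B` of `𝔭` (`HasForm`). The canonical connection has
`B = 0` (`hasForm_canonicalConnection`); for a naturally reductive metric the Levi-Civita
connection has `B v w = ½ [v, w]_𝔭` (`hasForm_leviCivita`). Hence `D = ½ [·, ·]_𝔭`, and with
`HasForm.curvature_eq` invariance under `D` and either curvature tensor becomes an algebraic
condition on a subspace `W` of `𝔭`: `[W, W]_𝔭 ⊆ W` and `[[W, W]_𝔨, W] ⊆ W` (`IsInvariantSubspace`).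

If `W` satisfies it, the Jacobi identity makes `S = [W, W] + W` a canonically embedded subalgebra
(`IsInvariantSubspace.lieBL_mem`), which integrates to a connected Lie subgroup
(`exists_lieSubgroup`). The geodesics of a naturally reductive space are `t ↦ g exp(tX) • o` with
`X ∈ 𝔭` (`isGeodesicOn_exp`), so the orbit of `o` under this subgroup is complete and totally
geodesic (`exists_orbit_submanifold`). Conversely, `S ∩ 𝔭` is invariant for every canonically
embedded subalgebra `S` (`isInvariantSubspace_inf`).

A complete totally geodesic immersion `f` lifts every geodesic of `M` tangent to it
(`liftsGeodesics`), so the derivative of `exp` carries tangent spaces of `f` to tangent spaces of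
`f`. Applied along a short geodesic and back (`eventually_roundTrip`), its terms of second order in
the length give `[X, [X, Y]_𝔨] ∈ W` when `f` is `D`-invariant (`lieBL_prK_mem_of_roundTrip`);
polarisation and the Jacobi identity turn this into the algebraic condition
(`lieBL_prK_mem_of_polarization`). For uniqueness, the points where `f` is tangent to the orbit form
an open and closed set (`exists_mem_expSubgroup_tangentSubmodule_eq`), whence the statements on
compatible immersions (`injective_of_compatible`, `range_eq_orbit`, `exists_smooth_lift`).

The Lie theory used is built from the local group law: the exponential map, the Maurer-Cartan
equation, the adjoint action, and the connected Lie subgroup of a subalgebra, whose charts are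
slices `s exp(v)`. Tangent spaces are treated as the model spaces they are definitionally equal to.
-/

open Filter Topology Set

/-! ### Smooth inverse functions and smooth dependence of solutions of differential equations -/

section Analysis

/-- The inverse function theorem for smooth maps, with a smooth local inverse on a neighbourhood. -/
theorem exists_smooth_localInverse {E F : Type*} [NormedAddCommGroup E] [NormedSpace ℝ E]
    [CompleteSpace E] [NormedAddCommGroup F] [NormedSpace ℝ F] [CompleteSpace F]
    {f : E → F} {a : E}
    (hf : ∀ᶠ x in 𝓝 a, ContDiffAt ℝ ∞ f x) (f' : E ≃L[ℝ] F)
    (hf' : HasFDerivAt f (f' : E →L[ℝ] F) a) :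
    ∃ g : F → E, g (f a) = a ∧ (∀ᶠ x in 𝓝 a, g (f x) = x) ∧ (∀ᶠ y in 𝓝 (f a), f (g y) = y) ∧
      ∀ᶠ y in 𝓝 (f a), ContDiffAt ℝ ∞ g y := by
  have hfa : ContDiffAt ℝ ∞ f a := hf.self_of_nhds
  have h0 : (∞ : WithTop ℕ∞) ≠ 0 := by simp
  let e := hfa.toOpenPartialHomeomorph f hf' h0
  have hae : a ∈ e.source := hfa.mem_toOpenPartialHomeomorph_source hf' h0
  have hee : ∀ x, e x = f x := fun x ↦ rfl
  have hga : e.symm (f a) = a := e.left_inv hae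
  have hta : f a ∈ e.target := e.map_source hae
  have hcont : ContinuousAt (fderiv ℝ f) a :=
    (hfa.fderiv_right (m := 0) (by simp)).continuousAt
  have hopen : ∀ᶠ x in 𝓝 a, fderiv ℝ f x ∈ range ((↑) : (E ≃L[ℝ] F) → E →L[ℝ] F) := by
    refine hcont.eventually_mem ((ContinuousLinearEquiv.isOpen (𝕜 := ℝ) (E := E) (F := F)).mem_nhds ?_)
    rw [hf'.fderiv]; exact ⟨f', rfl⟩
  have hsymm : Tendsto e.symm (𝓝 (f a)) (𝓝 a) := by
    have := e.continuousAt_symm hta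
    rwa [ContinuousAt, hga] at this
  refine ⟨e.symm, hga, ?_, ?_, ?_⟩
  · filter_upwards [e.open_source.mem_nhds hae] with x hx using e.left_inv hx
  · filter_upwards [e.open_target.mem_nhds hta] with y hy using e.right_inv hy
  · filter_upwards [e.open_target.mem_nhds hta, hsymm.eventually hf, hsymm.eventually hopen]
      with y hy h1 ⟨A, hA⟩
    refine e.contDiffAt_symm (f₀' := A) hy ?_ h1
    rw [hA]
    exact (h1.differentiableAt h0).hasFDerivAt

/-- The equation `γ = A(γ) q` has a solution depending smoothly on the small parameter `q`. -/
theorem exists_smooth_fixedPoint {E C : Type*} [NormedAddCommGroup E] [NormedSpace ℝ E]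
    [CompleteSpace E] [NormedAddCommGroup C] [NormedSpace ℝ C] [CompleteSpace C]
    {A : C → E →L[ℝ] C} (hA : ContDiff ℝ ∞ A) :
    ∃ γ : E → C, γ 0 = 0 ∧ (∀ᶠ q in 𝓝 0, γ q = A (γ q) q) ∧
      ∀ᶠ q in 𝓝 0, ContDiffAt ℝ ∞ γ q := by
  -- Fixed points of `A · q` are preimages of `(q, 0)` under `Ψ`, whose derivative at the origin is
  -- unipotent.
  let Ψ : E × C → E × C := fun p ↦ (p.1, p.2 - A p.2 p.1)
  have hΨ : ContDiff ℝ ∞ Ψ :=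
    contDiff_fst.prodMk (contDiff_snd.sub ((hA.comp contDiff_snd).clm_apply contDiff_fst))
  have hΨ0 : Ψ (0, 0) = (0, 0) := by simp [Ψ]
  let fstL := ContinuousLinearMap.fst ℝ E C
  let sndL := ContinuousLinearMap.snd ℝ E C
  let Ψ' : (E × C) ≃L[ℝ] (E × C) := ContinuousLinearEquiv.equivOfInverse
    (fstL.prod (sndL - A 0 ∘L fstL)) (fstL.prod (sndL + A 0 ∘L fstL))
    (fun p ↦ by simp [fstL, sndL]) (fun p ↦ by simp [fstL, sndL])
  have hΨ' : HasFDerivAt Ψ (Ψ' : (E × C) →L[ℝ] (E × C)) (0, 0) := by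
    have h1 : HasFDerivAt (fun p : E × C ↦ A p.2) (fderiv ℝ A 0 ∘L sndL) (0, 0) :=
      ((hA.differentiable (by simp)) 0).hasFDerivAt.comp ((0 : E), (0 : C)) hasFDerivAt_snd
    have h3 : HasFDerivAt Ψ _ (0, 0) := (hasFDerivAt_fst (p := ((0 : E), (0 : C)))).prodMk
      ((hasFDerivAt_snd (p := ((0 : E), (0 : C)))).sub (h1.clm_apply hasFDerivAt_fst))
    refine h3.congr_fderiv ?_
    ext p <;> simp [Ψ', fstL, sndL]
  obtain ⟨g, hg0, -, hΨg, hgs⟩ := exists_smooth_localInverse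
    (Eventually.of_forall fun x ↦ hΨ.contDiffAt) Ψ' hΨ'
  rw [hΨ0] at hg0 hΨg hgs
  have hι : Tendsto (fun q : E ↦ (q, (0 : C))) (𝓝 0) (𝓝 (0, 0)) :=
    (Continuous.prodMk continuous_id continuous_const).tendsto' _ _ rfl
  refine ⟨fun q ↦ (g (q, 0)).2, by simp [hg0], ?_, ?_⟩
  · filter_upwards [hι.eventually hΨg] with q hq
    have hq1 : (g (q, 0)).1 = q := congrArg Prod.fst hq
    have := congrArg Prod.snd hq
    simp only [Ψ, hq1] at this
    exact sub_eq_zero.1 this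
  · filter_upwards [hι.eventually hgs] with q hq
    exact contDiffAt_snd.comp q (hq.comp q (contDiffAt_id.prodMk contDiffAt_const))

set_option synthInstance.maxHeartbeats 400000

variable {K : Type*} [TopologicalSpace K] [CompactSpace K]

/-- Pointwise application of a family of continuous linear maps, as a bilinear map between spaces
of continuous functions. -/
noncomputable def ContinuousMap.applyL (K : Type*) [TopologicalSpace K] [CompactSpace K]
    (E F : Type*) [NormedAddCommGroup E] [NormedSpace ℝ E]
    [NormedAddCommGroup F] [NormedSpace ℝ F] :
    C(K, E →L[ℝ] F) →L[ℝ] C(K, E) →L[ℝ] C(K, F) :=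
  LinearMap.mkContinuous₂ (E := C(K, E →L[ℝ] F)) (F := C(K, E)) (G := C(K, F))
    (LinearMap.mk₂ ℝ (fun (A : C(K, E →L[ℝ] F)) (h : C(K, E)) ↦
        (⟨fun k ↦ A k (h k), by fun_prop⟩ : C(K, F)))
      (fun A B h ↦ by ext k; simp) (fun c A h ↦ by ext k; simp)
      (fun A h h' ↦ by ext k; simp) (fun c A h ↦ by ext k; simp)) 1
    (fun A h ↦ by
      refine (ContinuousMap.norm_le _ (by positivity)).2 fun k ↦ ?_
      simp only [LinearMap.mk₂_apply, ContinuousMap.coe_mk, one_mul]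
      exact (A k).le_opNorm_of_le (h.norm_coe_le_norm k) |>.trans
        (mul_le_mul_of_nonneg_right (A.norm_coe_le_norm k) (norm_nonneg _)))

/-- The derivative of `γ ↦ f ∘ γ` at `γ` is pointwise application of `f' ∘ γ`: the mean value
inequality at each point, uniform over the compact space `K`. -/
theorem hasFDerivAt_postcomp {E F : Type*} [NormedAddCommGroup E] [NormedSpace ℝ E]
    [NormedAddCommGroup F] [NormedSpace ℝ F] {f : E → F} {f' : E → E →L[ℝ] F}
    (hf : ∀ x, HasFDerivAt f (f' x) x) (hc : Continuous f) (hf' : Continuous f') (γ : C(K, E)) :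
    HasFDerivAt (fun γ : C(K, E) ↦ (⟨f ∘ γ, hc.comp γ.continuous⟩ : C(K, F)))
      (ContinuousMap.applyL K E F ⟨f' ∘ γ, hf'.comp γ.continuous⟩) γ := by
  have hcont := (ContinuousMap.continuous_postcomp (X := K) ⟨f', hf'⟩).continuousAt (x := γ)
  rw [hasFDerivAt_iff_isLittleO_nhds_zero, Asymptotics.isLittleO_iff]
  intro ε hε
  obtain ⟨δ, hδ, H⟩ := (Metric.continuousAt_iff (α := C(K, E)) (β := C(K, E →L[ℝ] F))).1 hcont ε hε
  filter_upwards [Metric.ball_mem_nhds _ hδ] with h hh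
  rw [mem_ball_zero_iff] at hh
  rw [ContinuousMap.norm_le _ (by positivity)]
  intro k
  have key : ∀ y ∈ segment ℝ (γ k) (γ k + h k), ‖f' y - f' (γ k)‖ ≤ ε := by
    intro y hy
    rw [segment_eq_image'] at hy
    obtain ⟨s, ⟨hs0, hs1⟩, rfl⟩ := hy
    have h1 : dist (γ + s • h) γ < δ := by
      rw [dist_eq_norm, add_sub_cancel_left, norm_smul, Real.norm_of_nonneg hs0]
      exact (mul_le_of_le_one_left (norm_nonneg _) hs1).trans_lt hh
    have h2 := H h1
    have h3 := (ContinuousMap.dist_apply_le_dist (α := K) (β := E →L[ℝ] F) k).trans h2.le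
    rw [dist_eq_norm] at h3
    simpa using h3
  have := (convex_segment (𝕜 := ℝ) (γ k) (γ k + h k)).norm_image_sub_le_of_norm_hasFDerivWithin_le'
    (f := f) (f' := f') (φ := f' (γ k)) (C := ε) (x := γ k) (y := γ k + h k)
    (fun y _ ↦ (hf y).hasFDerivWithinAt) key (left_mem_segment ..) (right_mem_segment ..)
  simp only [add_sub_cancel_left] at this
  exact this.trans (mul_le_mul_of_nonneg_left (h.norm_coe_le_norm k) hε.le)

/-- Composition with a smooth map is a smooth operator between spaces of continuous functions. -/
theorem contDiff_postcomp.{u} {E : Type u} [NormedAddCommGroup E] [NormedSpace ℝ E] (n : ℕ) :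
    ∀ {F : Type u} [NormedAddCommGroup F] [NormedSpace ℝ F] {f : E → F} (hf : ContDiff ℝ n f),
    ContDiff ℝ n (fun γ : C(K, E) ↦ (⟨f ∘ γ, hf.continuous.comp γ.continuous⟩ : C(K, F))) := by
  induction n with
  | zero =>
    intro F _ _ f hf
    exact contDiff_zero.2 (ContinuousMap.continuous_postcomp (X := K) ⟨f, hf.continuous⟩)
  | succ n ih =>
    intro F _ _ f hf
    have h1 : ContDiff ℝ n (fderiv ℝ f) := hf.fderiv_right (by norm_cast)
    have hd : Differentiable ℝ f := hf.differentiable (by simp)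
    have := (ContinuousMap.applyL K E F).contDiff.comp (ih h1)
    exact (contDiff_succ_iff_hasFDerivAt (n := n) (𝕜 := ℝ)).2 ⟨_, this, fun γ ↦
      hasFDerivAt_postcomp (fun x ↦ (hd x).hasFDerivAt) hf.continuous h1.continuous γ⟩

/-- The retraction of the real line onto `[-1, 1]`. -/
noncomputable def projUnit : ℝ → Icc (-1 : ℝ) 1 := projIcc (-1) 1 (by norm_num)

theorem continuous_projUnit : Continuous projUnit := continuous_projIcc

theorem projUnit_of_mem {t : ℝ} (ht : t ∈ Icc (-1 : ℝ) 1) : projUnit t = ⟨t, ht⟩ :=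
  projIcc_of_mem _ ht

/-- Integration from `0`, as an operator on the continuous functions on `[-1, 1]`. -/
noncomputable def ContinuousMap.primitiveL (E : Type*) [NormedAddCommGroup E] [NormedSpace ℝ E]
    [CompleteSpace E] : C(Icc (-1 : ℝ) 1, E) →L[ℝ] C(Icc (-1 : ℝ) 1, E) :=
  LinearMap.mkContinuous
    { toFun := fun h ↦ ⟨fun t ↦ ∫ τ in (0 : ℝ)..t, h (projUnit τ),
        (intervalIntegral.continuous_primitive (fun a b ↦ Continuous.intervalIntegrable
          (h.continuous.comp continuous_projUnit) a b) 0).comp continuous_subtype_val⟩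
      map_add' := fun h h' ↦ by
        ext t
        simp only [ContinuousMap.add_apply, ContinuousMap.coe_mk]
        exact intervalIntegral.integral_add
          (Continuous.intervalIntegrable (h.continuous.comp continuous_projUnit) _ _)
          (Continuous.intervalIntegrable (h'.continuous.comp continuous_projUnit) _ _)
      map_smul' := fun c h ↦ by
        ext t
        simp } 1
    (fun h ↦ by
      refine (ContinuousMap.norm_le _ (by simp)).2 fun t ↦ ?_
      have := intervalIntegral.norm_integral_le_of_norm_le_const (a := 0) (b := (t : ℝ))
        (f := fun τ ↦ h (projUnit τ)) (C := ‖h‖)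
        (fun x _ ↦ h.norm_coe_le_norm _)
      refine this.trans ?_
      rw [one_mul, sub_zero]
      exact mul_le_of_le_one_right (norm_nonneg _) (abs_le.2 t.2))

/-- Solutions of `u' = f(u) q`, `u(0) = 0`, depend smoothly on the small parameter `q`. For `q = 0`
the solution is constant, and the derivative there of `u ↦ u - ∫ f(u) q` is the identity, so that
the inverse function theorem in the space of continuous curves applies. -/
theorem exists_smooth_solution {E : Type*} [NormedAddCommGroup E] [NormedSpace ℝ E]
    [FiniteDimensional ℝ E] {f : E → E →L[ℝ] E} (hf : ∀ᶠ x in 𝓝 0, ContDiffAt ℝ ∞ f x)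
    {W : Set E} (hW : W ∈ 𝓝 (0 : E)) :
    ∃ u : E → ℝ → E, (∀ᶠ q in 𝓝 0, u q 0 = 0 ∧
        ∀ t ∈ Ioo (-1 : ℝ) 1, u q t ∈ W ∧ HasDerivAt (u q) (f (u q t) q) t) ∧
      ∀ t, ∀ᶠ q in 𝓝 0, ContDiffAt ℝ ∞ (fun q ↦ u q t) q := by
  obtain ⟨r, hr, hrf⟩ := Metric.eventually_nhds_iff_ball.1 hf
  -- Cut `f` off, so that composition with it is defined on all curves.
  let χ : ContDiffBump (0 : E) := ⟨r / 4, r / 2, by positivity, by linarith⟩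
  let f₁ : E → E →L[ℝ] E := fun x ↦ χ x • f x
  have hf₁ : ContDiff ℝ ∞ f₁ := by
    refine contDiff_iff_contDiffAt.2 fun x ↦ ?_
    by_cases hx : x ∈ tsupport f₁
    swap
    · exact contDiffAt_const.congr_of_eventuallyEq (notMem_tsupport_iff_eventuallyEq.1 hx)
    have hx' : x ∈ tsupport χ := closure_mono (Function.support_smul_subset_left _ _) hx
    rw [χ.tsupport_eq, Metric.mem_closedBall] at hx'
    exact χ.contDiffAt.smul (hrf x (by rw [Metric.mem_ball]; simp only [χ] at hx'; linarith))
  let 𝒞 := C(Icc (-1 : ℝ) 1, E)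
  let cst : E →L[ℝ] 𝒞 := LinearMap.toContinuousLinearMap
    { toFun := fun q ↦ ContinuousMap.const _ q
      map_add' := fun _ _ ↦ rfl
      map_smul' := fun _ _ ↦ rfl }
  let N : 𝒞 → C(Icc (-1 : ℝ) 1, E →L[ℝ] E) :=
    fun γ ↦ ⟨f₁ ∘ γ, hf₁.continuous.comp γ.continuous⟩
  have hN : ContDiff ℝ ∞ N := contDiff_infty.2 fun n ↦
    contDiff_postcomp n (hf₁.of_le (by exact_mod_cast le_top))
  let B := ContinuousMap.applyL (Icc (-1 : ℝ) 1) E E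
  let I := ContinuousMap.primitiveL E
  have hB : ContDiff ℝ ∞ B := ContinuousLinearMap.contDiff
    (E := C(Icc (-1 : ℝ) 1, E →L[ℝ] E)) (F := C(Icc (-1 : ℝ) 1, E) →L[ℝ] C(Icc (-1 : ℝ) 1, E)) _
  -- The integral equation is the fixed point equation `γ = A γ q` for this operator-valued map.
  have hA : ContDiff ℝ ∞ fun γ : 𝒞 ↦ I ∘L (B (N γ)) ∘L cst :=
    contDiff_const.clm_comp (ContDiff.clm_comp (g := fun γ ↦ B (N γ)) (hB.comp hN)
      contDiff_const)
  obtain ⟨g, hg0, hgA, hgs⟩ := exists_smooth_fixedPoint hA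
  refine ⟨fun q t ↦ g q (projUnit t), ?_, fun t ↦ ?_⟩
  · obtain ⟨δ, hδ, hδW⟩ := Metric.mem_nhds_iff.1 hW
    have hsmall : ∀ᶠ q in 𝓝 (0 : E), ‖g q‖ < min δ (r / 4) := by
      have h1 := hgs.self_of_nhds.continuousAt.norm
      have h2 : ‖g 0‖ < min δ (r / 4) := by
        rw [hg0]; simp [hδ, hr]
      exact h1.eventually_lt continuousAt_const h2
    filter_upwards [hgA, hsmall] with q hq2 hs
    set γ := g q with hγ
    have hq3 : ∀ t : Icc (-1 : ℝ) 1,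
        γ t = ∫ τ in (0 : ℝ)..t, f₁ (γ (projUnit τ)) q := by
      intro t
      conv_lhs => rw [hq2]
      rfl
    have hlt : ∀ t, ‖γ t‖ < min δ (r / 4) := fun t ↦ (γ.norm_coe_le_norm t).trans_lt hs
    refine ⟨?_, fun t ht ↦ ⟨?_, ?_⟩⟩
    · rw [hq3, projUnit_of_mem (show (0 : ℝ) ∈ Icc (-1 : ℝ) 1 by simp)]
      simp
    · exact hδW (by rw [mem_ball_zero_iff]; exact (hlt _).trans_le (min_le_left _ _))
    · have hfeq : f (γ (projUnit t)) =
          f₁ (γ (projUnit t)) := by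
        simp only [f₁]
        rw [χ.one_of_mem_closedBall, one_smul]
        rw [mem_closedBall_zero_iff]
        exact ((hlt _).trans_le (min_le_right _ _)).le
      rw [hfeq]
      have hc : Continuous fun τ ↦ f₁ (γ (projUnit τ)) q :=
        (hf₁.continuous.comp (γ.continuous.comp continuous_projUnit)).clm_apply continuous_const
      have := intervalIntegral.integral_hasDerivAt_right (hc.intervalIntegrable 0 t)
        (hc.stronglyMeasurableAtFilter _ _) hc.continuousAt
      refine this.congr_of_eventuallyEq ?_
      filter_upwards [isOpen_Ioo.mem_nhds ht] with s hs
      rw [hq3, projUnit_of_mem (Ioo_subset_Icc_self hs)]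
  · filter_upwards [hgs] with q hq
    exact (ContinuousMap.evalCLM ℝ (projUnit t)).contDiff.contDiffAt.comp q hq

end Analysis

/-! ### Derivatives of maps between manifolds as maps between model spaces -/

section ModelDeriv

/-- The differential of a map between manifolds without boundary, as a linear map between the model
spaces (the tangent spaces being copies of these). Its type does not depend on the base point. -/
noncomputable def md (E F : Type*) [NormedAddCommGroup E] [NormedSpace ℝ E]
    [NormedAddCommGroup F] [NormedSpace ℝ F] {M N : Type*} [TopologicalSpace M] [ChartedSpace E M]
    [TopologicalSpace N] [ChartedSpace F N] (f : M → N) (x : M) : E →L[ℝ] F :=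
  mfderiv 𝓘(ℝ, E) 𝓘(ℝ, F) f x

variable {E F H : Type*} [NormedAddCommGroup E] [NormedSpace ℝ E]
    [NormedAddCommGroup F] [NormedSpace ℝ F] [NormedAddCommGroup H] [NormedSpace ℝ H]
    {M N P : Type*} [TopologicalSpace M] [ChartedSpace E M]
    [TopologicalSpace N] [ChartedSpace F N] [TopologicalSpace P] [ChartedSpace H P]

theorem md_comp {g : N → P} {f : M → N} (x : M) (hg : MDifferentiableAt 𝓘(ℝ, F) 𝓘(ℝ, H) g (f x))
    (hf : MDifferentiableAt 𝓘(ℝ, E) 𝓘(ℝ, F) f x) :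
    md E H (fun y ↦ g (f y)) x = md F H g (f x) ∘L md E F f x :=
  mfderiv_comp x hg hf

theorem md_comp_apply {g : N → P} {f : M → N} (x : M)
    (hg : MDifferentiableAt 𝓘(ℝ, F) 𝓘(ℝ, H) g (f x))
    (hf : MDifferentiableAt 𝓘(ℝ, E) 𝓘(ℝ, F) f x) (v : E) :
    md E H (fun y ↦ g (f y)) x v = md F H g (f x) (md E F f x v) := by
  rw [md_comp x hg hf]; rfl

theorem md_eq_fderiv (f : E → F) (x : E) : md E F f x = fderiv ℝ f x := mfderiv_eq_fderiv

theorem md_congr {f g : M → N} {x : M} (h : f =ᶠ[𝓝 x] g) : md E F f x = md E F g x := by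
  have h1 := h.mfderiv_eq (I := 𝓘(ℝ, E)) (I' := 𝓘(ℝ, F))
  exact h1

theorem md_id (x : M) : md E E (fun y : M ↦ y) x = ContinuousLinearMap.id ℝ E := mfderiv_id

theorem md_const (c : N) (x : M) : md E F (fun _ : M ↦ c) x = 0 := mfderiv_const

theorem ContMDiffAt.mdiff {f : M → N} {x : M} (hf : ContMDiffAt 𝓘(ℝ, E) 𝓘(ℝ, F) ∞ f x) :
    MDifferentiableAt 𝓘(ℝ, E) 𝓘(ℝ, F) f x := hf.mdifferentiableAt (by simp)

theorem md_extChartAt_self [IsManifold 𝓘(ℝ, E) ∞ M] (x : M) :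
    md E E (extChartAt 𝓘(ℝ, E) x) x = ContinuousLinearMap.id ℝ E := by
  have : IsManifold 𝓘(ℝ, E) 1 M := IsManifold.of_le (n := ∞) (by simp)
  exact mfderiv_extChartAt_self

theorem extChartAt_target_mem_nhds_of_mem {x : M} {y : E}
    (hy : y ∈ (extChartAt 𝓘(ℝ, E) x).target) : (extChartAt 𝓘(ℝ, E) x).target ∈ 𝓝 y :=
  (isOpen_extChartAt_target x).mem_nhds hy

theorem contMDiffAt_extChartAt_symm_of_mem [IsManifold 𝓘(ℝ, E) ∞ M] {x : M} {y : E}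
    (hy : y ∈ (extChartAt 𝓘(ℝ, E) x).target) :
    ContMDiffAt 𝓘(ℝ, E) 𝓘(ℝ, E) ∞ (extChartAt 𝓘(ℝ, E) x).symm y :=
  (contMDiffOn_extChartAt_symm x).contMDiffAt (extChartAt_target_mem_nhds_of_mem hy)

theorem contMDiffAt_extChartAt_of_mem [IsManifold 𝓘(ℝ, E) ∞ M] {x y : M}
    (hy : y ∈ (extChartAt 𝓘(ℝ, E) x).source) :
    ContMDiffAt 𝓘(ℝ, E) 𝓘(ℝ, E) ∞ (extChartAt 𝓘(ℝ, E) x) y :=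
  contMDiffAt_extChartAt' (by simpa using hy)

theorem md_leftInverse {p : M → N} {l : N → M} {x : M} (h : ∀ᶠ y in 𝓝 x, l (p y) = y)
    (hl : MDifferentiableAt 𝓘(ℝ, F) 𝓘(ℝ, E) l (p x))
    (hp : MDifferentiableAt 𝓘(ℝ, E) 𝓘(ℝ, F) p x) :
    md F E l (p x) ∘L md E F p x = ContinuousLinearMap.id ℝ E := by
  rw [← md_comp x hl hp, ← md_id x]
  exact md_congr h

theorem mlieBracket_model (V W : E → E) (x : E) :
    (mlieBracket 𝓘(ℝ, E) (V : Π x : E, TangentSpace 𝓘(ℝ, E) x) W x : E) =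
      fderiv ℝ W x (V x) - fderiv ℝ V x (W x) := by
  have h := congrFun (mlieBracketWithin_eq_lieBracketWithin (𝕜 := ℝ) (E := E) (V := V) (W := W)
    (s := univ)) x
  rw [lieBracketWithin_univ] at h
  exact (congrFun (mlieBracketWithin_univ (I := 𝓘(ℝ, E)) (V := V) (W := W)).symm x).trans h

end ModelDeriv

/-! ### The left Maurer-Cartan form in a local parametrisation -/

section LocalParam

variable {E : Type*} [NormedAddCommGroup E] [NormedSpace ℝ E]
  {G : Type*} [TopologicalSpace G] [ChartedSpace E G] [Group G]

/-- `p` is a smooth parametrisation of a neighbourhood of the identity of `G`, with differential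
the identity at `0`, and `l` is its smooth local inverse. -/
structure IsLocalParam (p : E → G) (l : G → E) : Prop where
  map_zero : p 0 = 1
  smooth : ∀ᶠ x in 𝓝 0, ContMDiffAt 𝓘(ℝ, E) 𝓘(ℝ, E) ∞ p x
  smooth_symm : ∀ᶠ g in 𝓝 1, ContMDiffAt 𝓘(ℝ, E) 𝓘(ℝ, E) ∞ l g
  left_inv : ∀ᶠ x in 𝓝 0, l (p x) = x
  right_inv : ∀ᶠ g in 𝓝 1, p (l g) = g
  md_zero : md E E p 0 = ContinuousLinearMap.id ℝ E

/-- The frame of left-invariant vector fields in the coordinates of a local parametrisation: the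
derivative at `0` of `y ↦ l (p x * p y)`. -/
noncomputable def leftFrame (p : E → G) (l : G → E) (x : E) : E →L[ℝ] E :=
  fderiv ℝ (fun y ↦ l (p x * p y)) 0

/-- The bracket of the Lie algebra of `G`, on the model space. -/
noncomputable def lieB (E : Type*) [NormedAddCommGroup E] [NormedSpace ℝ E]
    (G : Type*) [TopologicalSpace G] [ChartedSpace E G] [Group G] (X Y : E) : E :=
  (Bracket.bracket (L := GroupLieAlgebra 𝓘(ℝ, E) G) (M := GroupLieAlgebra 𝓘(ℝ, E) G) X Y :
    GroupLieAlgebra 𝓘(ℝ, E) G)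

variable [LieGroup 𝓘(ℝ, E) ∞ G]

variable (E G) in
theorem LieGroup.minSmoothness_three : LieGroup 𝓘(ℝ, E) (minSmoothness ℝ 3) G := by
  have : minSmoothness ℝ 3 ≤ (∞ : WithTop ℕ∞) := by
    rw [minSmoothness_of_isRCLikeNormedField]; exact WithTop.coe_le_coe.2 le_top
  exact LieGroup.of_le this

variable (E G) in
include E in
theorem LieGroup.isTopologicalGroup :
    IsTopologicalGroup G := topologicalGroup_of_lieGroup 𝓘(ℝ, E) ∞

theorem contMDiffAt_mul_comp {W : Type*} [NormedAddCommGroup W] [NormedSpace ℝ W]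
    {N : Type*} [TopologicalSpace N] [ChartedSpace W N] {a b : N → G} {x : N}
    (ha : ContMDiffAt 𝓘(ℝ, W) 𝓘(ℝ, E) ∞ a x) (hb : ContMDiffAt 𝓘(ℝ, W) 𝓘(ℝ, E) ∞ b x) :
    ContMDiffAt 𝓘(ℝ, W) 𝓘(ℝ, E) ∞ (fun y ↦ a y * b y) x := ha.mul hb

namespace IsLocalParam

variable {p : E → G} {l : G → E}

theorem continuousAt_zero (h : IsLocalParam p l) : Tendsto p (𝓝 0) (𝓝 1) := by
  have := h.smooth.self_of_nhds.continuousAt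
  rwa [ContinuousAt, h.map_zero] at this

theorem symm_one (h : IsLocalParam p l) : l 1 = 0 := by
  rw [← h.map_zero]; exact h.left_inv.self_of_nhds

theorem continuousAt_symm (h : IsLocalParam p l) : Tendsto l (𝓝 1) (𝓝 0) := by
  have := h.smooth_symm.self_of_nhds.continuousAt
  rwa [ContinuousAt, h.symm_one] at this

theorem eventually_smooth_mul (h : IsLocalParam p l) : ∀ᶠ q : E × E in 𝓝 0,
    ContDiffAt ℝ ∞ (fun q : E × E ↦ l (p q.1 * p q.2)) q := by
  have := LieGroup.isTopologicalGroup E G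
  have h1 : Tendsto (fun q : E × E ↦ q.1) (𝓝 0) (𝓝 0) := continuous_fst.tendsto' _ _ rfl
  have h2 : Tendsto (fun q : E × E ↦ q.2) (𝓝 0) (𝓝 0) := continuous_snd.tendsto' _ _ rfl
  have h3 : Tendsto (fun q : E × E ↦ p q.1 * p q.2) (𝓝 0) (𝓝 1) := by
    simpa using (h.continuousAt_zero.comp h1).mul (h.continuousAt_zero.comp h2)
  filter_upwards [h1.eventually h.smooth, h2.eventually h.smooth, h3.eventually h.smooth_symm]
    with q k1 k2 k3
  rw [← contMDiffAt_iff_contDiffAt]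
  exact k3.comp q (contMDiffAt_mul_comp (k1.comp q contDiffAt_fst.contMDiffAt)
    (k2.comp q contDiffAt_snd.contMDiffAt))

theorem eventually_smooth_mul_zero (h : IsLocalParam p l) : ∀ᶠ x : E in 𝓝 0,
    ContDiffAt ℝ ∞ (fun q : E × E ↦ l (p q.1 * p q.2)) (x, 0) :=
  ((Continuous.prodMk continuous_id continuous_const).tendsto' (0 : E) (0 : E × E) rfl).eventually
    h.eventually_smooth_mul

theorem eventually_smooth_leftFrame (h : IsLocalParam p l) : ∀ᶠ x in 𝓝 0, ContDiffAt ℝ ∞ (leftFrame p l) x := by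
  filter_upwards [h.eventually_smooth_mul_zero] with x hx
  exact ContDiffAt.fderiv (f := fun x y ↦ l (p x * p y)) (g := fun _ ↦ 0) hx contDiffAt_const
    (by simp)

theorem leftFrame_zero (h : IsLocalParam p l) : leftFrame p l 0 = ContinuousLinearMap.id ℝ E := by
  rw [leftFrame, ← fderiv_id (x := (0 : E))]
  refine Filter.EventuallyEq.fderiv_eq ?_
  filter_upwards [h.left_inv] with y hy
  simp [h.map_zero, hy]

theorem eventually_md_leftFrame (h : IsLocalParam p l) : ∀ᶠ x in 𝓝 0, ∀ X : E,
    md E E p x (leftFrame p l x X) = md E E (fun g : G ↦ p x * g) 1 X := by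
  have := LieGroup.isTopologicalGroup E G
  filter_upwards [h.eventually_smooth_mul_zero, h.smooth, h.left_inv,
    h.continuousAt_zero.eventually h.right_inv.eventually_nhds] with x h1 h2 h3 h4 X
  have h5 : Tendsto (fun y ↦ p x * p y) (𝓝 0) (𝓝 (p x)) := by
    simpa using h.continuousAt_zero.const_mul (p x)
  have h6 : ∀ᶠ y in 𝓝 0, p (l (p x * p y)) = p x * p y := h5.eventually h4
  have h7 : ContMDiffAt 𝓘(ℝ, E) 𝓘(ℝ, E) ∞ (fun y ↦ l (p x * p y)) 0 := by
    rw [contMDiffAt_iff_contDiffAt]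
    exact h1.comp (0 : E) (contDiffAt_const.prodMk contDiffAt_id)
  have e0 : l (p x * p 0) = x := by rw [h.map_zero, mul_one, h3]
  have hL : ContMDiffAt 𝓘(ℝ, E) 𝓘(ℝ, E) ∞ (fun g ↦ p x * g) (p 0) := contMDiffAt_mul_left
  have h8 := md_comp_apply (g := p) (f := fun y ↦ l (p x * p y)) (0 : E) (by rw [e0]; exact h2.mdiff)
    h7.mdiff X
  rw [e0, md_eq_fderiv, md_congr h6] at h8
  rw [leftFrame, ← h8, md_comp_apply (E := E) (F := E) (H := E) (g := fun g ↦ p x * g) (0 : E), h.map_zero, h.md_zero]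
  · rfl
  · exact hL.mdiff
  · exact h.smooth.self_of_nhds.mdiff

theorem eventually_inverse (h : IsLocalParam p l) : ∀ᶠ x in 𝓝 0,
    md E E l (p x) ∘L md E E p x = ContinuousLinearMap.id ℝ E ∧
    md E E p x ∘L md E E l (p x) = ContinuousLinearMap.id ℝ E := by
  filter_upwards [h.smooth, h.continuousAt_zero.eventually h.smooth_symm, h.left_inv.eventually_nhds,
    h.continuousAt_zero.eventually h.right_inv.eventually_nhds] with x h1 h2 h3 h4
  have e := h3.self_of_nhds
  refine ⟨md_leftInverse h3 h2.mdiff h1.mdiff, ?_⟩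
  have := md_leftInverse h4 (by rw [e]; exact h1.mdiff) h2.mdiff
  rwa [e] at this

/-- The bracket is the antisymmetrised derivative of the left-invariant frame. -/
theorem lieB_eq [CompleteSpace E] (h : IsLocalParam p l) (X Y : E) :
    lieB E G X Y = fderiv ℝ (leftFrame p l) 0 X Y - fderiv ℝ (leftFrame p l) 0 Y X := by
  have := LieGroup.minSmoothness_three E G
  have : IsManifold 𝓘(ℝ, E) (minSmoothness ℝ 2) G := by
    have : minSmoothness ℝ 2 ≤ (∞ : WithTop ℕ∞) := by
      rw [minSmoothness_of_isRCLikeNormedField]; exact WithTop.coe_le_coe.2 le_top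
    exact IsManifold.of_le this
  -- Both fields are pulled back along `p`, where left-invariant fields are given by the left frame.
  have key : ∀ Z : E, mpullback 𝓘(ℝ, E) 𝓘(ℝ, E) p
      (mulInvariantVectorField (Z : GroupLieAlgebra 𝓘(ℝ, E) G)) =ᶠ[𝓝 0]
      fun x ↦ leftFrame p l x Z := by
    intro Z
    filter_upwards [h.eventually_inverse, h.eventually_md_leftFrame] with x hx h2
    have h3 : (mfderiv 𝓘(ℝ, E) 𝓘(ℝ, E) p x).inverse = md E E l (p x) :=
      ContinuousLinearMap.inverse_eq hx.2 hx.1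
    have h4 : mulInvariantVectorField (Z : GroupLieAlgebra 𝓘(ℝ, E) G) (p x) =
      md E E p x (leftFrame p l x Z) := (h2 Z).symm
    rw [mpullback_apply, h3, h4]
    exact congrArg (fun A : E →L[ℝ] E ↦ A (leftFrame p l x Z)) hx.1
  have hp : ContMDiffAt 𝓘(ℝ, E) 𝓘(ℝ, E) ∞ p 0 := h.smooth.self_of_nhds
  have h1 := mpullback_mlieBracket (x₀ := (0 : E)) (n := ∞) (f := p) (I := 𝓘(ℝ, E)) (I' := 𝓘(ℝ, E))
    (mdifferentiableAt_mulInvariantVectorField (X : GroupLieAlgebra 𝓘(ℝ, E) G))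
    (mdifferentiableAt_mulInvariantVectorField (Y : GroupLieAlgebra 𝓘(ℝ, E) G)) hp
    (by rw [minSmoothness_of_isRCLikeNormedField]; exact WithTop.coe_le_coe.2 le_top)
  rw [Filter.EventuallyEq.mlieBracket_vectorField_eq (key X) (key Y)] at h1
  have h2 : mpullback 𝓘(ℝ, E) 𝓘(ℝ, E) p (mlieBracket 𝓘(ℝ, E)
      (mulInvariantVectorField (X : GroupLieAlgebra 𝓘(ℝ, E) G))
      (mulInvariantVectorField (Y : GroupLieAlgebra 𝓘(ℝ, E) G))) 0 = lieB E G X Y := by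
    rw [mpullback_apply]
    have h3 : (mfderiv 𝓘(ℝ, E) 𝓘(ℝ, E) p 0).inverse = ContinuousLinearMap.id ℝ E := by
      have h4 : mfderiv 𝓘(ℝ, E) 𝓘(ℝ, E) p 0 = ContinuousLinearMap.id ℝ E := h.md_zero
      rw [h4]; exact ContinuousLinearMap.inverse_id
    rw [h3]
    exact congrArg (fun g ↦ (mlieBracket 𝓘(ℝ, E)
      (mulInvariantVectorField (X : GroupLieAlgebra 𝓘(ℝ, E) G))
      (mulInvariantVectorField (Y : GroupLieAlgebra 𝓘(ℝ, E) G)) g : E)) h.map_zero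
  rw [← h2, h1]
  refine (mlieBracket_model _ _ _).trans ?_
  have hd := h.eventually_smooth_leftFrame.self_of_nhds.differentiableAt (by simp)
  have h5 : ∀ Z, fderiv ℝ (fun x ↦ leftFrame p l x Z) 0 = (fderiv ℝ (leftFrame p l) 0).flip Z := by
    intro Z
    rw [fderiv_clm_apply hd (differentiableAt_const _)]
    simp
  rw [h5, h5, h.leftFrame_zero]
  rfl

end IsLocalParam

end LocalParam

/-! ### The exponential map of a Lie group -/

section Exponential

variable {E : Type*} [NormedAddCommGroup E] [NormedSpace ℝ E]
  {G : Type*} [TopologicalSpace G] [ChartedSpace E G] [Group G] [LieGroup 𝓘(ℝ, E) ∞ G]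

theorem ContMDiff.mdiff {F : Type*} [NormedAddCommGroup F] [NormedSpace ℝ F]
    {M N : Type*} [TopologicalSpace M] [ChartedSpace E M] [TopologicalSpace N] [ChartedSpace F N]
    {f : M → N} (hf : ContMDiff 𝓘(ℝ, E) 𝓘(ℝ, F) ∞ f) (x : M) :
    MDifferentiableAt 𝓘(ℝ, E) 𝓘(ℝ, F) f x := hf.contMDiffAt.mdiff

theorem smooth_mul_left (g : G) : ContMDiff 𝓘(ℝ, E) 𝓘(ℝ, E) ∞ (fun h : G ↦ g * h) :=
  contMDiff_mul_left

theorem smooth_mul_right (g : G) : ContMDiff 𝓘(ℝ, E) 𝓘(ℝ, E) ∞ (fun h : G ↦ h * g) :=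
  contMDiff_mul_right

theorem md_mul_left_comp {F : Type*} [NormedAddCommGroup F] [NormedSpace ℝ F]
    {N : Type*} [TopologicalSpace N] [ChartedSpace F N] {φ : N → G} {x : N} (g : G)
    (hφ : MDifferentiableAt 𝓘(ℝ, F) 𝓘(ℝ, E) φ x) (v : F) :
    md F E (fun y ↦ g * φ y) x v = md E E (fun h : G ↦ g * h) (φ x) (md F E φ x v) :=
  md_comp_apply (g := fun h : G ↦ g * h) (f := φ) x ((smooth_mul_left g).mdiff _) hφ v

theorem md_mul_left_mul (g h : G) (a : G) (X : E) :
    md E E (fun x : G ↦ g * h * x) a X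
      = md E E (fun x : G ↦ g * x) (h * a) (md E E (fun x : G ↦ h * x) a X) := by
  rw [← md_mul_left_comp g ((smooth_mul_left h).mdiff a)]
  simp only [mul_assoc]

/-- Curves everywhere tangent to the left-invariant vector field of `X`. -/
theorem isMIntegralCurve_iff_md {γ : ℝ → G} {X : E} :
    IsMIntegralCurve γ (mulInvariantVectorField (I := 𝓘(ℝ, E)) (G := G) X) ↔
      ∀ t, MDifferentiableAt 𝓘(ℝ, ℝ) 𝓘(ℝ, E) γ t ∧
        md ℝ E γ t 1 = md E E (fun g : G ↦ γ t * g) 1 X := by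
  refine forall_congr' fun t ↦ ⟨fun h ↦ ⟨h.mdifferentiableAt, ?_⟩, fun h ↦ ?_⟩
  · have h1 : md ℝ E γ t = (1 : ℝ →L[ℝ] ℝ).smulRight (md E E (fun g : G ↦ γ t * g) 1 X) := h.mfderiv
    rw [h1]; simp
  · have h1 : md ℝ E γ t = (1 : ℝ →L[ℝ] ℝ).smulRight (md E E (fun g : G ↦ γ t * g) 1 X) := by
      ext; simp [h.2]
    have h2 := h.1.hasMFDerivAt
    exact (show mfderiv 𝓘(ℝ, ℝ) 𝓘(ℝ, E) γ t = _ from h1) ▸ h2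

theorem isMIntegralCurve_mul_left {γ : ℝ → G} {X : E} (g : G)
    (h : IsMIntegralCurve γ (mulInvariantVectorField (I := 𝓘(ℝ, E)) (G := G) X)) :
    IsMIntegralCurve (fun t ↦ g * γ t) (mulInvariantVectorField (I := 𝓘(ℝ, E)) (G := G) X) := by
  rw [isMIntegralCurve_iff_md] at h ⊢
  intro t
  refine ⟨((smooth_mul_left g).mdiff _).comp t (h t).1, ?_⟩
  rw [md_mul_left_comp g (h t).1, (h t).2, md_mul_left_mul, mul_one]

theorem isMIntegralCurve_of_add {γ : ℝ → G} (hγ : MDifferentiableAt 𝓘(ℝ, ℝ) 𝓘(ℝ, E) γ 0)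
    (hadd : ∀ s t, γ (s + t) = γ s * γ t) :
    IsMIntegralCurve γ (mulInvariantVectorField (I := 𝓘(ℝ, E)) (G := G) (md ℝ E γ 0 1)) := by
  rw [isMIntegralCurve_iff_md]
  intro t
  have h0 : γ 0 = 1 := by simpa using hadd 0 0
  have e : γ = fun s ↦ γ t * γ (s - t) := by ext s; rw [← hadd]; simp
  have hs : MDifferentiableAt 𝓘(ℝ, ℝ) 𝓘(ℝ, ℝ) (fun s : ℝ ↦ s - t) t :=
    ((differentiableAt_id (𝕜 := ℝ)).sub_const t).mdifferentiableAt
  have hc : MDifferentiableAt 𝓘(ℝ, ℝ) 𝓘(ℝ, E) (fun s ↦ γ (s - t)) t :=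
    MDifferentiableAt.comp (I' := 𝓘(ℝ, ℝ)) (g := γ) (f := fun s : ℝ ↦ s - t) t (by simpa using hγ) hs
  constructor
  · rw [e]; exact ((smooth_mul_left _).mdiff _).comp t hc
  · have h1 : md ℝ E γ t 1 = md ℝ E (fun s ↦ γ t * γ (s - t)) t 1 := by rw [← e]
    rw [h1, md_mul_left_comp _ hc, sub_self, h0,
      md_comp_apply (g := γ) (f := fun s : ℝ ↦ s - t) t (by simpa using hγ) hs, md_eq_fderiv]
    simp

variable [FiniteDimensional ℝ E]

variable (E G) in
omit [FiniteDimensional ℝ E] in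
theorem chart_isLocalParam : ∃ (p : E → G) (l : G → E), IsLocalParam p l := by
  set φ := extChartAt 𝓘(ℝ, E) (1 : G)
  have hc : Tendsto (fun x : E ↦ φ 1 + x) (𝓝 0) (𝓝 (φ 1)) :=
    (continuous_const.add continuous_id).tendsto' _ _ (add_zero _)
  have h0 : φ.symm (φ 1 + 0) = 1 := by rw [add_zero]; exact extChartAt_to_inv (1 : G)
  have ht : φ.target ∈ 𝓝 (φ 1) := extChartAt_target_mem_nhds (1 : G)
  have hsm : ∀ᶠ x in 𝓝 (0 : E), ContMDiffAt 𝓘(ℝ, E) 𝓘(ℝ, E) ∞ (fun x ↦ φ.symm (φ 1 + x)) x := by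
    filter_upwards [hc.eventually ht] with x hx
    exact (contMDiffAt_extChartAt_symm_of_mem hx).comp x
      (contDiffAt_const.add contDiffAt_id).contMDiffAt
  have hsl : ∀ᶠ g in 𝓝 (1 : G), ContMDiffAt 𝓘(ℝ, E) 𝓘(ℝ, E) ∞ (fun g ↦ φ g - φ 1) g := by
    filter_upwards [extChartAt_source_mem_nhds (I := 𝓘(ℝ, E)) (1 : G)] with g hg
    exact (contDiffAt_id.sub contDiffAt_const).contMDiffAt.comp g (contMDiffAt_extChartAt_of_mem hg)
  refine ⟨fun x ↦ φ.symm (φ 1 + x), fun g ↦ φ g - φ 1, h0, hsm, hsl, ?_, ?_, ?_⟩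
  · filter_upwards [hc.eventually ht] with x hx
    rw [φ.right_inv hx]; abel
  · filter_upwards [extChartAt_source_mem_nhds (I := 𝓘(ℝ, E)) (1 : G)] with g hg
    rw [add_sub_cancel]; exact φ.left_inv hg
  · have hp := hsm.self_of_nhds.mdiff
    have hl : MDifferentiableAt 𝓘(ℝ, E) 𝓘(ℝ, E) φ (1 : G) :=
      (contMDiffAt_extChartAt_of_mem (mem_extChartAt_source (1 : G))).mdiff
    have h2 := md_comp (g := φ) (f := fun x ↦ φ.symm (φ 1 + x)) (0 : E) (by rw [h0]; exact hl) hp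
    have h3 : md E E φ (1 : G) = ContinuousLinearMap.id ℝ E := md_extChartAt_self (1 : G)
    rw [h0, h3, ContinuousLinearMap.id_comp] at h2
    rw [← h2, md_congr (g := fun x : E ↦ φ 1 + x) (hc.eventually ht |>.mono fun x hx ↦ φ.right_inv hx),
      md_eq_fderiv, fderiv_const_add]
    exact fderiv_id

theorem hasDerivAt.md {u : ℝ → E} {t : ℝ} {v : E} (h : HasDerivAt u v t) : md ℝ E u t 1 = v := by
  rw [md_eq_fderiv, h.hasFDerivAt.fderiv]; simp

variable (E G) in
/-- Near `0`, the integral curves through the identity of the left-invariant vector fields depend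
smoothly on the initial velocity. -/
theorem exists_local_curves :
    ∃ c : E → ℝ → G, (∀ᶠ X in 𝓝 0, c X 0 = 1 ∧ IsMIntegralCurveOn (c X)
      (mulInvariantVectorField (I := 𝓘(ℝ, E)) (G := G) X) (Ioo (-1) 1)) ∧
      ∀ t ∈ Ioo (-1 : ℝ) 1, ∀ᶠ X in 𝓝 0, ContMDiffAt 𝓘(ℝ, E) 𝓘(ℝ, E) ∞ (fun X ↦ c X t) X := by
  obtain ⟨p, l, h⟩ := chart_isLocalParam E G
  obtain ⟨u, hu, hs⟩ := exists_smooth_solution h.eventually_smooth_leftFrame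
    (h.smooth.and h.eventually_md_leftFrame)
  refine ⟨fun X t ↦ p (u X t), ?_, fun t ht ↦ ?_⟩
  · filter_upwards [hu] with X hX
    refine ⟨by rw [hX.1, h.map_zero], fun t ht ↦ HasMFDerivAt.hasMFDerivWithinAt ?_⟩
    obtain ⟨⟨h1, h2⟩, h3⟩ := hX.2 t ht
    have h4 : MDifferentiableAt 𝓘(ℝ, ℝ) 𝓘(ℝ, E) (u X) t := h3.differentiableAt.mdifferentiableAt
    have h5 : MDifferentiableAt 𝓘(ℝ, ℝ) 𝓘(ℝ, E) (fun t ↦ p (u X t)) t := h1.mdiff.comp t h4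
    have h6 : md ℝ E (fun t ↦ p (u X t)) t = (1 : ℝ →L[ℝ] ℝ).smulRight
        (md E E (fun g : G ↦ p (u X t) * g) 1 X) := by
      ext
      rw [md_comp_apply (g := p) (f := u X) t h1.mdiff h4, hasDerivAt.md h3, h2]
      simp
    have h7 := h5.hasMFDerivAt
    exact (show mfderiv 𝓘(ℝ, ℝ) 𝓘(ℝ, E) (fun t ↦ p (u X t)) t = _ from h6) ▸ h7
  · filter_upwards [hu, hs t] with X hX h2
    exact (hX.2 t ht).1.1.comp X h2.contMDiffAt

theorem IsMIntegralCurveOn.mul_left {γ : ℝ → G} {X : E} {a : ℝ} (g : G)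
    (h : IsMIntegralCurveOn γ (mulInvariantVectorField (I := 𝓘(ℝ, E)) (G := G) X) (Ioo (-a) a)) :
    IsMIntegralCurveOn (fun t ↦ g * γ t)
      (mulInvariantVectorField (I := 𝓘(ℝ, E)) (G := G) X) (Ioo (-a) a) := by
  intro t ht
  have h1 := (h t ht).hasMFDerivAt (isOpen_Ioo.mem_nhds ht)
  have h2 : md ℝ E γ t = (1 : ℝ →L[ℝ] ℝ).smulRight (md E E (fun g : G ↦ γ t * g) 1 X) := h1.mfderiv
  have h3 : MDifferentiableAt 𝓘(ℝ, ℝ) 𝓘(ℝ, E) (fun t ↦ g * γ t) t :=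
    ((smooth_mul_left g).mdiff _).comp t h1.mdifferentiableAt
  have h6 : md ℝ E (fun t ↦ g * γ t) t = (1 : ℝ →L[ℝ] ℝ).smulRight
        (md E E (fun k : G ↦ g * γ t * k) 1 X) := by
    ext
    rw [md_mul_left_comp g h1.mdifferentiableAt, h2, md_mul_left_mul, mul_one]
    simp
  have h7 := h3.hasMFDerivAt
  exact ((show mfderiv 𝓘(ℝ, ℝ) 𝓘(ℝ, E) (fun t ↦ g * γ t) t = _ from h6) ▸ h7).hasMFDerivWithinAt

theorem one_le_infty_manifold (E : Type*) [NormedAddCommGroup E] [NormedSpace ℝ E]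
    (M : Type*) [TopologicalSpace M] [ChartedSpace E M] [IsManifold 𝓘(ℝ, E) ∞ M] :
    IsManifold 𝓘(ℝ, E) 1 M := IsManifold.of_le (n := ∞) (by simp)

variable [T2Space G]

theorem smooth_mulInvariantVectorField (X : E) : ContMDiff 𝓘(ℝ, E) 𝓘(ℝ, E).tangent 1
    (fun g : G ↦ (⟨g, mulInvariantVectorField (I := 𝓘(ℝ, E)) (G := G) X g⟩ :
      TangentBundle 𝓘(ℝ, E) G)) := by
  have := LieGroup.minSmoothness_three E G
  refine (contMDiff_mulInvariantVectorField (I := 𝓘(ℝ, E)) (G := G) X).of_le ?_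
  rw [minSmoothness_of_isRCLikeNormedField]; norm_num

variable (G) in
/-- A local curve with small initial velocity, rescaled in time; left translations extend it. -/
theorem exists_oneParam (X : E) : ∃ γ : ℝ → G, γ 0 = 1 ∧
    IsMIntegralCurve γ (mulInvariantVectorField (I := 𝓘(ℝ, E)) (G := G) X) := by
  have := one_le_infty_manifold E G
  obtain ⟨c, hc, -⟩ := exists_local_curves E G
  have h1 : Tendsto (fun r : ℝ ↦ r • X) (𝓝[>] 0) (𝓝 0) :=
    ((continuous_id.smul continuous_const).tendsto' 0 0 (by simp)).mono_left nhdsWithin_le_nhds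
  obtain ⟨r, ⟨h2, h3⟩, hr⟩ := ((h1.eventually hc).and self_mem_nhdsWithin).exists
  have hr' : (0 : ℝ) < r := hr
  have h4 := h3.comp_mul r⁻¹
  have h5 : IsMIntegralCurveOn (c (r • X) ∘ fun t ↦ t * r⁻¹)
      (mulInvariantVectorField (I := 𝓘(ℝ, E)) (G := G) X) (Ioo (-r) r) := by
    convert h4 using 1
    · have : mulInvariantVectorField (I := 𝓘(ℝ, E)) (G := G) (r • X) = r • mulInvariantVectorField X :=
        mulInvariantVectorField_smul r X
      rw [this, smul_smul, inv_mul_cancel₀ hr'.ne', one_smul]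
    · ext t
      simp only [mem_Ioo, Set.mem_ofPred_eq]
      rw [← div_eq_mul_inv, lt_div_iff₀ hr', div_lt_iff₀ hr']
      simp
  exact exists_isMIntegralCurve_of_isMIntegralCurveOn (smooth_mulInvariantVectorField X) hr'
    (fun g ↦ ⟨_, by simp [h2], h5.mul_left g⟩) 1

/-- The one-parameter subgroup with initial velocity `X`. -/
noncomputable def oneParam (G : Type*) [TopologicalSpace G] [ChartedSpace E G] [Group G]
    [LieGroup 𝓘(ℝ, E) ∞ G] [T2Space G] (X : E) : ℝ → G :=
  (exists_oneParam G X).choose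

/-- The exponential map of a Lie group. -/
noncomputable def lieExp (G : Type*) [TopologicalSpace G] [ChartedSpace E G] [Group G]
    [LieGroup 𝓘(ℝ, E) ∞ G] [T2Space G] (X : E) : G := oneParam G X 1

theorem oneParam_zero (X : E) : oneParam G X 0 = 1 := (exists_oneParam G X).choose_spec.1

theorem isMIntegralCurve_oneParam (X : E) : IsMIntegralCurve (oneParam G X)
    (mulInvariantVectorField (I := 𝓘(ℝ, E)) (G := G) X) := (exists_oneParam G X).choose_spec.2

theorem oneParam_unique {γ : ℝ → G} {X : E} (h0 : γ 0 = 1)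
    (h : IsMIntegralCurve γ (mulInvariantVectorField (I := 𝓘(ℝ, E)) (G := G) X)) :
    γ = oneParam G X := by
  have := one_le_infty_manifold E G
  exact isMIntegralCurve_Ioo_eq_of_contMDiff_boundaryless (t₀ := 0) (smooth_mulInvariantVectorField X)
    h (isMIntegralCurve_oneParam X) (h0.trans (oneParam_zero X).symm)

theorem oneParam_smul (X : E) (c t : ℝ) : oneParam G (c • X) t = oneParam G X (c * t) := by
  have h := (isMIntegralCurve_oneParam (G := G) X).comp_mul c
  have e : mulInvariantVectorField (I := 𝓘(ℝ, E)) (G := G) (c • X) = c • mulInvariantVectorField X :=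
    mulInvariantVectorField_smul c X
  rw [← e] at h
  have := congrFun (oneParam_unique (by simp [oneParam_zero]) h) t
  rw [← this]; simp [mul_comm]

theorem lieExp_smul (X : E) (t : ℝ) : lieExp G (t • X) = oneParam G X t := by
  rw [lieExp, oneParam_smul, mul_one]

theorem lieExp_zero : lieExp G (0 : E) = 1 := by
  have := lieExp_smul (G := G) (0 : E) 0
  rwa [zero_smul, oneParam_zero] at this

theorem oneParam_add (X : E) (s t : ℝ) : oneParam G X (s + t) = oneParam G X s * oneParam G X t := by
  have h1 := isMIntegralCurve_mul_left (oneParam G X s)⁻¹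
    ((isMIntegralCurve_oneParam (G := G) X).comp_add s)
  have := congrFun (oneParam_unique (by simp) h1) t
  rw [← this]; simp [add_comm]

theorem lieExp_add_smul (X : E) (s t : ℝ) :
    lieExp G ((s + t) • X) = lieExp G (s • X) * lieExp G (t • X) := by
  simp only [lieExp_smul, oneParam_add]

theorem lieExp_neg (X : E) : lieExp G (-X) = (lieExp G X)⁻¹ := by
  have := lieExp_add_smul (G := G) X 1 (-1)
  simp only [add_neg_cancel, zero_smul, lieExp_zero, one_smul, neg_smul] at this
  exact (inv_eq_of_mul_eq_one_right this.symm).symm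

theorem lieExp_nsmul (X : E) (n : ℕ) : lieExp G ((n : ℝ) • X) = lieExp G X ^ n := by
  induction n with
  | zero => simp [lieExp_zero]
  | succ n ih => rw [pow_succ, ← ih, Nat.cast_succ, lieExp_add_smul, one_smul]

/-- Near `0` by smooth dependence on parameters; elsewhere because `exp X = exp (X / n) ^ n`. -/
theorem contMDiff_lieExp : ContMDiff 𝓘(ℝ, E) 𝓘(ℝ, E) ∞ (lieExp G : E → G) := by
  have := one_le_infty_manifold E G
  obtain ⟨c, hc, hs⟩ := exists_local_curves E G
  have h2 : Tendsto (fun X : E ↦ (2 : ℝ) • X) (𝓝 0) (𝓝 0) :=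
    (continuous_const_smul (2 : ℝ)).tendsto' _ _ (by simp)
  have hev : (fun X ↦ c ((2 : ℝ) • X) (1 / 2)) =ᶠ[𝓝 0] (lieExp G : E → G) := by
    filter_upwards [h2.eventually hc] with X hX
    have h3 := isMIntegralCurveOn_Ioo_eqOn_of_contMDiff_boundaryless (t₀ := 0) (a := -1) (b := 1)
      (by norm_num) (smooth_mulInvariantVectorField ((2 : ℝ) • X)) hX.2
      ((isMIntegralCurve_oneParam ((2 : ℝ) • X)).isMIntegralCurveOn _)
      (hX.1.trans (oneParam_zero _).symm) (show (1 / 2 : ℝ) ∈ Ioo (-1 : ℝ) 1 by norm_num)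
    rw [h3, oneParam_smul, lieExp]
    norm_num
  have hnear : ∀ᶠ X in 𝓝 (0 : E), ContMDiffAt 𝓘(ℝ, E) 𝓘(ℝ, E) ∞ (lieExp G : E → G) X := by
    filter_upwards [h2.eventually (hs (1 / 2) (by norm_num)), hev.eventually_nhds] with X h3 h4
    have h5 : ContMDiffAt 𝓘(ℝ, E) 𝓘(ℝ, E) ∞ (fun X ↦ c ((2 : ℝ) • X) (1 / 2)) X :=
      ContMDiffAt.comp (I' := 𝓘(ℝ, E)) (g := fun Y ↦ c Y (1 / 2)) (f := fun X : E ↦ (2 : ℝ) • X) X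
        h3 (contDiffAt_const.smul contDiffAt_id).contMDiffAt
    exact h5.congr_of_eventuallyEq (h4.mono fun _ h ↦ h.symm)
  intro X
  have h6 : Tendsto (fun n : ℕ ↦ ((n : ℝ) + 1)⁻¹ • X) atTop (𝓝 0) := by
    have := tendsto_one_div_add_atTop_nhds_zero_nat (𝕜 := ℝ)
    simpa using this.smul_const X
  obtain ⟨n, hn⟩ := (h6.eventually hnear).exists
  have hpow : ∀ (k : ℕ) (f : E → G), ContMDiffAt 𝓘(ℝ, E) 𝓘(ℝ, E) ∞ f X →
      ContMDiffAt 𝓘(ℝ, E) 𝓘(ℝ, E) ∞ (fun y ↦ f y ^ k) X := by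
    intro k f hf
    induction k with
    | zero => simpa using contMDiffAt_const
    | succ k ih => simpa only [pow_succ] using contMDiffAt_mul_comp ih hf
  have h7 := hpow (n + 1) (fun Y ↦ lieExp G (((n : ℝ) + 1)⁻¹ • Y))
    (ContMDiffAt.comp (I' := 𝓘(ℝ, E)) (g := lieExp G) (f := fun Y : E ↦ ((n : ℝ) + 1)⁻¹ • Y) X
        hn (contDiffAt_const.smul contDiffAt_id).contMDiffAt)
  refine h7.congr_of_eventuallyEq (Eventually.of_forall fun Y ↦ ?_)
  have hne : ((n : ℝ) + 1) ≠ 0 := by positivity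
  show lieExp G Y = lieExp G (((n : ℝ) + 1)⁻¹ • Y) ^ (n + 1)
  rw [← lieExp_nsmul, smul_smul]; push_cast
  rw [mul_inv_cancel₀ hne, one_smul]

theorem lieExp_of_add {γ : ℝ → G} (hγ : MDifferentiableAt 𝓘(ℝ, ℝ) 𝓘(ℝ, E) γ 0)
    (hadd : ∀ s t, γ (s + t) = γ s * γ t) (t : ℝ) : γ t = lieExp G (t • md ℝ E γ 0 1) := by
  rw [lieExp_smul, ← oneParam_unique (by simpa using hadd 0 0) (isMIntegralCurve_of_add hγ hadd)]

theorem hasDerivAt_smul_line (X : E) (t : ℝ) : HasDerivAt (fun t : ℝ ↦ t • X) X t := by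
  simpa using (hasDerivAt_id t).smul_const X

theorem md_lieExp_zero : md E E (lieExp G) (0 : E) = ContinuousLinearMap.id ℝ E := by
  ext X
  have h1 := (isMIntegralCurve_iff_md.1 (isMIntegralCurve_oneParam (G := G) X) 0).2
  have h2 : oneParam G X = fun t : ℝ ↦ lieExp G (t • X) := by ext t; rw [lieExp_smul]
  have h3 := md_comp_apply (g := lieExp G) (f := fun t : ℝ ↦ t • X) 0 (contMDiff_lieExp.mdiff _)
    (hasDerivAt_smul_line X 0).differentiableAt.mdifferentiableAt 1
  rw [← h2, hasDerivAt.md (hasDerivAt_smul_line X 0), h1, oneParam_zero, zero_smul] at h3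
  rw [← h3]
  simp only [one_mul]
  rw [md_id]

variable (E G) in
theorem exists_lieLog : ∃ l : G → E, IsLocalParam (lieExp G) l := by
  obtain ⟨p, l, h⟩ := chart_isLocalParam E G
  have hc : Tendsto (lieExp G : E → G) (𝓝 0) (𝓝 1) :=
    contMDiff_lieExp.continuous.tendsto' _ _ lieExp_zero
  have hf : ∀ᶠ X in 𝓝 (0 : E), ContDiffAt ℝ ∞ (fun X ↦ l (lieExp G X)) X := by
    filter_upwards [hc.eventually h.smooth_symm] with X hX
    rw [← contMDiffAt_iff_contDiffAt]
    exact hX.comp X contMDiff_lieExp.contMDiffAt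
  have hl : md E E l 1 = ContinuousLinearMap.id ℝ E := by
    have := h.eventually_inverse.self_of_nhds.1
    rwa [h.map_zero, h.md_zero, ContinuousLinearMap.comp_id] at this
  have hd : fderiv ℝ (fun X ↦ l (lieExp G X)) 0 = ContinuousLinearMap.id ℝ E := by
    rw [← md_eq_fderiv, md_comp (g := l) (f := (lieExp G : E → G)) 0 _ (contMDiff_lieExp.mdiff _),
      md_lieExp_zero, lieExp_zero, hl]
    · rfl
    · rw [lieExp_zero]; exact h.smooth_symm.self_of_nhds.mdiff
  have hd' : HasFDerivAt (fun X ↦ l (lieExp G X))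
      (ContinuousLinearEquiv.refl ℝ E : E →L[ℝ] E) 0 := by
    have := (hf.self_of_nhds.differentiableAt (by simp)).hasFDerivAt
    rw [hd] at this; exact this
  obtain ⟨g, g0, g1, g2, g3⟩ := exists_smooth_localInverse hf _ hd'
  simp only [lieExp_zero, h.symm_one] at g0 g2 g3
  have hlc := h.continuousAt_symm
  have hgc : Tendsto g (𝓝 0) (𝓝 0) := by
    have := g3.self_of_nhds.continuousAt
    rwa [ContinuousAt, g0] at this
  have hgl := hgc.comp hlc
  refine ⟨fun x ↦ g (l x), lieExp_zero, Eventually.of_forall fun _ ↦ contMDiff_lieExp.contMDiffAt,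
    ?_, g1, ?_, md_lieExp_zero⟩
  · filter_upwards [h.smooth_symm, hlc.eventually g3] with x h1 h2
    exact h2.contMDiffAt.comp x h1
  · have h1 : Tendsto (fun x ↦ lieExp G (g (l x))) (𝓝 1) (𝓝 1) := hc.comp hgl
    filter_upwards [hlc.eventually g2, h.right_inv, h1.eventually h.right_inv] with x h2 h3 h4
    rw [← h4, h2, h3]

variable (E) in
/-- A local inverse at the identity of the exponential map. -/
noncomputable def lieLog : G → E := (exists_lieLog E G).choose

variable (E G) in
theorem isLocalParam_lieExp : IsLocalParam (lieExp G : E → G) (lieLog E) :=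
  (exists_lieLog E G).choose_spec

end Exponential

/-! ### Logarithmic derivatives and the Maurer-Cartan equation -/

section MaurerCartan

variable {E : Type*} [NormedAddCommGroup E] [NormedSpace ℝ E] [FiniteDimensional ℝ E]
  {G : Type*} [TopologicalSpace G] [ChartedSpace E G] [Group G] [LieGroup 𝓘(ℝ, E) ∞ G] [T2Space G]
  {W : Type*} [NormedAddCommGroup W] [NormedSpace ℝ W]
  {W' : Type*} [NormedAddCommGroup W'] [NormedSpace ℝ W']

variable (E G) in
/-- The Lie bracket of `G` on the model space, as a continuous bilinear map. -/
noncomputable def lieBL : E →L[ℝ] E →L[ℝ] E :=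
  fderiv ℝ (leftFrame (lieExp G) (lieLog E)) 0 - (fderiv ℝ (leftFrame (lieExp G) (lieLog E)) 0).flip

theorem lieBL_apply (X Y : E) : lieBL E G X Y = lieB E G X Y :=
  ((isLocalParam_lieExp E G).lieB_eq X Y).symm

theorem lieBL_skew (X Y : E) : lieBL E G X Y = - lieBL E G Y X := by simp [lieBL]

theorem lieBL_jacobi (X Y Z : E) :
    lieBL E G X (lieBL E G Y Z) = lieBL E G (lieBL E G X Y) Z + lieBL E G Y (lieBL E G X Z) := by
  have := LieGroup.minSmoothness_three E G
  simp only [lieBL_apply]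
  have h : ∀ a b c : GroupLieAlgebra 𝓘(ℝ, E) G, ⁅a, ⁅b, c⁆⁆ = ⁅⁅a, b⁆, c⁆ + ⁅b, ⁅a, c⁆⁆ :=
    fun a b c ↦ leibniz_lie a b c
  exact h X Y Z

/-- The left logarithmic derivative `φ⁻¹ dφ` of a map into a Lie group. -/
noncomputable def lder (φ : W → G) (x : W) : W →L[ℝ] E :=
  fderiv ℝ (fun y ↦ lieLog E ((φ x)⁻¹ * φ y)) x

theorem tendsto_inv_mul (E : Type*) [NormedAddCommGroup E] [NormedSpace ℝ E]
    {G : Type*} [TopologicalSpace G] [ChartedSpace E G] [Group G] [LieGroup 𝓘(ℝ, E) ∞ G]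
    {N : Type*} [TopologicalSpace N] {φ : N → G} {x : N} (h : ContinuousAt φ x) :
    Tendsto (fun y ↦ (φ x)⁻¹ * φ y) (𝓝 x) (𝓝 1) := by
  have := LieGroup.isTopologicalGroup E G
  simpa using h.tendsto.const_mul (φ x)⁻¹

theorem contDiffAt_log_inv_mul {φ : W → G} {x : W} (h : ContMDiffAt 𝓘(ℝ, W) 𝓘(ℝ, E) ∞ φ x) :
    ContDiffAt ℝ ∞ (fun y ↦ lieLog E ((φ x)⁻¹ * φ y)) x := by
  rw [← contMDiffAt_iff_contDiffAt]
  have h1 := (isLocalParam_lieExp E G).smooth_symm.self_of_nhds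
  refine ContMDiffAt.comp (I' := 𝓘(ℝ, E)) (g := lieLog E) (f := fun y ↦ (φ x)⁻¹ * φ y) x ?_
    (contMDiffAt_mul_comp contMDiffAt_const h)
  rwa [inv_mul_cancel]

theorem eventually_eq_mul_exp {φ : W → G} {x : W} (h : ContMDiffAt 𝓘(ℝ, W) 𝓘(ℝ, E) ∞ φ x) :
    ∀ᶠ y in 𝓝 x, φ y = φ x * lieExp G (lieLog E ((φ x)⁻¹ * φ y)) := by
  filter_upwards [(tendsto_inv_mul E h.continuousAt).eventually
    (isLocalParam_lieExp E G).right_inv] with y hy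
  rw [hy]; group

theorem lieLog_one : lieLog E (1 : G) = 0 := (isLocalParam_lieExp E G).symm_one

theorem lder_comp {φ : W → G} {f : W' → W} (x : W')
    (h : ContMDiffAt 𝓘(ℝ, W) 𝓘(ℝ, E) ∞ φ (f x)) (hf : DifferentiableAt ℝ f x) :
    lder (E := E) (fun y ↦ φ (f y)) x = lder φ (f x) ∘L fderiv ℝ f x :=
  fderiv_comp x ((contDiffAt_log_inv_mul h).differentiableAt (by simp)) hf

theorem lder_congr {φ ψ : W → G} {x : W} (h : φ =ᶠ[𝓝 x] ψ) :
    lder (E := E) φ x = lder ψ x := by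
  refine Filter.EventuallyEq.fderiv_eq ?_
  filter_upwards [h] with y hy
  rw [hy, h.self_of_nhds]

theorem lder_mul_left (g : G) (φ : W → G) (x : W) :
    lder (E := E) (fun y ↦ g * φ y) x = lder φ x := by
  simp [lder, mul_assoc]

theorem lder_lieExp_zero : lder (lieExp G) (0 : E) = ContinuousLinearMap.id ℝ E := by
  rw [lder, ← fderiv_id (x := (0 : E))]
  refine Filter.EventuallyEq.fderiv_eq ?_
  filter_upwards [(isLocalParam_lieExp E G).left_inv] with y hy
  rw [lieExp_zero, inv_one, one_mul, hy]; rfl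

theorem md_eq_lder {φ : W → G} {x : W} (h : ContMDiffAt 𝓘(ℝ, W) 𝓘(ℝ, E) ∞ φ x) (v : W) :
    md W E φ x v = md E E (fun g : G ↦ φ x * g) 1 (lder φ x v) := by
  have h1 := (contDiffAt_log_inv_mul (E := E) h).contMDiffAt.mdiff
  have e : lieLog E ((φ x)⁻¹ * φ x) = 0 := by rw [inv_mul_cancel, lieLog_one]
  have h2 : MDifferentiableAt 𝓘(ℝ, W) 𝓘(ℝ, E) (fun y ↦ lieExp G (lieLog E ((φ x)⁻¹ * φ y))) x :=
    (contMDiff_lieExp.mdiff _).comp x h1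
  rw [md_congr (eventually_eq_mul_exp (E := E) h), md_mul_left_comp (φ x) h2,
    md_comp_apply (g := lieExp G) (f := fun y ↦ lieLog E ((φ x)⁻¹ * φ y)) x
      (contMDiff_lieExp.mdiff _) h1, e, lieExp_zero, md_lieExp_zero, md_eq_fderiv]
  rfl

theorem eventually_lder_eq {φ : W → G} (h : ContMDiff 𝓘(ℝ, W) 𝓘(ℝ, E) ∞ φ) (x : W) :
    ∀ᶠ y in 𝓝 x, lder (E := E) φ y = lder (lieExp G) (lieLog E ((φ x)⁻¹ * φ y)) ∘L
      fderiv ℝ (fun y ↦ lieLog E ((φ x)⁻¹ * φ y)) y := by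
  have h3 := contDiffAt_log_inv_mul (E := E) (h x)
  have h4 : ∀ᶠ y in 𝓝 x, ContDiffAt ℝ 1 (fun y ↦ lieLog E ((φ x)⁻¹ * φ y)) y :=
    (h3.of_le (by simp)).eventually (by simp)
  filter_upwards [(eventually_eq_mul_exp (E := E) (h x)).eventually_nhds, h4] with y h1 h2
  rw [lder_congr h1, lder_mul_left, lder_comp y contMDiff_lieExp.contMDiffAt
    (h2.differentiableAt (by simp))]

theorem contDiff_lder {φ : W → G} (h : ContMDiff 𝓘(ℝ, W) 𝓘(ℝ, E) ∞ φ) :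
    ContDiff ℝ ∞ (lder (E := E) φ) := by
  refine contDiff_iff_contDiffAt.2 fun x ↦ ?_
  refine ContDiffAt.fderiv (f := fun x y ↦ lieLog E ((φ x)⁻¹ * φ y)) (n := ∞) (g := fun x ↦ x) ?_
    contDiffAt_id (by simp)
  rw [← contMDiffAt_iff_contDiffAt]
  have h1 := (isLocalParam_lieExp E G).smooth_symm.self_of_nhds
  refine ContMDiffAt.comp (I' := 𝓘(ℝ, E)) (g := lieLog E)
    (f := fun q : W × W ↦ (φ q.1)⁻¹ * φ q.2) (x, x) ?_
    (contMDiffAt_mul_comp ?_ ?_)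
  · rwa [inv_mul_cancel]
  · exact ((h x).comp (x, x) contDiffAt_fst.contMDiffAt).inv
  · exact (h x).comp (x, x) contDiffAt_snd.contMDiffAt

theorem eventually_lder_exp_leftFrame : ∀ᶠ x in 𝓝 (0 : E),
    lder (lieExp G) x ∘L leftFrame (lieExp G) (lieLog E) x = ContinuousLinearMap.id ℝ E := by
  have := LieGroup.isTopologicalGroup E G
  have hp := isLocalParam_lieExp E G
  filter_upwards [hp.left_inv, hp.continuousAt_zero.eventually hp.right_inv.eventually_nhds,
    hp.eventually_smooth_mul_zero] with x h1 h2 h3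
  have h5 : Tendsto (fun y : E ↦ lieExp G x * lieExp G y) (𝓝 0) (𝓝 (lieExp G x)) := by
    simpa using hp.continuousAt_zero.const_mul (lieExp G x)
  have h6 := h5.eventually h2
  have h7 : ContDiffAt ℝ ∞ (fun y : E ↦ lieLog E (lieExp G x * lieExp G y)) 0 :=
    h3.comp (0 : E) (contDiffAt_const.prodMk contDiffAt_id)
  have h8 := lder_comp (φ := (lieExp G : E → G)) (f := fun y : E ↦ lieLog E (lieExp G x * lieExp G y)) 0
    contMDiff_lieExp.contMDiffAt (h7.differentiableAt (by simp))
  rw [lder_congr h6, lder_mul_left, lder_lieExp_zero] at h8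
  rw [lieExp_zero, mul_one, h1] at h8
  exact h8.symm

theorem contDiff_lder_lieExp : ContDiff ℝ ∞ (lder (lieExp G) : E → E →L[ℝ] E) :=
  contDiff_lder contMDiff_lieExp

/-- Differentiate `eventually_lder_exp_leftFrame` at `0`, where both factors are the identity. -/
theorem fderiv_lder_exp_zero (a b : E) : fderiv ℝ (lder (lieExp G)) (0 : E) a b =
    - fderiv ℝ (leftFrame (lieExp G) (lieLog E)) 0 a b := by
  have h1 := (contDiff_lder_lieExp (E := E) (G := G)).differentiable (by simp) (0 : E) |>.hasFDerivAt
  have h2 := ((isLocalParam_lieExp E G).eventually_smooth_leftFrame.self_of_nhds.differentiableAt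
    (by simp)).hasFDerivAt
  have h3 := h1.clm_comp h2
  have h4 := (hasFDerivAt_const (𝕜 := ℝ) (ContinuousLinearMap.id ℝ E) (0 : E)).congr_of_eventuallyEq
    (eventually_lder_exp_leftFrame (E := E) (G := G))
  have h5 := DFunLike.congr_fun (DFunLike.congr_fun (h3.unique h4) a) b
  simp only [lder_lieExp_zero, (isLocalParam_lieExp E G).leftFrame_zero] at h5
  simp at h5
  exact eq_neg_of_add_eq_zero_right h5

/-- The Maurer-Cartan equation. -/
theorem maurerCartan {φ : W → G} (h : ContMDiff 𝓘(ℝ, W) 𝓘(ℝ, E) ∞ φ) (x v w : W) :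
    fderiv ℝ (lder (E := E) φ) x v w - fderiv ℝ (lder (E := E) φ) x w v =
      - lieBL E G (lder φ x v) (lder φ x w) := by
  -- Near `x`, `lder φ` is `lder exp` at `u` composed with the derivative of `u`, and the second
  -- derivative of `u` is symmetric.
  set u : W → E := fun y ↦ lieLog E ((φ x)⁻¹ * φ y) with hu
  have hus : ContDiffAt ℝ ∞ u x := contDiffAt_log_inv_mul (E := E) (h x)
  have e : u x = 0 := by rw [hu]; simp only [inv_mul_cancel, lieLog_one]
  have hsymm : IsSymmSndFDerivAt ℝ u x := hus.isSymmSndFDerivAt (by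
    rw [minSmoothness_of_isRCLikeNormedField]; exact WithTop.coe_le_coe.2 le_top)
  have h1 := (contDiff_lder_lieExp (E := E) (G := G)).differentiable (by simp) (u x) |>.hasFDerivAt
  have h2 := (hus.differentiableAt (by simp)).hasFDerivAt
  have h3 : HasFDerivAt (fderiv ℝ u) (fderiv ℝ (fderiv ℝ u) x) x :=
    ((hus.fderiv_right (m := 1) (by exact WithTop.coe_le_coe.2 le_top)).differentiableAt (by simp)).hasFDerivAt
  have h4 := (h1.comp x h2).clm_comp h3
  have h5 := (h4.congr_of_eventuallyEq (eventually_lder_eq (E := E) h x)).fderiv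
  have h6 : fderiv ℝ u x = lder φ x := rfl
  rw [h5]
  simp only [add_apply, ContinuousLinearMap.comp_apply,
    ContinuousLinearMap.compL_apply, ContinuousLinearMap.flip_apply, Function.comp_apply, e,
    lder_lieExp_zero, h6]
  simp only [fderiv_lder_exp_zero, lieBL, sub_apply, ContinuousLinearMap.flip_apply,
    ContinuousLinearMap.id_apply]
  rw [hsymm v w]
  abel

theorem lder_lieExp_smul_self (X : E) (t : ℝ) : lder (lieExp G) (t • X) X = X := by
  have h1 := lder_comp (φ := (lieExp G : E → G)) (f := fun s : ℝ ↦ s • X) t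
    contMDiff_lieExp.contMDiffAt (hasDerivAt_smul_line X t).differentiableAt
  have h2 : (fderiv ℝ (fun s : ℝ ↦ s • X) t) 1 = X := by
    simpa using (hasDerivAt_smul_line X t).deriv
  have h3 : Tendsto (fun s : ℝ ↦ (s - t) • X) (𝓝 t) (𝓝 0) := by
    have : Continuous fun s : ℝ ↦ (s - t) • X := by fun_prop
    exact this.tendsto' _ _ (by simp)
  have h4 : (fun s : ℝ ↦ lieLog E ((lieExp G (t • X))⁻¹ * lieExp G (s • X))) =ᶠ[𝓝 t]
      fun s ↦ (s - t) • X := by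
    filter_upwards [h3.eventually (isLocalParam_lieExp E G).left_inv] with s hs
    rw [← lieExp_neg, ← neg_smul, ← lieExp_add_smul, neg_add_eq_sub, hs]
  have h5 : HasDerivAt (fun s : ℝ ↦ (s - t) • X) X t := by
    simpa using ((hasDerivAt_id t).sub_const t).smul_const X
  have h6 := congrArg (fun A ↦ A (1 : ℝ)) h1
  simp only [ContinuousLinearMap.comp_apply, h2] at h6
  rw [← h6, lder, h4.fderiv_eq, h5.hasFDerivAt.fderiv]
  simp

theorem lder_lieExp_self (X : E) : lder (lieExp G) X X = X := by
  simpa using lder_lieExp_smul_self (G := G) X 1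

/-- The Jacobi field `t ↦ t • lder exp (t X) W` solves a linear differential equation. -/
theorem hasDerivAt_smul_lder (X W : E) (t : ℝ) :
    HasDerivAt (fun t : ℝ ↦ t • lder (E := E) (lieExp G) (t • X) W)
      (W - lieBL E G X (t • lder (E := E) (lieExp G) (t • X) W)) t := by
  have hP := (contDiff_lder_lieExp (E := E) (G := G)).differentiable (by simp)
  have h1 : HasDerivAt (fun t : ℝ ↦ lder (E := E) (lieExp G) (t • X) W)
      (fderiv ℝ (lder (E := E) (lieExp G)) (t • X) X W) t := by
    have := (hP (t • X)).hasFDerivAt.comp_hasDerivAt t (hasDerivAt_smul_line X t)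
    simpa using this.clm_apply (hasDerivAt_const t W)
  have h2 : fderiv ℝ (lder (E := E) (lieExp G)) (t • X) W (t • X) + lder (E := E) (lieExp G) (t • X) W = W := by
    have h3 := (hP (t • X)).hasFDerivAt.clm_apply (hasFDerivAt_id (t • X))
    have h4 : (fun y : E ↦ lder (E := E) (lieExp G) y (id y)) = (id : E → E) := by
      ext y; exact lder_lieExp_self y
    rw [h4] at h3
    have := DFunLike.congr_fun (h3.unique (hasFDerivAt_id (t • X))) W
    simp only [add_apply, ContinuousLinearMap.comp_apply,
      ContinuousLinearMap.flip_apply, ContinuousLinearMap.id_apply, id] at this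
    rw [add_comm]; exact this
  have h5 := maurerCartan (contMDiff_lieExp (E := E) (G := G)) (t • X) X W
  rw [lder_lieExp_smul_self] at h5
  have h6 := (hasDerivAt_id t).smul h1
  refine h6.congr_deriv ?_
  rw [one_smul, map_smul]
  rw [map_smul] at h2
  have h7 : fderiv ℝ (lder (E := E) (lieExp G)) (t • X) X W =
    - lieBL E G X (lder (E := E) (lieExp G) (t • X) W)
      + fderiv ℝ (lder (E := E) (lieExp G)) (t • X) W X := sub_eq_iff_eq_add.1 h5
  rw [sub_eq_neg_add]
  nth_rewrite 4 [← h2]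
  rw [h7, smul_add, smul_neg, id, add_assoc]

/-! ### The adjoint representation -/

/-- The adjoint representation on the model space. -/
noncomputable def adE (E : Type*) [NormedAddCommGroup E] [NormedSpace ℝ E]
    {G : Type*} [TopologicalSpace G] [ChartedSpace E G] [Group G] (k : G) : E →L[ℝ] E :=
  md E E (fun g : G ↦ k * g * k⁻¹) 1

theorem smooth_conj (k : G) : ContMDiff 𝓘(ℝ, E) 𝓘(ℝ, E) ∞ (fun g : G ↦ k * g * k⁻¹) :=
  (smooth_mul_right k⁻¹).comp (smooth_mul_left k)

theorem md_exp_line (X : E) : md ℝ E (fun t : ℝ ↦ lieExp G (t • X)) 0 1 = X := by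
  have h1 := (hasDerivAt_smul_line X 0).differentiableAt.mdifferentiableAt
  rw [md_comp_apply (g := lieExp G) (f := fun t : ℝ ↦ t • X) 0 (contMDiff_lieExp.mdiff _) h1,
    hasDerivAt.md (hasDerivAt_smul_line X 0), zero_smul, md_lieExp_zero]
  rfl

theorem contMDiff_exp_line (X : E) :
    ContMDiff 𝓘(ℝ, ℝ) 𝓘(ℝ, E) ∞ (fun t : ℝ ↦ lieExp G (t • X)) :=
  ContMDiff.comp (I' := 𝓘(ℝ, E)) (g := lieExp G) (f := fun t : ℝ ↦ t • X) contMDiff_lieExp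
    (contDiff_id.smul contDiff_const).contMDiff

theorem lieExp_adE (k : G) (X : E) : lieExp G (adE E k X) = k * lieExp G X * k⁻¹ := by
  have h1 : ContMDiff 𝓘(ℝ, ℝ) 𝓘(ℝ, E) ∞ (fun t : ℝ ↦ k * lieExp G (t • X) * k⁻¹) :=
    (smooth_conj k).comp (contMDiff_exp_line X)
  have h2 := lieExp_of_add (h1.mdiff 0) (fun s t ↦ by rw [lieExp_add_smul]; group) 1
  rw [one_smul, one_smul, md_comp_apply (g := fun g : G ↦ k * g * k⁻¹)
    (f := fun t : ℝ ↦ lieExp G (t • X)) 0 ((smooth_conj k).mdiff _)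
    ((contMDiff_exp_line X).mdiff 0), md_exp_line, zero_smul, lieExp_zero] at h2
  exact h2.symm

theorem adE_mul (g h : G) (X : E) : adE E (g * h) X = adE E g (adE E h X) := by
  have h1 := md_comp_apply (g := fun x : G ↦ g * x * g⁻¹) (f := fun x : G ↦ h * x * h⁻¹) 1
    ((smooth_conj g).mdiff _) ((smooth_conj h).mdiff 1) X
  rw [mul_one, mul_inv_cancel] at h1
  rw [adE, adE, adE, ← h1]
  congr 2; ext x; group

theorem adE_one (X : E) : adE E (1 : G) X = X := by
  simp only [adE, one_mul, inv_one, mul_one, md_id]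
  rfl

theorem adE_inv_adE (g : G) (X : E) : adE E g⁻¹ (adE E g X) = X := by
  rw [← adE_mul, inv_mul_cancel, adE_one]

theorem adE_adE_inv (g : G) (X : E) : adE E g (adE E g⁻¹ X) = X := by
  rw [← adE_mul, mul_inv_cancel, adE_one]

/-- Left logarithmic derivatives change under right translation by the adjoint action. -/
theorem lder_conj (φ : W → G) (x : W) (g : G) (h : ContMDiffAt 𝓘(ℝ, W) 𝓘(ℝ, E) ∞ φ x) (v : W) :
    lder (E := E) (fun y ↦ φ y * g) x v = adE E g⁻¹ (lder φ x v) := by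
  have h0 := contDiffAt_log_inv_mul (E := E) h
  have h1 : Tendsto (fun y ↦ adE E g⁻¹ (lieLog E ((φ x)⁻¹ * φ y))) (𝓝 x) (𝓝 0) := by
    have := ((adE E g⁻¹).continuous.continuousAt.comp h0.continuousAt).tendsto
    rw [Function.comp_def] at this
    simpa [lieLog_one] using this
  have h2 : (fun y ↦ lieLog E ((φ x * g)⁻¹ * (φ y * g))) =ᶠ[𝓝 x]
      fun y ↦ adE E g⁻¹ (lieLog E ((φ x)⁻¹ * φ y)) := by
    filter_upwards [h1.eventually (isLocalParam_lieExp E G).left_inv,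
      (tendsto_inv_mul E h.continuousAt).eventually
      (isLocalParam_lieExp E G).right_inv] with y h3 h4
    rw [← h3, lieExp_adE, h4]
    congr 1; group
  rw [lder, h2.fderiv_eq]
  have := ((adE E g⁻¹).hasFDerivAt.comp x (h0.differentiableAt (by simp)).hasFDerivAt).fderiv
  exact DFunLike.congr_fun this v

/-- `Ad (exp (-tX)) Y` is a logarithmic derivative of `exp (sY) exp (tX)`, so that its derivative is
given by the Maurer-Cartan equation. -/
theorem hasDerivAt_adE_neg (X Y : E) (t : ℝ) :
    HasDerivAt (fun t : ℝ ↦ adE E (lieExp G (-(t • X))) Y)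
      (- lieBL E G X (adE E (lieExp G (-(t • X))) Y)) t := by
  -- The logarithmic derivative is `X` in the first direction and `Ad (exp (-tX)) Y` in the second.
  let φ : ℝ × ℝ → G := fun q ↦ lieExp G (q.2 • Y) * lieExp G (q.1 • X)
  have hφ : ContMDiff 𝓘(ℝ, ℝ × ℝ) 𝓘(ℝ, E) ∞ φ := by
    intro q
    refine contMDiffAt_mul_comp ?_ ?_
    · exact ((contMDiff_exp_line (G := G) Y) q.2).comp q contDiffAt_snd.contMDiffAt
    · exact ((contMDiff_exp_line (G := G) X) q.1).comp q contDiffAt_fst.contMDiffAt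
  have hline : ∀ (Z : E) (s : ℝ), lder (fun r : ℝ ↦ lieExp G (r • Z)) s 1 = Z := by
    intro Z s
    rw [lder_comp (φ := (lieExp G : E → G)) (f := fun r : ℝ ↦ r • Z) s contMDiff_lieExp.contMDiffAt
      (hasDerivAt_smul_line Z s).differentiableAt, ContinuousLinearMap.comp_apply,
      (hasDerivAt_smul_line Z s).hasFDerivAt.fderiv]
    simp [lder_lieExp_smul_self]
  have h1 : ∀ q, lder φ q (1, 0) = X := by
    intro q
    have h2 : HasDerivAt (fun r : ℝ ↦ ((r, q.2) : ℝ × ℝ)) (1, 0) q.1 :=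
      (hasDerivAt_id q.1).prodMk (hasDerivAt_const q.1 q.2)
    have h3 := lder_comp (φ := φ) (f := fun r : ℝ ↦ ((r, q.2) : ℝ × ℝ)) q.1 (hφ _)
      h2.differentiableAt
    have h4 := DFunLike.congr_fun h3 1
    rw [ContinuousLinearMap.comp_apply, h2.hasFDerivAt.fderiv] at h4
    simp only [φ, lder_mul_left, hline] at h4
    rw [h4]; simp [φ]
  have h1' : ∀ q, lder φ q (0, 1) = adE E (lieExp G (-(q.1 • X))) Y := by
    intro q
    have h2 : HasDerivAt (fun r : ℝ ↦ ((q.1, r) : ℝ × ℝ)) (0, 1) q.2 :=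
      (hasDerivAt_const q.2 q.1).prodMk (hasDerivAt_id q.2)
    have h3 := lder_comp (φ := φ) (f := fun r : ℝ ↦ ((q.1, r) : ℝ × ℝ)) q.2 (hφ _)
      h2.differentiableAt
    have h4 := DFunLike.congr_fun h3 1
    rw [ContinuousLinearMap.comp_apply, h2.hasFDerivAt.fderiv] at h4
    simp only [φ] at h4
    rw [lder_conj _ _ _ (contMDiff_exp_line (G := G) Y q.2), hline, ← lieExp_neg] at h4
    rw [h4]; simp [φ]
  have h5 := maurerCartan hφ (t, 0) (1, 0) (0, 1)
  have hd := (contDiff_lder hφ).differentiable (by simp)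
  have h6 : HasDerivAt (fun t : ℝ ↦ lder φ (t, (0 : ℝ)) (0, 1))
      (fderiv ℝ (lder (E := E) φ) (t, 0) (1, 0) (0, 1)) t := by
    have h2 : HasDerivAt (fun r : ℝ ↦ ((r, 0) : ℝ × ℝ)) (1, 0) t :=
      (hasDerivAt_id t).prodMk (hasDerivAt_const t 0)
    have := (hd (t, 0)).hasFDerivAt.comp_hasDerivAt t h2
    simpa using this.clm_apply (hasDerivAt_const t ((0, 1) : ℝ × ℝ))
  have h7 : fderiv ℝ (lder (E := E) φ) (t, 0) (0, 1) (1, 0) = 0 := by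
    have := (hd (t, 0)).hasFDerivAt.clm_apply (hasFDerivAt_const ((1, 0) : ℝ × ℝ) ((t, 0) : ℝ × ℝ))
    have h8 : (fun y ↦ lder (E := E) φ y (1, 0)) = fun _ ↦ X := funext h1
    rw [h8] at this
    have := DFunLike.congr_fun (this.unique (hasFDerivAt_const X _)) (0, 1)
    simpa using this
  rw [h7, sub_zero, h1, h1'] at h5
  rw [h5] at h6
  simpa only [h1'] using h6

theorem hasDerivAt_adE (X Y : E) (t : ℝ) :
    HasDerivAt (fun t : ℝ ↦ adE E (lieExp G (t • X)) Y)
      (lieBL E G X (adE E (lieExp G (t • X)) Y)) t := by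
  have := hasDerivAt_adE_neg (G := G) (-X) Y t
  simpa using this

end MaurerCartan

/-! ### Smooth actions and orbit maps -/

section Action

variable {E : Type*} [NormedAddCommGroup E] [NormedSpace ℝ E]
  {G : Type*} [TopologicalSpace G] [ChartedSpace E G] [Group G] [LieGroup 𝓘(ℝ, E) ∞ G]
  {F : Type*} [NormedAddCommGroup F] [NormedSpace ℝ F]
  {M : Type*} [TopologicalSpace M] [ChartedSpace F M] [IsManifold 𝓘(ℝ, F) ∞ M]
  [MulAction G M] [ContMDiffSMul 𝓘(ℝ, E) 𝓘(ℝ, F) ∞ G M]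
  {W : Type*} [NormedAddCommGroup W] [NormedSpace ℝ W]

/-- The differential at `x` of the action of `g`. -/
noncomputable def push (F : Type*) [NormedAddCommGroup F] [NormedSpace ℝ F]
    {G M : Type*} [TopologicalSpace M] [ChartedSpace F M] [Group G] [MulAction G M]
    (g : G) (x : M) : F →L[ℝ] F :=
  md F F (fun y : M ↦ g • y) x

/-- The differential at the identity of the orbit map of `x`, on the model spaces. -/
noncomputable def fundE (E F G : Type*) [NormedAddCommGroup E] [NormedSpace ℝ E]
    [NormedAddCommGroup F] [NormedSpace ℝ F]
    [TopologicalSpace G] [ChartedSpace E G] [Group G] {M : Type*}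
    [TopologicalSpace M] [ChartedSpace F M] [MulAction G M] (x : M) : E →L[ℝ] F :=
  md E F (fun g : G ↦ g • x) 1

variable (E) in
theorem smooth_smul_comp {N : Type*} [TopologicalSpace N] [ChartedSpace W N] {a : N → G} {b : N → M}
    {x : N} (ha : ContMDiffAt 𝓘(ℝ, W) 𝓘(ℝ, E) ∞ a x) (hb : ContMDiffAt 𝓘(ℝ, W) 𝓘(ℝ, F) ∞ b x) :
    ContMDiffAt 𝓘(ℝ, W) 𝓘(ℝ, F) ∞ (fun y ↦ a y • b y) x := ha.smul hb

variable (E) in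
include E in
theorem smooth_smul (g : G) :
    ContMDiff 𝓘(ℝ, F) 𝓘(ℝ, F) ∞ (fun x : M ↦ g • x) :=
  fun _ ↦ smooth_smul_comp E contMDiffAt_const contMDiffAt_id

theorem smooth_orbit (x : M) : ContMDiff 𝓘(ℝ, E) 𝓘(ℝ, F) ∞ (fun g : G ↦ g • x) :=
  fun _ ↦ smooth_smul_comp E contMDiffAt_id contMDiffAt_const

theorem push_one (x : M) : push F (1 : G) x = ContinuousLinearMap.id ℝ F := by
  simp only [push, one_smul, md_id]

section
variable (E)
include E

theorem push_mul (g h : G) (x : M) : push F (g * h) x = push F g (h • x) ∘L push F h x := by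
  rw [push, push, push, ← md_comp (g := fun y : M ↦ g • y) (f := fun y : M ↦ h • y) x
    ((smooth_smul E g).mdiff _) ((smooth_smul E h).mdiff _)]
  simp only [mul_smul]

theorem push_mul_apply (g h : G) (x : M) (v : F) :
    push F (g * h) x v = push F g (h • x) (push F h x v) := by rw [push_mul E]; rfl

theorem push_inv_push (g : G) (x : M) (v : F) : push F g⁻¹ (g • x) (push F g x v) = v := by
  rw [← push_mul_apply E, inv_mul_cancel, push_one]; rfl

theorem push_push_inv (g : G) (x : M) (v : F) : push F g x (push F g⁻¹ (g • x) v) = v := by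
  have h := push_mul_apply E g g⁻¹ (g • x) v
  rw [mul_inv_cancel, push_one, inv_smul_smul] at h
  exact h.symm

theorem push_injective (g : G) (x : M) : Function.Injective (push F g x) :=
  Function.LeftInverse.injective (push_inv_push E g x)

theorem md_smul_comp {N : Type*} [TopologicalSpace N] [ChartedSpace W N] {f : N → M} {x : N} (g : G)
    (hf : MDifferentiableAt 𝓘(ℝ, W) 𝓘(ℝ, F) f x) (v : W) :
    md W F (fun y ↦ g • f y) x v = push F g (f x) (md W F f x v) :=
  md_comp_apply (g := fun y : M ↦ g • y) (f := f) x ((smooth_smul E g).mdiff _) hf v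

end

theorem md_orbit (g : G) (x : M) (X : E) :
    md E F (fun h : G ↦ h • x) g (md E E (fun h : G ↦ g * h) 1 X) = push F g x (fundE E F G x X) := by
  have h1 := md_comp_apply (g := fun h : G ↦ h • x) (f := fun h : G ↦ g * h) (1 : G)
    ((smooth_orbit (E := E) (F := F) x).mdiff _) ((smooth_mul_left g).mdiff _) X
  have h2 := md_smul_comp E (f := fun h : G ↦ h • x) (x := (1 : G)) g
    ((smooth_orbit (E := E) (F := F) x).mdiff _) X
  simp only [mul_smul, one_smul, mul_one] at h1 h2
  rw [← h1, h2]; rfl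

variable [FiniteDimensional ℝ E] [T2Space G]

theorem fundE_adE (g : G) (x : M) (X : E) :
    fundE E F G (g • x) (adE E g X) = push F g x (fundE E F G x X) := by
  have h1 := md_comp_apply (g := fun h : G ↦ h • (g • x)) (f := fun h : G ↦ g * h * g⁻¹) (1 : G)
    ((smooth_orbit (E := E) (F := F) (g • x)).mdiff _) ((smooth_conj g).mdiff _) X
  have h2 := md_smul_comp E (f := fun h : G ↦ h • x) (x := (1 : G)) g
    ((smooth_orbit (E := E) (F := F) x).mdiff _) X
  simp only [mul_smul, inv_smul_smul, mul_one, mul_inv_cancel, one_smul] at h1 h2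
  rw [h1] at h2
  exact h2

theorem md_smul_orbit {φ : W → G} {y : W} (h : ContMDiffAt 𝓘(ℝ, W) 𝓘(ℝ, E) ∞ φ y) (x : M) (v : W) :
    md W F (fun z ↦ φ z • x) y v = push F (φ y) x (fundE E F G x (lder φ y v)) := by
  rw [md_comp_apply (g := fun h : G ↦ h • x) (f := φ) y
    ((smooth_orbit (E := E) (F := F) x).mdiff _) h.mdiff, md_eq_lder h, md_orbit]

theorem lder_exp_line (X : E) (t : ℝ) : lder (fun r : ℝ ↦ lieExp G (r • X)) t 1 = X := by
  rw [lder_comp (φ := (lieExp G : E → G)) (f := fun r : ℝ ↦ r • X) t contMDiff_lieExp.contMDiffAt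
      (hasDerivAt_smul_line X t).differentiableAt, ContinuousLinearMap.comp_apply,
      (hasDerivAt_smul_line X t).hasFDerivAt.fderiv]
  simp [lder_lieExp_smul_self]

theorem smooth_exp_orbit (X : E) (x : M) :
    ContMDiff 𝓘(ℝ, ℝ) 𝓘(ℝ, F) ∞ (fun t : ℝ ↦ lieExp G (t • X) • x) :=
  (smooth_orbit (E := E) (F := F) x).comp (contMDiff_exp_line X)

theorem md_exp_orbit (X : E) (x : M) (t : ℝ) :
    md ℝ F (fun t : ℝ ↦ lieExp G (t • X) • x) t 1 =
      push F (lieExp G (t • X)) x (fundE E F G x X) := by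
  rw [md_smul_orbit (contMDiff_exp_line X t), lder_exp_line]

/-- The orbit of a zero of a fundamental field is constant, by uniqueness of integral curves. -/
theorem exp_smul_eq_of_fundE_eq_zero [CompleteSpace F] [T2Space M] {x : M} {X : E}
    (h : fundE E F G x X = 0) : lieExp G X • x = x := by
  have := one_le_infty_manifold F M
  have hz : ContMDiff 𝓘(ℝ, F) 𝓘(ℝ, F).tangent 1
      (fun x : M ↦ (⟨x, (0 : F)⟩ : TangentBundle 𝓘(ℝ, F) M)) :=
    Bundle.contMDiff_zeroSection ℝ (TangentSpace 𝓘(ℝ, F) : M → Type _)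
  have h1 : IsMIntegralCurve (I := 𝓘(ℝ, F)) (fun t : ℝ ↦ lieExp G (t • X) • x)
      (fun _ : M ↦ (0 : F) : Π x : M, TangentSpace 𝓘(ℝ, F) x) := by
    intro t
    have h2 := ((smooth_exp_orbit (G := G) (F := F) X x).mdiff t).hasMFDerivAt
    have h3 : md ℝ F (fun t : ℝ ↦ lieExp G (t • X) • x) t =
        (1 : ℝ →L[ℝ] ℝ).smulRight (0 : F) := by
      ext
      rw [md_exp_orbit, h]; simp
    exact (show mfderiv 𝓘(ℝ, ℝ) 𝓘(ℝ, F) (fun t : ℝ ↦ lieExp G (t • X) • x) t = _ from h3) ▸ h2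
  have h2 : IsMIntegralCurve (I := 𝓘(ℝ, F)) (fun _ : ℝ ↦ x)
      (fun _ : M ↦ (0 : F) : Π x : M, TangentSpace 𝓘(ℝ, F) x) := isMIntegralCurve_const rfl
  have := congrFun (isMIntegralCurve_Ioo_eq_of_contMDiff_boundaryless (t₀ := 0) hz h1 h2
    (by simp [lieExp_zero])) 1
  simpa using this

variable (E G) in
/-- To first order, the local group law is addition. -/
theorem hasFDerivAt_lieLog_mul :
    HasFDerivAt (fun q : E × E ↦ lieLog E (lieExp G q.1 * lieExp G q.2))
      (ContinuousLinearMap.fst ℝ E E + ContinuousLinearMap.snd ℝ E E) 0 := by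
  have hp := isLocalParam_lieExp E G
  have h1 := (hp.eventually_smooth_mul.self_of_nhds.differentiableAt (by simp)).hasFDerivAt
  set A := fderiv ℝ (fun q : E × E ↦ lieLog E (lieExp G q.1 * lieExp G q.2)) 0
  have h2 : A ∘L ContinuousLinearMap.inl ℝ E E = ContinuousLinearMap.id ℝ E := by
    have h3 := HasFDerivAt.comp (g := fun q : E × E ↦ lieLog E (lieExp G q.1 * lieExp G q.2))
      (f := fun x : E ↦ ((x, 0) : E × E)) (0 : E) h1 (hasFDerivAt_prodMk_left (0 : E) (0 : E))
    refine h3.unique ((hasFDerivAt_id _).congr_of_eventuallyEq ?_)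
    filter_upwards [hp.left_inv] with x hx
    simp [lieExp_zero, hx]
  have h2' : A ∘L ContinuousLinearMap.inr ℝ E E = ContinuousLinearMap.id ℝ E := by
    have h3 := HasFDerivAt.comp (g := fun q : E × E ↦ lieLog E (lieExp G q.1 * lieExp G q.2))
      (f := fun x : E ↦ ((0, x) : E × E)) (0 : E) h1 (hasFDerivAt_prodMk_right (0 : E) (0 : E))
    refine h3.unique ((hasFDerivAt_id _).congr_of_eventuallyEq ?_)
    filter_upwards [hp.left_inv] with x hx
    simp [lieExp_zero, hx]
  have hA : A = ContinuousLinearMap.fst ℝ E E + ContinuousLinearMap.snd ℝ E E := by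
    refine ContinuousLinearMap.ext fun q ↦ ?_
    have e : q = ContinuousLinearMap.inl ℝ E E q.1 + ContinuousLinearMap.inr ℝ E E q.2 := by simp
    have k1 := DFunLike.congr_fun h2 q.1
    have k2 := DFunLike.congr_fun h2' q.2
    rw [ContinuousLinearMap.comp_apply] at k1 k2
    conv_lhs => rw [e, map_add, k1, k2]
    rfl
  rw [hA] at h1
  exact h1

variable (G) in
/-- Canonical coordinates of the second kind adapted to a splitting. -/
theorem exists_product_coords (pr : E →L[ℝ] E) : ∃ θ : E → E, θ 0 = 0 ∧
    ∀ᶠ z in 𝓝 (0 : E), ContDiffAt ℝ ∞ θ z ∧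
      lieExp G z = lieExp G (pr (θ z)) * lieExp G (θ z - pr (θ z)) := by
  have hp := isLocalParam_lieExp E G
  have hL : Tendsto (fun X : E ↦ ((pr X, X - pr X) : E × E)) (𝓝 0) (𝓝 0) := by
    have : Continuous fun X : E ↦ ((pr X, X - pr X) : E × E) := by fun_prop
    exact this.tendsto' _ _ (by simp)
  have hLd : ∀ X, ContDiffAt ℝ ∞ (fun X : E ↦ ((pr X, X - pr X) : E × E)) X := fun X ↦
    pr.contDiff.contDiffAt.prodMk (contDiffAt_id.sub pr.contDiff.contDiffAt)
  have hf : ∀ᶠ X in 𝓝 (0 : E), ContDiffAt ℝ ∞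
      (fun X ↦ lieLog E (lieExp G (pr X) * lieExp G (X - pr X))) X := by
    filter_upwards [hL.eventually hp.eventually_smooth_mul] with X hX
    exact ContDiffAt.comp (g := fun q : E × E ↦ lieLog E (lieExp G q.1 * lieExp G q.2)) X hX (hLd X)
  have hf0 : lieLog E (lieExp G (pr (0 : E)) * lieExp G ((0 : E) - pr 0)) = 0 := by
    simp [lieExp_zero, lieLog_one]
  have hd : HasFDerivAt (fun X ↦ lieLog E (lieExp G (pr X) * lieExp G (X - pr X)))
      (ContinuousLinearEquiv.refl ℝ E : E →L[ℝ] E) 0 := by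
    have h2 : HasFDerivAt (fun X : E ↦ ((pr X, X - pr X) : E × E))
        (pr.prod (ContinuousLinearMap.id ℝ E - pr)) 0 :=
      pr.hasFDerivAt.prodMk ((hasFDerivAt_id _).sub pr.hasFDerivAt)
    have h3 := HasFDerivAt.comp (g := fun q : E × E ↦ lieLog E (lieExp G q.1 * lieExp G q.2))
        (f := fun X : E ↦ ((pr X, X - pr X) : E × E)) (0 : E) (by
          have e : ((pr (0 : E), (0 : E) - pr 0) : E × E) = 0 := by simp
          rw [e]; exact hasFDerivAt_lieLog_mul E G) h2
    refine h3.congr_fderiv (ContinuousLinearMap.ext fun x ↦ ?_)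
    show pr x + (x - pr x) = x
    abel
  obtain ⟨g, g0, -, g2, g3⟩ := exists_smooth_localInverse hf _ hd
  rw [hf0] at g0 g2 g3
  have hgc : Tendsto g (𝓝 0) (𝓝 0) := by
    have := g3.self_of_nhds.continuousAt
    rwa [ContinuousAt, g0] at this
  have hT : Tendsto (fun z ↦ lieExp G (pr (g z)) * lieExp G (g z - pr (g z))) (𝓝 0) (𝓝 1) := by
    have := LieGroup.isTopologicalGroup E G
    have hc : Continuous fun X ↦ lieExp G (pr X) * lieExp G (X - pr X) :=
      (contMDiff_lieExp.continuous.comp pr.continuous).mul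
        (contMDiff_lieExp.continuous.comp (continuous_id.sub pr.continuous))
    exact (hc.tendsto' 0 1 (by simp [lieExp_zero])).comp hgc
  refine ⟨g, g0, ?_⟩
  filter_upwards [g2, g3, hT.eventually hp.right_inv] with z h1 h2 h3
  exact ⟨h2, by rw [← h3, h1]⟩

end Action

/-! ### Reductive decompositions -/

section Reductive

variable {EG : Type*} [NormedAddCommGroup EG] [NormedSpace ℝ EG] [FiniteDimensional ℝ EG]
    {EM : Type*} [NormedAddCommGroup EM] [NormedSpace ℝ EM] [FiniteDimensional ℝ EM]
    {G : Type*} [TopologicalSpace G] [T2Space G]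
    [ChartedSpace EG G] [Group G] [LieGroup 𝓘(ℝ, EG) ∞ G]
    {M : Type*} [TopologicalSpace M] [T2Space M]
    [ChartedSpace EM M] [IsManifold 𝓘(ℝ, EM) ∞ M]
    [MulAction G M] [ContMDiffSMul 𝓘(ℝ, EG) 𝓘(ℝ, EM) ∞ G M]
    {o : M}

namespace ReductiveDecomposition

/-- The isotropy subalgebra as a subspace of the model space. -/
def kE (d : ReductiveDecomposition EG G o) : Submodule ℝ EG := d.𝔨

/-- The reductive complement as a subspace of the model space. -/
def pE (d : ReductiveDecomposition EG G o) : Submodule ℝ EG := d.𝔭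

/-- The projection to the reductive complement, on the model space. -/
noncomputable def prP (d : ReductiveDecomposition EG G o) : EG →L[ℝ] EG :=
  LinearMap.toContinuousLinearMap (show EG →ₗ[ℝ] EG from d.proj𝔭)

/-- The projection to the isotropy subalgebra, on the model space. -/
noncomputable def prK (d : ReductiveDecomposition EG G o) : EG →L[ℝ] EG :=
  LinearMap.toContinuousLinearMap (show EG →ₗ[ℝ] EG from d.proj𝔨)

variable (d : ReductiveDecomposition EG G o)

theorem prP_mem (X : EG) : d.prP X ∈ d.pE :=
  Submodule.projection_apply_mem (E := GroupLieAlgebra 𝓘(ℝ, EG) G) d.isCompl.symm X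

theorem prK_mem (X : EG) : d.prK X ∈ d.kE :=
  Submodule.projection_apply_mem (E := GroupLieAlgebra 𝓘(ℝ, EG) G) d.isCompl X

theorem prK_add_prP (X : EG) : d.prK X + d.prP X = X :=
  Submodule.projection_add_projection_eq_self (E := GroupLieAlgebra 𝓘(ℝ, EG) G) d.isCompl X

theorem prP_of_mem {X : EG} (h : X ∈ d.pE) : d.prP X = X :=
  (Submodule.projection_eq_self_iff (E := GroupLieAlgebra 𝓘(ℝ, EG) G) d.isCompl.symm X).2 h

theorem prK_of_mem {X : EG} (h : X ∈ d.kE) : d.prK X = X :=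
  (Submodule.projection_eq_self_iff (E := GroupLieAlgebra 𝓘(ℝ, EG) G) d.isCompl X).2 h

theorem prP_of_mem_kE {X : EG} (h : X ∈ d.kE) : d.prP X = 0 := by
  have := d.prK_add_prP X
  rw [d.prK_of_mem h] at this
  simpa using this

theorem prP_eq_self_sub (X : EG) : d.prP X = X - d.prK X := by
  rw [eq_sub_iff_add_eq', d.prK_add_prP]

theorem mem_kE_iff {X : EG} : X ∈ d.kE ↔ fundE EG EM G o X = 0 := by
  constructor
  · intro hX
    have h : X ∈ (d.𝔨 : Set (GroupLieAlgebra 𝓘(ℝ, EG) G)) := hX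
    rw [d.coe_𝔨] at h
    obtain ⟨γ, h1, h2, h3, h4⟩ := h
    have h5 : (fun t ↦ γ t • o) = fun _ ↦ o := funext fun t ↦ h4 t
    have h6 := md_comp_apply (g := fun g : G ↦ g • o) (f := γ) 0
      ((smooth_orbit (E := EG) (F := EM) o).mdiff _) (h1.mdiff 0) 1
    have h7 : γ 0 = 1 := by simpa using h2 0 0
    rw [h5, md_const, h7] at h6
    have h8 : md ℝ EG γ 0 1 = X := h3
    rw [h8] at h6
    exact h6.symm
  · intro h
    show X ∈ (d.𝔨 : Set (GroupLieAlgebra 𝓘(ℝ, EG) G))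
    rw [d.coe_𝔨]
    refine ⟨fun t ↦ lieExp G (t • X), contMDiff_exp_line X, fun s t ↦ lieExp_add_smul X s t,
      md_exp_line X, fun t ↦ ?_⟩
    exact exp_smul_eq_of_fundE_eq_zero (F := EM) (by rw [map_smul, h, smul_zero])

variable (EM) in
include EM in
theorem exp_smul_of_mem_kE {X : EG} (h : X ∈ d.kE) : lieExp G X • o = o :=
  exp_smul_eq_of_fundE_eq_zero (F := EM) (d.mem_kE_iff.1 h)

theorem fundE_prP (X : EG) : fundE EG EM G o (d.prP X) = fundE EG EM G o X := by
  rw [d.prP_eq_self_sub, map_sub, d.mem_kE_iff.1 (d.prK_mem X), sub_zero]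

theorem adE_mem_pE {k : G} (hk : k • o = o) {X : EG} (hX : X ∈ d.pE) : adE EG k X ∈ d.pE := by
  have h := d.map_Ad k hk
  have h1 : adE EG k X ∈ d.𝔭.map (Ad k).toLinearMap := ⟨X, hX, rfl⟩
  rw [h] at h1
  exact h1

variable (EM) in
include EM in
theorem adE_mem_kE {k : G} (hk : k • o = o) {X : EG} (hX : X ∈ d.kE) :
    adE EG k X ∈ d.kE := by
  rw [d.mem_kE_iff (EM := EM)] at hX ⊢
  have := fundE_adE (F := EM) k o X
  rw [hk, hX, map_zero] at this
  exact this

variable (EM) in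
include EM in
theorem prP_adE {k : G} (hk : k • o = o) (X : EG) :
    d.prP (adE EG k X) = adE EG k (d.prP X) := by
  conv_lhs => rw [← d.prK_add_prP X]
  rw [map_add, map_add, d.prP_of_mem_kE (d.adE_mem_kE EM hk (d.prK_mem X)),
    d.prP_of_mem (d.adE_mem_pE hk (d.prP_mem X)), zero_add]

theorem mem_of_hasDerivAt {E : Type*} [NormedAddCommGroup E] [NormedSpace ℝ E]
    [FiniteDimensional ℝ E] (S : Submodule ℝ E) {f : ℝ → E} {f' : E} {t : ℝ} (h : HasDerivAt f f' t)
    (hf : ∀ᶠ s in 𝓝 t, f s ∈ S) : f' ∈ S := by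
  have hc : IsClosed (S : Set E) := S.closed_of_finiteDimensional
  refine hc.mem_of_tendsto h.tendsto_slope ?_
  filter_upwards [hf.filter_mono nhdsWithin_le_nhds] with s hs
  exact S.smul_mem _ (S.sub_mem hs hf.self_of_nhds)

variable (EM) in
include EM in
theorem lieBL_mem_pE {A X : EG} (hA : A ∈ d.kE) (hX : X ∈ d.pE) :
    lieBL EG G A X ∈ d.pE := by
  have h := hasDerivAt_adE (G := G) A X 0
  rw [zero_smul, lieExp_zero, adE_one] at h
  exact mem_of_hasDerivAt d.pE h (Eventually.of_forall fun s ↦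
    d.adE_mem_pE (d.exp_smul_of_mem_kE EM (d.kE.smul_mem s hA)) hX)

variable [SecondCountableTopology G] [MulAction.IsPretransitive G M]

variable (EG EM) in
include EG EM in
/-- An instance of the open mapping theorem for transitive actions of σ-compact groups, which needs
no rank condition on the orbit map. -/
theorem isOpenMap_orbit (x : M) :
    IsOpenMap (fun g : G ↦ g • x) := by
  have := LieGroup.isTopologicalGroup EG G
  have : LocallyCompactSpace G := Manifold.locallyCompact_of_finiteDimensional 𝓘(ℝ, EG)
  have : LocallyCompactSpace M := Manifold.locallyCompact_of_finiteDimensional 𝓘(ℝ, EM)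
  have : ContinuousSMul G M :=
    ContMDiffSMul.continuousSMul (I := 𝓘(ℝ, EG)) (I' := 𝓘(ℝ, EM)) ∞
  exact isOpenMap_smul_of_sigmaCompact x

variable (EM) in
include EM in
/-- A small element of `G` is a product `exp X exp A` with `X ∈ 𝔭` and `A ∈ 𝔨`, and `exp A` fixes
`o`. -/
theorem exp_pE_mem_nhds (d : ReductiveDecomposition EG G o) {U : Set EG} (hU : U ∈ 𝓝 0) :
    (fun X : EG ↦ lieExp G X • o) '' (U ∩ d.pE) ∈ 𝓝 o := by
  obtain ⟨θ, h0, hθ⟩ := exists_product_coords G d.prP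
  have hp := isLocalParam_lieExp EG G
  have hc : Tendsto (fun z ↦ d.prP (θ z)) (𝓝 0) (𝓝 0) := by
    have := d.prP.continuous.continuousAt.comp hθ.self_of_nhds.1.continuousAt
    rw [ContinuousAt, Function.comp_apply, h0, map_zero] at this
    exact this
  have h1 : ∀ᶠ g in 𝓝 (1 : G), ∃ X ∈ U ∩ (d.pE : Set EG), lieExp G X • o = g • o := by
    filter_upwards [hp.right_inv, hp.continuousAt_symm.eventually hθ,
      hp.continuousAt_symm.eventually (hc.eventually hU)] with g h2 h3 h4
    refine ⟨d.prP (θ (lieLog EG g)), ⟨h4, d.prP_mem _⟩, ?_⟩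
    have h5 : θ (lieLog EG g) - d.prP (θ (lieLog EG g)) ∈ d.kE := by
      have := d.prK_mem (θ (lieLog EG g))
      rwa [eq_sub_of_add_eq (d.prK_add_prP (θ (lieLog EG g)))] at this
    have h6 := congrArg (· • o) h3.2
    simp only [h2, mul_smul] at h6
    rw [h6, d.exp_smul_of_mem_kE EM h5]
  have h5 := (isOpenMap_orbit EG EM (G := G) o).image_mem_nhds h1
  rw [one_smul] at h5
  filter_upwards [h5] with y hy
  obtain ⟨g, ⟨X, hX, h6⟩, rfl⟩ := hy
  exact ⟨X, hX, h6⟩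

/-- Smooth maps do not raise Hausdorff dimension, and the image of `𝔭` under `X ↦ exp X • o` is a
neighbourhood of `o`. This replaces an appeal to Sard's theorem in proving that the orbit map is a
submersion. -/
theorem finrank_le (d : ReductiveDecomposition EG G o) :
    Module.finrank ℝ EM ≤ Module.finrank ℝ d.pE := by
  -- The exponential orbit map on `𝔭`, read in the chart at `o`.
  let f : d.pE → EM := fun u ↦ extChartAt 𝓘(ℝ, EM) o (lieExp G (u : EG) • o)
  have hs : ContMDiff 𝓘(ℝ, d.pE) 𝓘(ℝ, EM) ∞ (fun u : d.pE ↦ lieExp G (u : EG) • o) :=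
    (smooth_orbit (E := EG) (F := EM) o).comp (contMDiff_lieExp.comp
      (d.pE.subtypeL.contDiff.contMDiff : ContMDiff 𝓘(ℝ, d.pE) 𝓘(ℝ, EG) ∞ d.pE.subtypeL))
  have h0 : lieExp G ((0 : d.pE) : EG) • o = o := by simp [lieExp_zero]
  have h1 : ∀ᶠ u in 𝓝 (0 : d.pE), ContDiffAt ℝ 1 f u := by
    have : Tendsto (fun u : d.pE ↦ lieExp G (u : EG) • o) (𝓝 0) (𝓝 o) := by
      have := hs.continuous.tendsto 0
      rwa [h0] at this
    filter_upwards [this.eventually (extChartAt_source_mem_nhds (I := 𝓘(ℝ, EM)) o)] with u hu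
    have h2 : ContMDiffAt 𝓘(ℝ, d.pE) 𝓘(ℝ, EM) ∞ f u :=
      (contMDiffAt_extChartAt_of_mem hu).comp u (hs u)
    exact h2.contDiffAt.of_le (by simp)
  obtain ⟨r, hr, h2⟩ := Metric.eventually_nhds_iff_ball.1 h1
  have h3 : dimH (f '' Metric.ball 0 r) ≤ dimH (Metric.ball (0 : d.pE) r) :=
    ContDiffOn.dimH_image_le (fun u hu ↦ (h2 u hu).contDiffWithinAt) (convex_ball 0 r) subset_rfl
  have h4 : dimH (Metric.ball (0 : d.pE) r) = Module.finrank ℝ d.pE :=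
    Real.dimH_of_mem_nhds (Metric.ball_mem_nhds _ hr)
  have h5 : f '' Metric.ball 0 r ∈ 𝓝 (extChartAt 𝓘(ℝ, EM) o o) := by
    have h6 := exp_pE_mem_nhds EM d (Metric.ball_mem_nhds (0 : EG) hr)
    have h7 := (continuousAt_extChartAt_symm (I := 𝓘(ℝ, EM)) o).preimage_mem_nhds
      (by rwa [extChartAt_to_inv])
    filter_upwards [h7, extChartAt_target_mem_nhds (I := 𝓘(ℝ, EM)) o] with y hy hy2
    obtain ⟨X, ⟨hX1, hX2⟩, h8⟩ := hy
    refine ⟨⟨X, hX2⟩, by simpa using hX1, ?_⟩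
    simp only [f]
    rw [show lieExp G X • o = _ from h8]
    exact (extChartAt 𝓘(ℝ, EM) o).right_inv hy2
  have h6 := Real.dimH_of_mem_nhds h5
  rw [h6, h4] at h3
  exact_mod_cast h3

/-- The fundamental fields are injective on `𝔭` at `o`, and surjective by dimension. -/
theorem exists_fundE_eq (d : ReductiveDecomposition EG G o) (v : EM) :
    ∃ X ∈ d.pE, fundE EG EM G o X = v := by
  let A : d.pE →ₗ[ℝ] EM := (fundE EG EM G o).toLinearMap ∘ₗ d.pE.subtype
  have hA : Function.Injective A := by
    rw [← LinearMap.ker_eq_bot, LinearMap.ker_eq_bot']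
    intro X hX
    have h1 : (X : EG) ∈ d.kE := d.mem_kE_iff.2 hX
    have h2 := d.prP_of_mem_kE h1
    rw [d.prP_of_mem X.2] at h2
    exact Subtype.ext h2
  have h1 : Module.finrank ℝ d.pE = Module.finrank ℝ EM :=
    le_antisymm (LinearMap.finrank_le_finrank_of_injective hA) (finrank_le d)
  obtain ⟨X, hX⟩ := (LinearMap.injective_iff_surjective_of_finrank_eq_finrank h1).1 hA v
  exact ⟨X, X.2, hX⟩

variable (EM) in
theorem exists_jE (d : ReductiveDecomposition EG G o) : ∃ J : EM →L[ℝ] EG, (∀ v, J v ∈ d.pE) ∧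
      (∀ v, fundE EG EM G o (J v) = v) ∧ ∀ X, J (fundE EG EM G o X) = d.prP X := by
  choose j hj1 hj2 using fun v : EM ↦ d.exists_fundE_eq v
  have hinj : ∀ X ∈ d.pE, ∀ Y ∈ d.pE, fundE EG EM G o X = fundE EG EM G o Y → X = Y := by
    intro X hX Y hY h
    have h1 : X - Y ∈ d.kE := (d.mem_kE_iff (EM := EM)).2 (by rw [map_sub, h, sub_self])
    have h2 := d.prP_of_mem_kE h1
    rw [d.prP_of_mem (d.pE.sub_mem hX hY)] at h2
    exact sub_eq_zero.1 h2
  let J : EM →ₗ[ℝ] EG :=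
    { toFun := j
      map_add' := fun v w ↦ hinj _ (hj1 _) _ (d.pE.add_mem (hj1 _) (hj1 _)) (by simp [hj2])
      map_smul' := fun c v ↦ hinj _ (hj1 _) _ (d.pE.smul_mem _ (hj1 _)) (by simp [hj2]) }
  refine ⟨LinearMap.toContinuousLinearMap J, hj1, hj2, fun X ↦ ?_⟩
  exact hinj _ (hj1 _) _ (d.prP_mem X) (by rw [hj2, d.fundE_prP])

/-- The inverse `T_o M → 𝔭` of the identification `X ↦ X^*_o`. -/
noncomputable def jE (d : ReductiveDecomposition EG G o) (EM : Type*) [NormedAddCommGroup EM]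
    [NormedSpace ℝ EM] [FiniteDimensional ℝ EM] [ChartedSpace EM M] [IsManifold 𝓘(ℝ, EM) ∞ M]
    [ContMDiffSMul 𝓘(ℝ, EG) 𝓘(ℝ, EM) ∞ G M] : EM →L[ℝ] EG := (d.exists_jE EM).choose

theorem jE_mem (v : EM) : d.jE EM v ∈ d.pE := (d.exists_jE EM).choose_spec.1 v

theorem fundE_jE (v : EM) : fundE EG EM G o (d.jE EM v) = v := (d.exists_jE EM).choose_spec.2.1 v

theorem jE_fundE (X : EG) : d.jE EM (fundE EG EM G o X) = d.prP X :=
  (d.exists_jE EM).choose_spec.2.2 X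

/-- The identification `T_o M ≅ 𝔭` intertwines the isotropy and the adjoint representation. -/
theorem jE_push {k : G} (hk : k • o = o) (v : EM) :
    d.jE EM (push EM k o v) = adE EG k (d.jE EM v) := by
  have h := fundE_adE (F := EM) k o (d.jE EM v)
  rw [d.fundE_jE, hk] at h
  rw [← h, d.jE_fundE, d.prP_of_mem (d.adE_mem_pE hk (d.jE_mem v))]

theorem smooth_expJ : ContMDiff 𝓘(ℝ, EM) 𝓘(ℝ, EM) ∞ (fun v : EM ↦ lieExp G (d.jE EM v) • o) :=
  (smooth_orbit (E := EG) (F := EM) o).comp (contMDiff_lieExp.comp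
      ((d.jE EM).contDiff.contMDiff : ContMDiff 𝓘(ℝ, EM) 𝓘(ℝ, EG) ∞ (d.jE EM)))

theorem md_expJ (v w : EM) : md EM EM (fun v : EM ↦ lieExp G (d.jE EM v) • o) v w =
    push EM (lieExp G (d.jE EM v)) o (fundE EG EM G o (lder (lieExp G) (d.jE EM v) (d.jE EM w))) := by
  have h : ContMDiff 𝓘(ℝ, EM) 𝓘(ℝ, EG) ∞ (fun v : EM ↦ lieExp G (d.jE EM v)) :=
    contMDiff_lieExp.comp ((d.jE EM).contDiff.contMDiff : ContMDiff 𝓘(ℝ, EM) 𝓘(ℝ, EG) ∞ (d.jE EM))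
  rw [md_smul_orbit (h v), lder_comp (φ := (lieExp G : EG → G)) (f := fun v : EM ↦ d.jE EM v) v
    contMDiff_lieExp.contMDiffAt (d.jE EM).differentiableAt]
  simp

variable (EM) in
/-- `v ↦ exp (J v) • o` has a smooth local inverse at `o`. -/
theorem exists_logM (d : ReductiveDecomposition EG G o) : ∃ l : M → EM, l o = 0 ∧
      (∀ᶠ v in 𝓝 0, l (lieExp G (d.jE EM v) • o) = v) ∧
      (∀ᶠ x in 𝓝 o, lieExp G (d.jE EM (l x)) • o = x) ∧
      ∀ᶠ x in 𝓝 o, ContMDiffAt 𝓘(ℝ, EM) 𝓘(ℝ, EM) ∞ l x := by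
  set p : EM → M := fun v : EM ↦ lieExp G (d.jE EM v) • o with hpdef
  have hps : ContMDiff 𝓘(ℝ, EM) 𝓘(ℝ, EM) ∞ p := d.smooth_expJ
  have hp0 : p 0 = o := by simp [p, lieExp_zero]
  have hpc : Tendsto p (𝓝 0) (𝓝 o) := by
    have := hps.continuous.tendsto 0
    rwa [hp0] at this
  set φ := extChartAt 𝓘(ℝ, EM) o
  have hsrc : φ.source ∈ 𝓝 o := extChartAt_source_mem_nhds o
  have hf : ∀ᶠ v in 𝓝 (0 : EM), ContDiffAt ℝ ∞ (fun v ↦ φ (p v)) v := by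
    filter_upwards [hpc.eventually hsrc] with v hv
    rw [← contMDiffAt_iff_contDiffAt]
    exact (contMDiffAt_extChartAt_of_mem hv).comp v (hps v)
  have hmp : md EM EM p 0 = ContinuousLinearMap.id ℝ EM := by
    ext v
    rw [hpdef, d.md_expJ, map_zero, lieExp_zero, push_one, lder_lieExp_zero]
    simp [d.fundE_jE]
  have hφ : MDifferentiableAt 𝓘(ℝ, EM) 𝓘(ℝ, EM) φ o :=
    (contMDiffAt_extChartAt_of_mem (mem_extChartAt_source o)).mdiff
  have hd : HasFDerivAt (fun v ↦ φ (p v)) (ContinuousLinearEquiv.refl ℝ EM : EM →L[ℝ] EM) 0 := by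
    have h1 := (hf.self_of_nhds.differentiableAt (by simp)).hasFDerivAt
    have h2 : fderiv ℝ (fun v ↦ φ (p v)) 0 = ContinuousLinearMap.id ℝ EM := by
      have h3 : md EM EM φ o = ContinuousLinearMap.id ℝ EM := md_extChartAt_self o
      rw [← md_eq_fderiv, md_comp (g := φ) (f := p) 0 (by rwa [hp0]) (hps.mdiff 0), hmp, hp0, h3]
      rfl
    rw [h2] at h1; exact h1
  obtain ⟨g, g0, g1, g2, g3⟩ := exists_smooth_localInverse hf _ hd
  rw [hp0] at g0 g2 g3
  have hφc : Tendsto φ (𝓝 o) (𝓝 (φ o)) := continuousAt_extChartAt o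
  have hgc : Tendsto g (𝓝 (φ o)) (𝓝 0) := by
    have := g3.self_of_nhds.continuousAt
    rwa [ContinuousAt, g0] at this
  refine ⟨fun x ↦ g (φ x), g0, g1, ?_, ?_⟩
  · filter_upwards [hφc.eventually g2, hsrc, (hpc.comp (hgc.comp hφc)).eventually hsrc] with x h1 h2 h3
    exact φ.injOn h3 h2 h1
  · filter_upwards [hφc.eventually g3, hsrc] with x h1 h2
    exact h1.contMDiffAt.comp x (contMDiffAt_extChartAt_of_mem h2)

end ReductiveDecomposition

end Reductive

/-! ### Vector fields on a homogeneous space as functions on the group -/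

section Sections

variable {F : Type*} [NormedAddCommGroup F] [NormedSpace ℝ F]
  {M : Type*} [TopologicalSpace M] [ChartedSpace F M] [IsManifold 𝓘(ℝ, F) ∞ M]

/-- The components of a vector field in the preferred chart at `x₀`. -/
noncomputable def coordField (x₀ : M) (σ : Π x : M, TangentSpace 𝓘(ℝ, F) x) (x : M) : F :=
  md F F (extChartAt 𝓘(ℝ, F) x₀) x (σ x)

theorem eventually_trivialization_eq (x₀ : M) (σ : Π x : M, TangentSpace 𝓘(ℝ, F) x) :
    (fun x ↦ (trivializationAt F (TangentSpace 𝓘(ℝ, F)) x₀ (⟨x, σ x⟩ : TangentBundle 𝓘(ℝ, F) M)).2)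
      =ᶠ[𝓝 x₀] coordField x₀ σ := by
  have := one_le_infty_manifold F M
  filter_upwards [(chartAt F x₀).open_source.mem_nhds (mem_chart_source F x₀)] with x hx
  have h1 := TangentBundle.continuousLinearMapAt_trivializationAt (I := 𝓘(ℝ, F)) hx
  have h2 := congrArg (fun A : F →L[ℝ] F ↦ A (σ x)) h1
  rw [Trivialization.continuousLinearMapAt] at h2
  rw [coordField, md]
  refine Eq.trans ?_ h2
  have hb : x ∈ (trivializationAt F (TangentSpace 𝓘(ℝ, F)) x₀).baseSet := by
    simpa [TangentBundle.trivializationAt_baseSet] using hx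
  exact (congrFun (Trivialization.coe_linearMapAt_of_mem (R := ℝ) _ hb) (σ x)).symm

theorem mdiffAt_section_iff (σ : Π x : M, TangentSpace 𝓘(ℝ, F) x) (x₀ : M) :
    MDiffAt (T% σ) x₀ ↔ MDifferentiableAt 𝓘(ℝ, F) 𝓘(ℝ, F) (coordField x₀ σ) x₀ := by
  have := one_le_infty_manifold F M
  rw [mdifferentiableAt_section]
  exact (eventually_trivialization_eq x₀ σ).mdifferentiableAt_iff

theorem cmdiffAt_section_iff (σ : Π x : M, TangentSpace 𝓘(ℝ, F) x) (x₀ : M) :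
    CMDiffAt ∞ (T% σ) x₀ ↔ ContMDiffAt 𝓘(ℝ, F) 𝓘(ℝ, F) ∞ (coordField x₀ σ) x₀ := by
  have := one_le_infty_manifold F M
  rw [contMDiffAt_section]
  exact (eventually_trivialization_eq x₀ σ).contMDiffAt_iff

end Sections

section Hat

variable {E : Type*} [NormedAddCommGroup E] [NormedSpace ℝ E] [FiniteDimensional ℝ E]
  {G : Type*} [TopologicalSpace G] [ChartedSpace E G] [Group G] [LieGroup 𝓘(ℝ, E) ∞ G] [T2Space G]
  {F : Type*} [NormedAddCommGroup F] [NormedSpace ℝ F] [FiniteDimensional ℝ F]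
  {M : Type*} [TopologicalSpace M] [ChartedSpace F M] [IsManifold 𝓘(ℝ, F) ∞ M]
  [MulAction G M] [ContMDiffSMul 𝓘(ℝ, E) 𝓘(ℝ, F) ∞ G M]

/-- The equivariant function on `G` with values in `T_o M` that corresponds to a vector field. -/
noncomputable def hat {F : Type*} [NormedAddCommGroup F] [NormedSpace ℝ F]
    {G M : Type*} [TopologicalSpace M] [ChartedSpace F M] [Group G] [MulAction G M] (o : M)
    (σ : Π x : M, TangentSpace 𝓘(ℝ, F) x) (g : G) : F :=
  push F g⁻¹ (g • o) (σ (g • o))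

variable (E) in
include E in
theorem push_hat (o : M) (σ : Π x : M, TangentSpace 𝓘(ℝ, F) x) (g : G) :
    push F g o (hat o σ g) = σ (g • o) := push_push_inv E g o _

/-- The differential at `o` of the action of `g₀ * exp z`, in charts. -/
noncomputable def frameM (E : Type*) [NormedAddCommGroup E] [NormedSpace ℝ E]
    [FiniteDimensional ℝ E]
    {F : Type*} [NormedAddCommGroup F] [NormedSpace ℝ F]
    {G M : Type*} [TopologicalSpace M] [ChartedSpace F M] [Group G] [MulAction G M]
    [TopologicalSpace G] [ChartedSpace E G] [LieGroup 𝓘(ℝ, E) ∞ G] [T2Space G]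
    (o : M) (g₀ : G) (z : E) : F →L[ℝ] F :=
  fderiv ℝ (fun y ↦ extChartAt 𝓘(ℝ, F) (g₀ • o)
    ((g₀ * lieExp G z) • (extChartAt 𝓘(ℝ, F) o).symm y)) (extChartAt 𝓘(ℝ, F) o o)

theorem contMDiff_mul_exp (g₀ : G) : ContMDiff 𝓘(ℝ, E) 𝓘(ℝ, E) ∞ (fun z : E ↦ g₀ * lieExp G z) :=
  (smooth_mul_left g₀).comp contMDiff_lieExp

theorem contMDiff_mul_exp_smul (g₀ : G) (o : M) :
    ContMDiff 𝓘(ℝ, E) 𝓘(ℝ, F) ∞ (fun z : E ↦ (g₀ * lieExp G z) • o) :=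
  (smooth_orbit (E := E) (F := F) o).comp (contMDiff_mul_exp g₀)

variable (F) in
include F in
theorem tendsto_mul_exp_smul (g₀ : G) (o : M) :
    Tendsto (fun z : E ↦ (g₀ * lieExp G z) • o) (𝓝 0) (𝓝 (g₀ • o)) := by
  have := (contMDiff_mul_exp_smul (E := E) (F := F) g₀ o).continuous.tendsto 0
  simpa only [lieExp_zero, mul_one] using this

theorem contDiffAt_frameM (o : M) (g₀ : G) : ContDiffAt ℝ ∞ (frameM E (F := F) o g₀) 0 := by
  have h0 : (g₀ * lieExp G (0 : E)) • (extChartAt 𝓘(ℝ, F) o).symm (extChartAt 𝓘(ℝ, F) o o)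
      = g₀ • o := by rw [lieExp_zero, mul_one, extChartAt_to_inv]
  refine ContDiffAt.fderiv (n := ∞) (g := fun _ ↦ extChartAt 𝓘(ℝ, F) o o) (f := fun z y ↦
    extChartAt 𝓘(ℝ, F) (g₀ • o) ((g₀ * lieExp G z) • (extChartAt 𝓘(ℝ, F) o).symm y)) ?_
    contDiffAt_const (by simp)
  rw [← contMDiffAt_iff_contDiffAt]
  have h1 : ContMDiffAt 𝓘(ℝ, E × F) 𝓘(ℝ, E) ∞ (fun q : E × F ↦ g₀ * lieExp G q.1)
      (0, extChartAt 𝓘(ℝ, F) o o) :=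
    ContMDiffAt.comp (I' := 𝓘(ℝ, E)) (g := fun z : E ↦ g₀ * lieExp G z) (f := fun q : E × F ↦ q.1)
      (0, extChartAt 𝓘(ℝ, F) o o) (contMDiff_mul_exp g₀ (0 : E)) contDiffAt_fst.contMDiffAt
  have h2 : ContMDiffAt 𝓘(ℝ, E × F) 𝓘(ℝ, F) ∞ (fun q : E × F ↦ (extChartAt 𝓘(ℝ, F) o).symm q.2)
      (0, extChartAt 𝓘(ℝ, F) o o) :=
    (contMDiffAt_extChartAt_symm_of_mem (mem_extChartAt_target o)).comp
      (0, extChartAt 𝓘(ℝ, F) o o) contDiffAt_snd.contMDiffAt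
  refine ContMDiffAt.comp (I' := 𝓘(ℝ, F)) (g := extChartAt 𝓘(ℝ, F) (g₀ • o))
    (f := fun q : E × F ↦ (g₀ * lieExp G q.1) • (extChartAt 𝓘(ℝ, F) o).symm q.2) _ ?_
    (smooth_smul_comp E h1 h2)
  refine contMDiffAt_extChartAt_of_mem ?_
  rw [h0]; exact mem_extChartAt_source _

theorem md_extChartAt_symm_self (o : M) :
    md F F (extChartAt 𝓘(ℝ, F) o).symm (extChartAt 𝓘(ℝ, F) o o) = ContinuousLinearMap.id ℝ F := by
  have h := md_leftInverse (p := (extChartAt 𝓘(ℝ, F) o).symm) (l := extChartAt 𝓘(ℝ, F) o)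
    (x := extChartAt 𝓘(ℝ, F) o o)
    (by filter_upwards [extChartAt_target_mem_nhds (I := 𝓘(ℝ, F)) o] with y hy
        exact (extChartAt 𝓘(ℝ, F) o).right_inv hy)
    (by rw [extChartAt_to_inv]; exact (contMDiffAt_extChartAt_of_mem (mem_extChartAt_source o)).mdiff)
    (contMDiffAt_extChartAt_symm_of_mem (mem_extChartAt_target o)).mdiff
  rw [extChartAt_to_inv, md_extChartAt_self, ContinuousLinearMap.id_comp] at h
  exact h

theorem eventually_frameM (o : M) (g₀ : G) : ∀ᶠ z in 𝓝 (0 : E), ∀ v : F, frameM E o g₀ z v =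
    md F F (extChartAt 𝓘(ℝ, F) (g₀ • o)) ((g₀ * lieExp G z) • o)
      (push F (g₀ * lieExp G z) o v) := by
  filter_upwards [(tendsto_mul_exp_smul F g₀ o).eventually (extChartAt_source_mem_nhds (I := 𝓘(ℝ, F)) (g₀ • o))]
    with z hz v
  have h1 : MDifferentiableAt 𝓘(ℝ, F) 𝓘(ℝ, F)
      (fun y ↦ (g₀ * lieExp G z) • (extChartAt 𝓘(ℝ, F) o).symm y) (extChartAt 𝓘(ℝ, F) o o) :=
    ((smooth_smul E (g₀ * lieExp G z)).mdiff _).comp _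
      (contMDiffAt_extChartAt_symm_of_mem (mem_extChartAt_target o)).mdiff
  rw [frameM, ← md_eq_fderiv, md_comp_apply (g := extChartAt 𝓘(ℝ, F) (g₀ • o))
    (f := fun y ↦ (g₀ * lieExp G z) • (extChartAt 𝓘(ℝ, F) o).symm y) _ _ h1,
    md_smul_comp E _ (contMDiffAt_extChartAt_symm_of_mem (mem_extChartAt_target o)).mdiff,
    md_extChartAt_symm_self, extChartAt_to_inv]
  · rfl
  · rw [extChartAt_to_inv]
    exact (contMDiffAt_extChartAt_of_mem hz).mdiff

theorem frameM_zero (o : M) (g₀ : G) : frameM E (F := F) o g₀ 0 = push F g₀ o := by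
  ext v
  rw [(eventually_frameM (E := E) (F := F) o g₀).self_of_nhds, lieExp_zero, mul_one, md_extChartAt_self]
  rfl

theorem eventually_coordField_eq (o : M) (g₀ : G) (σ : Π x : M, TangentSpace 𝓘(ℝ, F) x) :
    ∀ᶠ z in 𝓝 (0 : E), coordField (g₀ • o) σ ((g₀ * lieExp G z) • o) =
      frameM E o g₀ z (hat o σ (g₀ * lieExp G z)) := by
  filter_upwards [eventually_frameM (E := E) (F := F) o g₀] with z hz
  rw [hz, push_hat E, coordField]

variable (E) in
include E in
/-- The differential of the action, as an equivalence. -/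
noncomputable def pushEquiv (g : G) (x : M) : F ≃L[ℝ] F :=
  ContinuousLinearEquiv.equivOfInverse (push F g x) (push F g⁻¹ (g • x)) (push_inv_push E g x)
    (push_push_inv E g x)

theorem contDiffAt_inverse_frameM (o : M) (g₀ : G) :
    ContDiffAt ℝ ∞ (fun z ↦ (frameM E (F := F) o g₀ z).inverse) 0 := by
  have h : ContDiffAt ℝ ∞ (ContinuousLinearMap.inverse : (F →L[ℝ] F) → _) (frameM E o g₀ 0) := by
    rw [frameM_zero]
    exact contDiffAt_map_inverse (pushEquiv E g₀ o)
  exact h.comp (0 : E) (contDiffAt_frameM o g₀)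

theorem eventually_inverse_frameM (o : M) (g₀ : G) : ∀ᶠ z in 𝓝 (0 : E), ∀ v,
    (frameM E (F := F) o g₀ z).inverse (frameM E o g₀ z v) = v := by
  have h1 : {A : F →L[ℝ] F | ∃ e : F ≃L[ℝ] F, (e : F →L[ℝ] F) = A} ∈ 𝓝 (frameM E (F := F) o g₀ 0) := by
    rw [frameM_zero]
    exact ContinuousLinearEquiv.nhds (pushEquiv (F := F) E g₀ o)
  filter_upwards [(contDiffAt_frameM (E := E) (F := F) o g₀).continuousAt.eventually h1] with z hz v
  obtain ⟨e, he⟩ := hz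
  rw [← he, ContinuousLinearMap.inverse_equiv]; simp

theorem eventually_hat_eq (o : M) (g₀ : G) (σ : Π x : M, TangentSpace 𝓘(ℝ, F) x) :
    (fun z : E ↦ hat o σ (g₀ * lieExp G z)) =ᶠ[𝓝 0] fun z ↦
      (frameM E o g₀ z).inverse (coordField (g₀ • o) σ ((g₀ * lieExp G z) • o)) := by
  filter_upwards [eventually_coordField_eq (E := E) (F := F) o g₀ σ,
    eventually_inverse_frameM (E := E) (F := F) o g₀] with z h1 h2
  rw [h1, h2]

theorem differentiableAt_hat {o : M} {g₀ : G} {σ : Π x : M, TangentSpace 𝓘(ℝ, F) x}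
    (h : MDiffAt (T% σ) (g₀ • o)) :
    DifferentiableAt ℝ (fun z : E ↦ hat o σ (g₀ * lieExp G z)) 0 := by
  rw [mdiffAt_section_iff] at h
  refine DifferentiableAt.congr_of_eventuallyEq ?_ (eventually_hat_eq o g₀ σ)
  refine ((contDiffAt_inverse_frameM o g₀).differentiableAt (by simp)).clm_apply ?_
  refine MDifferentiableAt.differentiableAt (MDifferentiableAt.comp (I' := 𝓘(ℝ, F))
    (g := coordField (g₀ • o) σ) (f := fun z : E ↦ (g₀ * lieExp G z) • o) (0 : E) ?_
    ((contMDiff_mul_exp_smul g₀ o).mdiff 0))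
  simpa only [lieExp_zero, mul_one] using h

theorem contDiffAt_hat {o : M} {g₀ : G} {σ : Π x : M, TangentSpace 𝓘(ℝ, F) x}
    (h : CMDiffAt ∞ (T% σ) (g₀ • o)) :
    ContDiffAt ℝ ∞ (fun z : E ↦ hat o σ (g₀ * lieExp G z)) 0 := by
  rw [cmdiffAt_section_iff] at h
  refine ContDiffAt.congr_of_eventuallyEq ?_ (eventually_hat_eq o g₀ σ)
  refine (contDiffAt_inverse_frameM o g₀).clm_apply ?_
  refine ContMDiffAt.contDiffAt (ContMDiffAt.comp (I' := 𝓘(ℝ, F))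
    (g := coordField (g₀ • o) σ) (f := fun z : E ↦ (g₀ * lieExp G z) • o) (0 : E) ?_
    (contMDiff_mul_exp_smul g₀ o 0))
  simpa only [lieExp_zero, mul_one] using h

variable [T2Space M] [SecondCountableTopology G] [MulAction.IsPretransitive G M] {o : M}

/-- Near `g₀ • o`, points are of the form `(g₀ * exp z) • o` with `z` depending smoothly on the
point. -/
theorem ReductiveDecomposition.exists_local_section (d : ReductiveDecomposition E G o) (g₀ : G) :
    ∃ ζ : M → E, ζ (g₀ • o) = 0 ∧ ContMDiffAt 𝓘(ℝ, F) 𝓘(ℝ, E) ∞ ζ (g₀ • o) ∧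
      ∀ᶠ x in 𝓝 (g₀ • o), (g₀ * lieExp G (ζ x)) • o = x := by
  obtain ⟨l, l0, -, l1, l2⟩ := d.exists_logM F
  have hc : Tendsto (fun x : M ↦ g₀⁻¹ • x) (𝓝 (g₀ • o)) (𝓝 o) := by
    have := (smooth_smul (M := M) (F := F) E g₀⁻¹).continuous.tendsto (g₀ • o)
    rwa [inv_smul_smul] at this
  refine ⟨fun x ↦ d.jE F (l (g₀⁻¹ • x)), by simp [l0], ?_, ?_⟩
  · have h1 : ContMDiff 𝓘(ℝ, F) 𝓘(ℝ, E) ∞ (d.jE F) := (d.jE F).contDiff.contMDiff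
    refine h1.contMDiffAt.comp (g₀ • o) (ContMDiffAt.comp (I' := 𝓘(ℝ, F)) (g := l)
      (f := fun x : M ↦ g₀⁻¹ • x) (g₀ • o) ?_ (smooth_smul E g₀⁻¹ _))
    rw [inv_smul_smul]; exact l2.self_of_nhds
  · filter_upwards [hc.eventually l1] with x hx
    rw [mul_smul, hx, smul_inv_smul]

theorem eventually_coordField_eq' {ζ : M → E} {g₀ : G} (h0 : ζ (g₀ • o) = 0)
    (h1 : ContMDiffAt 𝓘(ℝ, F) 𝓘(ℝ, E) ∞ ζ (g₀ • o))
    (h2 : ∀ᶠ x in 𝓝 (g₀ • o), (g₀ * lieExp G (ζ x)) • o = x)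
    (σ : Π x : M, TangentSpace 𝓘(ℝ, F) x) :
    coordField (g₀ • o) σ =ᶠ[𝓝 (g₀ • o)]
      fun x ↦ frameM E o g₀ (ζ x) (hat o σ (g₀ * lieExp G (ζ x))) := by
  have hc : Tendsto ζ (𝓝 (g₀ • o)) (𝓝 0) := by
    have := h1.continuousAt
    rwa [ContinuousAt, h0] at this
  filter_upwards [hc.eventually (eventually_coordField_eq (E := E) (F := F) o g₀ σ), h2] with x h3 h4
  rw [← h3, h4]

/-- A section is recovered from its function on the group by means of a smooth local section of the
orbit map. -/
theorem mdiffAt_of_hat (d : ReductiveDecomposition E G o) {g₀ : G}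
    {σ : Π x : M, TangentSpace 𝓘(ℝ, F) x}
    (h : DifferentiableAt ℝ (fun z : E ↦ hat o σ (g₀ * lieExp G z)) 0) :
    MDiffAt (T% σ) (g₀ • o) := by
  obtain ⟨ζ, h0, h1, h2⟩ := d.exists_local_section (F := F) g₀
  rw [mdiffAt_section_iff]
  refine MDifferentiableAt.congr_of_eventuallyEq ?_ (eventually_coordField_eq' h0 h1 h2 σ)
  refine MDifferentiableAt.comp (I' := 𝓘(ℝ, E))
    (g := fun z ↦ frameM E o g₀ z (hat o σ (g₀ * lieExp G z))) (f := ζ) (g₀ • o) ?_ h1.mdiff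
  rw [h0]
  exact (((contDiffAt_frameM o g₀).differentiableAt (by simp)).clm_apply h).mdifferentiableAt

theorem cmdiffAt_of_hat (d : ReductiveDecomposition E G o) {g₀ : G}
    {σ : Π x : M, TangentSpace 𝓘(ℝ, F) x}
    (h : ContDiffAt ℝ ∞ (fun z : E ↦ hat o σ (g₀ * lieExp G z)) 0) :
    CMDiffAt ∞ (T% σ) (g₀ • o) := by
  obtain ⟨ζ, h0, h1, h2⟩ := d.exists_local_section (F := F) g₀
  rw [cmdiffAt_section_iff]
  refine ContMDiffAt.congr_of_eventuallyEq ?_ (eventually_coordField_eq' h0 h1 h2 σ)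
  refine ContMDiffAt.comp (I' := 𝓘(ℝ, E))
    (g := fun z ↦ frameM E o g₀ z (hat o σ (g₀ * lieExp G z))) (f := ζ) (g₀ • o) ?_ h1
  rw [h0]
  exact ((contDiffAt_frameM o g₀).clm_apply h).contMDiffAt

/-- The derivative of a function on `G` in the direction of a left-invariant vector field. -/
noncomputable def lD {E : Type*} [NormedAddCommGroup E] [NormedSpace ℝ E]
    [FiniteDimensional ℝ E]
    {G : Type*} [TopologicalSpace G] [ChartedSpace E G] [Group G] [LieGroup 𝓘(ℝ, E) ∞ G] [T2Space G]
    {W : Type*} [NormedAddCommGroup W] [NormedSpace ℝ W] (f : G → W) (g : G) : E →L[ℝ] W :=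
  fderiv ℝ (fun z : E ↦ f (g * lieExp G z)) 0

theorem fundE_smul (g : G) (X : E) : fundE E F G (g • o) X = push F g o (fundE E F G o (adE E g⁻¹ X)) := by
  rw [← fundE_adE, adE_adE_inv]

theorem hat_fundamentalField (Y : E) (g : G) :
    hat o (fundamentalField (EG := E) (EM := F) (G := G) (M := M) Y) g =
      fundE E F G o (adE E g⁻¹ Y) := by
  have h : (fundamentalField (EG := E) (EM := F) (G := G) (M := M) Y (g • o) : F) =
    fundE E F G (g • o) Y := rfl
  rw [hat, h, fundE_smul, push_inv_push E]

theorem contDiff_adE_exp_neg (Y : E) : ContDiff ℝ ∞ (fun z : E ↦ adE E (lieExp G (-z)) Y) := by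
  let φ : ℝ × E → G := fun q ↦ lieExp G (q.1 • Y) * lieExp G q.2
  have hφ : ContMDiff 𝓘(ℝ, ℝ × E) 𝓘(ℝ, E) ∞ φ := by
    intro q
    refine contMDiffAt_mul_comp ?_ ?_
    · exact ((contMDiff_exp_line (G := G) Y) q.1).comp q contDiffAt_fst.contMDiffAt
    · exact (contMDiff_lieExp q.2).comp q contDiffAt_snd.contMDiffAt
  have h1 : ∀ z, lder φ ((0 : ℝ), z) (1, 0) = adE E (lieExp G (-z)) Y := by
    intro z
    have h2 : HasDerivAt (fun r : ℝ ↦ ((r, z) : ℝ × E)) (1, 0) (0 : ℝ) :=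
      (hasDerivAt_id (0 : ℝ)).prodMk (hasDerivAt_const (0 : ℝ) z)
    have h3 := lder_comp (φ := φ) (f := fun r : ℝ ↦ ((r, z) : ℝ × E)) 0 (hφ _)
      h2.differentiableAt
    have h4 := DFunLike.congr_fun h3 1
    rw [ContinuousLinearMap.comp_apply, h2.hasFDerivAt.fderiv] at h4
    simp only [φ] at h4
    rw [lder_conj _ _ _ (contMDiff_exp_line (G := G) Y 0), lder_exp_line, ← lieExp_neg] at h4
    rw [h4]; simp [φ]
  have h5 := (contDiff_lder hφ).comp (contDiff_const.prodMk contDiff_id : ContDiff ℝ ∞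
    (fun z : E ↦ ((0 : ℝ), z)))
  have h6 := h5.clm_apply (contDiff_const (c := ((1, 0) : ℝ × E)))
  exact (funext fun z ↦ (h1 z).symm : (fun z : E ↦ adE E (lieExp G (-z)) Y) = _) ▸ h6

theorem contMDiff_fundamentalField (d : ReductiveDecomposition E G o) (Y : E) :
    CMDiff ∞ (T% (fundamentalField (EG := E) (EM := F) (G := G) (M := M) Y)) := by
  intro x
  obtain ⟨g, rfl⟩ := MulAction.exists_smul_eq G o x
  refine cmdiffAt_of_hat d ?_
  have : (fun z : E ↦ hat o (fundamentalField (EG := E) (EM := F) (G := G) (M := M) Y)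
      (g * lieExp G z)) = fun z ↦ fundE E F G o (adE E (lieExp G (-z)) (adE E g⁻¹ Y)) := by
    ext z
    rw [hat_fundamentalField, mul_inv_rev, adE_mul, lieExp_neg]
  rw [this]
  exact ((fundE E F G o).contDiff.comp (contDiff_adE_exp_neg _)).contDiffAt

theorem lD_hat_fundamentalField (X Y : E) :
    lD (hat o (fundamentalField (EG := E) (EM := F) (G := G) (M := M) Y)) (1 : G) X =
      - fundE E F G o (lieBL E G X Y) := by
  have h1 : (fun z : E ↦ hat o (fundamentalField (EG := E) (EM := F) (G := G) (M := M) Y)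
      ((1 : G) * lieExp G z)) = fun z ↦ fundE E F G o (adE E (lieExp G (-z)) Y) := by
    ext z
    rw [hat_fundamentalField, one_mul, lieExp_neg]
  have h2 : DifferentiableAt ℝ (fun z : E ↦ fundE E F G o (adE E (lieExp G (-z)) Y)) (0 : E) :=
    ((fundE E F G o).contDiff.comp (contDiff_adE_exp_neg _)).differentiable (n := ∞) (by simp) 0
  have h3 := h2.hasFDerivAt.comp_hasDerivAt_of_eq (0 : ℝ) (hasDerivAt_smul_line X 0) (by simp)
  have h4 := (fundE E F G o).hasFDerivAt.comp_hasDerivAt (0 : ℝ) (hasDerivAt_adE_neg (G := G) X Y 0)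
  rw [lD, h1]
  refine (h3.unique h4).trans ?_
  simp [lieExp_zero, adE_one]

end Hat

/-! ### Invariant connections on a reductive homogeneous space -/

section Connections

variable {E : Type*} [NormedAddCommGroup E] [NormedSpace ℝ E] [FiniteDimensional ℝ E]
  {G : Type*} [TopologicalSpace G] [ChartedSpace E G] [Group G] [LieGroup 𝓘(ℝ, E) ∞ G] [T2Space G]
  {F : Type*} [NormedAddCommGroup F] [NormedSpace ℝ F] [FiniteDimensional ℝ F]
  {M : Type*} [TopologicalSpace M] [ChartedSpace F M] [IsManifold 𝓘(ℝ, F) ∞ M]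
  [MulAction G M] [ContMDiffSMul 𝓘(ℝ, E) 𝓘(ℝ, F) ∞ G M]
  [T2Space M] [SecondCountableTopology G] [MulAction.IsPretransitive G M] {o : M}

theorem hasFDerivAt_lD {o : M} {g : G} {σ : Π x : M, TangentSpace 𝓘(ℝ, F) x}
    (h : MDiffAt (T% σ) (g • o)) :
    HasFDerivAt (fun z : E ↦ hat o σ (g * lieExp G z)) (lD (hat o σ) g) 0 :=
  (differentiableAt_hat h).hasFDerivAt

variable (E) in
include E in
theorem hat_mul_stab (σ : Π x : M, TangentSpace 𝓘(ℝ, F) x) (g : G) {k : G} (hk : k • o = o) :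
    hat o σ (g * k) = push F k⁻¹ o (hat o σ g) := by
  apply push_injective E (g * k) o
  rw [push_hat E, push_mul_apply E, hk]
  have h := push_push_inv E k o (hat o σ g)
  rw [hk] at h
  rw [h, push_hat E, mul_smul, hk]

/-- The horizontal derivative of an equivariant function is equivariant under the isotropy group. -/
theorem lD_hat_mul_stab (d : ReductiveDecomposition E G o)
    {σ : Π x : M, TangentSpace 𝓘(ℝ, F) x} {g k : G} (hk : k • o = o)
    (h : MDiffAt (T% σ) (g • o)) (v : F) :
    lD (hat o σ) (g * k) (d.jE F v) = push F k⁻¹ o (lD (hat o σ) g (d.jE F (push F k o v))) := by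
  have h1 : (fun z : E ↦ hat o σ (g * k * lieExp G z)) =
      fun z ↦ push F k⁻¹ o (hat o σ (g * lieExp G (adE E k z))) := by
    ext z
    rw [← hat_mul_stab E σ _ hk, lieExp_adE]
    congr 1; group
  have h2 : HasFDerivAt (fun z : E ↦ hat o σ (g * lieExp G (adE E k z)))
      (lD (hat o σ) g ∘L adE E k) 0 :=
    HasFDerivAt.comp (g := fun z : E ↦ hat o σ (g * lieExp G z)) (0 : E)
      (by rw [map_zero]; exact hasFDerivAt_lD h) (adE E k).hasFDerivAt
  rw [lD, h1, d.jE_push hk]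
  exact DFunLike.congr_fun ((push F k⁻¹ o).hasFDerivAt.comp (0 : E) h2).fderiv (d.jE F v)

/-- The covariant derivative `cov` is, in terms of equivariant functions on `G`, the left-invariant
derivative along `𝔭` plus the bilinear map `B`. -/
def HasForm (d : ReductiveDecomposition E G o)
    (cov : CovariantDerivative 𝓘(ℝ, F) F (fun x : M ↦ TangentSpace 𝓘(ℝ, F) x))
    (B : F →L[ℝ] F →L[ℝ] F) : Prop :=
  ∀ (σ : Π x : M, TangentSpace 𝓘(ℝ, F) x) (g : G) (v : F), MDiffAt (T% σ) (g • o) →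
    (cov σ (g • o) (push F g o v) : F) = push F g o (lD (hat o σ) g (d.jE F v) + B v (hat o σ g))

/-- The operator underlying the invariant connection determined by `B`. -/
noncomputable def formMap (d : ReductiveDecomposition E G o) (B : F →L[ℝ] F →L[ℝ] F)
    (σ : Π x : M, TangentSpace 𝓘(ℝ, F) x) (x : M) : F →L[ℝ] F :=
  let g := (MulAction.exists_smul_eq G o x).choose
  push F g o ∘L (lD (hat o σ) g ∘L d.jE F + B.flip (hat o σ g)) ∘L push F g⁻¹ x

/-- `formMap` does not depend on the element of the group chosen to reach a point. -/
theorem formMap_apply (d : ReductiveDecomposition E G o) {B : F →L[ℝ] F →L[ℝ] F}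
    (hB : ∀ k : G, k • o = o → ∀ v w, B (push F k o v) (push F k o w) = push F k o (B v w))
    {σ : Π x : M, TangentSpace 𝓘(ℝ, F) x} {g : G} (h : MDiffAt (T% σ) (g • o)) (v : F) :
    formMap d B σ (g • o) (push F g o v) =
      push F g o (lD (hat o σ) g (d.jE F v) + B v (hat o σ g)) := by
  rw [formMap]
  set g₀ := (MulAction.exists_smul_eq G o (g • o)).choose
  have hg₀ : g₀ • o = g • o := (MulAction.exists_smul_eq G o (g • o)).choose_spec
  clear_value g₀
  -- The chosen element `g₀` and `g` differ by an element `k` of the isotropy group.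
  obtain ⟨k, hkdef⟩ : ∃ k, k = g₀⁻¹ * g := ⟨_, rfl⟩
  have hk : k • o = o := by rw [hkdef, mul_smul, ← hg₀, inv_smul_smul]
  have hg : g = g₀ * k := by rw [hkdef, mul_inv_cancel_left]
  have hd : MDiffAt (T% σ) (g₀ • o) := by rw [hg₀]; exact h
  have e1 : push F g₀⁻¹ (g • o) (push F g o v) = push F k o v := by
    rw [← push_mul_apply E, hkdef]
  have e2 : push F k o (push F k⁻¹ o (lD (hat o σ) g₀ (d.jE F (push F k o v)))) =
      lD (hat o σ) g₀ (d.jE F (push F k o v)) := by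
    have := push_push_inv E k o (lD (hat o σ) g₀ (d.jE F (push F k o v)))
    rwa [hk] at this
  have e3 : push F k o (push F k⁻¹ o (hat o σ g₀)) = hat o σ g₀ := by
    have := push_push_inv E k o (hat o σ g₀)
    rwa [hk] at this
  simp only [ContinuousLinearMap.comp_apply, add_apply, ContinuousLinearMap.flip_apply, e1]
  rw [hg, lD_hat_mul_stab d hk hd, hat_mul_stab E σ g₀ hk, push_mul_apply E, hk, map_add, map_add,
    map_add, e2, ← hB k hk, e3]

theorem hat_add (σ τ : Π x : M, TangentSpace 𝓘(ℝ, F) x) (g : G) :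
    hat o (σ + τ) g = hat o σ g + hat o τ g := map_add (push F g⁻¹ (g • o)) _ _

theorem hat_smul (f : M → ℝ) (σ : Π x : M, TangentSpace 𝓘(ℝ, F) x) (g : G) :
    hat o (f • σ) g = f (g • o) • hat o σ g := map_smul (push F g⁻¹ (g • o)) _ _

theorem md_mul_exp_smul_zero (g : G) (o : M) (X : E) :
    md E F (fun z : E ↦ (g * lieExp G z) • o) 0 X = push F g o (fundE E F G o X) := by
  rw [md_smul_orbit (contMDiff_mul_exp g 0), lder_mul_left, lder_lieExp_zero, lieExp_zero, mul_one]
  rfl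

theorem hasFDerivAt_comp_orbit (d : ReductiveDecomposition E G o) {W : Type*}
    [NormedAddCommGroup W] [NormedSpace ℝ W] {f : M → W} {g : G}
    (h : MDifferentiableAt 𝓘(ℝ, F) 𝓘(ℝ, W) f (g • o)) (v : F) :
    lD (fun h : G ↦ f (h • o)) g (d.jE F v) = md F W f (g • o) (push F g o v) := by
  have h1 := md_comp_apply (g := f) (f := fun z : E ↦ (g * lieExp G z) • o) (0 : E)
    (by simpa only [lieExp_zero, mul_one] using h) ((contMDiff_mul_exp_smul g o).mdiff 0) (d.jE F v)
  rw [md_mul_exp_smul_zero, d.fundE_jE, lieExp_zero, mul_one, md_eq_fderiv] at h1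
  exact h1

theorem differentiableAt_comp_orbit {W : Type*}
    [NormedAddCommGroup W] [NormedSpace ℝ W] {f : M → W} {g : G}
    (h : MDifferentiableAt 𝓘(ℝ, F) 𝓘(ℝ, W) f (g • o)) :
    DifferentiableAt ℝ (fun z : E ↦ f ((g * lieExp G z) • o)) 0 := by
  refine MDifferentiableAt.differentiableAt (MDifferentiableAt.comp (I' := 𝓘(ℝ, F))
    (g := f) (f := fun z : E ↦ (g * lieExp G z) • o) (0 : E) ?_
    ((contMDiff_mul_exp_smul g o).mdiff 0))
  simpa only [lieExp_zero, mul_one] using h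

/-- The invariant connection determined by an invariant bilinear map `B`. -/
noncomputable def formConnection (d : ReductiveDecomposition E G o) (B : F →L[ℝ] F →L[ℝ] F)
    (hB : ∀ k : G, k • o = o → ∀ v w, B (push F k o v) (push F k o w) = push F k o (B v w)) :
    CovariantDerivative 𝓘(ℝ, F) F (fun x : M ↦ TangentSpace 𝓘(ℝ, F) x) where
  toFun := formMap d B
  isCovariantDerivativeOnUniv :=
    { add := by
        intro σ τ x hσ hτ _
        obtain ⟨g, rfl⟩ := MulAction.exists_smul_eq G o x
        refine ContinuousLinearMap.ext fun (v : F) ↦ ?_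
        obtain ⟨w, rfl⟩ : ∃ w, push F g o w = v := ⟨_, push_push_inv E g o v⟩
        show formMap d B (σ + τ) (g • o) (push F g o w) = formMap d B σ (g • o) (push F g o w) +
          formMap d B τ (g • o) (push F g o w)
        have h1 : lD (E := E) (hat o (σ + τ)) g = lD (hat o σ) g + lD (hat o τ) g := by
          rw [lD]
          simp only [hat_add]
          exact ((hasFDerivAt_lD hσ).add (hasFDerivAt_lD hτ)).fderiv
        rw [formMap_apply d hB (mdifferentiableAt_add_section hσ hτ), formMap_apply d hB hσ,
          formMap_apply d hB hτ, h1, hat_add, ← map_add]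
        congr 1
        rw [map_add, add_apply]; abel
      leibniz := by
        intro σ f x hσ hf _
        obtain ⟨g, rfl⟩ := MulAction.exists_smul_eq G o x
        refine ContinuousLinearMap.ext fun (v : F) ↦ ?_
        obtain ⟨w, rfl⟩ : ∃ w, push F g o w = v := ⟨_, push_push_inv E g o v⟩
        show formMap d B (f • σ) (g • o) (push F g o w) =
          f (g • o) • formMap d B σ (g • o) (push F g o w) +
          @HSMul.hSMul ℝ F F _ (md F ℝ f (g • o) (push F g o w)) (σ (g • o))
        have h1 : lD (hat o (f • σ)) g (d.jE F w) = f (g • o) • lD (hat o σ) g (d.jE F w) +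
            md F ℝ f (g • o) (push F g o w) • hat o σ g := by
          rw [← hasFDerivAt_comp_orbit d hf]
          have h2 := ((differentiableAt_comp_orbit (E := E) hf).hasFDerivAt.smul
            (hasFDerivAt_lD (E := E) hσ)).fderiv
          rw [lD]
          simp only [hat_smul]
          have h3 := DFunLike.congr_fun h2 (d.jE F w)
          refine Eq.trans h3 ?_
          simp only [lieExp_zero, mul_one]
          rfl
        rw [formMap_apply d hB (hf.smul_section hσ), formMap_apply d hB hσ, h1, hat_smul,
          ← push_hat E o σ g]
        simp only [map_add, map_smul, smul_add]
        abel }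

theorem hasForm_formConnection (d : ReductiveDecomposition E G o) (B : F →L[ℝ] F →L[ℝ] F)
    (hB : ∀ k : G, k • o = o → ∀ v w, B (push F k o v) (push F k o w) = push F k o (B v w)) :
    HasForm d (formConnection d B hB) B :=
  fun _ _ v h ↦ formMap_apply d hB h v

variable (E) in
include E in
theorem hat_of_push {σ τ : Π x : M, TangentSpace 𝓘(ℝ, F) x} {h : G}
    (hτ : ∀ y, (τ (h • y) : F) = push F h y (σ y)) (g : G) :
    hat o τ (h * g) = hat o σ g := by
  apply push_injective E (h * g) o
  rw [push_hat E, push_mul_apply E, push_hat E, ← hτ, mul_smul]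

theorem mdiffAt_of_push (d : ReductiveDecomposition E G o)
    {σ τ : Π x : M, TangentSpace 𝓘(ℝ, F) x} {h g : G}
    (hτ : ∀ y, (τ (h • y) : F) = push F h y (σ y)) (hσ : MDiffAt (T% σ) (g • o)) :
    MDiffAt (T% τ) ((h * g) • o) := by
  refine mdiffAt_of_hat d ?_
  simp only [mul_assoc, hat_of_push E hτ]
  exact differentiableAt_hat hσ

theorem lD_of_push {σ τ : Π x : M, TangentSpace 𝓘(ℝ, F) x} {h : G}
    (hτ : ∀ y, (τ (h • y) : F) = push F h y (σ y)) (g : G) :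
    lD (E := E) (hat o τ) (h * g) = lD (hat o σ) g := by
  rw [lD]
  simp only [mul_assoc, hat_of_push E hτ]
  rfl

/-- Differentiation along the left-invariant fields in `𝔭` satisfies the defining properties of the
canonical connection. -/
theorem isCanonicalConnection_formConnection_zero (d : ReductiveDecomposition E G o) :
    d.IsCanonicalConnection (formConnection d (0 : F →L[ℝ] F →L[ℝ] F) (by simp)) where
  invariant := by
    intro h σ τ hτ x (v : F) hσ
    obtain ⟨g, rfl⟩ := MulAction.exists_smul_eq G o x
    obtain ⟨w, rfl⟩ : ∃ w, push F g o w = v := ⟨_, push_push_inv E g o v⟩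
    have hτ' : ∀ y, (τ (h • y) : F) = push F h y (σ y) := hτ
    have h1 := hasForm_formConnection d (0 : F →L[ℝ] F →L[ℝ] F) (by simp)
    have h2 := h1 τ (h * g) w (mdiffAt_of_push d hτ' hσ)
    have h3 := h1 σ g w hσ
    rw [lD_of_push hτ', hat_of_push E hτ', push_mul_apply E h g o w, push_mul_apply E h g o,
      ← h3, mul_smul] at h2
    exact h2
  apply_fundamentalField := by
    intro (X : E) hX (Y : E) hY
    have hX' : X ∈ d.pE := hX
    have h1 := hasForm_formConnection d (0 : F →L[ℝ] F →L[ℝ] F) (by simp)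
      (fundamentalField (EG := E) (EM := F) (G := G) (M := M) Y) 1
      (fundE E F G o X) ((contMDiff_fundamentalField d Y).mdifferentiable (by simp) _)
    rw [push_one, ContinuousLinearMap.id_apply, ContinuousLinearMap.id_apply,
      d.jE_fundE (EM := F) X, d.prP_of_mem hX', lD_hat_fundamentalField, one_smul, lieBL_apply] at h1
    have h2 : (fundE E F G o (d.prP (lieB E G X Y)) : F) = fundE E F G o (lieB E G X Y) :=
      d.fundE_prP _
    refine h1.trans ?_
    rw [zero_apply, zero_apply, add_zero]
    exact congrArg Neg.neg h2.symm

theorem isCanonicalConnection_canonicalConnection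
    [RiemannianBundle (fun x : M ↦ TangentSpace 𝓘(ℝ, F) x)]
    [IsContMDiffRiemannianBundle 𝓘(ℝ, F) ∞ F (fun x : M ↦ TangentSpace 𝓘(ℝ, F) x)]
    (d : ReductiveDecomposition E G o) :
    d.IsCanonicalConnection (d.canonicalConnection (EM := F)) :=
  Classical.epsilon_spec (p := d.IsCanonicalConnection)
    ⟨_, isCanonicalConnection_formConnection_zero d⟩

/-- The difference of two connections is tensorial, so that at `o` it can be tested on fundamental
fields; invariance moves any point to `o`. -/
theorem IsCanonicalConnection.unique (d : ReductiveDecomposition E G o)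
    {cov cov' : CovariantDerivative 𝓘(ℝ, F) F (fun x : M ↦ TangentSpace 𝓘(ℝ, F) x)}
    (h : d.IsCanonicalConnection cov) (h' : d.IsCanonicalConnection cov')
    (σ : Π x : M, TangentSpace 𝓘(ℝ, F) x) (g : G) (v : F) (hσ : MDiffAt (T% σ) (g • o)) :
    (cov σ (g • o) (push F g o v) : F) = cov' σ (g • o) (push F g o v) := by
  have := one_le_infty_manifold F M
  have h0 : ∀ (τ : Π x : M, TangentSpace 𝓘(ℝ, F) x), MDiffAt (T% τ) o → ∀ v : F,
      (cov τ o v : F) = cov' τ o v := by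
    intro τ hτ v
    have h1 := cov.isCovariantDerivativeOnUniv.difference_apply cov'.isCovariantDerivativeOnUniv
      (mem_univ o) hτ
    obtain ⟨X, hX, rfl⟩ := d.exists_fundE_eq v
    obtain ⟨Y, hY, hYe⟩ := d.exists_fundE_eq (EM := F) (τ o)
    have h2 := cov.isCovariantDerivativeOnUniv.difference_apply cov'.isCovariantDerivativeOnUniv
      (mem_univ o) ((contMDiff_fundamentalField (F := F) d Y).mdifferentiable (by simp) o)
    have h3 : (fundamentalField (EG := E) (EM := F) (G := G) (M := M) Y o) = τ o := hYe
    rw [h3, h1] at h2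
    have h4 := congrArg (fun A : F →L[ℝ] F ↦ A (fundE E F G o X)) h2
    have h5 : cov (fundamentalField Y) o (fundE E F G o X) =
        cov' (fundamentalField Y) o (fundE E F G o X) :=
      (h.apply_fundamentalField X hX Y hY).trans (h'.apply_fundamentalField X hX Y hY).symm
    have h6 : (cov τ o (fundE E F G o X) : F) - cov' τ o (fundE E F G o X) =
      cov (fundamentalField Y) o (fundE E F G o X) -
        cov' (fundamentalField Y) o (fundE E F G o X) := h4
    rw [h5, sub_self] at h6
    exact sub_eq_zero.1 h6
  let τ : Π x : M, TangentSpace 𝓘(ℝ, F) x := fun x ↦ push F g⁻¹ (g • x) (σ (g • x))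
  have hτ : ∀ y, (σ (g • y) : F) = push F g y (τ y) := fun y ↦ (push_push_inv (F := F) E g y (σ (g • y))).symm
  have hτ' : ∀ y, (τ (g⁻¹ • y) : F) = push F g⁻¹ y (σ y) := fun y ↦
    congrArg (fun x : M ↦ (push F g⁻¹ x (σ x) : F)) (smul_inv_smul g y)
  have hd : MDiffAt (T% τ) o := by
    have := mdiffAt_of_push d hτ' hσ
    rwa [inv_mul_cancel, one_smul] at this
  have h1 : (cov σ (g • o) (push F g o v) : F) = push F g o (cov τ o v) :=
    h.invariant g τ σ hτ o v hd
  have h2 : (cov' σ (g • o) (push F g o v) : F) = push F g o (cov' τ o v) :=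
    h'.invariant g τ σ hτ o v hd
  rw [h1, h2, h0 τ hd v]

/-- By uniqueness, the canonical connection differentiates along left-invariant fields in `𝔭`. -/
theorem hasForm_canonicalConnection
    [RiemannianBundle (fun x : M ↦ TangentSpace 𝓘(ℝ, F) x)]
    [IsContMDiffRiemannianBundle 𝓘(ℝ, F) ∞ F (fun x : M ↦ TangentSpace 𝓘(ℝ, F) x)]
    (d : ReductiveDecomposition E G o) :
    HasForm d (d.canonicalConnection (EM := F)) 0 := by
  intro σ g v hσ
  rw [IsCanonicalConnection.unique d (isCanonicalConnection_canonicalConnection d)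
    (isCanonicalConnection_formConnection_zero d) σ g v hσ]
  exact hasForm_formConnection d 0 (by simp) σ g v hσ

/-! ### The Lie bracket of vector fields -/

/-- The differential of `v ↦ (g * exp (J v)) • o`, brought back to `T_o M`. -/
noncomputable def expFrame (d : ReductiveDecomposition E G o) (v : F) : F →L[ℝ] F :=
  fundE E F G o ∘L lder (lieExp G) (d.jE F v) ∘L d.jE F

theorem contDiff_expFrame (d : ReductiveDecomposition E G o) : ContDiff ℝ ∞ (expFrame (F := F) d) :=
  contDiff_const.clm_comp ((contDiff_lder_lieExp.comp (d.jE F).contDiff).clm_comp contDiff_const)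

theorem expFrame_zero (d : ReductiveDecomposition E G o) :
    expFrame (F := F) d 0 = ContinuousLinearMap.id ℝ F := by
  ext v
  rw [expFrame, map_zero, lder_lieExp_zero]
  exact d.fundE_jE v

theorem md_mul_expJ (d : ReductiveDecomposition E G o) (g : G) (v w : F) :
    md F F (fun v : F ↦ (g * lieExp G (d.jE F v)) • o) v w =
      push F (g * lieExp G (d.jE F v)) o (expFrame d v w) := by
  have h := (d.smooth_expJ (EM := F)).mdiff v
  simp only [mul_smul]
  rw [md_smul_comp E g h, d.md_expJ, push_mul_apply E]
  rfl

theorem smooth_mul_expJ (d : ReductiveDecomposition E G o) (g : G) :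
    ContMDiff 𝓘(ℝ, F) 𝓘(ℝ, F) ∞ (fun v : F ↦ (g * lieExp G (d.jE F v)) • o) := by
  simp only [mul_smul]
  exact (smooth_smul E g).comp d.smooth_expJ

/-- The Maurer-Cartan equation of `exp` at `0`. -/
theorem fderiv_lder_antisymm (a b : E) : fderiv ℝ (lder (lieExp G)) (0 : E) a b -
    fderiv ℝ (lder (lieExp G)) (0 : E) b a = - lieBL E G a b := by
  have := maurerCartan (contMDiff_lieExp (E := E) (G := G)) 0 a b
  rwa [lder_lieExp_zero] at this

/-- Brackets are computed after pulling back along `v ↦ g exp(v) • o`; the bracket in the Lie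
algebra is the antisymmetric part of the derivative of `lder exp` at `0`. -/
theorem hat_mlieBracket (d : ReductiveDecomposition E G o)
    {X Y : Π x : M, TangentSpace 𝓘(ℝ, F) x} {g : G}
    (hX : MDiffAt (T% X) (g • o)) (hY : MDiffAt (T% Y) (g • o)) :
    hat o (mlieBracket 𝓘(ℝ, F) X Y) g =
      lD (hat o Y) g (d.jE F (hat o X g)) - lD (hat o X) g (d.jE F (hat o Y g)) +
        fundE E F G o (lieBL E G (d.jE F (hat o X g)) (d.jE F (hat o Y g))) := by
  have : IsManifold 𝓘(ℝ, F) (minSmoothness ℝ 2) M := by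
    have : minSmoothness ℝ 2 ≤ (∞ : WithTop ℕ∞) := by
      rw [minSmoothness_of_isRCLikeNormedField]; exact WithTop.coe_le_coe.2 le_top
    exact IsManifold.of_le this
  have := one_le_infty_manifold F M
  set e : F → M := fun v : F ↦ (g * lieExp G (d.jE F v)) • o with hedef
  have he0 : e 0 = g • o := by simp [e, lieExp_zero]
  have hes : ContMDiff 𝓘(ℝ, F) 𝓘(ℝ, F) ∞ e := smooth_mul_expJ d g
  have hinvC : ContDiffAt ℝ ∞ (fun v ↦ (expFrame (F := F) d v).inverse) 0 := by
    have h : ContDiffAt ℝ ∞ (ContinuousLinearMap.inverse : (F →L[ℝ] F) → _) (expFrame d 0) := by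
      rw [expFrame_zero]
      exact contDiffAt_map_inverse (ContinuousLinearEquiv.refl ℝ F)
    exact h.comp (0 : F) (contDiff_expFrame d).contDiffAt
  have hequiv : ∀ᶠ v in 𝓝 (0 : F), ∃ c : F ≃L[ℝ] F, (c : F →L[ℝ] F) = expFrame d v := by
    have h1 : {A : F →L[ℝ] F | ∃ e : F ≃L[ℝ] F, (e : F →L[ℝ] F) = A} ∈ 𝓝 (expFrame (F := F) d 0) := by
      rw [expFrame_zero]
      exact ContinuousLinearEquiv.nhds (ContinuousLinearEquiv.refl ℝ F)
    exact (contDiff_expFrame d).continuous.continuousAt.eventually h1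
  -- The pulled back field is `hat o Z` read in the frame `expFrame`.
  have key : ∀ Z : Π x : M, TangentSpace 𝓘(ℝ, F) x, mpullback 𝓘(ℝ, F) 𝓘(ℝ, F) e Z =ᶠ[𝓝 0]
      fun v ↦ (expFrame d v).inverse (hat o Z (g * lieExp G (d.jE F v))) := by
    intro Z
    filter_upwards [hequiv] with v hv
    obtain ⟨c, hc⟩ := hv
    have h1 : md F F e v =
        ((c.trans (pushEquiv E (g * lieExp G (d.jE F v)) o) : F ≃L[ℝ] F) : F →L[ℝ] F) := by
      refine ContinuousLinearMap.ext fun w ↦ ?_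
      refine (md_mul_expJ d g v w).trans ?_
      rw [← hc]; rfl
    have h2 : (md F F e v).inverse =
        (((c.trans (pushEquiv E (g * lieExp G (d.jE F v)) o)).symm : F ≃L[ℝ] F) : F →L[ℝ] F) := by
      rw [h1, ContinuousLinearMap.inverse_equiv]
    rw [mpullback_apply, ← hc, ContinuousLinearMap.inverse_equiv]
    exact congrArg (fun A : F →L[ℝ] F ↦ A (Z (e v))) h2
  have h1 := mpullback_mlieBracket (x₀ := (0 : F)) (n := ∞) (f := e) (I := 𝓘(ℝ, F)) (I' := 𝓘(ℝ, F))
    (V := X) (W := Y) (by rw [he0]; exact hX) (by rw [he0]; exact hY) (hes 0)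
    (by rw [minSmoothness_of_isRCLikeNormedField]; exact WithTop.coe_le_coe.2 le_top)
  rw [Filter.EventuallyEq.mlieBracket_vectorField_eq (key X) (key Y)] at h1
  have h2 := (key (mlieBracket 𝓘(ℝ, F) X Y)).self_of_nhds
  rw [h1] at h2
  have hid : (ContinuousLinearMap.id ℝ F).inverse = ContinuousLinearMap.id ℝ F :=
    ContinuousLinearMap.inverse_id
  simp only [map_zero, lieExp_zero, mul_one, expFrame_zero, hid,
    ContinuousLinearMap.id_apply] at h2
  rw [← h2]
  refine (mlieBracket_model _ _ _).trans ?_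
  have hder : ∀ (Z : Π x : M, TangentSpace 𝓘(ℝ, F) x), MDiffAt (T% Z) (g • o) → ∀ w : F,
      fderiv ℝ (fun v ↦ (expFrame d v).inverse (hat o Z (g * lieExp G (d.jE F v)))) 0 w =
      lD (hat o Z) g (d.jE F w) -
        fundE E F G o (fderiv ℝ (lder (lieExp G)) 0 (d.jE F w) (d.jE F (hat o Z g))) := by
    intro Z hZ w
    set f : F → F := fun v ↦ (expFrame d v).inverse (hat o Z (g * lieExp G (d.jE F v))) with hf
    have hZd : HasFDerivAt (fun v : F ↦ hat o Z (g * lieExp G (d.jE F v)))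
        (lD (hat o Z) g ∘L d.jE F) 0 :=
      HasFDerivAt.comp (g := fun z : E ↦ hat o Z (g * lieExp G z)) (0 : F)
        (by rw [map_zero]; exact hasFDerivAt_lD hZ) (d.jE F).hasFDerivAt
    have hfd : DifferentiableAt ℝ f 0 :=
      (hinvC.differentiableAt (by simp)).clm_apply hZd.differentiableAt
    have hCd := (contDiff_expFrame (F := F) d).differentiable (by simp) 0
    have h3 : HasFDerivAt (fun v ↦ expFrame d v (f v)) (lD (hat o Z) g ∘L d.jE F) 0 := by
      refine hZd.congr_of_eventuallyEq ?_
      filter_upwards [hequiv] with v hv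
      obtain ⟨c, hc⟩ := hv
      simp only [hf]
      rw [← hc, ContinuousLinearMap.inverse_equiv]; simp
    have h4 := DFunLike.congr_fun (h3.unique (hCd.hasFDerivAt.clm_apply hfd.hasFDerivAt)) w
    have hf0 : f 0 = hat o Z g := by
      simp only [hf, map_zero, lieExp_zero, mul_one, expFrame_zero, hid,
        ContinuousLinearMap.id_apply]
    have hCd' : fderiv ℝ (expFrame (F := F) d) 0 w (hat o Z g) =
        fundE E F G o (fderiv ℝ (lder (lieExp G)) 0 (d.jE F w) (d.jE F (hat o Z g))) := by
      have h5 : HasFDerivAt (fun v : F ↦ lder (E := E) (lieExp G) (d.jE F v))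
          (fderiv ℝ (lder (lieExp G)) 0 ∘L d.jE F) 0 :=
        HasFDerivAt.comp (g := fun z : E ↦ lder (E := E) (lieExp G) z) (0 : F)
          (by rw [map_zero]
              exact (contDiff_lder_lieExp.differentiable (by simp) 0).hasFDerivAt)
          (d.jE F).hasFDerivAt
      have h6 := h5.clm_apply (hasFDerivAt_const (d.jE F (hat o Z g)) (0 : F))
      have h7 := (fundE E F G o).hasFDerivAt.comp (0 : F) h6
      have h8 := hCd.hasFDerivAt.clm_apply (hasFDerivAt_const (hat o Z g) (0 : F))
      have := DFunLike.congr_fun (h8.unique h7) w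
      simpa using this
    simp only [add_apply, ContinuousLinearMap.comp_apply, ContinuousLinearMap.flip_apply,
      expFrame_zero, ContinuousLinearMap.id_apply, hf0, hCd'] at h4
    rw [h4]; abel
  simp only [map_zero, lieExp_zero, mul_one, expFrame_zero, hid, ContinuousLinearMap.id_apply]
  rw [hder X hX, hder Y hY]
  have h9 := fderiv_lder_antisymm (G := G) (d.jE F (hat o X g)) (d.jE F (hat o Y g))
  have h10 : lieBL E G (d.jE F (hat o X g)) (d.jE F (hat o Y g)) =
    fderiv ℝ (lder (lieExp G)) 0 (d.jE F (hat o Y g)) (d.jE F (hat o X g)) -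
    fderiv ℝ (lder (lieExp G)) 0 (d.jE F (hat o X g)) (d.jE F (hat o Y g)) := by
    rw [← neg_sub, h9, neg_neg]
  rw [h10, map_sub]
  abel

end Connections

/-! ### The Levi-Civita connection and curvature of a naturally reductive space -/

section Curvature

variable {E : Type*} [NormedAddCommGroup E] [NormedSpace ℝ E] [FiniteDimensional ℝ E]
  {G : Type*} [TopologicalSpace G] [ChartedSpace E G] [Group G] [LieGroup 𝓘(ℝ, E) ∞ G] [T2Space G]
  {F : Type*} [NormedAddCommGroup F] [NormedSpace ℝ F] [FiniteDimensional ℝ F]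
  {M : Type*} [TopologicalSpace M] [ChartedSpace F M] [IsManifold 𝓘(ℝ, F) ∞ M]
  [MulAction G M] [ContMDiffSMul 𝓘(ℝ, E) 𝓘(ℝ, F) ∞ G M]
  [T2Space M] [SecondCountableTopology G] [MulAction.IsPretransitive G M] {o : M}

/-- Left-invariant derivatives at `exp z` in terms of the ordinary derivative at `z`. -/
theorem eventually_lD_exp {W : Type*} [NormedAddCommGroup W] [NormedSpace ℝ W] {f : G → W}
    (hf : ContDiffAt ℝ ∞ (fun z : E ↦ f (lieExp G z)) 0) :
    ∀ᶠ z in 𝓝 (0 : E), lD f (lieExp G z) =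
      fderiv ℝ (fun z : E ↦ f (lieExp G z)) z ∘L leftFrame (lieExp G) (lieLog E) z := by
  have := LieGroup.isTopologicalGroup E G
  have h := isLocalParam_lieExp E G
  have hev : ∀ᶠ z in 𝓝 (0 : E), DifferentiableAt ℝ (fun z : E ↦ f (lieExp G z)) z := by
    filter_upwards [(hf.of_le (m := 1) (by simp)).eventually (by simp)] with z hz
    exact hz.differentiableAt (by simp)
  filter_upwards [h.eventually_smooth_mul_zero, h.left_inv, hev,
    h.continuousAt_zero.eventually h.right_inv.eventually_nhds] with z h1 h3 h2 h4
  have h5 : Tendsto (fun y : E ↦ lieExp G z * lieExp G y) (𝓝 0) (𝓝 (lieExp G z)) := by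
    simpa [lieExp_zero] using h.continuousAt_zero.const_mul (lieExp G z)
  have h6 : ∀ᶠ y in 𝓝 (0 : E), lieExp G (lieLog E (lieExp G z * lieExp G y)) =
    lieExp G z * lieExp G y := h5.eventually h4
  have h7 : (fun y : E ↦ f (lieExp G z * lieExp G y)) =ᶠ[𝓝 0]
      fun y ↦ f (lieExp G (lieLog E (lieExp G z * lieExp G y))) := by
    filter_upwards [h6] with y hy
    rw [hy]
  have h8 : ContDiffAt ℝ ∞ (fun y ↦ lieLog E (lieExp G z * lieExp G y)) (0 : E) := by
    exact ContDiffAt.comp (g := fun q : E × E ↦ lieLog E (lieExp G q.1 * lieExp G q.2))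
      (f := fun y ↦ (z, y)) (0 : E) h1 (contDiffAt_const.prodMk contDiffAt_id)
  rw [lD, h7.fderiv_eq]
  refine (HasFDerivAt.comp (g := fun z : E ↦ f (lieExp G z)) (0 : E) ?_
    (h8.differentiableAt (by simp)).hasFDerivAt).fderiv
  simp only [lieExp_zero, mul_one, h3]
  exact h2.hasFDerivAt

/-- Left-invariant derivatives commute up to the derivative along the Lie bracket. -/
theorem fderiv_lD_comm {W : Type*} [NormedAddCommGroup W] [NormedSpace ℝ W] {f : G → W}
    (hf : ContDiffAt ℝ ∞ (fun z : E ↦ f (lieExp G z)) 0) :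
    ContDiffAt ℝ ∞ (fun z : E ↦ lD (E := E) f (lieExp G z)) 0 ∧ ∀ a b : E,
    fderiv ℝ (fun z : E ↦ lD (E := E) f (lieExp G z)) 0 a b -
      fderiv ℝ (fun z : E ↦ lD (E := E) f (lieExp G z)) 0 b a = lD f 1 (lieBL E G a b) := by
  have h := isLocalParam_lieExp E G
  set φ := fun z : E ↦ f (lieExp G z) with hφ
  have h1 : ContDiffAt ℝ ∞ (fderiv ℝ φ) 0 := hf.fderiv_right (by simp)
  have h2 := h.eventually_smooth_leftFrame.self_of_nhds
  have h3 := eventually_lD_exp hf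
  have h4 : lD (E := E) f 1 = fderiv ℝ φ 0 := by
    rw [lD]; simp only [one_mul]; rfl
  refine ⟨(h1.clm_comp h2).congr_of_eventuallyEq h3, fun a b ↦ ?_⟩
  have hsymm : fderiv ℝ (fderiv ℝ φ) 0 a b = fderiv ℝ (fderiv ℝ φ) 0 b a := by
    have := hf.isSymmSndFDerivAt (by
      rw [minSmoothness_of_isRCLikeNormedField]; exact WithTop.coe_le_coe.2 le_top)
    exact this a b
  have h5 := (h1.differentiableAt (by simp)).hasFDerivAt.clm_comp
    (h2.differentiableAt (by simp)).hasFDerivAt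
  rw [Filter.EventuallyEq.fderiv_eq h3, h5.fderiv, h4, lieBL]
  simp [h.leftFrame_zero, hsymm]

variable (E) in
include E in
theorem hat_one (σ : Π x : M, TangentSpace 𝓘(ℝ, F) x) : hat o σ (1 : G) = σ o := by
  have := push_hat E o σ (1 : G)
  rw [push_one] at this
  exact this.trans (congrArg (fun x : M ↦ (σ x : F)) (one_smul G o))

/-- In isotropy directions the derivative of an equivariant function is determined by equivariance.
-/
theorem lD_hat_of_mem_kE (d : ReductiveDecomposition E G o)
    {σ : Π x : M, TangentSpace 𝓘(ℝ, F) x} (h : MDiffAt (T% σ) o) {A : E} (hA : A ∈ d.kE) :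
    lD (hat o σ) (1 : G) A = - fundE E F G o (lieBL E G A (d.jE F (hat o σ (1 : G)))) := by
  have h1 : (fun t : ℝ ↦ hat o σ (1 * lieExp G (t • A))) =
      fun t ↦ fundE E F G o (adE E (lieExp G (-(t • A))) (d.jE F (hat o σ (1 : G)))) := by
    funext t
    have hk : lieExp G (t • A) • o = o := d.exp_smul_of_mem_kE F (d.kE.smul_mem t hA)
    have hk' : (lieExp G (t • A))⁻¹ • o = o := inv_smul_eq_iff.2 hk.symm
    rw [hat_mul_stab E σ 1 hk, lieExp_neg, ← d.jE_push hk', d.fundE_jE]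
  have h2 := (fundE E F G o).hasFDerivAt.comp_hasDerivAt (0 : ℝ)
    (hasDerivAt_adE_neg (G := G) A (d.jE F (hat o σ (1 : G))) 0)
  have h3 : HasDerivAt (fun t : ℝ ↦ hat o σ (1 * lieExp G (t • A))) (lD (hat o σ) (1 : G) A) 0 :=
    (hasFDerivAt_lD (E := E) (g := (1 : G)) (by rwa [one_smul])).comp_hasDerivAt_of_eq (0 : ℝ)
      (hasDerivAt_smul_line A 0) (by simp)
  rw [h1] at h3
  rw [h3.unique h2]
  simp [lieExp_zero, adE_one]

theorem HasForm.apply_one {d : ReductiveDecomposition E G o}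
    {cov : CovariantDerivative 𝓘(ℝ, F) F (fun x : M ↦ TangentSpace 𝓘(ℝ, F) x)}
    {B : F →L[ℝ] F →L[ℝ] F} (h : HasForm d cov B) {σ : Π x : M, TangentSpace 𝓘(ℝ, F) x}
    (hσ : MDiffAt (T% σ) o) (v : F) :
    (cov σ o v : F) = lD (hat o σ) (1 : G) (d.jE F v) + B v (hat o σ (1 : G)) := by
  have h1 := h σ 1 v (by rwa [one_smul])
  rw [push_one] at h1
  have h2 : (cov σ ((1 : G) • o) v : F) = cov σ o v :=
    congrArg (fun x : M ↦ (cov σ x v : F)) (one_smul G o)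
  exact h2.symm.trans h1

/-- The curvature at `o` of the invariant connection determined by `B`. -/
theorem HasForm.curvature_eq {d : ReductiveDecomposition E G o}
    {cov : CovariantDerivative 𝓘(ℝ, F) F (fun x : M ↦ TangentSpace 𝓘(ℝ, F) x)}
    {B : F →L[ℝ] F →L[ℝ] F} (h : HasForm d cov B)
    {X Y Z : Π x : M, TangentSpace 𝓘(ℝ, F) x}
    (hX : CMDiff ∞ (T% X)) (hY : CMDiff ∞ (T% Y)) (hZ : CMDiff ∞ (T% Z)) :
    (curvature cov X Y Z o : F) =
      - fundE E F G o (lieBL E G (d.prK (lieBL E G (d.jE F (hat o X (1 : G))) (d.jE F (hat o Y (1 : G))))) (d.jE F (hat o Z (1 : G))))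
      + (B (hat o X (1 : G)) (B (hat o Y (1 : G)) (hat o Z (1 : G))) - B (hat o Y (1 : G)) (B (hat o X (1 : G)) (hat o Z (1 : G))))
      - B (fundE E F G o (lieBL E G (d.jE F (hat o X (1 : G))) (d.jE F (hat o Y (1 : G))))) (hat o Z (1 : G)) := by
  have hsm : ∀ {W : Π x : M, TangentSpace 𝓘(ℝ, F) x}, CMDiff ∞ (T% W) → ∀ x, MDiffAt (T% W) x :=
    fun hW x ↦ (hW x).mdifferentiableAt (by simp)
  have hC : ∀ {W : Π x : M, TangentSpace 𝓘(ℝ, F) x}, CMDiff ∞ (T% W) →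
      ContDiffAt ℝ ∞ (fun z : E ↦ hat o W (lieExp G z)) 0 := fun {W} hW ↦ by
    have := contDiffAt_hat (E := E) (G := G) (o := o) (g₀ := 1) (σ := W) (hW _)
    simpa only [one_mul] using this
  have hD : ∀ {W : Π x : M, TangentSpace 𝓘(ℝ, F) x}, CMDiff ∞ (T% W) →
      HasFDerivAt (fun z : E ↦ hat o W (lieExp G z)) (lD (hat o W) (1 : G)) 0 := fun {W} hW ↦ by
    have := hasFDerivAt_lD (E := E) (G := G) (o := o) (g := 1) (σ := W) (hsm hW _)
    simpa only [one_mul] using this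
  obtain ⟨hL, hLc⟩ := fderiv_lD_comm (hC hZ)
  set L : E → E →L[ℝ] F := fun z ↦ lD (hat o Z) (lieExp G z) with hLdef
  have hL0 : L 0 = lD (hat o Z) (1 : G) := by simp only [hLdef, lieExp_zero]
  -- the equivariant function of `y ↦ ∇_{Y y} Z`
  have key : ∀ {Y : Π x : M, TangentSpace 𝓘(ℝ, F) x}, CMDiff ∞ (T% Y) → ∀ x : F,
      (cov (fun y ↦ cov Z y (Y y)) o x : F) =
        fderiv ℝ L 0 (d.jE F x) (d.jE F (hat o Y (1 : G))) +
          lD (hat o Z) (1 : G) (d.jE F (lD (hat o Y) (1 : G) (d.jE F x))) +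
        (B (lD (hat o Y) (1 : G) (d.jE F x)) (hat o Z (1 : G)) + B (hat o Y (1 : G)) (lD (hat o Z) (1 : G) (d.jE F x))) +
        B x (lD (hat o Z) (1 : G) (d.jE F (hat o Y (1 : G))) + B (hat o Y (1 : G)) (hat o Z (1 : G))) := by
    intro Y hY x
    have h1 : ∀ g : G, hat o (fun y ↦ cov Z y (Y y)) g =
        lD (hat o Z) g (d.jE F (hat o Y g)) + B (hat o Y g) (hat o Z g) := by
      intro g
      have h2 := h Z g (hat o Y g) (hsm hZ _)
      rw [push_hat E] at h2
      apply push_injective E g o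
      rw [← h2, push_hat E]
    have hd : HasFDerivAt (fun z : E ↦ L z (d.jE F (hat o Y (lieExp G z))) +
        B (hat o Y (lieExp G z)) (hat o Z (lieExp G z))) _ 0 :=
      ((hL.differentiableAt (by simp)).hasFDerivAt.clm_apply
        ((d.jE F).hasFDerivAt.comp (0 : E) (hD hY))).add
        ((B.hasFDerivAt.comp (0 : E) (hD hY)).clm_apply (hD hZ))
    have hfun : (fun z : E ↦ hat o (fun y ↦ cov Z y (Y y)) ((1 : G) * lieExp G z)) =
        fun z : E ↦ L z (d.jE F (hat o Y (lieExp G z))) +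
        B (hat o Y (lieExp G z)) (hat o Z (lieExp G z)) := by
      funext z
      rw [h1, one_mul]
    have hMD : MDiffAt (T% (fun y ↦ cov Z y (Y y))) o := by
      have := mdiffAt_of_hat d (g₀ := (1 : G)) (σ := fun y ↦ cov Z y (Y y))
        (by rw [hfun]; exact hd.differentiableAt)
      rwa [one_smul] at this
    rw [h.apply_one hMD]
    have h4 : lD (hat o (fun y ↦ cov Z y (Y y))) (1 : G) (d.jE F x) =
        fderiv ℝ L 0 (d.jE F x) (d.jE F (hat o Y (1 : G))) +
          lD (hat o Z) (1 : G) (d.jE F (lD (hat o Y) (1 : G) (d.jE F x))) +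
        (B (lD (hat o Y) (1 : G) (d.jE F x)) (hat o Z (1 : G)) +
          B (hat o Y (1 : G)) (lD (hat o Z) (1 : G) (d.jE F x))) := by
      rw [lD, hfun, hd.fderiv]
      simp only [add_apply, ContinuousLinearMap.comp_apply, ContinuousLinearMap.flip_apply,
        Function.comp_apply, lieExp_zero, hL0]
      abel
    rw [h4, h1]
  have hbr := hat_mlieBracket d (g := (1 : G)) (hsm hX _) (hsm hY _)
  have hcov := h.apply_one (hsm hZ o) (hat (F := F) o (mlieBracket 𝓘(ℝ, F) X Y) (1 : G))
  have hk := lD_hat_of_mem_kE d (hsm hZ o)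
    (d.prK_mem (lieBL E G (d.jE F (hat (F := F) o X (1 : G))) (d.jE F (hat (F := F) o Y (1 : G)))))
  rw [eq_sub_of_add_eq (d.prK_add_prP _), map_sub, ← hLc (d.jE F (hat (F := F) o X (1 : G))) (d.jE F (hat (F := F) o Y (1 : G)))] at hk
  have hdef : ∀ a b c : F, cov (fun y ↦ cov Z y (Y y)) o (hat (F := F) o X (1 : G)) = a →
      cov (fun y ↦ cov Z y (X y)) o (hat (F := F) o Y (1 : G)) = b →
      cov Z o (hat (F := F) o (mlieBracket 𝓘(ℝ, F) X Y) (1 : G)) = c →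
      (curvature cov X Y Z o : F) = a - b - c := by
    rintro _ _ _ rfl rfl rfl
    rw [hat_one E X, hat_one E Y, hat_one E (mlieBracket 𝓘(ℝ, F) X Y)]
    rfl
  refine (hdef _ _ _ (key hY _) (key hX _) hcov).trans ?_
  rw [hbr]
  rw [eq_sub_of_add_eq (d.prK_add_prP (lieBL E G (d.jE F (hat o X (1 : G))) (d.jE F (hat o Y (1 : G))))), ← hk]
  simp only [map_add, map_sub, add_apply, sub_apply, d.jE_fundE]
  abel

end Curvature

section LeviCivita

variable {F : Type*} [NormedAddCommGroup F] [NormedSpace ℝ F] [FiniteDimensional ℝ F]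
  {M : Type*} [TopologicalSpace M] [ChartedSpace F M]
  [RiemannianBundle (fun x : M ↦ TangentSpace 𝓘(ℝ, F) x)]

/-- The inner product of the tangent space at `x`, as a bilinear map on the model space. -/
noncomputable def innL (F : Type*) [NormedAddCommGroup F] [NormedSpace ℝ F] [FiniteDimensional ℝ F]
    {M : Type*} [TopologicalSpace M] [ChartedSpace F M]
    [RiemannianBundle (fun x : M ↦ TangentSpace 𝓘(ℝ, F) x)] (x : M) : F →L[ℝ] F →L[ℝ] ℝ :=
  LinearMap.toContinuousBilinearMap
    (show F →ₗ[ℝ] F →ₗ[ℝ] ℝ from innerₗ (TangentSpace 𝓘(ℝ, F) x))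

theorem innL_comm (x : M) (u v : F) : innL F x u v = innL F x v u :=
  real_inner_comm (F := TangentSpace 𝓘(ℝ, F) x) v u

theorem innL_ext {x : M} {u v : F} (h : ∀ w, innL F x u w = innL F x v w) : u = v :=
  ext_inner_right (E := TangentSpace 𝓘(ℝ, F) x) ℝ h

theorem innL_self_eq_zero {x : M} {u : F} (h : innL F x u u = 0) : u = 0 :=
  (inner_self_eq_zero (𝕜 := ℝ) (E := TangentSpace 𝓘(ℝ, F) x)).1 h

theorem exists_mdiffAt_extension [IsManifold 𝓘(ℝ, F) ∞ M] (x : M)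
    (v : TangentSpace 𝓘(ℝ, F) x) :
    ∃ Z : Π x : M, TangentSpace 𝓘(ℝ, F) x, MDiffAt (T% Z) x ∧ Z x = v :=
  have := one_le_infty_manifold F M
  ⟨FiberBundle.extend F v, FiberBundle.mdifferentiableAt_extend .., by simp⟩

end LeviCivita

section NaturallyReductive

variable {E : Type*} [NormedAddCommGroup E] [NormedSpace ℝ E] [FiniteDimensional ℝ E]
  {G : Type*} [TopologicalSpace G] [ChartedSpace E G] [Group G] [LieGroup 𝓘(ℝ, E) ∞ G] [T2Space G]
  {F : Type*} [NormedAddCommGroup F] [NormedSpace ℝ F] [FiniteDimensional ℝ F]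
  {M : Type*} [TopologicalSpace M] [ChartedSpace F M] [IsManifold 𝓘(ℝ, F) ∞ M]
  [MulAction G M] [ContMDiffSMul 𝓘(ℝ, E) 𝓘(ℝ, F) ∞ G M]
  [T2Space M] [SecondCountableTopology G] [MulAction.IsPretransitive G M] {o : M}
  [RiemannianBundle (fun x : M ↦ TangentSpace 𝓘(ℝ, F) x)]

/-- The group acts by isometries. -/
def ActsIsometrically (F : Type*) [NormedAddCommGroup F] [NormedSpace ℝ F] [FiniteDimensional ℝ F]
    (G M : Type*) [TopologicalSpace M] [ChartedSpace F M] [Group G] [MulAction G M]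
    [RiemannianBundle (fun x : M ↦ TangentSpace 𝓘(ℝ, F) x)] : Prop :=
  ∀ (g : G) (x : M) (u v : F), innL F (g • x) (push F g x u) (push F g x v) = innL F x u v

theorem ReductiveDecomposition.IsNaturallyReductive.innL_eq {d : ReductiveDecomposition E G o}
    (h : d.IsNaturallyReductive F) {X Y Z : E} (hX : X ∈ d.pE) (hY : Y ∈ d.pE) (hZ : Z ∈ d.pE) :
    innL F o (fundE E F G o (lieBL E G Z X)) (fundE E F G o Y) +
      innL F o (fundE E F G o X) (fundE E F G o (lieBL E G Z Y)) = 0 := by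
  have h1 := h X hX Y hY Z hZ
  rw [← d.fundE_prP (lieBL E G Z X), ← d.fundE_prP (lieBL E G Z Y), lieBL_apply, lieBL_apply]
  exact h1

/-- The bilinear map `(v, w) ↦ [v, w]_𝔭 / 2` on `T_o M ≅ 𝔭`. -/
noncomputable def halfBracket (F : Type*) [NormedAddCommGroup F] [NormedSpace ℝ F]
    [FiniteDimensional ℝ F] [ChartedSpace F M] [IsManifold 𝓘(ℝ, F) ∞ M]
    [ContMDiffSMul 𝓘(ℝ, E) 𝓘(ℝ, F) ∞ G M] (d : ReductiveDecomposition E G o) :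
    F →L[ℝ] F →L[ℝ] F :=
  (1 / 2 : ℝ) • (ContinuousLinearMap.compL ℝ F E F (fundE E F G o) ∘L
    (lieBL E G).bilinearComp (d.jE F) (d.jE F))

theorem halfBracket_apply (d : ReductiveDecomposition E G o) (v w : F) :
    halfBracket F d v w = (1 / 2 : ℝ) • fundE E F G o (lieBL E G (d.jE F v) (d.jE F w)) := rfl

variable [IsContMDiffRiemannianBundle 𝓘(ℝ, F) ∞ F (fun x : M ↦ TangentSpace 𝓘(ℝ, F) x)]

/-- As `G` acts by isometries, inner products of sections are those of their functions on `G` at the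
base point. -/
theorem mvfderiv_inner_eq (hiso : ActsIsometrically F G M) (d : ReductiveDecomposition E G o)
    {Y Z : Π x : M, TangentSpace 𝓘(ℝ, F) x} {g : G} (hY : MDiffAt (T% Y) (g • o))
    (hZ : MDiffAt (T% Z) (g • o)) (v : F) :
    md F ℝ (fun y ↦ (inner ℝ (Y y) (Z y) : ℝ)) (g • o) (push F g o v) =
      innL F o (lD (hat o Y) g (d.jE F v)) (hat o Z g) +
        innL F o (hat o Y g) (lD (hat o Z) g (d.jE F v)) := by
  rw [← hasFDerivAt_comp_orbit d (mdifferentiableAt_inner_tangent hY hZ)]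
  have h1 : (fun h : G ↦ (inner ℝ (Y (h • o)) (Z (h • o)) : ℝ)) =
      fun h ↦ innL F o (hat o Y h) (hat o Z h) := by
    funext h
    rw [← hiso h o, push_hat E, push_hat E]
    rfl
  rw [h1]
  have h2 := ((innL F o).hasFDerivAt.comp (0 : E) (hasFDerivAt_lD hY)).clm_apply (hasFDerivAt_lD hZ)
  have h3 := DFunLike.congr_fun h2.fderiv (d.jE F v)
  refine Eq.trans h3 ?_
  simp only [add_apply, ContinuousLinearMap.comp_apply, ContinuousLinearMap.flip_apply,
    Function.comp_apply, lieExp_zero, mul_one]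
  rw [add_comm]

/-- The Levi-Civita connection of a naturally reductive space is `∇^c + [·, ·]_𝔭 / 2`. -/
theorem hasForm_leviCivita (hiso : ActsIsometrically F G M) (d : ReductiveDecomposition E G o)
    (hd : d.IsNaturallyReductive F) : HasForm d (leviCivita F M) (halfBracket F d) := by
  have := one_le_infty_manifold F M
  intro σ g v hσ
  have hext : ∀ u : F, ∃ Z : Π x : M, TangentSpace 𝓘(ℝ, F) x, MDiffAt (T% Z) (g • o) ∧
      (Z (g • o) : F) = push F g o u := fun u ↦
    exists_mdiffAt_extension (g • o) (push F g o u)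
  have hhat : ∀ {Z : Π x : M, TangentSpace 𝓘(ℝ, F) x} {u : F},
      (Z (g • o) : F) = push F g o u → hat o Z g = u := fun {Z u} hZ ↦ by
    apply push_injective E g o
    rw [push_hat E, hZ]
  obtain ⟨X, hX, hXv⟩ := hext v
  refine innL_ext (F := F) (x := g • o) fun w ↦ ?_
  obtain ⟨u, rfl⟩ : ∃ u, push F g o u = w := ⟨_, push_push_inv E g o w⟩
  obtain ⟨Z, hZ, hZu⟩ := hext u
  have h1 : innL F (g • o) (leviCivita F M σ (g • o) (push F g o v)) (push F g o u) =
      1 / 2 * koszul X σ Z (g • o) := by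
    rw [← hXv, ← hZu]
    exact inner_koszulMap X σ Z (g • o) hX hσ hZ
  rw [h1, hiso]
  have hs := push_hat E o σ g
  have hk : koszul X σ Z (g • o) =
      md F ℝ (fun y ↦ (inner ℝ (σ y) (Z y) : ℝ)) (g • o) (push F g o v) +
      md F ℝ (fun y ↦ (inner ℝ (X y) (Z y) : ℝ)) (g • o) (push F g o (hat o σ g)) -
      md F ℝ (fun y ↦ (inner ℝ (X y) (σ y) : ℝ)) (g • o) (push F g o u) +
      innL F (g • o) (push F g o (hat o (mlieBracket 𝓘(ℝ, F) X σ) g)) (push F g o u) -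
      innL F (g • o) (push F g o (hat o (mlieBracket 𝓘(ℝ, F) X Z) g)) (push F g o (hat o σ g)) -
      innL F (g • o) (push F g o (hat o (mlieBracket 𝓘(ℝ, F) σ Z) g)) (push F g o v) := by
    rw [push_hat E, push_hat E, push_hat E, push_hat E, ← hXv, ← hZu]
    rfl
  rw [hk, hiso, hiso, hiso, mvfderiv_inner_eq hiso d hσ hZ, mvfderiv_inner_eq hiso d hX hZ,
    mvfderiv_inner_eq hiso d hX hσ, hat_mlieBracket d hX hσ, hat_mlieBracket d hX hZ,
    hat_mlieBracket d hσ hZ, hhat hXv, hhat hZu, halfBracket_apply]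
  generalize hat o σ g = s
  have n1 := hd.innL_eq (d.jE_mem s) (d.jE_mem v) (d.jE_mem u)
  rw [d.fundE_jE, d.fundE_jE, lieBL_skew (d.jE F u), lieBL_skew (d.jE F u) (d.jE F v)] at n1
  simp only [map_add, map_sub, map_neg, add_apply, sub_apply, neg_apply, map_smul, smul_apply,
    smul_eq_mul] at n1 ⊢
  rw [innL_comm o s (fundE E F G o _)] at n1
  rw [innL_comm o s (lD (hat o Z) g _), innL_comm o v (lD (hat o Z) g _),
    innL_comm o v (lD (hat o σ) g _)]
  linarith

/-- The two connections have the forms `½ [·, ·]_𝔭` and `0`, which gives their difference. -/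
theorem differenceTensor_eq (hiso : ActsIsometrically F G M) (d : ReductiveDecomposition E G o)
    (hd : d.IsNaturallyReductive F) (g : G) (u v : F) :
    (d.differenceTensor (g • o) (push F g o u) (push F g o v) : F) =
      push F g o (halfBracket F d u v) := by
  have := one_le_infty_manifold F M
  obtain ⟨Z, hZ, hZv⟩ : ∃ Z : Π x : M, TangentSpace 𝓘(ℝ, F) x, MDiffAt (T% Z) (g • o) ∧
      (Z (g • o) : F) = push F g o v :=
    exists_mdiffAt_extension (g • o) (push F g o v)
  have h1 := (leviCivita F M).isCovariantDerivativeOnUniv.difference_apply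
    (d.canonicalConnection (EM := F)).isCovariantDerivativeOnUniv (mem_univ (g • o)) hZ
  have h2 := congrArg (fun A : F →L[ℝ] F ↦ A (push F g o u)) h1
  have h3 := hasForm_leviCivita hiso d hd Z g u hZ
  have h4 := hasForm_canonicalConnection d Z g u hZ
  have h5 : hat o Z g = v := by
    apply push_injective E g o
    rw [push_hat E, hZv]
  rw [← hZv]
  have h6 : (d.differenceTensor (g • o) (push F g o u) (Z (g • o)) : F) =
    @HSub.hSub F F F _ (leviCivita F M Z (g • o) (push F g o u))
      (d.canonicalConnection (EM := F) Z (g • o) (push F g o u)) := h2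
  rw [h6, h3, h4, h5, ← map_sub]
  simp only [zero_apply, add_zero, add_sub_cancel_left]
  rfl

/-- Invariance under `D` of `g_* 𝔴`, for a subspace `𝔴` of `𝔭`. -/
theorem isDInvariant_iff (hiso : ActsIsometrically F G M) (d : ReductiveDecomposition E G o)
    (hd : d.IsNaturallyReductive F) (g : G) {W : Submodule ℝ E} (hW : W ≤ d.pE)
    {U : Submodule ℝ (TangentSpace 𝓘(ℝ, F) (g • o))}
    (hU : ∀ u : F, u ∈ U ↔ ∃ X ∈ W, push F g o (fundE E F G o X) = u) :
    d.IsDInvariant (g • o) U ↔ ∀ X ∈ W, ∀ Y ∈ W, d.prP (lieBL E G X Y) ∈ W := by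
  have hmem : ∀ X, X ∈ d.pE → push F g o (fundE E F G o X) ∈ U → X ∈ W := by
    intro X hX h
    obtain ⟨Y, hY, h1⟩ := (hU _).1 h
    have h2 := congrArg (d.jE F) (push_injective E g o h1)
    rw [d.jE_fundE, d.jE_fundE, d.prP_of_mem hX, d.prP_of_mem (hW hY)] at h2
    exact h2 ▸ hY
  have key : ∀ X ∈ W, ∀ Y ∈ W, (d.differenceTensor (g • o) (push F g o (fundE E F G o X))
      (push F g o (fundE E F G o Y)) : F) =
      (1 / 2 : ℝ) • push F g o (fundE E F G o (d.prP (lieBL E G X Y))) := by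
    intro X hX Y hY
    rw [differenceTensor_eq hiso d hd, halfBracket_apply, d.jE_fundE, d.jE_fundE,
      d.prP_of_mem (hW hX), d.prP_of_mem (hW hY), map_smul, d.fundE_prP]
  constructor
  · intro h X hX Y hY
    have h1 := h _ ((hU _).2 ⟨X, hX, rfl⟩) _ ((hU _).2 ⟨Y, hY, rfl⟩)
    have h2 : (1 / 2 : ℝ) • push F g o (fundE E F G o (d.prP (lieBL E G X Y))) ∈ U := by
      rw [← key X hX Y hY]; exact h1
    refine hmem _ (d.prP_mem _) ?_
    have h3 := U.smul_mem (2 : ℝ) h2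
    have h4 : (2 : ℝ) • (1 / 2 : ℝ) • push F g o (fundE E F G o (d.prP (lieBL E G X Y))) =
      push F g o (fundE E F G o (d.prP (lieBL E G X Y))) := by rw [smul_smul]; norm_num
    rw [← h4]; exact h3
  · intro h u hu v hv
    obtain ⟨X, hX, rfl⟩ := (hU _).1 hu
    obtain ⟨Y, hY, rfl⟩ := (hU _).1 hv
    have h1 : (1 / 2 : ℝ) • push F g o (fundE E F G o (d.prP (lieBL E G X Y))) ∈ U :=
      U.smul_mem (1 / 2 : ℝ) ((hU _).2 ⟨_, h X hX Y hY, rfl⟩)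
    rw [← key X hX Y hY] at h1
    exact h1

/-- The subspace `V` of `T_o M` that corresponds to a subspace `𝔳` of `𝔭`. -/
theorem mem_iff_jE_mem (d : ReductiveDecomposition E G o) {W : Submodule ℝ E} (hW : W ≤ d.pE)
    {U : Submodule ℝ (TangentSpace 𝓘(ℝ, F) o)}
    (hU : ∀ u : F, u ∈ U ↔ ∃ X ∈ W, fundE E F G o X = u) (u : F) : u ∈ U ↔ d.jE F u ∈ W := by
  rw [hU]
  constructor
  · rintro ⟨X, hX, rfl⟩
    rw [d.jE_fundE, d.prP_of_mem (hW hX)]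
    exact hX
  · exact fun h ↦ ⟨_, h, d.fundE_jE u⟩

/-- The curvature of a connection of form `B` at `o` is a polynomial in `B` and `ad [·, ·]_𝔨`; if
`W` is closed under `B` and `[·, ·]_𝔭`, only the isotropy term can leave `W`. -/
theorem isCurvatureInvariant_iff (d : ReductiveDecomposition E G o)
    {cov : CovariantDerivative 𝓘(ℝ, F) F (fun x : M ↦ TangentSpace 𝓘(ℝ, F) x)}
    {B : F →L[ℝ] F →L[ℝ] F} (h : HasForm d cov B) {W : Submodule ℝ E} (hW : W ≤ d.pE)
    {U : Submodule ℝ (TangentSpace 𝓘(ℝ, F) o)}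
    (hU : ∀ u : F, u ∈ U ↔ ∃ X ∈ W, fundE E F G o X = u)
    (hB : ∀ u v : F, u ∈ U → v ∈ U → B u v ∈ U)
    (hB' : ∀ X ∈ W, ∀ Y ∈ W, ∀ v : F, v ∈ U → B (fundE E F G o (lieBL E G X Y)) v ∈ U) :
    IsCurvatureInvariant cov o U ↔
      ∀ X ∈ W, ∀ Y ∈ W, ∀ Z ∈ W, lieBL E G (d.prK (lieBL E G X Y)) Z ∈ W := by
  have hmem : ∀ X ∈ W, fundE E F G o X ∈ U := fun X hX ↦ (hU _).2 ⟨X, hX, rfl⟩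
  constructor
  · intro hc X hX Y hY Z hZ
    have h1 : (curvature cov (fundamentalField (EG := E) (G := G) X) (fundamentalField (EG := E) (G := G) Y)
        (fundamentalField (EG := E) (G := G) Z) o : F) ∈ U :=
      hc _ _ _ (contMDiff_fundamentalField d X) (contMDiff_fundamentalField d Y)
        (contMDiff_fundamentalField d Z) (hmem X hX) (hmem Y hY) (hmem Z hZ)
    have h2 := h.curvature_eq (contMDiff_fundamentalField (F := F) d X)
      (contMDiff_fundamentalField (F := F) d Y) (contMDiff_fundamentalField (F := F) d Z)
    obtain ⟨c, hc'⟩ : ∃ c : F, (curvature cov (fundamentalField (EG := E) (G := G) X)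
      (fundamentalField (EG := E) (G := G) Y)
        (fundamentalField (EG := E) (G := G) Z) o : F) = c := ⟨_, rfl⟩
    rw [hc'] at h1 h2
    have hh : ∀ X ∈ W, hat o (fundamentalField (EG := E) (EM := F) (G := G) (M := M) X) (1 : G) =
        fundE E F G o X := fun X _ ↦ hat_one E _
    rw [hh X hX, hh Y hY, hh Z hZ, d.jE_fundE, d.jE_fundE, d.jE_fundE, d.prP_of_mem (hW hX),
      d.prP_of_mem (hW hY), d.prP_of_mem (hW hZ)] at h2
    have h3 : fundE E F G o (lieBL E G (d.prK (lieBL E G X Y)) Z) =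
        (B (fundE E F G o X) (B (fundE E F G o Y) (fundE E F G o Z)) -
          B (fundE E F G o Y) (B (fundE E F G o X) (fundE E F G o Z))) -
        B (fundE E F G o (lieBL E G X Y)) (fundE E F G o Z) - c := by
      rw [h2]; abel
    have h4 : fundE E F G o (lieBL E G (d.prK (lieBL E G X Y)) Z) ∈ U := by
      rw [h3]
      exact U.sub_mem (U.sub_mem (U.sub_mem
        (hB _ _ (hmem X hX) (hB _ _ (hmem Y hY) (hmem Z hZ)))
        (hB _ _ (hmem Y hY) (hB _ _ (hmem X hX) (hmem Z hZ))))
        (hB' X hX Y hY _ (hmem Z hZ))) h1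
    have h5 := (mem_iff_jE_mem d hW hU _).1 h4
    rwa [d.jE_fundE, d.prP_of_mem (d.lieBL_mem_pE F (d.prK_mem _) (hW hZ))] at h5
  · intro hc X Y Z hX hY hZ hXU hYU hZU
    have h2 := h.curvature_eq hX hY hZ
    have hj : ∀ X : Π x : M, TangentSpace 𝓘(ℝ, F) x, X o ∈ U → hat o X (1 : G) ∈ U ∧
        d.jE F (hat o X (1 : G)) ∈ W := by
      intro X hX
      have : hat o X (1 : G) ∈ U := by rw [hat_one E]; exact hX
      exact ⟨this, (mem_iff_jE_mem d hW hU _).1 this⟩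
    have h3 : (curvature cov X Y Z o : F) ∈ U := by
      rw [h2]
      refine U.sub_mem (U.add_mem (U.neg_mem ?_) (U.sub_mem ?_ ?_)) ?_
      · exact hmem _ (hc _ (hj X hXU).2 _ (hj Y hYU).2 _ (hj Z hZU).2)
      · exact hB _ _ (hj X hXU).1 (hB _ _ (hj Y hYU).1 (hj Z hZU).1)
      · exact hB _ _ (hj Y hYU).1 (hB _ _ (hj X hXU).1 (hj Z hZU).1)
      · exact hB' _ (hj X hXU).2 _ (hj Y hYU).2 _ (hj Z hZU).1
    exact h3

theorem isCurvatureInvariant_canonicalConnection_iff (d : ReductiveDecomposition E G o)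
    {W : Submodule ℝ E} (hW : W ≤ d.pE) {U : Submodule ℝ (TangentSpace 𝓘(ℝ, F) o)}
    (hU : ∀ u : F, u ∈ U ↔ ∃ X ∈ W, fundE E F G o X = u) :
    IsCurvatureInvariant d.canonicalConnection o U ↔
      ∀ X ∈ W, ∀ Y ∈ W, ∀ Z ∈ W, lieBL E G (d.prK (lieBL E G X Y)) Z ∈ W :=
  isCurvatureInvariant_iff d (hasForm_canonicalConnection d) hW hU
    (fun _ _ _ _ ↦ U.zero_mem) (fun _ _ _ _ _ _ ↦ U.zero_mem)

theorem isCurvatureInvariant_leviCivita_iff (hiso : ActsIsometrically F G M)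
    (d : ReductiveDecomposition E G o) (hd : d.IsNaturallyReductive F)
    {W : Submodule ℝ E} (hW : W ≤ d.pE) {U : Submodule ℝ (TangentSpace 𝓘(ℝ, F) o)}
    (hU : ∀ u : F, u ∈ U ↔ ∃ X ∈ W, fundE E F G o X = u)
    (hD : ∀ X ∈ W, ∀ Y ∈ W, d.prP (lieBL E G X Y) ∈ W) :
    IsCurvatureInvariant (leviCivita F M) o U ↔
      ∀ X ∈ W, ∀ Y ∈ W, ∀ Z ∈ W, lieBL E G (d.prK (lieBL E G X Y)) Z ∈ W := by
  have hB : ∀ u v : F, u ∈ U → v ∈ U → halfBracket F d u v ∈ U := by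
    intro u v hu hv
    rw [mem_iff_jE_mem d hW hU] at hu hv ⊢
    rw [halfBracket_apply, map_smul, d.jE_fundE]
    exact W.smul_mem _ (hD _ hu _ hv)
  refine isCurvatureInvariant_iff d (hasForm_leviCivita hiso d hd) hW hU hB ?_
  intro X hX Y hY v hv
  refine hB _ _ ?_ hv
  rw [mem_iff_jE_mem d hW hU, d.jE_fundE]
  exact hD X hX Y hY

end NaturallyReductive

/-! ### The geodesic equation in a parametrization -/

section Calculus

variable {E F H : Type*} [NormedAddCommGroup E] [NormedSpace ℝ E] [FiniteDimensional ℝ E]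
  [NormedAddCommGroup F] [NormedSpace ℝ F]
  [NormedAddCommGroup H] [NormedSpace ℝ H] [FiniteDimensional ℝ H]

theorem contDiffAt_of_forall_apply {f : H → E →L[ℝ] F} {x : H}
    (h : ∀ a, ContDiffAt ℝ ∞ (fun y ↦ f y a) x) : ContDiffAt ℝ ∞ f x := by
  let b := Module.finBasis ℝ E
  have : f = fun y ↦ ∑ i, (ContinuousLinearMap.smulRightL ℝ E F
      (LinearMap.toContinuousLinearMap (b.coord i))) (f y (b i)) := by
    funext y
    ext a
    have h1 := congrArg (f y) (b.sum_repr a)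
    rw [map_sum] at h1
    simp only [map_smul] at h1
    rw [← h1]
    simp
  rw [this]
  exact ContDiffAt.sum fun i _ ↦ (ContinuousLinearMap.contDiff _).contDiffAt.comp x (h _)

theorem contDiffAt_bilinearComp {m : H → F →L[ℝ] F →L[ℝ] ℝ} {A : H → E →L[ℝ] F} {x : H}
    (hm : ContDiffAt ℝ ∞ m x) (hA : ContDiffAt ℝ ∞ A x) :
    ContDiffAt ℝ ∞ (fun y ↦ (m y).bilinearComp (A y) (A y)) x := by
  refine contDiffAt_of_forall_apply fun a ↦ contDiffAt_of_forall_apply fun b ↦ ?_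
  exact (hm.clm_apply (hA.clm_apply contDiffAt_const)).clm_apply (hA.clm_apply contDiffAt_const)

/-- The geodesic equation at time `t` for the curve `u` and the metric `m` on a vector space, as the
Euler-Lagrange equation of the energy. -/
def EulerLagrange (m : H → H →L[ℝ] H →L[ℝ] ℝ) (u : ℝ → H) (t : ℝ) : Prop :=
  ∀ w, HasDerivAt (fun s ↦ m (u s) (deriv u s) w)
    ((1 / 2) * fderiv ℝ (fun y ↦ m y (deriv u t) (deriv u t)) (u t) w) t

set_option synthInstance.maxHeartbeats 200000 in
/-- The geodesic equation pulls back along maps. -/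
theorem EulerLagrange.of_comp [FiniteDimensional ℝ F] {m : F → F →L[ℝ] F →L[ℝ] ℝ}
    (hsymm : ∀ z a b, m z a b = m z b a)
    {Ψ : H → F} {u : ℝ → H} {t : ℝ} (hu : ContDiffAt ℝ ∞ u t) (hΨ : ContDiffAt ℝ ∞ Ψ (u t))
    (hm : DifferentiableAt ℝ m (Ψ (u t))) (h : EulerLagrange m (fun s ↦ Ψ (u s)) t)
    {G : H → H →L[ℝ] H →L[ℝ] ℝ}
    (hG : ∀ᶠ y in 𝓝 (u t), G y = (m (Ψ y)).bilinearComp (fderiv ℝ Ψ y) (fderiv ℝ Ψ y)) :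
    EulerLagrange G u t := by
  intro w
  have hev : ∀ᶠ s in 𝓝 t, DifferentiableAt ℝ u s := by
    filter_upwards [(hu.of_le (m := 1) (by simp)).eventually (by simp)] with s hs
    exact hs.differentiableAt (by simp)
  have hevΨ : ∀ᶠ y in 𝓝 (u t), DifferentiableAt ℝ Ψ y := by
    filter_upwards [(hΨ.of_le (m := 1) (by simp)).eventually (by simp)] with s hs
    exact hs.differentiableAt (by simp)
  have huc : Tendsto u (𝓝 t) (𝓝 (u t)) := hu.continuousAt
  have hv : deriv (fun s ↦ Ψ (u s)) =ᶠ[𝓝 t] fun s ↦ fderiv ℝ Ψ (u s) (deriv u s) := by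
    filter_upwards [hev, huc.eventually hevΨ] with s h1 h2
    exact (h2.hasFDerivAt.comp_hasDerivAt s h1.hasDerivAt).deriv
  have hv0 := hv.self_of_nhds
  have hDΨ : ContDiffAt ℝ ∞ (fderiv ℝ Ψ) (u t) := hΨ.fderiv_right (by simp)
  have hu1 : HasDerivAt u (deriv u t) t := hev.self_of_nhds.hasDerivAt
  have hv1 : HasDerivAt (fun s ↦ Ψ (u s)) (fderiv ℝ Ψ (u t) (deriv u t)) t :=
    hevΨ.self_of_nhds.hasFDerivAt.comp_hasDerivAt t hu1
  have hΨu : ContDiffAt ℝ ∞ (fun s ↦ Ψ (u s)) t := hΨ.comp t hu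
  have hv' : DifferentiableAt ℝ (deriv fun s ↦ Ψ (u s)) t := by
    have := hΨu.fderiv_right (m := ∞) (by simp)
    exact (this.differentiableAt (by simp)).clm_apply (differentiableAt_const (1 : ℝ))
  set a := deriv u t with ha
  set D2 := fderiv ℝ (fderiv ℝ Ψ) (u t) with hD2
  have hD2' : HasFDerivAt (fderiv ℝ Ψ) D2 (u t) := (hDΨ.differentiableAt (by simp)).hasFDerivAt
  have hsym2 : ∀ x y, D2 x y = D2 y x := by
    have := hΨ.isSymmSndFDerivAt (by
      rw [minSmoothness_of_isRCLikeNormedField]; exact WithTop.coe_le_coe.2 le_top)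
    exact fun x y ↦ this x y
  -- the momentum `m (v, v')` along `v = Ψ ∘ u`
  have hL : HasDerivAt (fun s ↦ m (Ψ (u s)) (deriv (fun s ↦ Ψ (u s)) s))
      (deriv (fun s ↦ m (Ψ (u s)) (deriv (fun s ↦ Ψ (u s)) s)) t) t :=
    DifferentiableAt.hasDerivAt
      ((hm.comp t hv1.differentiableAt).clm_apply hv')
  have hb : HasDerivAt (fun s ↦ fderiv ℝ Ψ (u s) w) (D2 a w) t := by
    have := (hD2'.comp_hasDerivAt t hu1).clm_apply (hasDerivAt_const t w)
    simpa using this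
  have h1 := hL.clm_apply hb
  have h2 : deriv (fun s ↦ m (Ψ (u s)) (deriv (fun s ↦ Ψ (u s)) s)) t (fderiv ℝ Ψ (u t) w) =
      (1 / 2) * fderiv ℝ (fun y ↦ m y (fderiv ℝ Ψ (u t) a) (fderiv ℝ Ψ (u t) a)) (Ψ (u t))
        (fderiv ℝ Ψ (u t) w) := by
    have h3 := h (fderiv ℝ Ψ (u t) w)
    rw [hv0] at h3
    have h4 := hL.clm_apply (hasDerivAt_const t (fderiv ℝ Ψ (u t) w))
    have h5 := h4.unique h3
    simpa using h5
  have hLHS : (fun s ↦ G (u s) (deriv u s) w) =ᶠ[𝓝 t]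
      fun s ↦ m (Ψ (u s)) (deriv (fun s ↦ Ψ (u s)) s) (fderiv ℝ Ψ (u s) w) := by
    filter_upwards [huc.eventually hG, hv] with s h3 h4
    rw [h3, h4]; rfl
  refine (h1.congr_of_eventuallyEq hLHS).congr_deriv ?_
  -- the variation of the energy density
  have hm1 : ∀ x y : F, HasFDerivAt (fun z ↦ m z x y) _ (Ψ (u t)) := fun x y ↦
    (hm.hasFDerivAt.clm_apply (hasFDerivAt_const x _)).clm_apply (hasFDerivAt_const y _)
  have hE : (fun y ↦ G y a a) =ᶠ[𝓝 (u t)]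
      fun y ↦ m (Ψ y) (fderiv ℝ Ψ y a) (fderiv ℝ Ψ y a) := by
    filter_upwards [hG] with y hy
    rw [hy]; rfl
  have hmΨ : HasFDerivAt (fun y ↦ m (Ψ y)) (fderiv ℝ m (Ψ (u t)) ∘L fderiv ℝ Ψ (u t)) (u t) :=
    HasFDerivAt.comp (g := m) (u t) hm.hasFDerivAt hevΨ.self_of_nhds.hasFDerivAt
  have hDa : HasFDerivAt (fun y ↦ fderiv ℝ Ψ y a) (D2.flip a) (u t) := by
    have := hD2'.clm_apply (hasFDerivAt_const a (u t))
    simpa using this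
  have h6 := ((hmΨ.clm_apply hDa).clm_apply hDa).fderiv
  rw [hE.fderiv_eq, h6, h2, (hm1 _ _).fderiv, hv0]
  simp only [add_apply, ContinuousLinearMap.comp_apply, ContinuousLinearMap.flip_apply,
    ContinuousLinearMap.comp_zero, zero_add]
  rw [hsym2 w a, hsymm (Ψ (u t)) (D2 a w)]
  ring

set_option synthInstance.maxHeartbeats 200000 in
/-- The acceleration of a geodesic, contracted with the metric, as a function of position and
velocity. -/
noncomputable def geodesicForce (m : H → H →L[ℝ] H →L[ℝ] ℝ) (q : H × H) : H →L[ℝ] ℝ :=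
  (1 / 2 : ℝ) • ((fderiv ℝ m q.1).flip q.2).flip q.2 - fderiv ℝ m q.1 q.2 q.2

set_option synthInstance.maxHeartbeats 200000 in
set_option maxSynthPendingDepth 6 in
theorem contDiffAt_geodesicForce {m : H → H →L[ℝ] H →L[ℝ] ℝ} {q : H × H}
    (hm : ContDiffAt ℝ ∞ m q.1) : ContDiffAt ℝ ∞ (geodesicForce m) q := by
  have h0 : ContDiffAt ℝ ∞ (fderiv ℝ m) q.1 := hm.fderiv_right (by simp)
  have h1 : ContDiffAt ℝ ∞ (fun q : H × H ↦ fderiv ℝ m q.1) q :=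
    ContDiffAt.comp (g := fderiv ℝ m) (f := Prod.fst) q h0 contDiffAt_fst
  have h3 : ∀ a b c : H × H → H, ContDiffAt ℝ ∞ a q → ContDiffAt ℝ ∞ b q → ContDiffAt ℝ ∞ c q →
      ContDiffAt ℝ ∞ (fun q ↦ fderiv ℝ m q.1 (a q) (b q) (c q)) q := fun a b c ha hb hc ↦
    ((h1.clm_apply ha).clm_apply hb).clm_apply hc
  refine contDiffAt_of_forall_apply fun w ↦ ?_
  exact (contDiffAt_const.smul (h3 _ _ _ contDiffAt_const contDiffAt_snd contDiffAt_snd)).sub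
    (h3 _ _ _ contDiffAt_snd contDiffAt_snd contDiffAt_const)

set_option synthInstance.maxHeartbeats 200000 in
set_option maxSynthPendingDepth 6 in
/-- The geodesic equation solved for the acceleration. -/
theorem EulerLagrange.apply_deriv_deriv {m : H → H →L[ℝ] H →L[ℝ] ℝ} {c : ℝ → H} {t : ℝ}
    (hm : DifferentiableAt ℝ m (c t)) (hc : ContDiffAt ℝ ∞ c t) (h : EulerLagrange m c t) :
    HasDerivAt (deriv c) (deriv (deriv c) t) t ∧
      m (c t) (deriv (deriv c) t) = geodesicForce m (c t, deriv c t) := by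
  have h5 : HasDerivAt c (deriv c t) t := (hc.differentiableAt (by simp)).hasDerivAt
  have h6 : HasDerivAt (deriv c) (deriv (deriv c) t) t := by
    have := hc.fderiv_right (m := ∞) (by simp)
    exact ((this.differentiableAt (by simp)).clm_apply
      (differentiableAt_const (1 : ℝ))).hasDerivAt
  refine ⟨h6, ?_⟩
  have h7 : HasDerivAt (fun s ↦ m (c s) (deriv c s))
      (fderiv ℝ m (c t) (deriv c t) (deriv c t) + m (c t) (deriv (deriv c) t)) t :=
    (hm.hasFDerivAt.comp_hasDerivAt t h5).clm_apply h6
  ext w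
  have h9 := (h7.clm_apply (hasDerivAt_const t w)).unique (h w)
  have h10 : fderiv ℝ (fun y ↦ m y (deriv c t) (deriv c t)) (c t) w =
      fderiv ℝ m (c t) w (deriv c t) (deriv c t) := by
    have := ((hm.hasFDerivAt.clm_apply (hasFDerivAt_const (deriv c t) (c t))).clm_apply
      (hasFDerivAt_const (deriv c t) (c t))).fderiv
    rw [this]; simp
  rw [h10] at h9
  simp only [map_zero, add_zero, add_apply] at h9
  simp only [geodesicForce, sub_apply, smul_apply, ContinuousLinearMap.flip_apply, smul_eq_mul]
  linarith

/-- The geodesic equation has at most one solution with given initial position and velocity. -/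
theorem EulerLagrange.unique {m : H → H →L[ℝ] H →L[ℝ] ℝ} {y₀ : H}
    (hm : ContDiffAt ℝ ∞ m y₀) (hpos : ∀ a, m y₀ a a = 0 → a = 0) {u v : ℝ → H} {t₀ : ℝ}
    (hu0 : u t₀ = y₀) (hv0 : v t₀ = y₀) (hd : deriv u t₀ = deriv v t₀)
    (hu : ∀ᶠ t in 𝓝 t₀, ContDiffAt ℝ ∞ u t ∧ EulerLagrange m u t)
    (hv : ∀ᶠ t in 𝓝 t₀, ContDiffAt ℝ ∞ v t ∧ EulerLagrange m v t) : u =ᶠ[𝓝 t₀] v := by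
  -- The first-order system satisfied by position and velocity.
  let X : H × H → H × H := fun q ↦ (q.2, (m q.1).inverse (geodesicForce m q))
  have hinj : Function.Injective (m y₀) := by
    refine (injective_iff_map_eq_zero _).2 fun a ha ↦ hpos a ?_
    rw [ha]; rfl
  have hrank : Module.finrank ℝ H = Module.finrank ℝ (H →L[ℝ] ℝ) := by
    rw [← (LinearMap.toContinuousLinearMap (𝕜 := ℝ) (E := H) (F' := ℝ)).finrank_eq]
    exact (Subspace.dual_finrank_eq (K := ℝ) (V := H)).symm
  let e : H ≃L[ℝ] (H →L[ℝ] ℝ) :=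
    (LinearEquiv.ofInjectiveOfFinrankEq (m y₀).toLinearMap hinj hrank).toContinuousLinearEquiv
  have he : (e : H →L[ℝ] (H →L[ℝ] ℝ)) = m y₀ := by
    ext1 a
    exact congrArg (fun f : H →ₗ[ℝ] (H →L[ℝ] ℝ) ↦ f a)
      (LinearEquiv.coe_ofInjectiveOfFinrankEq (m y₀).toLinearMap hinj hrank)
  have hinv : ∀ᶠ y in 𝓝 y₀, ∀ a, (m y).inverse (m y a) = a := by
    have h1 : {A : H →L[ℝ] (H →L[ℝ] ℝ) | ∃ e : H ≃L[ℝ] (H →L[ℝ] ℝ), (e : H →L[ℝ] _) = A} ∈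
        𝓝 (m y₀) := by
      rw [← he]; exact ContinuousLinearEquiv.nhds e
    filter_upwards [hm.continuousAt.eventually h1] with y hy a
    obtain ⟨c, hc⟩ := hy
    rw [← hc, ContinuousLinearMap.inverse_equiv]; simp
  have hmd : ∀ᶠ y in 𝓝 y₀, DifferentiableAt ℝ m y := by
    filter_upwards [(hm.of_le (m := 1) (by simp)).eventually (by simp)] with s hs
    exact hs.differentiableAt (by simp)
  have hX : ContDiffAt ℝ ∞ X (y₀, deriv u t₀) := by
    have h2 := contDiffAt_geodesicForce (q := (y₀, deriv u t₀)) hm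
    have h3 : ContDiffAt ℝ ∞ (fun q : H × H ↦ (m q.1).inverse) (y₀, deriv u t₀) := by
      have h4 : ContDiffAt ℝ ∞ (ContinuousLinearMap.inverse : (H →L[ℝ] (H →L[ℝ] ℝ)) → _)
          (m (y₀, deriv u t₀).1) := by
        rw [← he]; exact contDiffAt_map_inverse e
      exact ContDiffAt.comp (g := ContinuousLinearMap.inverse) (f := fun q : H × H ↦ m q.1)
        (y₀, deriv u t₀) h4 (ContDiffAt.comp (g := m) (f := Prod.fst) (y₀, deriv u t₀) hm
          contDiffAt_fst)
    exact contDiffAt_snd.prodMk (h3.clm_apply h2)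
  have key : ∀ c : ℝ → H, c t₀ = y₀ →
      (∀ᶠ t in 𝓝 t₀, ContDiffAt ℝ ∞ c t ∧ EulerLagrange m c t) →
      (∀ᶠ t in 𝓝 t₀, HasDerivAt (fun t ↦ (c t, deriv c t)) (X (c t, deriv c t)) t) ∧
      ContinuousAt (fun t ↦ (c t, deriv c t)) t₀ := by
    intro c hc0 hc
    have hcc : Tendsto c (𝓝 t₀) (𝓝 y₀) := by
      have := hc.self_of_nhds.1.continuousAt
      rwa [ContinuousAt, hc0] at this
    have h1 : ∀ᶠ t in 𝓝 t₀, HasDerivAt (fun t ↦ (c t, deriv c t)) (X (c t, deriv c t)) t := by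
      filter_upwards [hc, hcc.eventually hinv, hcc.eventually hmd] with t h2 h3 h4
      have h5 : HasDerivAt c (deriv c t) t := (h2.1.differentiableAt (by simp)).hasDerivAt
      obtain ⟨h6, h8⟩ := h2.2.apply_deriv_deriv h4 h2.1
      have h9 : X (c t, deriv c t) = (deriv c t, deriv (deriv c) t) := by
        simp only [X]
        rw [← h8, h3]
      rw [h9]
      exact h5.prodMk h6
    exact ⟨h1, h1.self_of_nhds.continuousAt⟩
  obtain ⟨K, S, hS, hK⟩ := (hX.of_le (m := 1) (by simp)).exists_lipschitzOnWith
  obtain ⟨hu1, hu2⟩ := key u hu0 hu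
  obtain ⟨hv1, hv2⟩ := key v hv0 hv
  have huS : ∀ᶠ t in 𝓝 t₀, (u t, deriv u t) ∈ S := hu2.eventually (by show S ∈ 𝓝 (u t₀, deriv u t₀); rwa [hu0])
  have hvS : ∀ᶠ t in 𝓝 t₀, (v t, deriv v t) ∈ S := hv2.eventually (by show S ∈ 𝓝 (v t₀, deriv v t₀); rwa [hv0, ← hd])
  have h := ODE_solution_unique_of_eventually (v := fun _ ↦ X) (s := fun _ ↦ S) (t₀ := t₀)
    (Eventually.of_forall fun _ ↦ hK) (hu1.and huS) (hv1.and hvS) (by rw [hu0, hv0, hd])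
  filter_upwards [h] with t ht
  exact congrArg Prod.fst ht

end Calculus

section Parametrizations

variable {F : Type*} [NormedAddCommGroup F] [NormedSpace ℝ F] [FiniteDimensional ℝ F]
  {M : Type*} [TopologicalSpace M] [ChartedSpace F M] [IsManifold 𝓘(ℝ, F) ∞ M]
  [RiemannianBundle (fun x : M ↦ TangentSpace 𝓘(ℝ, F) x)]
  {H : Type*} [NormedAddCommGroup H] [NormedSpace ℝ H] [FiniteDimensional ℝ H]
  {H' : Type*} [NormedAddCommGroup H'] [NormedSpace ℝ H'] [FiniteDimensional ℝ H']

/-- The Riemannian metric pulled back to a vector space along a parametrization `ψ`. -/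
noncomputable def pullbackMetric (ψ : H → M) (y : H) : H →L[ℝ] H →L[ℝ] ℝ :=
  (innL F (ψ y)).bilinearComp (md H F ψ y) (md H F ψ y)

theorem pullbackMetric_apply (ψ : H → M) (y a b : H) :
    pullbackMetric (F := F) ψ y a b = innL F (ψ y) (md H F ψ y a) (md H F ψ y b) := rfl

theorem pullbackMetric_symm (ψ : H → M) (y a b : H) :
    pullbackMetric (F := F) ψ y a b = pullbackMetric (F := F) ψ y b a := innL_comm _ _ _

theorem pullbackMetric_congr {ψ ψ' : H → M} {y : H} (h : ψ =ᶠ[𝓝 y] ψ') :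
    pullbackMetric (F := F) ψ y = pullbackMetric (F := F) ψ' y := by
  rw [pullbackMetric, pullbackMetric, md_congr h, h.self_of_nhds]

theorem pullbackMetric_comp {ψ : H → M} {Ψ : H' → H} {y : H'}
    (hψ : MDifferentiableAt 𝓘(ℝ, H) 𝓘(ℝ, F) ψ (Ψ y)) (hΨ : DifferentiableAt ℝ Ψ y) :
    pullbackMetric (F := F) (fun y ↦ ψ (Ψ y)) y =
      (pullbackMetric (F := F) ψ (Ψ y)).bilinearComp (fderiv ℝ Ψ y) (fderiv ℝ Ψ y) := by
  rw [pullbackMetric, md_comp (g := ψ) (f := Ψ) y hψ hΨ.mdifferentiableAt, md_eq_fderiv]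
  rfl

theorem pullbackMetric_eq_zero {ψ : H → M} {y a : H} (hψ : Function.Injective (md H F ψ y))
    (h : pullbackMetric (F := F) ψ y a a = 0) : a = 0 :=
  hψ ((innL_self_eq_zero h).trans (map_zero _).symm)

theorem eventually_contMDiffAt {N : Type*} [TopologicalSpace N] [ChartedSpace H' N]
    [IsManifold 𝓘(ℝ, H') ∞ N] {ψ : N → M} {y : N}
    (h : ContMDiffAt 𝓘(ℝ, H') 𝓘(ℝ, F) ∞ ψ y) :
    ∀ᶠ z in 𝓝 y, MDifferentiableAt 𝓘(ℝ, H') 𝓘(ℝ, F) ψ z := by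
  have := one_le_infty_manifold F M
  have := one_le_infty_manifold H' N
  have h1 : ContMDiffAt 𝓘(ℝ, H') 𝓘(ℝ, F) 1 ψ y := h.of_le (by simp)
  filter_upwards [(contMDiffAt_iff_contMDiffAt_nhds (by simp)).1 h1] with z hz
  exact hz.mdifferentiableAt (by simp)

variable [IsContMDiffRiemannianBundle 𝓘(ℝ, F) ∞ F (fun x : M ↦ TangentSpace 𝓘(ℝ, F) x)]

theorem contDiffAt_pullbackMetric_chart (x₀ : M) :
    ContDiffAt ℝ ∞ (pullbackMetric (F := F) (extChartAt 𝓘(ℝ, F) x₀).symm)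
      (extChartAt 𝓘(ℝ, F) x₀ x₀) := by
  have := one_le_infty_manifold F M
  set χ := extChartAt 𝓘(ℝ, F) x₀
  have hsrc : χ.source ∈ 𝓝 x₀ := extChartAt_source_mem_nhds x₀
  let σ : F → Π x : M, TangentSpace 𝓘(ℝ, F) x := fun a x ↦ md F F χ.symm (χ x) a
  have hσ : ∀ a, CMDiffAt ∞ (T% (σ a)) x₀ := by
    intro a
    rw [cmdiffAt_section_iff]
    have : coordField x₀ (σ a) =ᶠ[𝓝 x₀] fun _ ↦ a := by
      filter_upwards [hsrc] with x hx
      have h1 := md_leftInverse (p := χ.symm) (l := χ) (x := χ x)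
        (by filter_upwards [extChartAt_target_mem_nhds_of_mem (χ.map_source hx)] with y hy
            exact χ.right_inv hy)
        (by rw [χ.left_inv hx]; exact (contMDiffAt_extChartAt_of_mem hx).mdiff)
        (contMDiffAt_extChartAt_symm_of_mem (χ.map_source hx)).mdiff
      rw [χ.left_inv hx] at h1
      exact DFunLike.congr_fun h1 a
    exact contMDiffAt_const.congr_of_eventuallyEq this
  refine contDiffAt_of_forall_apply fun a ↦ contDiffAt_of_forall_apply fun b ↦ ?_
  have h1 : ContMDiffAt 𝓘(ℝ, F) 𝓘(ℝ, ℝ) ∞ (fun x ↦ (inner ℝ (σ a x) (σ b x) : ℝ)) x₀ := by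
    refine ContMDiffAt.inner_bundle (IB := 𝓘(ℝ, F)) (F := F)
      (E := fun x : M ↦ TangentSpace 𝓘(ℝ, F) x) (b := id) (v := σ a) (w := σ b) ?_ ?_
    · exact hσ a
    · exact hσ b
  have h2 : ContMDiffAt 𝓘(ℝ, F) 𝓘(ℝ, ℝ) ∞ (fun z ↦ (inner ℝ (σ a (χ.symm z)) (σ b (χ.symm z)) : ℝ))
      (χ x₀) := by
    refine ContMDiffAt.comp (I' := 𝓘(ℝ, F)) (g := fun x ↦ (inner ℝ (σ a x) (σ b x) : ℝ))
      (f := χ.symm) (χ x₀) ?_ (contMDiffAt_extChartAt_symm_of_mem (mem_extChartAt_target x₀))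
    rw [χ.left_inv (mem_extChartAt_source x₀)]
    exact h1
  refine h2.contDiffAt.congr_of_eventuallyEq ?_
  filter_upwards [extChartAt_target_mem_nhds (I := 𝓘(ℝ, F)) x₀] with z hz
  have h3 : χ (χ.symm z) = z := χ.right_inv hz
  show _ = innL F (χ.symm z) (md F F χ.symm (χ (χ.symm z)) a) (md F F χ.symm (χ (χ.symm z)) b)
  rw [h3]
  rfl

theorem contDiffAt_pullbackMetric {ψ : H → M} {y₀ : H}
    (hψ : ContMDiffAt 𝓘(ℝ, H) 𝓘(ℝ, F) ∞ ψ y₀) :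
    ContDiffAt ℝ ∞ (pullbackMetric (F := F) ψ) y₀ := by
  set χ := extChartAt 𝓘(ℝ, F) (ψ y₀)
  have hsrc : χ.source ∈ 𝓝 (ψ y₀) := extChartAt_source_mem_nhds (ψ y₀)
  have hΨ : ContDiffAt ℝ ∞ (fun y ↦ χ (ψ y)) y₀ :=
    ((contMDiffAt_extChartAt_of_mem (mem_extChartAt_source (ψ y₀))).comp y₀ hψ).contDiffAt
  have hev : ∀ᶠ y in 𝓝 y₀, DifferentiableAt ℝ (fun y ↦ χ (ψ y)) y := by
    filter_upwards [(hΨ.of_le (m := 1) (by simp)).eventually (by simp)] with s hs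
    exact hs.differentiableAt (by simp)
  have h1 := contDiffAt_bilinearComp (m := fun y ↦ pullbackMetric (F := F) χ.symm (χ (ψ y)))
    (A := fderiv ℝ (fun y ↦ χ (ψ y)))
    (ContDiffAt.comp (g := pullbackMetric (F := F) χ.symm) (f := fun y ↦ χ (ψ y)) y₀
      (contDiffAt_pullbackMetric_chart (ψ y₀)) hΨ) (hΨ.fderiv_right (by simp))
  refine h1.congr_of_eventuallyEq ?_
  have hs : ∀ᶠ y in 𝓝 y₀, ψ y ∈ χ.source := hψ.continuousAt.eventually hsrc
  filter_upwards [hs.eventually_nhds, hev] with y hy hd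
  have h2 : ψ =ᶠ[𝓝 y] fun y ↦ χ.symm (χ (ψ y)) := by
    filter_upwards [hy] with z hz
    exact (χ.left_inv hz).symm
  rw [pullbackMetric_congr h2]
  exact pullbackMetric_comp (Ψ := fun y ↦ χ (ψ y))
    (contMDiffAt_extChartAt_symm_of_mem (χ.map_source hy.self_of_nhds)).mdiff hd

/-- Change of parametrization in the geodesic equation. -/
theorem EulerLagrange.of_param {ψ : H → M} {ψ' : H' → M} {Ψ : H → H'} {u : ℝ → H} {t : ℝ}
    (hu : ContDiffAt ℝ ∞ u t) (hΨ : ContDiffAt ℝ ∞ Ψ (u t))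
    (hψ' : ContMDiffAt 𝓘(ℝ, H') 𝓘(ℝ, F) ∞ ψ' (Ψ (u t)))
    (h : ψ =ᶠ[𝓝 (u t)] fun y ↦ ψ' (Ψ y))
    (hEL : EulerLagrange (pullbackMetric (F := F) ψ') (fun s ↦ Ψ (u s)) t) :
    EulerLagrange (pullbackMetric (F := F) ψ) u t := by
  refine EulerLagrange.of_comp (pullbackMetric_symm ψ') hu hΨ
    ((contDiffAt_pullbackMetric hψ').differentiableAt (by simp)) hEL ?_
  have hev : ∀ᶠ y in 𝓝 (u t), DifferentiableAt ℝ Ψ y := by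
    filter_upwards [(hΨ.of_le (m := 1) (by simp)).eventually (by simp)] with s hs
    exact hs.differentiableAt (by simp)
  have hev2 := hΨ.continuousAt.eventually (eventually_contMDiffAt hψ')
  filter_upwards [h.eventually_nhds, hev, hev2] with y h1 h2 h3
  rw [pullbackMetric_congr h1]
  exact pullbackMetric_comp h3 h2

theorem EulerLagrange.congr {m : H → H →L[ℝ] H →L[ℝ] ℝ} {u v : ℝ → H} {t : ℝ}
    (h : u =ᶠ[𝓝 t] v) (hu : EulerLagrange m u t) : EulerLagrange m v t := by
  intro w
  have h1 := hu w
  rw [h.self_of_nhds, h.deriv_eq] at h1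
  refine h1.congr_of_eventuallyEq ?_
  filter_upwards [h, h.deriv] with s h2 h3
  rw [h2, h3]

end Parametrizations

/-! ### Geodesics of induced metrics -/

section Geodesics

variable {F : Type*} [NormedAddCommGroup F] [NormedSpace ℝ F] [FiniteDimensional ℝ F]
  {M : Type*} [TopologicalSpace M] [ChartedSpace F M] [IsManifold 𝓘(ℝ, F) ∞ M]
  [RiemannianBundle (fun x : M ↦ TangentSpace 𝓘(ℝ, F) x)]
  [IsContMDiffRiemannianBundle 𝓘(ℝ, F) ∞ F (fun x : M ↦ TangentSpace 𝓘(ℝ, F) x)]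
  {H : Type*} [NormedAddCommGroup H] [NormedSpace ℝ H] [FiniteDimensional ℝ H]
  {N : Type*} [TopologicalSpace N] [ChartedSpace H N] [IsManifold 𝓘(ℝ, H) ∞ N]

/-- The metric induced by a map into a Riemannian manifold. -/
noncomputable def metricOf (F : Type*) [NormedAddCommGroup F] [NormedSpace ℝ F] [FiniteDimensional ℝ F]
    {M : Type*} [TopologicalSpace M] [ChartedSpace F M]
    [RiemannianBundle (fun x : M ↦ TangentSpace 𝓘(ℝ, F) x)]
    (H : Type*) [NormedAddCommGroup H] [NormedSpace ℝ H]
    {N : Type*} [TopologicalSpace N] [ChartedSpace H N] (f : N → M) (p : N) (u v : TangentSpace 𝓘(ℝ, H) p) : ℝ :=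
  innL F (f p) (md H F f p u) (md H F f p v)

/-- The geodesic equation at time `t` for `γ`, in the chart at `x₀`. -/
def GeodesicEqAt (F : Type*) [NormedAddCommGroup F] [NormedSpace ℝ F] [FiniteDimensional ℝ F]
    {M : Type*} [TopologicalSpace M] [ChartedSpace F M]
    [RiemannianBundle (fun x : M ↦ TangentSpace 𝓘(ℝ, F) x)]
    (H : Type*) [NormedAddCommGroup H] [NormedSpace ℝ H]
    {N : Type*} [TopologicalSpace N] [ChartedSpace H N] (f : N → M) (γ : ℝ → N) (x₀ : N) (t : ℝ) : Prop :=
  EulerLagrange (pullbackMetric (F := F) (fun y ↦ f ((extChartAt 𝓘(ℝ, H) x₀).symm y)))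
    (fun s ↦ extChartAt 𝓘(ℝ, H) x₀ (γ s)) t

theorem chartMetric_eq {f : N → M} (hf : ContMDiff 𝓘(ℝ, H) 𝓘(ℝ, F) ∞ f) (x₀ : N) {y : H}
    (hy : y ∈ (extChartAt 𝓘(ℝ, H) x₀).target) (a b : H) :
    chartMetric (metricOf F H f) x₀ y a b =
      pullbackMetric (F := F) (fun y ↦ f ((extChartAt 𝓘(ℝ, H) x₀).symm y)) y a b := by
  rw [pullbackMetric, md_comp (g := f) (f := (extChartAt 𝓘(ℝ, H) x₀).symm) y (hf.mdiff _)
    (contMDiffAt_extChartAt_symm_of_mem hy).mdiff]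
  rfl

/-- Being a geodesic of the induced metric is the Euler-Lagrange equation of the metric pulled back
to a chart at each point. -/
theorem isGeodesicOn_iff {f : N → M} (hf : ContMDiff 𝓘(ℝ, H) 𝓘(ℝ, F) ∞ f) {γ : ℝ → N} {J : Set ℝ}
    (hJ : IsOpen J) : IsGeodesicOn (metricOf F H f) γ J ↔
      ∀ t ∈ J, ContMDiffAt 𝓘(ℝ, ℝ) 𝓘(ℝ, H) ∞ γ t ∧ GeodesicEqAt F H f γ (γ t) t := by
  have key : ∀ t ∈ J, ContMDiffAt 𝓘(ℝ, ℝ) 𝓘(ℝ, H) ∞ γ t → ((∀ w : H,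
      HasDerivAt (fun s ↦ chartMetric (metricOf F H f) (γ t) (extChartAt 𝓘(ℝ, H) (γ t) (γ s))
        (deriv (fun s ↦ extChartAt 𝓘(ℝ, H) (γ t) (γ s)) s) w)
        ((1 / 2) * fderiv ℝ (fun y ↦ chartMetric (metricOf F H f) (γ t) y
          (deriv (fun s ↦ extChartAt 𝓘(ℝ, H) (γ t) (γ s)) t)
          (deriv (fun s ↦ extChartAt 𝓘(ℝ, H) (γ t) (γ s)) t))
          (extChartAt 𝓘(ℝ, H) (γ t) (γ t)) w) t) ↔ GeodesicEqAt F H f γ (γ t) t) := by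
    intro t ht hγ
    set φ := extChartAt 𝓘(ℝ, H) (γ t)
    have hsrc : ∀ᶠ s in 𝓝 t, γ s ∈ φ.source :=
      hγ.continuousAt.eventually (extChartAt_source_mem_nhds (γ t))
    refine forall_congr' fun w ↦ ?_
    have h1 : (fun s ↦ chartMetric (metricOf F H f) (γ t) (φ (γ s))
        (deriv (fun s ↦ φ (γ s)) s) w) =ᶠ[𝓝 t] fun s ↦ pullbackMetric (F := F)
        (fun y ↦ f (φ.symm y)) (φ (γ s)) (deriv (fun s ↦ φ (γ s)) s) w := by
      filter_upwards [hsrc] with s hs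
      exact chartMetric_eq hf (γ t) (φ.map_source hs) _ _
    have h2 : (fun y ↦ chartMetric (metricOf F H f) (γ t) y
        (deriv (fun s ↦ φ (γ s)) t) (deriv (fun s ↦ φ (γ s)) t)) =ᶠ[𝓝 (φ (γ t))]
        fun y ↦ pullbackMetric (F := F) (fun y ↦ f (φ.symm y)) y
        (deriv (fun s ↦ φ (γ s)) t) (deriv (fun s ↦ φ (γ s)) t) := by
      filter_upwards [extChartAt_target_mem_nhds (I := 𝓘(ℝ, H)) (γ t)] with y hy
      exact chartMetric_eq hf (γ t) hy _ _
    rw [h2.fderiv_eq]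
    exact h1.hasDerivAt_iff
  constructor
  · rintro ⟨h1, h2⟩ t ht
    have h3 := h1.contMDiffAt (hJ.mem_nhds ht)
    exact ⟨h3, (key t ht h3).1 (h2 t ht)⟩
  · intro h
    exact ⟨fun t ht ↦ (h t ht).1.contMDiffWithinAt, fun t ht ↦ (key t ht (h t ht).1).2 (h t ht).2⟩

/-- The geodesic equation in one chart of `N'` implies the geodesic equation, for the metric induced
by a map `N → N'`, in any chart of `N`. -/
theorem GeodesicEqAt.of_comp {H' : Type*} [NormedAddCommGroup H'] [NormedSpace ℝ H']
    [FiniteDimensional ℝ H'] {N' : Type*} [TopologicalSpace N'] [ChartedSpace H' N']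
    [IsManifold 𝓘(ℝ, H') ∞ N'] {f : N' → M} (hf : ContMDiff 𝓘(ℝ, H') 𝓘(ℝ, F) ∞ f)
    {k : N → N'} (hk : ContMDiff 𝓘(ℝ, H) 𝓘(ℝ, H') ∞ k) {γ : ℝ → N} {t : ℝ} {x₀ : N} {x₁ : N'}
    (hγ : ContMDiffAt 𝓘(ℝ, ℝ) 𝓘(ℝ, H) ∞ γ t) (h0 : γ t ∈ (extChartAt 𝓘(ℝ, H) x₀).source)
    (h1 : k (γ t) ∈ (extChartAt 𝓘(ℝ, H') x₁).source)
    (h : GeodesicEqAt F H' f (fun s ↦ k (γ s)) x₁ t) :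
    GeodesicEqAt F H (fun p ↦ f (k p)) γ x₀ t := by
  set φ := extChartAt 𝓘(ℝ, H) x₀
  set φ' := extChartAt 𝓘(ℝ, H') x₁
  have hφγ : φ.symm (φ (γ t)) = γ t := φ.left_inv h0
  have hsymm : ContMDiffAt 𝓘(ℝ, H) 𝓘(ℝ, H) ∞ φ.symm (φ (γ t)) :=
    contMDiffAt_extChartAt_symm_of_mem (φ.map_source h0)
  have hkφ : ContMDiffAt 𝓘(ℝ, H) 𝓘(ℝ, H') ∞ (fun y ↦ k (φ.symm y)) (φ (γ t)) :=
    (hk _).comp _ hsymm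
  have hs1 : ∀ᶠ y in 𝓝 (φ (γ t)), k (φ.symm y) ∈ φ'.source := by
    refine hkφ.continuousAt.eventually ?_
    show φ'.source ∈ 𝓝 (k (φ.symm (φ (γ t))))
    rw [hφγ]
    exact (isOpen_extChartAt_source x₁).mem_nhds h1
  have hs0 : ∀ᶠ s in 𝓝 t, γ s ∈ φ.source :=
    hγ.continuousAt.eventually ((isOpen_extChartAt_source x₀).mem_nhds h0)
  have hu : ContDiffAt ℝ ∞ (fun s ↦ φ (γ s)) t :=
    ((contMDiffAt_extChartAt_of_mem h0).comp t hγ).contDiffAt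
  have hΨ : ContDiffAt ℝ ∞ (fun y ↦ φ' (k (φ.symm y))) (φ (γ t)) := by
    refine ContMDiffAt.contDiffAt (ContMDiffAt.comp (I' := 𝓘(ℝ, H')) (g := φ')
      (f := fun y ↦ k (φ.symm y)) _ ?_ hkφ)
    rw [hφγ]
    exact contMDiffAt_extChartAt_of_mem h1
  refine EulerLagrange.of_param (Ψ := fun y ↦ φ' (k (φ.symm y)))
    (ψ' := fun y ↦ f (φ'.symm y)) hu hΨ ?_ ?_ ?_
  · refine (hf _).comp _ (contMDiffAt_extChartAt_symm_of_mem ?_)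
    show φ' (k (φ.symm (φ (γ t)))) ∈ φ'.target
    rw [hφγ]
    exact φ'.map_source h1
  · filter_upwards [hs1] with y hy
    rw [φ'.left_inv hy]
  · refine EulerLagrange.congr ?_ h
    filter_upwards [hs0] with s hs
    show φ' (k (γ s)) = φ' (k (φ.symm (φ (γ s))))
    rw [φ.left_inv hs]

theorem GeodesicEqAt.change_chart {f : N → M} (hf : ContMDiff 𝓘(ℝ, H) 𝓘(ℝ, F) ∞ f)
    {γ : ℝ → N} {t : ℝ} {x₀ x₁ : N} (hγ : ContMDiffAt 𝓘(ℝ, ℝ) 𝓘(ℝ, H) ∞ γ t)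
    (h0 : γ t ∈ (extChartAt 𝓘(ℝ, H) x₀).source) (h1 : γ t ∈ (extChartAt 𝓘(ℝ, H) x₁).source)
    (h : GeodesicEqAt F H f γ x₁ t) : GeodesicEqAt F H f γ x₀ t :=
  GeodesicEqAt.of_comp (k := fun p ↦ p) hf contMDiff_id hγ h0 h1 h

theorem GeodesicEqAt.congr {f : N → M} {γ γ' : ℝ → N} {t : ℝ} {x₀ : N} (h : γ =ᶠ[𝓝 t] γ')
    (hγ : GeodesicEqAt F H f γ x₀ t) : GeodesicEqAt F H f γ' x₀ t := by
  refine EulerLagrange.congr ?_ hγ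
  filter_upwards [h] with s hs
  rw [hs]

theorem metricOf_id : metricOf F F (fun x : M ↦ x) =
    fun (x : M) (u v : TangentSpace 𝓘(ℝ, F) x) ↦ (inner ℝ u v : ℝ) := by
  funext x u v
  rw [metricOf, md_id]
  rfl

/-- A curve in `N` whose image is a geodesic of `M` is a geodesic of the induced metric. -/
theorem IsGeodesicOn.of_comp {f : N → M} (hf : ContMDiff 𝓘(ℝ, H) 𝓘(ℝ, F) ∞ f) {γ : ℝ → N}
    {J : Set ℝ} (hJ : IsOpen J) (hγ : ∀ t ∈ J, ContMDiffAt 𝓘(ℝ, ℝ) 𝓘(ℝ, H) ∞ γ t)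
    (h : IsGeodesicOn (metricOf F F (fun x : M ↦ x)) (fun t ↦ f (γ t)) J) :
    IsGeodesicOn (metricOf F H f) γ J := by
  have hid : ContMDiff 𝓘(ℝ, F) 𝓘(ℝ, F) ∞ (fun x : M ↦ x) := contMDiff_id
  rw [isGeodesicOn_iff hid hJ] at h
  rw [isGeodesicOn_iff hf hJ]
  intro t ht
  exact ⟨hγ t ht, GeodesicEqAt.of_comp (f := fun x : M ↦ x) (k := f) hid hf (hγ t ht)
    (mem_extChartAt_source _) (mem_extChartAt_source _) (h t ht).2⟩

/-- Local uniqueness of geodesics with given velocity. -/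
theorem IsGeodesicOn.eventuallyEq {f : N → M} (hf : ContMDiff 𝓘(ℝ, H) 𝓘(ℝ, F) ∞ f)
    (hi : ∀ p, Function.Injective (md H F f p)) {γ γ' : ℝ → N} {J : Set ℝ} (hJ : IsOpen J)
    (h : IsGeodesicOn (metricOf F H f) γ J) (h' : IsGeodesicOn (metricOf F H f) γ' J)
    {t₀ : ℝ} (ht₀ : t₀ ∈ J) (h0 : γ t₀ = γ' t₀) (h1 : md ℝ H γ t₀ 1 = md ℝ H γ' t₀ 1) :
    γ =ᶠ[𝓝 t₀] γ' := by
  rw [isGeodesicOn_iff hf hJ] at h h'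
  set φ := extChartAt 𝓘(ℝ, H) (γ t₀) with hφ
  have hmem := mem_extChartAt_source (I := 𝓘(ℝ, H)) (γ t₀)
  have hsrc : ∀ c : ℝ → N, c t₀ = γ t₀ → ContMDiffAt 𝓘(ℝ, ℝ) 𝓘(ℝ, H) ∞ c t₀ →
      ∀ᶠ s in 𝓝 t₀, c s ∈ φ.source := by
    intro c hc0 hc
    refine hc.continuousAt.eventually ?_
    rw [hc0]; exact extChartAt_source_mem_nhds (γ t₀)
  have hev : ∀ c : ℝ → N, c t₀ = γ t₀ → (∀ t ∈ J, ContMDiffAt 𝓘(ℝ, ℝ) 𝓘(ℝ, H) ∞ c t ∧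
      GeodesicEqAt F H f c (c t) t) → ∀ᶠ t in 𝓝 t₀, ContDiffAt ℝ ∞ (fun s ↦ φ (c s)) t ∧
        EulerLagrange (pullbackMetric (F := F) (fun y ↦ f (φ.symm y))) (fun s ↦ φ (c s)) t := by
    intro c hc0 hc
    filter_upwards [hJ.mem_nhds ht₀, hsrc c hc0 (hc t₀ ht₀).1] with t ht hs
    exact ⟨((contMDiffAt_extChartAt_of_mem hs).comp t (hc t ht).1).contDiffAt,
      GeodesicEqAt.change_chart hf (hc t ht).1 hs (mem_extChartAt_source _) (hc t ht).2⟩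
  have hsymm : ContMDiffAt 𝓘(ℝ, H) 𝓘(ℝ, H) ∞ φ.symm (φ (γ t₀)) :=
    contMDiffAt_extChartAt_symm_of_mem (φ.map_source hmem)
  have hd : ∀ c : ℝ → N, c t₀ = γ t₀ → ContMDiffAt 𝓘(ℝ, ℝ) 𝓘(ℝ, H) ∞ c t₀ →
      deriv (fun s ↦ φ (c s)) t₀ = md ℝ H c t₀ 1 := by
    intro c hc0 hc
    have h2 := md_comp_apply (g := φ) (f := c) t₀
      (by rw [hc0]; exact (contMDiffAt_extChartAt_of_mem hmem).mdiff) hc.mdiff (1 : ℝ)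
    rw [hc0, hφ, md_extChartAt_self, md_eq_fderiv] at h2
    exact h2
  have hpos : ∀ a, pullbackMetric (F := F) (fun y ↦ f (φ.symm y)) (φ (γ t₀)) a a = 0 → a = 0 := by
    intro a
    refine pullbackMetric_eq_zero ?_
    rw [md_comp (g := f) (f := φ.symm) _ (hf.mdiff _) hsymm.mdiff, md_extChartAt_symm_self]
    exact hi _
  have h2 := EulerLagrange.unique (m := pullbackMetric (F := F) (fun y ↦ f (φ.symm y)))
    (y₀ := φ (γ t₀)) (u := fun s ↦ φ (γ s)) (v := fun s ↦ φ (γ' s)) (t₀ := t₀)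
    (contDiffAt_pullbackMetric ((hf _).comp _ hsymm)) hpos rfl (by rw [h0])
    (by rw [hd γ rfl (h t₀ ht₀).1, hd γ' h0.symm (h' t₀ ht₀).1, h1])
    (hev γ rfl h) (hev γ' h0.symm h')
  filter_upwards [h2, hsrc γ rfl (h t₀ ht₀).1, hsrc γ' h0.symm (h' t₀ ht₀).1] with s h3 h4 h5
  exact φ.injOn h4 h5 h3

end Geodesics

section GlobalUniqueness

variable {F : Type*} [NormedAddCommGroup F] [NormedSpace ℝ F] [FiniteDimensional ℝ F]
  {M : Type*} [TopologicalSpace M] [ChartedSpace F M] [IsManifold 𝓘(ℝ, F) ∞ M]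
  [RiemannianBundle (fun x : M ↦ TangentSpace 𝓘(ℝ, F) x)]
  [IsContMDiffRiemannianBundle 𝓘(ℝ, F) ∞ F (fun x : M ↦ TangentSpace 𝓘(ℝ, F) x)]
  {H : Type*} [NormedAddCommGroup H] [NormedSpace ℝ H] [FiniteDimensional ℝ H]
  {N : Type*} [TopologicalSpace N] [ChartedSpace H N] [IsManifold 𝓘(ℝ, H) ∞ N]

/-- Two smooth curves that agree to first order at points arbitrarily close to `t` agree to first
order at `t`. -/
theorem md_eq_of_frequently [T2Space N] {γ γ' : ℝ → N} {t : ℝ}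
    (h : ContMDiffAt 𝓘(ℝ, ℝ) 𝓘(ℝ, H) ∞ γ t) (h' : ContMDiffAt 𝓘(ℝ, ℝ) 𝓘(ℝ, H) ∞ γ' t)
    (hf : ∃ᶠ s in 𝓝 t, γ =ᶠ[𝓝 s] γ') : γ t = γ' t ∧ md ℝ H γ t 1 = md ℝ H γ' t 1 := by
  have h0 : γ t = γ' t := by
    by_contra hne
    obtain ⟨U, V, hU, hV, hUt, hVt, hd⟩ := t2_separation hne
    refine hf ?_
    filter_upwards [h.continuousAt.eventually (hU.mem_nhds hUt),
      h'.continuousAt.eventually (hV.mem_nhds hVt)] with s h1 h2 h3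
    exact Set.disjoint_left.1 hd h1 (h3.self_of_nhds ▸ h2)
  refine ⟨h0, ?_⟩
  set φ := extChartAt 𝓘(ℝ, H) (γ t) with hφ
  have hmem := mem_extChartAt_source (I := 𝓘(ℝ, H)) (γ t)
  have hd : ∀ c : ℝ → N, c t = γ t → ContMDiffAt 𝓘(ℝ, ℝ) 𝓘(ℝ, H) ∞ c t →
      deriv (fun s ↦ φ (c s)) t = md ℝ H c t 1 ∧ ContinuousAt (deriv fun s ↦ φ (c s)) t := by
    intro c hc0 hc
    have hφc : ContMDiffAt 𝓘(ℝ, H) 𝓘(ℝ, H) ∞ φ (c t) := by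
      rw [hc0]; exact contMDiffAt_extChartAt_of_mem hmem
    have h2 := md_comp_apply (g := φ) (f := c) t hφc.mdiff hc.mdiff (1 : ℝ)
    rw [hc0, hφ, md_extChartAt_self, md_eq_fderiv] at h2
    refine ⟨h2, ?_⟩
    have h3 : ContDiffAt ℝ ∞ (fun s ↦ φ (c s)) t := (hφc.comp t hc).contDiffAt
    have h4 := (h3.fderiv_right (m := ∞) (by simp)).continuousAt
    exact h4.clm_apply continuousAt_const
  obtain ⟨h1, h2⟩ := hd γ rfl h
  obtain ⟨h3, h4⟩ := hd γ' h0.symm h'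
  rw [← h1, ← h3]
  by_contra hne
  obtain ⟨U, V, hU, hV, hUt, hVt, hdis⟩ := t2_separation hne
  refine hf ?_
  filter_upwards [h2.eventually (hU.mem_nhds hUt), h4.eventually (hV.mem_nhds hVt)] with s h5 h6 h7
  have h8 : deriv (fun s ↦ φ (γ s)) s = deriv (fun s ↦ φ (γ' s)) s := by
    refine Filter.EventuallyEq.deriv_eq ?_
    filter_upwards [h7] with r hr
    rw [hr]
  exact Set.disjoint_left.1 hdis h5 (h8 ▸ h6)

/-- Global uniqueness: the set of times near which the curves agree is open and closed. -/
theorem IsGeodesicOn.eq_of_univ [T2Space N] {f : N → M} (hf : ContMDiff 𝓘(ℝ, H) 𝓘(ℝ, F) ∞ f)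
    (hi : ∀ p, Function.Injective (md H F f p)) {γ γ' : ℝ → N}
    (h : IsGeodesicOn (metricOf F H f) γ univ) (h' : IsGeodesicOn (metricOf F H f) γ' univ)
    {t₀ : ℝ} (h0 : γ t₀ = γ' t₀) (h1 : md ℝ H γ t₀ 1 = md ℝ H γ' t₀ 1) : γ = γ' := by
  have hs := (isGeodesicOn_iff hf isOpen_univ).1 h
  have hs' := (isGeodesicOn_iff hf isOpen_univ).1 h'
  have hclopen : IsClopen {t | γ =ᶠ[𝓝 t] γ'} := by
    refine ⟨isClosed_iff_frequently.2 fun t ht ↦ ?_, ?_⟩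
    · obtain ⟨h2, h3⟩ := md_eq_of_frequently (hs t trivial).1 (hs' t trivial).1 ht
      exact IsGeodesicOn.eventuallyEq hf hi isOpen_univ h h' trivial h2 h3
    · exact isOpen_setOfPred_eventually_nhds
  have h2 := hclopen.eq_univ ⟨t₀, IsGeodesicOn.eventuallyEq hf hi isOpen_univ h h' trivial h0 h1⟩
  funext t
  have h3 : t ∈ {t | γ =ᶠ[𝓝 t] γ'} := h2 ▸ mem_univ t
  exact h3.self_of_nhds

end GlobalUniqueness

/-! ### Geodesics of a naturally reductive space -/

section Homogeneous

variable {E : Type*} [NormedAddCommGroup E] [NormedSpace ℝ E] [FiniteDimensional ℝ E]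
  {G : Type*} [TopologicalSpace G] [ChartedSpace E G] [Group G] [LieGroup 𝓘(ℝ, E) ∞ G] [T2Space G]
  {F : Type*} [NormedAddCommGroup F] [NormedSpace ℝ F] [FiniteDimensional ℝ F]
  {M : Type*} [TopologicalSpace M] [ChartedSpace F M] [IsManifold 𝓘(ℝ, F) ∞ M]
  [MulAction G M] [ContMDiffSMul 𝓘(ℝ, E) 𝓘(ℝ, F) ∞ G M]
  [T2Space M] [SecondCountableTopology G] [MulAction.IsPretransitive G M] {o : M}

theorem fderiv_lder_lieExp_zero (a b : E) :
    fderiv ℝ (lder (E := E) (lieExp G)) (0 : E) a b = - (1 / 2 : ℝ) • lieBL E G a b := by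
  have hself : ∀ a : E, fderiv ℝ (lder (E := E) (lieExp G)) (0 : E) a a = (0 : E) := by
    intro a
    have h1 : HasDerivAt (fun s : ℝ ↦ lder (E := E) (lieExp G) (s • a) a)
        (fderiv ℝ (lder (E := E) (lieExp G)) (0 : E) a a) 0 := by
      have h2 := ((contDiff_lder_lieExp (E := E) (G := G)).differentiable (by simp)
        (0 : E)).hasFDerivAt.comp_hasDerivAt_of_eq (0 : ℝ) (hasDerivAt_smul_line a 0) (by simp)
      have h3 := h2.clm_apply (hasDerivAt_const (0 : ℝ) a)
      simpa using h3
    simp only [lder_lieExp_smul_self] at h1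
    exact h1.unique (hasDerivAt_const (0 : ℝ) a)
  set D : E →L[ℝ] E →L[ℝ] E := fderiv ℝ (lder (E := E) (lieExp G)) (0 : E) with hD
  have h1 : D a b + D b a = 0 := by
    have := hself (a + b)
    simpa [hself, add_comm] using this
  have h2 : D a b - D b a = - lieBL E G a b := fderiv_lder_antisymm a b
  have h3 : D b a = - D a b := eq_neg_of_add_eq_zero_right h1
  rw [h3, sub_neg_eq_add, ← two_smul ℝ] at h2
  rw [neg_smul, ← smul_neg, ← h2, smul_smul]
  norm_num

theorem fderiv_expFrame_zero (d : ReductiveDecomposition E G o) (v w : F) :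
    fderiv ℝ (expFrame (F := F) d) 0 v w =
      - (1 / 2 : ℝ) • fundE E F G o (lieBL E G (d.jE F v) (d.jE F w)) := by
  have hCd := (contDiff_expFrame (F := F) d).differentiable (by simp) 0
  have h5 : HasFDerivAt (fun v : F ↦ lder (E := E) (lieExp G) (d.jE F v))
      (fderiv ℝ (lder (lieExp G)) 0 ∘L d.jE F) 0 :=
    HasFDerivAt.comp (g := fun z : E ↦ lder (E := E) (lieExp G) z) (0 : F)
      (by rw [map_zero]
          exact (contDiff_lder_lieExp.differentiable (by simp) 0).hasFDerivAt)
      (d.jE F).hasFDerivAt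
  have h6 := h5.clm_apply (hasFDerivAt_const (d.jE F w) (0 : F))
  have h7 := (fundE E F G o).hasFDerivAt.comp (0 : F) h6
  have h8 := hCd.hasFDerivAt.clm_apply (hasFDerivAt_const w (0 : F))
  have h9 := DFunLike.congr_fun (h8.unique h7) v
  have h10 : fderiv ℝ (expFrame (F := F) d) 0 v w =
      fundE E F G o (fderiv ℝ (lder (lieExp G)) 0 (d.jE F v) (d.jE F w)) := by
    simpa using h9
  rw [h10, fderiv_lder_lieExp_zero, map_smul]

theorem expFrame_smul_self (d : ReductiveDecomposition E G o) (s : ℝ) (v : F) :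
    expFrame d (s • v) v = v := by
  show fundE E F G o (lder (lieExp G) (d.jE F (s • v)) (d.jE F v)) = v
  rw [map_smul, lder_lieExp_smul_self, d.fundE_jE]

variable (F) in
theorem contMDiff_mul_exp_line_smul (g : G) (X : E) (o : M) :
    ContMDiff 𝓘(ℝ, ℝ) 𝓘(ℝ, F) ∞ (fun t : ℝ ↦ (g * lieExp G (t • X)) • o) :=
  (contMDiff_mul_exp_smul g o).comp
    (contDiff_id.smul contDiff_const : ContDiff ℝ ∞ (fun t : ℝ ↦ t • X)).contMDiff

variable [RiemannianBundle (fun x : M ↦ TangentSpace 𝓘(ℝ, F) x)]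

theorem pullbackMetric_expJ (hiso : ActsIsometrically F G M) (d : ReductiveDecomposition E G o)
    (g : G) (v a b : F) :
    pullbackMetric (F := F) (fun v : F ↦ (g * lieExp G (d.jE F v)) • o) v a b =
      innL F o (expFrame d v a) (expFrame d v b) := by
  rw [pullbackMetric_apply, md_mul_expJ, md_mul_expJ, hiso]

/-- Both sides of the Euler-Lagrange equation of a line through the origin vanish, by natural
reductivity. -/
theorem eulerLagrange_expJ (hiso : ActsIsometrically F G M) (d : ReductiveDecomposition E G o)
    (hd : d.IsNaturallyReductive F) (g : G) (x : F) (t : ℝ) :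
    EulerLagrange (pullbackMetric (F := F) (fun v : F ↦ (g * lieExp G (d.jE F v)) • o))
      (fun s ↦ (s - t) • x) t := by
  intro w
  have hderiv : ∀ s : ℝ, HasDerivAt (fun s : ℝ ↦ (s - t) • x) x s := fun s ↦ by
    simpa using ((hasDerivAt_id s).sub_const t).smul_const x
  have hC : HasFDerivAt (expFrame (F := F) d) (fderiv ℝ (expFrame (F := F) d) 0) 0 :=
    ((contDiff_expFrame (F := F) d).differentiable (by simp) 0).hasFDerivAt
  have hnr : innL F o (fundE E F G o (lieBL E G (d.jE F w) (d.jE F x))) x = 0 := by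
    have h := hd.innL_eq (d.jE_mem x) (d.jE_mem x) (d.jE_mem w)
    rw [d.fundE_jE, innL_comm o x] at h
    linarith
  simp only [pullbackMetric_expJ hiso, (hderiv _).deriv, expFrame_smul_self]
  have h1 : HasDerivAt (fun s : ℝ ↦ innL F o x (expFrame d ((s - t) • x) w))
      (innL F o x (fderiv ℝ (expFrame (F := F) d) 0 x w)) t := by
    have h2 := (hC.comp_hasDerivAt_of_eq t (hderiv t) (by simp)).clm_apply (hasDerivAt_const t w)
    have h3 := (innL F o x).hasFDerivAt.comp_hasDerivAt t h2
    refine h3.congr_deriv ?_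
    simp
  have h2 : HasFDerivAt (fun y : F ↦ expFrame d y x) ((fderiv ℝ (expFrame (F := F) d) 0).flip x)
      0 := by
    have := hC.clm_apply (hasFDerivAt_const x (0 : F))
    simpa using this
  have h3 := (((innL F o).hasFDerivAt.comp (0 : F) h2).clm_apply h2).fderiv
  have h4 : fderiv ℝ (fun y ↦ innL F o (expFrame d y x) (expFrame d y x)) ((t - t) • x) w = 0 := by
    rw [sub_self, zero_smul]
    refine (DFunLike.congr_fun h3 w).trans ?_
    simp only [add_apply, ContinuousLinearMap.comp_apply, ContinuousLinearMap.flip_apply,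
      Function.comp_apply, expFrame_zero, ContinuousLinearMap.id_apply, fderiv_expFrame_zero]
    simp only [map_smul, smul_apply]
    rw [innL_comm o x, hnr]
    simp
  rw [h4, mul_zero]
  refine h1.congr_deriv ?_
  rw [fderiv_expFrame_zero, map_smul, lieBL_skew, map_neg, map_neg, innL_comm o x, hnr]
  simp

theorem md_mul_exp_line_smul (g : G) (X : E) (o : M) (t : ℝ) :
    md ℝ F (fun t : ℝ ↦ (g * lieExp G (t • X)) • o) t 1 =
      push F (g * lieExp G (t • X)) o (fundE E F G o X) := by
  have h1 := md_comp_apply (g := fun z : E ↦ ((g * lieExp G (t • X)) * lieExp G z) • o)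
    (f := fun s : ℝ ↦ (s - t) • X) t ((contMDiff_mul_exp_smul (F := F) _ o).mdiff _)
    (((hasDerivAt_id t).sub_const t).smul_const X).differentiableAt.mdifferentiableAt 1
  have h2 : (fun s : ℝ ↦ ((g * lieExp G (t • X)) * lieExp G ((s - t) • X)) • o) =
      fun s ↦ (g * lieExp G (s • X)) • o := by
    funext s
    rw [mul_assoc, ← lieExp_add_smul, add_sub_cancel]
  have h3 : md ℝ E (fun s : ℝ ↦ (s - t) • X) t 1 = X := by
    rw [md_eq_fderiv]
    have := (((hasDerivAt_id t).sub_const t).smul_const X).deriv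
    simpa using this
  rw [h2] at h1
  rw [h1, h3]
  simp only [sub_self, zero_smul]
  exact md_mul_exp_smul_zero _ _ _

variable [IsContMDiffRiemannianBundle 𝓘(ℝ, F) ∞ F (fun x : M ↦ TangentSpace 𝓘(ℝ, F) x)]

/-- In a naturally reductive space, the curves `t ↦ g exp(tX) o` with `X ∈ 𝔭` are geodesics. -/
theorem isGeodesicOn_exp (hiso : ActsIsometrically F G M) (d : ReductiveDecomposition E G o)
    (hd : d.IsNaturallyReductive F) (g : G) {X : E} (hX : X ∈ d.pE) :
    IsGeodesicOn (metricOf F F (fun x : M ↦ x)) (fun t : ℝ ↦ (g * lieExp G (t • X)) • o) univ := by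
  have hid : ContMDiff 𝓘(ℝ, F) 𝓘(ℝ, F) ∞ (fun x : M ↦ x) := contMDiff_id
  rw [isGeodesicOn_iff hid isOpen_univ]
  intro t _
  have hc := contMDiff_mul_exp_line_smul F g X o
  refine ⟨hc t, ?_⟩
  set c : ℝ → M := fun t : ℝ ↦ (g * lieExp G (t • X)) • o with hcdef
  -- Recentre at time `t`, where the curve is the image of a line through the origin.
  obtain ⟨k, hk⟩ : ∃ k, k = g * lieExp G (t • X) := ⟨_, rfl⟩
  have hct : k • o = c t := by rw [hk]
  obtain ⟨l, l0, l1, l2, l3⟩ := d.exists_logM F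
  set χ := extChartAt 𝓘(ℝ, F) (c t) with hχ
  have hmem := mem_extChartAt_source (I := 𝓘(ℝ, F)) (c t)
  have hχc : χ.symm (χ (c t)) = c t := χ.left_inv hmem
  have hko : k⁻¹ • c t = o := by rw [← hct, inv_smul_smul]
  have hsymm : ContMDiffAt 𝓘(ℝ, F) 𝓘(ℝ, F) ∞ (fun y ↦ k⁻¹ • χ.symm y) (χ (c t)) :=
    ((smooth_smul E k⁻¹) _).comp _ (contMDiffAt_extChartAt_symm_of_mem (χ.map_source hmem))
  have hΨ : ContDiffAt ℝ ∞ (fun y ↦ l (k⁻¹ • χ.symm y)) (χ (c t)) := by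
    refine ContMDiffAt.contDiffAt (ContMDiffAt.comp (I' := 𝓘(ℝ, F)) (g := l)
      (f := fun y ↦ k⁻¹ • χ.symm y) _ ?_ hsymm)
    rw [hχc, hko]
    exact l3.self_of_nhds
  have htend : Tendsto (fun y ↦ k⁻¹ • χ.symm y) (𝓝 (χ (c t))) (𝓝 o) := by
    have := hsymm.continuousAt
    rwa [ContinuousAt, hχc, hko] at this
  have hx : d.jE F (fundE E F G o X) = X := by rw [d.jE_fundE, d.prP_of_mem hX]
  refine EulerLagrange.of_param (ψ' := fun v : F ↦ (k * lieExp G (d.jE F v)) • o)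
    (Ψ := fun y ↦ l (k⁻¹ • χ.symm y)) ?_ hΨ (smooth_mul_expJ d k _) ?_ ?_
  · exact ((contMDiffAt_extChartAt_of_mem hmem).comp t (hc t)).contDiffAt
  · filter_upwards [htend.eventually l2] with y hy
    show χ.symm y = (k * lieExp G (d.jE F (l (k⁻¹ • χ.symm y)))) • o
    rw [mul_smul, hy, smul_inv_smul]
  · refine EulerLagrange.congr ?_ (eulerLagrange_expJ hiso d hd k (fundE E F G o X) t)
    have h1 : ∀ᶠ s in 𝓝 t, c s ∈ χ.source :=
      (hc t).continuousAt.eventually (extChartAt_source_mem_nhds (c t))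
    have h2 : Tendsto (fun s : ℝ ↦ (s - t) • fundE E F G o X) (𝓝 t) (𝓝 0) := by
      have : Continuous (fun s : ℝ ↦ (s - t) • fundE E F G o X) := by fun_prop
      simpa using this.tendsto t
    filter_upwards [h1, h2.eventually l1] with s h3 h4
    show (s - t) • fundE E F G o X = l (k⁻¹ • χ.symm (χ (c s)))
    rw [χ.left_inv h3]
    rw [map_smul, hx] at h4
    rw [← h4]
    congr 1
    rw [eq_inv_smul_iff, hk, ← mul_smul, mul_assoc, ← lieExp_add_smul, add_sub_cancel]

end Homogeneous

/-! ### Subalgebras and the local group law -/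

section LinearODE

variable {E : Type*} [NormedAddCommGroup E] [NormedSpace ℝ E] [FiniteDimensional ℝ E]

theorem Submodule.exists_clm_projection (S : Submodule ℝ E) :
    ∃ p : E →L[ℝ] E, (∀ x, p x ∈ S) ∧ ∀ x ∈ S, p x = x := by
  obtain ⟨q, hq⟩ := S.exists_isCompl
  refine ⟨(S.projection q hq).toContinuousLinearMap, fun x ↦ ?_, fun x hx ↦ ?_⟩
  · exact Submodule.projection_apply_mem hq x
  · exact (Submodule.projection_eq_self_iff hq x).2 hx

/-- A curve that starts in a subspace stays in it if its velocity leaves the subspace at most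
linearly in the distance of the curve to the subspace. -/
theorem Submodule.mem_of_norm_deriv_le (S : Submodule ℝ E) {p : E →L[ℝ] E}
    (hp : ∀ x, p x ∈ S) (hp' : ∀ x ∈ S, p x = x) {f f' : ℝ → E}
    (hf : ∀ t ∈ Icc (0 : ℝ) 1, HasDerivAt f (f' t) t) (h0 : f 0 ∈ S) (K : ℝ)
    (hK : ∀ t ∈ Icc (0 : ℝ) 1, ‖f' t - p (f' t)‖ ≤ K * ‖f t - p (f t)‖) : f 1 ∈ S := by
  have hd : ∀ t ∈ Icc (0 : ℝ) 1, HasDerivAt (fun t ↦ f t - p (f t)) (f' t - p (f' t)) t :=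
    fun t ht ↦ (hf t ht).sub (p.hasFDerivAt.comp_hasDerivAt t (hf t ht))
  have h := eq_zero_of_abs_deriv_le_mul_abs_self_of_eq_zero_right
    (f := fun t ↦ f t - p (f t)) (f' := fun t ↦ f' t - p (f' t)) (K := K) (a := 0) (b := 1)
    (fun t ht ↦ (hd t ht).continuousAt.continuousWithinAt)
    (fun t ht ↦ (hd t (Ico_subset_Icc_self ht)).hasDerivWithinAt)
    (by rw [hp' _ h0, sub_self]) (fun t ht ↦ hK t (Ico_subset_Icc_self ht)) 1 (by simp)
  rw [sub_eq_zero.1 h]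
  exact hp _

/-- Solutions of `f' = w + L f` that start in an `L`-invariant subspace containing `w` stay in
it. -/
theorem Submodule.mem_of_linear_ode (S : Submodule ℝ E) {L : E →L[ℝ] E} {w : E}
    (hL : ∀ x ∈ S, L x ∈ S) (hw : w ∈ S) {f : ℝ → E}
    (hf : ∀ t, HasDerivAt f (w + L (f t)) t) (h0 : f 0 ∈ S) : f 1 ∈ S := by
  obtain ⟨p, hp, hp'⟩ := S.exists_clm_projection
  refine S.mem_of_norm_deriv_le hp hp' (fun t _ ↦ hf t) h0
    ‖(ContinuousLinearMap.id ℝ E - p) ∘L L‖ fun t _ ↦ ?_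
  refine le_of_eq_of_le ?_ (((ContinuousLinearMap.id ℝ E - p) ∘L L).le_opNorm (f t - p (f t)))
  congr 1
  have h1 := hp' _ (hL _ (hp (f t)))
  simp only [ContinuousLinearMap.comp_apply, sub_apply, ContinuousLinearMap.id_apply,
    map_sub, map_add, hp' w hw, h1]
  abel

end LinearODE

section Subalgebra

variable {E : Type*} [NormedAddCommGroup E] [NormedSpace ℝ E] [FiniteDimensional ℝ E]
  {G : Type*} [TopologicalSpace G] [ChartedSpace E G] [Group G] [LieGroup 𝓘(ℝ, E) ∞ G] [T2Space G]
  {S : Submodule ℝ E} (hS : ∀ X ∈ S, ∀ Y ∈ S, lieBL E G X Y ∈ S)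
include hS

theorem lder_lieExp_mem {X W : E} (hX : X ∈ S) (hW : W ∈ S) : lder (E := E) (lieExp G) X W ∈ S := by
  have h := S.mem_of_linear_ode (L := -lieBL E G X) (w := W)
    (f := fun t : ℝ ↦ t • lder (E := E) (lieExp G) (t • X) W) (fun x hx ↦ S.neg_mem (hS X hX x hx))
    hW (fun t ↦ by simpa [sub_eq_add_neg] using hasDerivAt_smul_lder (G := G) X W t) (by simp)
  simpa using h

theorem adE_lieExp_mem {X Y : E} (hX : X ∈ S) (hY : Y ∈ S) : adE E (lieExp G X) Y ∈ S := by
  have h := S.mem_of_linear_ode (L := lieBL E G X) (w := 0)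
    (f := fun t : ℝ ↦ adE E (lieExp G (t • X)) Y) (fun x hx ↦ hS X hX x hx)
    S.zero_mem (fun t ↦ by simpa using hasDerivAt_adE (G := G) X Y t)
    (by simpa [lieExp_zero, adE_one] using hY)
  simpa using h

/-- The left frame inverts `lder exp`, which maps `S` into itself and is injective, hence onto. -/
theorem eventually_leftFrame_mem : ∀ᶠ z in 𝓝 (0 : E), z ∈ S → ∀ Y ∈ S,
    leftFrame (lieExp G) (lieLog E) z Y ∈ S := by
  filter_upwards [eventually_lder_exp_leftFrame (E := E) (G := G)] with z hz hzS Y hY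
  have hz' : leftFrame (lieExp G) (lieLog E) z ∘L lder (lieExp G) z =
      ContinuousLinearMap.id ℝ E := by
    have h1 : (lder (lieExp G) z).toLinearMap * (leftFrame (lieExp G) (lieLog E) z).toLinearMap
        = 1 := by
      ext x; exact DFunLike.congr_fun hz x
    have h2 := mul_eq_one_comm.1 h1
    ext x; exact DFunLike.congr_fun h2 x
  let P : S →ₗ[ℝ] S := ((lder (lieExp G) z).toLinearMap).restrict
    (fun w hw ↦ lder_lieExp_mem hS hzS hw)
  have hP : Function.Injective P := by
    intro a b hab
    have h1 : lder (lieExp G) z (a : E) = lder (lieExp G) z (b : E) := congrArg Subtype.val hab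
    have h2 := congrArg (leftFrame (lieExp G) (lieLog E) z) h1
    have h3 := fun c : E ↦ DFunLike.congr_fun hz' c
    exact Subtype.ext ((h3 a).symm.trans (h2.trans (h3 b)))
  obtain ⟨w, hw⟩ := (LinearMap.injective_iff_surjective.1 hP) ⟨Y, hY⟩
  have h1 : lder (lieExp G) z (w : E) = Y := congrArg Subtype.val hw
  rw [← h1]
  have h3 : leftFrame (lieExp G) (lieLog E) z (lder (lieExp G) z (w : E)) = w :=
    DFunLike.congr_fun hz' (w : E)
  rw [h3]; exact w.2

omit hS in
theorem eventually_lieExp_lieLog_mul : ∀ᶠ q in 𝓝 (0 : E × E),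
    lieExp G (lieLog E (lieExp G q.1 * lieExp G q.2)) = lieExp G q.1 * lieExp G q.2 := by
  have := LieGroup.isTopologicalGroup E G
  have hc : Continuous (lieExp G : E → G) := contMDiff_lieExp.continuous
  have h3 : Tendsto (fun q : E × E ↦ lieExp G q.1 * lieExp G q.2) (𝓝 0) (𝓝 1) :=
    ((hc.comp continuous_fst).mul (hc.comp continuous_snd)).tendsto' _ _
      (by simp [lieExp_zero])
  exact h3.eventually (isLocalParam_lieExp E G).right_inv

omit hS in
theorem tendsto_lieLog_mul : Tendsto (fun q : E × E ↦ lieLog E (lieExp G q.1 * lieExp G q.2))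
    (𝓝 0) (𝓝 0) := by
  have h := (isLocalParam_lieExp E G).eventually_smooth_mul.self_of_nhds.continuousAt.tendsto
  simpa [lieExp_zero, lieLog_one] using h

/-- Near the origin the local group law of `G`, in exponential coordinates, preserves a
subalgebra: `t ↦ log (exp x * exp (t y))` is an integral curve of a vector field tangent to the
subalgebra. -/
theorem eventually_lieLog_mul_mem : ∀ᶠ q in 𝓝 (0 : E × E), q.1 ∈ S → q.2 ∈ S →
    lieLog E (lieExp G q.1 * lieExp G q.2) ∈ S := by
  have := LieGroup.isTopologicalGroup E G
  have hlp := isLocalParam_lieExp E G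
  obtain ⟨p, hp, hp'⟩ := S.exists_clm_projection
  obtain ⟨K, U, hU, hK⟩ := (hlp.eventually_smooth_leftFrame.self_of_nhds.of_le
    (m := 1) (by simp)).exists_lipschitzOnWith
  have hUS := inter_mem hU (eventually_leftFrame_mem (G := G) hS)
  have hUp : ∀ᶠ z in 𝓝 (0 : E), z ∈ U ∧ p z ∈ U ∧ ∀ Y ∈ S,
      leftFrame (lieExp G) (lieLog E) (p z) Y ∈ S := by
    have h1 : Tendsto p (𝓝 0) (𝓝 0) := p.continuous.tendsto' _ _ (map_zero p)
    filter_upwards [hU, h1 hUS] with z h2 h3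
    exact ⟨h2, h3.1, h3.2 (hp z)⟩
  have hgood := (((tendsto_lieLog_mul (G := G)).eventually
    (hUp.and hlp.eventually_smooth_mul_zero)).and
    (hlp.eventually_smooth_mul.and (eventually_lieExp_lieLog_mul (G := G))))
  obtain ⟨r, hr, hball⟩ := Metric.eventually_nhds_iff_ball.1 hgood
  have hl : ∀ᶠ q : E × E in 𝓝 0, lieLog E (lieExp G q.1) = q.1 :=
    (continuous_fst.tendsto' (0 : E × E) (0 : E) rfl).eventually hlp.left_inv
  filter_upwards [Metric.ball_mem_nhds _ hr, hl] with q hq hl h1 h2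
  have hmem : ∀ t ∈ Icc (0 : ℝ) 1, (q.1, t • q.2) ∈ Metric.ball (0 : E × E) r := by
    intro t ht
    rw [mem_ball_zero_iff, Prod.norm_def, max_lt_iff] at hq ⊢
    refine ⟨hq.1, lt_of_le_of_lt ?_ hq.2⟩
    rw [norm_smul, Real.norm_of_nonneg ht.1]
    exact mul_le_of_le_one_left (norm_nonneg _) ht.2
  -- The distance from the product to `S` satisfies a linear differential inequality along `t ↦
  -- exp(x) exp(ty)`, and vanishes at `t = 0`.
  have key := S.mem_of_norm_deriv_le hp hp'
    (f := fun t : ℝ ↦ lieLog E (lieExp G q.1 * lieExp G (t • q.2)))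
    (f' := fun t ↦ leftFrame (lieExp G) (lieLog E)
      (lieLog E (lieExp G q.1 * lieExp G (t • q.2))) q.2) ?_ ?_
    (‖ContinuousLinearMap.id ℝ E - p‖ * K * ‖q.2‖) ?_
  · simpa using key
  · intro t ht
    obtain ⟨⟨-, hs⟩, -, he⟩ := hball _ (hmem t ht)
    set c := lieLog E (lieExp G q.1 * lieExp G (t • q.2))
    have hd : DifferentiableAt ℝ (fun y : E ↦ lieLog E (lieExp G c * lieExp G y)) 0 :=
      (hs.comp (0 : E) (contDiffAt_const.prodMk contDiffAt_id)).differentiableAt (by simp)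
    have h3 : HasDerivAt (fun s : ℝ ↦ (s - t) • q.2) q.2 t := by
      simpa using ((hasDerivAt_id t).sub_const t).smul_const q.2
    have h4 : HasFDerivAt (fun y : E ↦ lieLog E (lieExp G c * lieExp G y))
        (leftFrame (lieExp G) (lieLog E) c) ((t - t) • q.2) := by
      rw [sub_self, zero_smul]; exact hd.hasFDerivAt
    refine (h4.comp_hasDerivAt t h3).congr_of_eventuallyEq (Eventually.of_forall fun s ↦ ?_)
    have h5 : lieExp G (s • q.2) = lieExp G (t • q.2) * lieExp G ((s - t) • q.2) := by
      rw [← lieExp_add_smul]; congr 2; ring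
    simp only [Function.comp_apply]
    rw [h5, he, mul_assoc]
  · simpa [lieExp_zero, hl] using h1
  · intro t ht
    obtain ⟨⟨⟨hz, hpz, hY⟩, -⟩, -⟩ := hball _ (hmem t ht)
    dsimp only at hz hpz hY ⊢
    set c := lieLog E (lieExp G q.1 * lieExp G (t • q.2))
    have h6 := hp' _ (hY _ h2)
    have h7 : leftFrame (lieExp G) (lieLog E) c q.2 - p (leftFrame (lieExp G) (lieLog E) c q.2) =
        (ContinuousLinearMap.id ℝ E - p) ((leftFrame (lieExp G) (lieLog E) c -
          leftFrame (lieExp G) (lieLog E) (p c)) q.2) := by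
      simp only [sub_apply, ContinuousLinearMap.id_apply, map_sub, h6]
      abel
    rw [h7]
    refine (ContinuousLinearMap.le_opNorm _ _).trans ?_
    have h8 := ContinuousLinearMap.le_opNorm (leftFrame (lieExp G) (lieLog E) c -
          leftFrame (lieExp G) (lieLog E) (p c)) q.2
    have h9 := hK.norm_sub_le hz hpz
    calc _ ≤ ‖ContinuousLinearMap.id ℝ E - p‖ * ((K * ‖c - p c‖) * ‖q.2‖) := by
          gcongr
          exact h8.trans (by gcongr)
      _ = _ := by ring

end Subalgebra

/-! ### Manifold structures from families of slices -/

section Leaf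

variable {V : Type*} [NormedAddCommGroup V] [NormedSpace ℝ V]
  {F : Type*} [NormedAddCommGroup F] [NormedSpace ℝ F]
  {Y : Type*} [TopologicalSpace Y] [ChartedSpace F Y]
  {X A : Type*}

variable (F) in
/-- Slice parametrisations `ψ a`, defined on the ball of radius `r` of `V`, of a set `X` that is
mapped to a manifold `Y` by `ι`. They are smooth as maps to `Y`, where they have smooth left
inverses `l a`, and they overlap in open sets. -/
structure IsSliceFamily (ι : X → Y) (ψ : A → V → X) (l : A → Y → V) (r : ℝ) : Prop where
  pos : 0 < r
  cover : ∀ x, ∃ a, ψ a 0 = x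
  left_inv : ∀ a, ∀ v ∈ Metric.ball 0 r, l a (ι (ψ a v)) = v
  overlap : ∀ a b, ∀ v ∈ Metric.ball 0 r, ∀ w ∈ Metric.ball 0 r, ψ a v = ψ b w →
    ∀ᶠ v' in 𝓝 v, l b (ι (ψ a v')) ∈ Metric.ball 0 r ∧ ψ b (l b (ι (ψ a v'))) = ψ a v'
  smooth : ∀ a, ∀ v ∈ Metric.ball 0 r, ContMDiffAt 𝓘(ℝ, V) 𝓘(ℝ, F) ∞ (fun v ↦ ι (ψ a v)) v
  smooth_symm : ∀ a, ∀ v ∈ Metric.ball 0 r, ContMDiffAt 𝓘(ℝ, F) 𝓘(ℝ, V) ∞ (l a) (ι (ψ a v))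

/-- The manifold structure of `X` is the one for which the slice parametrisations are local
diffeomorphisms. -/
structure IsLeaf [TopologicalSpace X] [ChartedSpace V X] (ι : X → Y) (ψ : A → V → X)
    (l : A → Y → V) (r : ℝ) : Prop where
  smooth_param : ∀ a, ∀ v ∈ Metric.ball 0 r, ContMDiffAt 𝓘(ℝ, V) 𝓘(ℝ, V) ∞ (ψ a) v
  smooth_coord : ∀ a, ∀ v ∈ Metric.ball 0 r,
    ContMDiffAt 𝓘(ℝ, V) 𝓘(ℝ, V) ∞ (fun x ↦ l a (ι x)) (ψ a v)
  right_inv : ∀ a, ∀ v ∈ Metric.ball 0 r, ∀ᶠ x in 𝓝 (ψ a v), ψ a (l a (ι x)) = x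

namespace IsSliceFamily

variable {ι : X → Y} {ψ : A → V → X} {l : A → Y → V} {r : ℝ}

/-- The inverse of a slice parametrisation, as a partial equivalence. -/
def partialEquiv (h : IsSliceFamily F ι ψ l r) (a : A) : PartialEquiv X V where
  toFun x := l a (ι x)
  invFun := ψ a
  source := ψ a '' Metric.ball 0 r
  target := Metric.ball 0 r
  map_source' := by rintro _ ⟨v, hv, rfl⟩; rw [h.left_inv a v hv]; exact hv
  map_target' v hv := ⟨v, hv, rfl⟩
  left_inv' := by rintro _ ⟨v, hv, rfl⟩; rw [h.left_inv a v hv]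
  right_inv' v hv := h.left_inv a v hv

theorem contDiffOn_transition (h : IsSliceFamily F ι ψ l r) (a b : A) :
    IsOpen ((h.partialEquiv a).symm.trans (h.partialEquiv b)).source ∧
    ContDiffOn ℝ ∞ ((h.partialEquiv a).symm.trans (h.partialEquiv b))
      ((h.partialEquiv a).symm.trans (h.partialEquiv b)).source := by
  constructor
  · rw [isOpen_iff_mem_nhds]
    rintro v ⟨hv, w, hw, e⟩
    filter_upwards [h.overlap a b v hv w hw e.symm, Metric.isOpen_ball.mem_nhds hv] with v' h1 h2
    exact ⟨h2, _, h1.1, h1.2⟩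
  · rintro v ⟨hv, w, hw, e⟩
    have e' : ψ b w = ψ a v := e
    have h1 := h.smooth_symm b w hw
    rw [e'] at h1
    have h2 := ContMDiffAt.comp (I' := 𝓘(ℝ, F)) (g := l b) (f := fun v ↦ ι (ψ a v)) v h1
      (h.smooth a v hv)
    exact (contMDiffAt_iff_contDiffAt.1 h2).contDiffWithinAt

/-- The charts are the inverses of the slices. -/
theorem exists_isLeaf [T2Space Y] (h : IsSliceFamily F ι ψ l r) :
    ∃ (_ : TopologicalSpace X) (_ : ChartedSpace V X), IsManifold 𝓘(ℝ, V) ∞ X ∧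
      IsLeaf ι ψ l r := by
  choose a ha using h.cover
  let c : ChartedSpaceCore V X :=
    { atlas := range h.partialEquiv
      chartAt := fun x ↦ h.partialEquiv (a x)
      mem_chart_source := fun x ↦ ⟨0, Metric.mem_ball_self h.pos, ha x⟩
      chart_mem_atlas := fun x ↦ ⟨a x, rfl⟩
      open_source := by
        rintro _ _ ⟨a, rfl⟩ ⟨b, rfl⟩; exact (h.contDiffOn_transition a b).1
      continuousOn_toFun := by
        rintro _ _ ⟨a, rfl⟩ ⟨b, rfl⟩; exact (h.contDiffOn_transition a b).2.continuousOn }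
  let _ : TopologicalSpace X := c.toTopologicalSpace
  let _ : ChartedSpace V X := c.toChartedSpace
  have hm : IsManifold 𝓘(ℝ, V) ∞ X := by
    refine isManifold_of_contDiffOn _ _ _ ?_
    intro e e' he he'
    obtain ⟨_, ⟨a, rfl⟩, he⟩ : ∃ f, ∃ hf : f ∈ range h.partialEquiv,
        e = c.openPartialHomeomorph f hf := by
      obtain ⟨f, hf, h1⟩ := mem_iUnion₂.1 he
      exact ⟨f, hf, h1⟩
    obtain ⟨_, ⟨b, rfl⟩, he'⟩ : ∃ f, ∃ hf : f ∈ range h.partialEquiv,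
        e' = c.openPartialHomeomorph f hf := by
      obtain ⟨f, hf, h1⟩ := mem_iUnion₂.1 he'
      exact ⟨f, hf, h1⟩
    subst he he'
    have h1 := (h.contDiffOn_transition a b).2
    refine h1.mono ?_
    rintro x ⟨hx, -⟩
    exact hx
  refine ⟨_, _, hm, ?_⟩
  let e : A → OpenPartialHomeomorph X V := fun a ↦ c.openPartialHomeomorph _ ⟨a, rfl⟩
  have he : ∀ a, e a ∈ IsManifold.maximalAtlas 𝓘(ℝ, V) ∞ X := by
    intro a
    refine IsManifold.subset_maximalAtlas ?_
    exact mem_iUnion₂.2 ⟨_, ⟨a, rfl⟩, rfl⟩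
  refine ⟨fun a v hv ↦ ?_, fun a v hv ↦ ?_, fun a v hv ↦ ?_⟩
  · exact (contMDiffOn_symm_of_mem_maximalAtlas (he a)).contMDiffAt
      (Metric.isOpen_ball.mem_nhds hv)
  · exact (contMDiffOn_of_mem_maximalAtlas (he a)).contMDiffAt
      ((e a).open_source.mem_nhds ⟨v, hv, rfl⟩)
  · exact (e a).eventually_left_inverse ⟨v, hv, rfl⟩

end IsSliceFamily

namespace IsLeaf

variable [TopologicalSpace X] [ChartedSpace V X]
  {ι : X → Y} {ψ : A → V → X} {l : A → Y → V} {r : ℝ}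
  {H : Type*} [NormedAddCommGroup H] [NormedSpace ℝ H]
  {Z : Type*} [TopologicalSpace Z] [ChartedSpace H Z]

theorem contMDiffAt_of_comp (h : IsLeaf ι ψ l r) (hs : IsSliceFamily F ι ψ l r) {g : X → Z} {a : A}
    {v : V} (hv : v ∈ Metric.ball 0 r)
    (hg : ContMDiffAt 𝓘(ℝ, V) 𝓘(ℝ, H) ∞ (fun v ↦ g (ψ a v)) v) :
    ContMDiffAt 𝓘(ℝ, V) 𝓘(ℝ, H) ∞ g (ψ a v) := by
  have h1 := h.smooth_coord a v hv
  have h2 : ContMDiffAt 𝓘(ℝ, V) 𝓘(ℝ, H) ∞ (fun x ↦ g (ψ a (l a (ι x)))) (ψ a v) := by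
    refine ContMDiffAt.comp (I' := 𝓘(ℝ, V)) (g := fun v ↦ g (ψ a v)) (f := fun x ↦ l a (ι x)) _ ?_ h1
    rwa [hs.left_inv a v hv]
  refine h2.congr_of_eventuallyEq ?_
  filter_upwards [h.right_inv a v hv] with x hx
  rw [hx]

theorem contMDiff (h : IsLeaf ι ψ l r) (hs : IsSliceFamily F ι ψ l r) :
    ContMDiff 𝓘(ℝ, V) 𝓘(ℝ, F) ∞ ι := by
  intro x
  obtain ⟨a, rfl⟩ := hs.cover x
  exact h.contMDiffAt_of_comp hs (Metric.mem_ball_self hs.pos)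
    (hs.smooth a 0 (Metric.mem_ball_self hs.pos))

theorem injective_md (h : IsLeaf ι ψ l r) (hs : IsSliceFamily F ι ψ l r) (x : X) :
    Function.Injective (md V F ι x) := by
  obtain ⟨a, rfl⟩ := hs.cover x
  have h0 := Metric.mem_ball_self (x := (0 : V)) hs.pos
  have h1 := hs.smooth_symm a 0 h0
  have h2 : ContMDiffAt 𝓘(ℝ, F) 𝓘(ℝ, V) ∞ (fun y ↦ ψ a (l a y)) (ι (ψ a 0)) := by
    refine ContMDiffAt.comp (I' := 𝓘(ℝ, V)) (g := ψ a) (f := l a) _ ?_ h1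
    rw [hs.left_inv a 0 h0]
    exact h.smooth_param a 0 h0
  have h3 := md_leftInverse (p := ι) (l := fun y ↦ ψ a (l a y)) (h.right_inv a 0 h0) h2.mdiff
    (h.contMDiff hs (ψ a 0)).mdiff
  intro u w e
  have h4 := fun v : V ↦ DFunLike.congr_fun h3 v
  have h5 := congrArg (md F V (fun y ↦ ψ a (l a y)) (ι (ψ a 0))) e
  exact (h4 u).symm.trans (h5.trans (h4 w))

/-- The image of the differential of `ι` is the tangent space of the slice. -/
theorem mem_range_md_iff (h : IsLeaf ι ψ l r) (hs : IsSliceFamily F ι ψ l r) (a : A) (u : F) :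
    (∃ w, md V F ι (ψ a 0) w = u) ↔ ∃ w, md V F (fun v ↦ ι (ψ a v)) 0 w = u := by
  have h0 := Metric.mem_ball_self (x := (0 : V)) hs.pos
  have h1 : ∀ w, md V F (fun v ↦ ι (ψ a v)) 0 w = md V F ι (ψ a 0) (md V V (ψ a) 0 w) :=
    md_comp_apply (g := ι) (f := ψ a) 0 (h.contMDiff hs _).mdiff (h.smooth_param a 0 h0).mdiff
  constructor
  · rintro ⟨w, rfl⟩
    have h2 : ContMDiffAt 𝓘(ℝ, V) 𝓘(ℝ, V) ∞ (ψ a) ((fun x ↦ l a (ι x)) (ψ a 0)) := by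
      simp only [hs.left_inv a 0 h0]; exact h.smooth_param a 0 h0
    have h3 := md_leftInverse (E := V) (F := V) (h.right_inv a 0 h0) h2.mdiff
      (h.smooth_coord a 0 h0).mdiff
    refine ⟨md V V (fun x ↦ l a (ι x)) (ψ a 0) w, ?_⟩
    rw [h1]
    have h4 := DFunLike.congr_fun h3 w
    simp only [hs.left_inv a 0 h0] at h4
    exact congrArg _ h4
  · rintro ⟨w, rfl⟩
    exact ⟨_, (h1 w).symm⟩

theorem t2Space [T2Space Y] (h : IsLeaf ι ψ l r) (hs : IsSliceFamily F ι ψ l r)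
    (hi : Function.Injective ι) : T2Space X :=
  T2Space.of_injective_continuous hi (h.contMDiff hs).continuous

end IsLeaf

end Leaf

/-! ### The connected Lie subgroup of a subalgebra -/

section EuclideanModel

variable {E : Type*} [NormedAddCommGroup E] [NormedSpace ℝ E] [FiniteDimensional ℝ E]

theorem Submodule.exists_euclidean_param (S : Submodule ℝ E) :
    ∃ (n : ℕ) (i : EuclideanSpace ℝ (Fin n) →L[ℝ] E) (j : E →L[ℝ] EuclideanSpace ℝ (Fin n)),
      (∀ v, i v ∈ S) ∧ (∀ v, j (i v) = v) ∧ ∀ x ∈ S, i (j x) = x := by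
  obtain ⟨p, hp, hp'⟩ := S.exists_clm_projection
  let e : EuclideanSpace ℝ (Fin (Module.finrank ℝ S)) ≃L[ℝ] S :=
    ContinuousLinearEquiv.ofFinrankEq (by simp)
  refine ⟨_, S.subtypeL ∘L e.toContinuousLinearMap,
    e.symm.toContinuousLinearMap ∘L p.codRestrict S hp, fun v ↦ (e v).2, fun v ↦ ?_, fun x hx ↦ ?_⟩
  · have : p.codRestrict S hp (e v : E) = e v := Subtype.ext (hp' _ (e v).2)
    show e.symm (p.codRestrict S hp (e v : E)) = v
    rw [this, e.symm_apply_apply]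
  · show ((e (e.symm (p.codRestrict S hp x)) : S) : E) = x
    rw [e.apply_symm_apply]
    exact hp' x hx

end EuclideanModel

section Existence

variable {E : Type*} [NormedAddCommGroup E] [NormedSpace ℝ E] [FiniteDimensional ℝ E]
  {G : Type*} [TopologicalSpace G] [ChartedSpace E G] [Group G] [LieGroup 𝓘(ℝ, E) ∞ G] [T2Space G]

/-- The subgroup generated by the exponentials of the elements of `S`. -/
def expSubgroup (G : Type*) [TopologicalSpace G] [ChartedSpace E G] [Group G]
    [LieGroup 𝓘(ℝ, E) ∞ G] [T2Space G] (S : Submodule ℝ E) : Subgroup G :=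
  Subgroup.closure (lieExp G '' (S : Set E))

theorem lieExp_mem_expSubgroup {S : Submodule ℝ E} {X : E} (hX : X ∈ S) :
    lieExp G X ∈ expSubgroup G S := Subgroup.subset_closure ⟨X, hX, rfl⟩

theorem expSubgroup_le {S : Submodule ℝ E} {H : Subgroup G} (h : ∀ X ∈ S, lieExp G X ∈ H) :
    expSubgroup G S ≤ H := by
  rw [expSubgroup, Subgroup.closure_le]
  rintro _ ⟨X, hX, rfl⟩
  exact h X hX

/-- In exponential coordinates, the group law is smooth at `q`, corresponds to the multiplication
of `G` and preserves `S`. -/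
structure IsGoodPair (G : Type*) [TopologicalSpace G] [ChartedSpace E G] [Group G]
    [LieGroup 𝓘(ℝ, E) ∞ G] [T2Space G] (S : Submodule ℝ E) (q : E × E) : Prop where
  exp_log : lieExp G (lieLog E (lieExp G q.1 * lieExp G q.2)) = lieExp G q.1 * lieExp G q.2
  mem : q.1 ∈ S → q.2 ∈ S → lieLog E (lieExp G q.1 * lieExp G q.2) ∈ S
  smooth : ContDiffAt ℝ ∞ (fun q : E × E ↦ lieLog E (lieExp G q.1 * lieExp G q.2)) q

/-- Conditions on a point of `E` that is sufficiently close to the origin. -/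
structure IsGoodPoint (G : Type*) [TopologicalSpace G] [ChartedSpace E G] [Group G]
    [LieGroup 𝓘(ℝ, E) ∞ G] [T2Space G] (S : Submodule ℝ E) (x : E) : Prop where
  log_exp : ∀ᶠ y in 𝓝 x, lieLog E (lieExp G y) = y
  smooth_log : ContMDiffAt 𝓘(ℝ, E) 𝓘(ℝ, E) ∞ (lieLog E : G → E) (lieExp G x)
  right : ∀ᶠ q in 𝓝 (x, (0 : E)), IsGoodPair G S q
  diag : ∀ᶠ q in 𝓝 (-x, x), IsGoodPair G S q

variable {S : Submodule ℝ E}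

theorem eventually_isGoodPair (hS : ∀ X ∈ S, ∀ Y ∈ S, lieBL E G X Y ∈ S) :
    ∀ᶠ q in 𝓝 (0 : E × E), IsGoodPair G S q := by
  filter_upwards [eventually_lieExp_lieLog_mul (E := E) (G := G), eventually_lieLog_mul_mem hS,
    (isLocalParam_lieExp E G).eventually_smooth_mul] with q h1 h2 h3
  exact ⟨h1, h2, h3⟩

theorem eventually_isGoodPoint (hS : ∀ X ∈ S, ∀ Y ∈ S, lieBL E G X Y ∈ S) :
    ∀ᶠ x in 𝓝 (0 : E), IsGoodPoint G S x := by
  have hp := isLocalParam_lieExp E G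
  have h1 : Tendsto (fun x : E ↦ (x, (0 : E))) (𝓝 0) (𝓝 0) :=
    (continuous_id.prodMk continuous_const).tendsto' _ _ rfl
  have h2 : Tendsto (fun x : E ↦ (-x, x)) (𝓝 0) (𝓝 0) :=
    (continuous_neg.prodMk continuous_id).tendsto' _ _ (by simp)
  have h3 := (eventually_isGoodPair (G := G) hS).eventually_nhds
  filter_upwards [hp.left_inv.eventually_nhds, hp.continuousAt_zero.eventually hp.smooth_symm,
    h1.eventually h3, h2.eventually h3] with x a b c d
  exact ⟨a, b, c, d⟩

theorem adE_mem_of_mem_expSubgroup (hS : ∀ X ∈ S, ∀ Y ∈ S, lieBL E G X Y ∈ S) {g : G}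
    (hg : g ∈ expSubgroup G S) : ∀ Y ∈ S, adE E g Y ∈ S := by
  rw [expSubgroup] at hg
  induction hg using Subgroup.closure_induction'' with
  | mem x hx => obtain ⟨X, hX, rfl⟩ := hx; exact fun Y hY ↦ adE_lieExp_mem hS hX hY
  | inv_mem x hx =>
    obtain ⟨X, hX, rfl⟩ := hx
    rw [← lieExp_neg]
    exact fun Y hY ↦ adE_lieExp_mem hS (S.neg_mem hX) hY
  | one => exact fun Y hY ↦ by rwa [adE_one]
  | mul x y _ _ h1 h2 => exact fun Y hY ↦ by rw [adE_mul]; exact h1 _ (h2 Y hY)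

/-- If `x'` is close to `x`, then the coordinates of `exp(-x) exp(x')` are small;
this is the local transition between slices through a common point. -/
theorem IsGoodPoint.tendsto_diff {x : E} (h : IsGoodPoint G S x) :
    Tendsto (fun y ↦ lieLog E (lieExp G (-x) * lieExp G y)) (𝓝 x) (𝓝 0) := by
  have h1 : ContinuousAt (fun y : E ↦ (-x, y)) x := by fun_prop
  have h2 := ContinuousAt.comp (f := fun y : E ↦ (-x, y)) (x := x)
    h.diag.self_of_nhds.smooth.continuousAt h1
  have h3 := h2.tendsto
  simpa [Function.comp_def, lieExp_neg, lieLog_one] using h3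

theorem IsGoodPoint.eventually_diff {x : E} (h : IsGoodPoint G S x) :
    ∀ᶠ y in 𝓝 x, IsGoodPair G S (-x, y) := by
  have h1 : ContinuousAt (fun y : E ↦ (-x, y)) x := by fun_prop
  exact h1.eventually h.diag

theorem IsGoodPoint.tendsto_mul {x : E} (h : IsGoodPoint G S x) :
    Tendsto (fun z ↦ lieLog E (lieExp G x * lieExp G z)) (𝓝 (0 : E)) (𝓝 x) := by
  have h1 : ContinuousAt (fun z : E ↦ (x, z)) 0 := by fun_prop
  have h2 := ContinuousAt.comp (f := fun z : E ↦ (x, z)) (x := 0)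
    h.right.self_of_nhds.smooth.continuousAt h1
  have h3 := h2.tendsto
  simpa [Function.comp_def, lieExp_zero, h.log_exp.self_of_nhds] using h3

theorem IsGoodPoint.eventually_right {x : E} (h : IsGoodPoint G S x) :
    ∀ᶠ z in 𝓝 (0 : E), IsGoodPair G S (x, z) := by
  have h1 : ContinuousAt (fun z : E ↦ (x, z)) 0 := by fun_prop
  exact h1.eventually h.right

/-- The set underlying a subgroup `H`, to be given a topology finer than the subspace topology. -/
def LeafGroup (H : Subgroup G) : Type _ := H

namespace LeafGroup

instance (H : Subgroup G) : Group (LeafGroup H) := inferInstanceAs (Group H)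

/-- The inclusion into the ambient group. -/
def incl (H : Subgroup G) : LeafGroup H →* G := H.subtype

theorem incl_injective (H : Subgroup G) : Function.Injective (incl H) := Subtype.val_injective

theorem incl_mem {H : Subgroup G} (s : LeafGroup H) : incl H s ∈ H := s.2

variable {V : Type*} [NormedAddCommGroup V] [NormedSpace ℝ V] {i : V →L[ℝ] E} {j : E →L[ℝ] V}

/-- The element `exp (i v)` of the subgroup. -/
noncomputable def exp (i : V →L[ℝ] E) (hi : ∀ v, i v ∈ S) (v : V) : LeafGroup (expSubgroup G S) :=
  ⟨lieExp G (i v), lieExp_mem_expSubgroup (hi v)⟩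

theorem incl_exp (hi : ∀ v, i v ∈ S) (v : V) :
    incl (expSubgroup G S) (exp i hi v) = lieExp G (i v) := rfl

theorem exp_zero (hi : ∀ v, i v ∈ S) : exp (G := G) i hi 0 = 1 := by
  apply incl_injective
  rw [incl_exp, map_zero, lieExp_zero, map_one]

/-- Slices `v ↦ s exp(v)`; they overlap in open sets because the local group law
preserves the subalgebra. -/
theorem exists_isSliceFamily (hS : ∀ X ∈ S, ∀ Y ∈ S, lieBL E G X Y ∈ S) (hi : ∀ v, i v ∈ S)
    (hji : ∀ v, j (i v) = v) (hij : ∀ x ∈ S, i (j x) = x) :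
    ∃ r, IsSliceFamily E (incl (expSubgroup G S)) (fun s v ↦ s * exp i hi v)
      (fun (s : LeafGroup (expSubgroup G S)) y ↦ j (lieLog E ((incl _ s)⁻¹ * y))) r := by
  have := LieGroup.isTopologicalGroup E G
  obtain ⟨r, hr, hball⟩ := Metric.eventually_nhds_iff_ball.1
    ((i.continuous.tendsto' 0 0 (map_zero i)).eventually (eventually_isGoodPoint (G := G) hS))
  have hc : ∀ (s : LeafGroup (expSubgroup G S)) (v : V),
      (incl _ s)⁻¹ * incl (expSubgroup G S) (s * exp i hi v) = lieExp G (i v) := by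
    intro s v
    rw [map_mul, incl_exp, inv_mul_cancel_left]
  have hsm : ContMDiff 𝓘(ℝ, V) 𝓘(ℝ, E) ∞ (fun v ↦ lieExp G (i v)) :=
    ContMDiff.comp (I' := 𝓘(ℝ, E)) (g := lieExp G) (f := i) contMDiff_lieExp i.contDiff.contMDiff
  refine ⟨r, hr, fun x ↦ ⟨x, ?_⟩, fun s v hv ↦ ?_, ?_, fun s v hv ↦ ?_, fun s v hv ↦ ?_⟩
  · apply incl_injective
    rw [map_mul, incl_exp, map_zero, lieExp_zero, mul_one]
  · simp only [hc, (hball v hv).log_exp.self_of_nhds, hji]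
  · intro s s' v hv w hw e
    have e' : incl _ s * lieExp G (i v) = incl _ s' * lieExp G (i w) := by
      simpa only [map_mul, incl_exp] using congrArg (incl _) e
    have hz := (hball v hv).tendsto_diff.comp i.continuous.continuousAt
    have hm := (hball w hw).tendsto_mul.comp hz
    have hw' : ∀ᶠ x in 𝓝 (i w), j x ∈ Metric.ball 0 r :=
      j.continuous.continuousAt.eventually (Metric.isOpen_ball.mem_nhds (by rwa [hji]))
    filter_upwards [i.continuous.continuousAt.eventually (hball v hv).eventually_diff,
      hz.eventually (hball w hw).eventually_right, hm.eventually (hball w hw).log_exp,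
      hm.eventually hw'] with v' h1 h2 h3 h4
    simp only [Function.comp_apply] at h2 h3 h4
    set z := lieLog E (lieExp G (-i v) * lieExp G (i v')) with hzdef
    have h5 : incl (expSubgroup G S) (s * exp i hi v') =
        incl _ s' * lieExp G (lieLog E (lieExp G (i w) * lieExp G z)) := by
      rw [h2.exp_log, h1.exp_log, ← mul_assoc, ← e', map_mul, incl_exp, lieExp_neg]
      group
    have h6 := h2.mem (hi w) (h1.mem (S.neg_mem (hi v)) (hi v'))
    rw [h5, inv_mul_cancel_left, h3]
    refine ⟨h4, incl_injective _ ?_⟩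
    rw [map_mul, incl_exp, hij _ h6, h5]
  · exact ((smooth_mul_left (incl _ s)).comp hsm).contMDiffAt
  · have h1 := (hball v hv).smooth_log
    rw [← hc s v] at h1
    have h2 := ContMDiffAt.comp (I' := 𝓘(ℝ, E)) (g := lieLog E) (f := fun y ↦ (incl _ s)⁻¹ * y)
      _ h1 (smooth_mul_left (E := E) (incl _ s)⁻¹).contMDiffAt
    exact ContMDiffAt.comp (I' := 𝓘(ℝ, E)) (g := j) _ j.contDiff.contMDiff.contMDiffAt h2

end LeafGroup

end Existence

section LieSubgroupExistence

variable {E : Type*} [NormedAddCommGroup E] [NormedSpace ℝ E] [FiniteDimensional ℝ E]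
  {G : Type*} [TopologicalSpace G] [ChartedSpace E G] [Group G] [LieGroup 𝓘(ℝ, E) ∞ G] [T2Space G]
  {S : Submodule ℝ E}

namespace LeafGroup

variable {V : Type*} [NormedAddCommGroup V] [NormedSpace ℝ V] {i : V →L[ℝ] E} {j : E →L[ℝ] V}
  [TopologicalSpace (LeafGroup (expSubgroup G S))] [ChartedSpace V (LeafGroup (expSubgroup G S))]
  {r : ℝ}

theorem smooth_mul_exp {hi : ∀ v, i v ∈ S}
    (hL : IsLeaf (incl (expSubgroup G S)) (fun s v ↦ s * exp i hi v)
      (fun (s : LeafGroup (expSubgroup G S)) y ↦ j (lieLog E ((incl _ s)⁻¹ * y))) r) (hr : 0 < r)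
    (s : LeafGroup (expSubgroup G S)) :
    ContMDiffAt 𝓘(ℝ, V) 𝓘(ℝ, V) ∞ (fun v ↦ s * exp i hi v) 0 :=
  hL.smooth_param s 0 (Metric.mem_ball_self hr)

theorem smooth_coord {hi : ∀ v, i v ∈ S}
    (hL : IsLeaf (incl (expSubgroup G S)) (fun s v ↦ s * exp i hi v)
      (fun (s : LeafGroup (expSubgroup G S)) y ↦ j (lieLog E ((incl _ s)⁻¹ * y))) r) (hr : 0 < r)
    (s : LeafGroup (expSubgroup G S)) :
    ContMDiffAt 𝓘(ℝ, V) 𝓘(ℝ, V) ∞ (fun x ↦ j (lieLog E ((incl _ s)⁻¹ * incl _ x))) s ∧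
      (∀ᶠ x in 𝓝 s, s * exp i hi (j (lieLog E ((incl _ s)⁻¹ * incl _ x))) = x) := by
  have h0 := Metric.mem_ball_self (x := (0 : V)) hr
  have h1 := hL.smooth_coord s 0 h0
  have h2 := hL.right_inv s 0 h0
  simp only [exp_zero, mul_one] at h1 h2
  exact ⟨h1, h2⟩

/-- With the leaf topology, the subgroup generated by a subalgebra is a Lie group: in slice
coordinates the multiplication is given by the local group law and the adjoint representation,
both of which preserve the subalgebra. -/
theorem lieGroup [IsManifold 𝓘(ℝ, V) ∞ (LeafGroup (expSubgroup G S))]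
    (hS : ∀ X ∈ S, ∀ Y ∈ S, lieBL E G X Y ∈ S) {hi : ∀ v, i v ∈ S}
    (hij : ∀ x ∈ S, i (j x) = x)
    (hL : IsLeaf (incl (expSubgroup G S)) (fun s v ↦ s * exp i hi v)
      (fun (s : LeafGroup (expSubgroup G S)) y ↦ j (lieLog E ((incl _ s)⁻¹ * y))) r)
    (hr : 0 < r) : LieGroup 𝓘(ℝ, V) ∞ (LeafGroup (expSubgroup G S)) := by
  have hz : ∀ s : LeafGroup (expSubgroup G S),
      j (lieLog E ((incl _ s)⁻¹ * incl _ s)) = 0 := fun s ↦ by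
    rw [inv_mul_cancel, lieLog_one, map_zero]
  refine { contMDiff_mul := ?_, contMDiff_inv := ?_ }
  · rintro ⟨s, s'⟩
    obtain ⟨h1, h2⟩ := smooth_coord hL hr s
    obtain ⟨h1', h2'⟩ := smooth_coord hL hr s'
    have h3 : ContMDiffAt (𝓘(ℝ, V).prod 𝓘(ℝ, V)) 𝓘(ℝ, V × V) ∞
        (fun x : LeafGroup (expSubgroup G S) × LeafGroup (expSubgroup G S) ↦
          (j (lieLog E ((incl _ s)⁻¹ * incl _ x.1)), j (lieLog E ((incl _ s')⁻¹ * incl _ x.2))))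
        (s, s') :=
      (h1.comp (s, s') contMDiffAt_fst).prodMk_space (h1'.comp (s, s') contMDiffAt_snd)
    -- In the charts at `s` and `s'`: `(s exp a)(s' exp b) = s s' exp(Ad(s'⁻¹) a) exp b`.
    let A : V × V → E × E := fun q ↦ (adE E (incl _ s')⁻¹ (i q.1), i q.2)
    have hA : ContDiff ℝ ∞ A := by fun_prop
    have hA0 : A (0, 0) = 0 := by simp [A]
    have h4 : ContDiffAt ℝ ∞ (fun q ↦ j (lieLog E (lieExp G (A q).1 * lieExp G (A q).2))) (0, 0) := by
      have h5 := (eventually_isGoodPair (G := G) hS).self_of_nhds.smooth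
      rw [← hA0] at h5
      exact j.contDiff.contDiffAt.comp (0, 0) (ContDiffAt.comp
        (g := fun q : E × E ↦ lieLog E (lieExp G q.1 * lieExp G q.2)) (0, 0) h5 hA.contDiffAt)
    have h6 := smooth_mul_exp hL hr (s * s')
    have hv0 : j (lieLog E (lieExp G (A (0, 0)).1 * lieExp G (A (0, 0)).2)) = 0 := by
      simp [hA0, lieExp_zero, lieLog_one]
    rw [← hv0] at h6
    have h7 := ContMDiffAt.comp (I' := 𝓘(ℝ, V))
      (g := fun v ↦ s * s' * exp i hi v)
      (f := fun q ↦ j (lieLog E (lieExp G (A q).1 * lieExp G (A q).2))) (0, 0) h6 h4.contMDiffAt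
    have e0 : (j (lieLog E ((incl _ s)⁻¹ * incl _ s)), j (lieLog E ((incl _ s')⁻¹ * incl _ s'))) =
      ((0 : V), (0 : V)) := by rw [hz, hz]
    have h8 := ContMDiffAt.comp_of_eq h7 h3 e0
    have hgood : ∀ᶠ q in 𝓝 ((0 : V), (0 : V)), IsGoodPair G S (A q) := by
      refine hA.continuous.continuousAt.eventually ?_
      rw [hA0]; exact eventually_isGoodPair hS
    have h9 := h3.continuousAt.tendsto
    rw [hz, hz] at h9
    refine h8.congr_of_eventuallyEq ?_
    filter_upwards [h9.eventually hgood, continuousAt_fst.eventually h2,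
      continuousAt_snd.eventually h2'] with x hx e1 e2
    simp only [Function.comp_apply]
    set a := j (lieLog E ((incl _ s)⁻¹ * incl _ x.1))
    set b := j (lieLog E ((incl _ s')⁻¹ * incl _ x.2))
    apply incl_injective
    have hm := hx.mem (adE_mem_of_mem_expSubgroup hS (inv_mem (incl_mem s')) _ (hi a)) (hi b)
    rw [← e1, ← e2, map_mul, map_mul, map_mul, map_mul, map_mul, incl_exp, incl_exp, incl_exp,
      hij _ hm, hx.exp_log]
    simp only [A, lieExp_adE]
    group
  · intro s
    obtain ⟨h1, h2⟩ := smooth_coord hL hr s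
    -- In the chart at `s`: `(s exp a)⁻¹ = s⁻¹ exp(-Ad(s) a)`.
    let B : V → V := fun v ↦ - j (adE E (incl _ s) (i v))
    have hB : ContDiff ℝ ∞ B := by fun_prop
    have h3 := hB.contMDiff.contMDiffAt.comp s h1
    have h6 := smooth_mul_exp hL hr s⁻¹
    have h7 := ContMDiffAt.comp_of_eq h6 h3 (by simp [B, lieLog_one])
    refine h7.congr_of_eventuallyEq ?_
    filter_upwards [h2] with x e1
    simp only [Function.comp_apply]
    set a := j (lieLog E ((incl _ s)⁻¹ * incl _ x))
    apply incl_injective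
    have hm := adE_mem_of_mem_expSubgroup hS (incl_mem s) _ (hi a)
    rw [← e1, map_inv, map_mul, map_mul, map_inv, incl_exp, incl_exp]
    simp only [B, map_neg]
    rw [hij _ hm, lieExp_neg, lieExp_adE]
    group

/-- Every element is a product of exponentials, each joined to `1` by a path. -/
theorem connectedSpace [IsTopologicalGroup (LeafGroup (expSubgroup G S))] {hi : ∀ v, i v ∈ S}
    (hij : ∀ x ∈ S, i (j x) = x)
    (hL : IsLeaf (incl (expSubgroup G S)) (fun s v ↦ s * exp i hi v)
      (fun (s : LeafGroup (expSubgroup G S)) y ↦ j (lieLog E ((incl _ s)⁻¹ * y))) r)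
    (hr : 0 < r) : ConnectedSpace (LeafGroup (expSubgroup G S)) := by
  -- the one-parameter subgroups of elements of the subalgebra are continuous in the leaf topology
  have hline : ∀ v : V, Continuous (fun t : ℝ ↦ exp (G := G) i hi (t • v)) := by
    intro v
    rw [continuous_iff_continuousAt]
    intro t
    have h1 : ContinuousAt (fun t' : ℝ ↦ (t' - t) • v) t := by fun_prop
    have h2 := ContinuousAt.comp_of_eq
      (smooth_mul_exp hL hr (exp i hi (t • v))).continuousAt h1 (by simp)
    refine h2.congr (Eventually.of_forall fun t' ↦ ?_)
    apply incl_injective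
    simp only [Function.comp_apply, map_mul, incl_exp, map_smul]
    rw [← lieExp_add_smul]
    congr 2; ring
  let C : Subgroup (LeafGroup (expSubgroup G S)) := Subgroup.connectedComponentOfOne _
  have hexp : ∀ v, exp (G := G) i hi v ∈ C := by
    intro v
    have h1 : IsPreconnected (range fun t : ℝ ↦ exp (G := G) i hi (t • v)) :=
      isPreconnected_range (hline v)
    refine h1.subset_connectedComponent ⟨0, ?_⟩ ⟨1, ?_⟩
    · simp only [zero_smul]; exact exp_zero hi
    · simp
  have hall : ∀ g (hg : g ∈ Subgroup.closure (lieExp G '' (S : Set E))),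
      (⟨g, hg⟩ : LeafGroup (expSubgroup G S)) ∈ C := by
    intro g hg
    induction hg using Subgroup.closure_induction with
    | mem x hx =>
      obtain ⟨X, hX, rfl⟩ := hx
      have h1 := hexp (j X)
      have h2 : exp (G := G) i hi (j X) = ⟨lieExp G X, lieExp_mem_expSubgroup hX⟩ := by
        apply incl_injective
        rw [incl_exp, hij X hX]; rfl
      rwa [h2] at h1
    | one => exact C.one_mem
    | mul x y hx hy h1 h2 => exact C.mul_mem h1 h2
    | inv x hx h1 => exact C.inv_mem h1
  refine connectedSpace_iff_connectedComponent.2 ⟨1, ?_⟩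
  ext x
  simp only [mem_univ, iff_true]
  exact hall x.1 x.2

end LeafGroup

/-- A subspace closed under the bracket is the Lie algebra of a connected Lie subgroup. -/
theorem exists_lieSubgroup (hS : ∀ X ∈ S, ∀ Y ∈ S, lieBL E G X Y ∈ S) :
    ∃ L : LieSubgroup E G, ConnectedSpace L.Carrier ∧ ∀ X : E, X ∈ L.lieAlgebra ↔ X ∈ S := by
  obtain ⟨n, i, j, hi, hji, hij⟩ := S.exists_euclidean_param
  obtain ⟨r, hs⟩ := LeafGroup.exists_isSliceFamily (G := G) hS hi hji hij
  obtain ⟨top, cs, hm, hL⟩ := hs.exists_isLeaf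
  have hG := LeafGroup.lieGroup hS hij hL hs.pos
  have := LieGroup.isTopologicalGroup (EuclideanSpace ℝ (Fin n)) (LeafGroup (expSubgroup G S))
  refine ⟨{ Carrier := LeafGroup (expSubgroup G S), dim := n, incl := LeafGroup.incl _
            injective := LeafGroup.incl_injective _, contMDiff := hL.contMDiff hs
            injective_mfderiv := hL.injective_md hs }, LeafGroup.connectedSpace hij hL hs.pos,
    fun X ↦ ?_⟩
  have h1 := hL.mem_range_md_iff hs 1 X
  simp only [LeafGroup.exp_zero, mul_one, one_mul, LeafGroup.incl_exp] at h1
  refine Iff.trans h1 ?_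
  have h2 : ∀ w, md (EuclideanSpace ℝ (Fin n)) E (fun v ↦ lieExp G (i v)) 0 w = i w := by
    intro w
    rw [md_comp_apply (g := lieExp G) (f := i) 0 (contMDiff_lieExp.mdiff _)
      i.contDiff.contMDiff.contMDiffAt.mdiff, map_zero, md_lieExp_zero, md_eq_fderiv,
      ContinuousLinearMap.fderiv]
    rfl
  simp only [h2]
  exact ⟨fun ⟨w, hw⟩ ↦ hw ▸ hi w, fun h ↦ ⟨j X, hij X h⟩⟩

end LieSubgroupExistence

/-! ### Connected Lie groups are generated by exponentials -/

section Generation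

variable {E : Type*} [NormedAddCommGroup E] [NormedSpace ℝ E] [FiniteDimensional ℝ E]
  {G : Type*} [TopologicalSpace G] [ChartedSpace E G] [Group G] [LieGroup 𝓘(ℝ, E) ∞ G] [T2Space G]

variable (E G) in
theorem expSubgroup_top [ConnectedSpace G] : expSubgroup G (⊤ : Submodule ℝ E) = ⊤ := by
  have := LieGroup.isTopologicalGroup E G
  have h1 : IsOpen (expSubgroup G (⊤ : Submodule ℝ E) : Set G) := by
    refine Subgroup.isOpen_of_mem_nhds _ (g := 1) ?_
    filter_upwards [(isLocalParam_lieExp E G).right_inv] with g hg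
    rw [← hg]
    exact lieExp_mem_expSubgroup (G := G) (S := (⊤ : Submodule ℝ E)) Submodule.mem_top
  have h2 : IsClopen (expSubgroup G (⊤ : Submodule ℝ E) : Set G) :=
    ⟨Subgroup.isClosed_of_isOpen _ h1, h1⟩
  exact SetLike.coe_injective (h2.eq_univ ⟨1, one_mem _⟩)

variable (E G) in
include E in
/-- A connected Lie group is the union of the compact images of balls under the maps
`(X₁, …, Xₙ) ↦ exp X₁ ⋯ exp Xₙ`. -/
theorem sigmaCompactSpace_of_lieGroup [ConnectedSpace G] : SigmaCompactSpace G := by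
  have := LieGroup.isTopologicalGroup E G
  have hprop : ProperSpace E := FiniteDimensional.proper_real E
  have hc : Continuous (lieExp G : E → G) := contMDiff_lieExp.continuous
  let f : (n : ℕ) → (Fin n → E) → G := fun n x ↦
    ((List.finRange n).map fun k ↦ lieExp G (x k)).prod
  have hf : ∀ n, Continuous (f n) := fun n ↦ continuous_list_prod _ fun k _ ↦
    hc.comp (continuous_apply k)
  have hall : ∀ g : G, ∃ l : List E, (l.map (lieExp G)).prod = g := by
    intro g
    have hg : g ∈ expSubgroup G (⊤ : Submodule ℝ E) := by rw [expSubgroup_top]; trivial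
    rw [expSubgroup] at hg
    induction hg using Subgroup.closure_induction'' with
    | mem x hx => obtain ⟨X, -, rfl⟩ := hx; exact ⟨[X], by simp⟩
    | inv_mem x hx => obtain ⟨X, -, rfl⟩ := hx; exact ⟨[-X], by simp [lieExp_neg]⟩
    | one => exact ⟨[], by simp⟩
    | mul x y _ _ h1 h2 =>
      obtain ⟨l, rfl⟩ := h1
      obtain ⟨l', rfl⟩ := h2
      exact ⟨l ++ l', by simp⟩
  have h1 : (⋃ n, range (f n)) = univ := by
    refine eq_univ_of_forall fun g ↦ ?_
    obtain ⟨l, rfl⟩ := hall g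
    refine mem_iUnion.2 ⟨l.length, l.get, ?_⟩
    have h2 := congrArg (List.map (lieExp G)) (List.map_get_finRange l)
    rw [List.map_map] at h2
    exact congrArg List.prod h2
  rw [← isSigmaCompact_univ_iff, ← h1]
  exact isSigmaCompact_iUnion _ fun n ↦ isSigmaCompact_range (hf n)

end Generation

/-! ### Lie subgroups and their Lie algebras -/

namespace LieSubgroup

variable {E : Type*} [NormedAddCommGroup E] [NormedSpace ℝ E] [FiniteDimensional ℝ E]
  {G : Type*} [TopologicalSpace G] [ChartedSpace E G] [Group G] [LieGroup 𝓘(ℝ, E) ∞ G] [T2Space G]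
  (L : LieSubgroup E G)

/-- The model space of the subgroup. -/
abbrev model : Type := EuclideanSpace ℝ (Fin L.dim)

/-- The Lie algebra of the subgroup, as a subspace of the model space of `G`. -/
noncomputable def lieE : Submodule ℝ E := L.lieAlgebra

theorem mem_lieE_iff {X : E} : X ∈ L.lieE ↔ ∃ z, md L.model E L.incl (1 : L.Carrier) z = X := Iff.rfl

instance : T2Space L.Carrier :=
  T2Space.of_injective_continuous L.injective L.contMDiff.continuous

theorem incl_lieExp (z : L.model) :
    L.incl (lieExp L.Carrier z) = lieExp G (md L.model E L.incl (1 : L.Carrier) z) := by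
  have h1 : ContMDiff 𝓘(ℝ, ℝ) 𝓘(ℝ, E) ∞ (fun t : ℝ ↦ L.incl (lieExp L.Carrier (t • z))) :=
    L.contMDiff.comp (contMDiff_exp_line z)
  have h2 := lieExp_of_add (h1.mdiff 0) (fun s t ↦ by rw [lieExp_add_smul, map_mul]) 1
  rw [one_smul, one_smul, md_comp_apply (g := L.incl) (f := fun t : ℝ ↦ lieExp L.Carrier (t • z)) 0
    (L.contMDiff.mdiff _) ((contMDiff_exp_line z).mdiff 0), md_exp_line, zero_smul, lieExp_zero] at h2
  exact h2

theorem exists_incl_eq_lieExp {X : E} (hX : X ∈ L.lieE) :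
    ∃ z : L.model, L.incl (lieExp L.Carrier z) = lieExp G X := by
  obtain ⟨z, rfl⟩ := L.mem_lieE_iff.1 hX
  exact ⟨z, L.incl_lieExp z⟩

theorem adE_incl_mem (s : L.Carrier) {X : E} (hX : X ∈ L.lieE) : adE E (L.incl s) X ∈ L.lieE := by
  obtain ⟨z, rfl⟩ := L.mem_lieE_iff.1 hX
  refine L.mem_lieE_iff.2 ⟨adE L.model s z, ?_⟩
  have h1 := md_comp_apply (g := L.incl) (f := fun x ↦ s * x * s⁻¹) (1 : L.Carrier)
    (L.contMDiff.mdiff _) ((smooth_conj (E := L.model) s).mdiff _) z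
  have h2 := md_comp_apply (g := fun x ↦ L.incl s * x * (L.incl s)⁻¹) (f := L.incl) (1 : L.Carrier)
    ((smooth_conj (E := E) (L.incl s)).mdiff _) (L.contMDiff.mdiff _) z
  simp only [map_mul, map_inv, mul_one, mul_inv_cancel, map_one] at h1 h2
  exact h1.symm.trans h2

theorem lieBL_mem {X Y : E} (hX : X ∈ L.lieE) (hY : Y ∈ L.lieE) : lieBL E G X Y ∈ L.lieE := by
  have h := hasDerivAt_adE (G := G) X Y 0
  rw [zero_smul, lieExp_zero, adE_one] at h
  refine ReductiveDecomposition.mem_of_hasDerivAt L.lieE h (Eventually.of_forall fun t ↦ ?_)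
  obtain ⟨z, hz⟩ := L.exists_incl_eq_lieExp (L.lieE.smul_mem t hX)
  rw [← hz]
  exact L.adE_incl_mem _ hY

/-- Both groups are generated by the exponentials of the Lie algebra. -/
theorem range_incl [ConnectedSpace L.Carrier] : range L.incl = expSubgroup G L.lieE := by
  refine Subset.antisymm ?_ ?_
  · have h1 : expSubgroup L.Carrier (⊤ : Submodule ℝ L.model) ≤
        (expSubgroup G L.lieE).comap L.incl := by
      refine expSubgroup_le fun z _ ↦ ?_
      rw [Subgroup.mem_comap, L.incl_lieExp]
      exact lieExp_mem_expSubgroup (L.mem_lieE_iff.2 ⟨z, rfl⟩)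
    rintro _ ⟨s, rfl⟩
    exact h1 (by rw [expSubgroup_top]; trivial)
  · have h1 : expSubgroup G L.lieE ≤ L.incl.range := expSubgroup_le fun X hX ↦ by
      obtain ⟨z, hz⟩ := L.exists_incl_eq_lieExp hX
      exact ⟨_, hz⟩
    intro x hx
    exact h1 hx

theorem exists_eventually_incl_eq (s : L.Carrier) : ∃ m : L.Carrier → E, (∀ s', m s' ∈ L.lieE) ∧
    Tendsto m (𝓝 s) (𝓝 0) ∧ ∀ᶠ s' in 𝓝 s, L.incl s' = L.incl s * lieExp G (m s') := by
  have ht : Tendsto (fun s' ↦ s⁻¹ * s') (𝓝 s) (𝓝 1) := tendsto_inv_mul L.model continuousAt_id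
  refine ⟨fun s' ↦ md L.model E L.incl (1 : L.Carrier) (lieLog L.model (s⁻¹ * s')),
    fun s' ↦ L.mem_lieE_iff.2 ⟨_, rfl⟩,
    Tendsto.comp ((md L.model E L.incl (1 : L.Carrier)).continuous.tendsto' 0 0 (map_zero _))
      ((isLocalParam_lieExp L.model L.Carrier).continuousAt_symm.comp ht), ?_⟩
  filter_upwards [ht.eventually (isLocalParam_lieExp L.model L.Carrier).right_inv] with s' h1
  rw [← L.incl_lieExp, h1, map_mul, map_inv, mul_inv_cancel_left]

variable {F : Type*} [NormedAddCommGroup F] [NormedSpace ℝ F]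
  {M : Type*} [TopologicalSpace M] [ChartedSpace F M] [IsManifold 𝓘(ℝ, F) ∞ M]
  [MulAction G M] [ContMDiffSMul 𝓘(ℝ, E) 𝓘(ℝ, F) ∞ G M]

theorem smooth_incl_smul (o : M) : ContMDiff 𝓘(ℝ, L.model) 𝓘(ℝ, F) ∞
    (fun s : L.Carrier ↦ L.incl s • o) :=
  (smooth_orbit (E := E) (F := F) o).comp L.contMDiff

theorem mem_orbitTangentSpace_iff (o : M) (u : F) :
    u ∈ L.orbitTangentSpace o ↔ ∃ X ∈ L.lieE, fundE E F G o X = u := by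
  have h1 : ∀ z, md L.model F (fun s : L.Carrier ↦ L.incl s • o) 1 z =
      fundE E F G o (md L.model E L.incl (1 : L.Carrier) z) := by
    intro z
    rw [md_comp_apply (g := fun g : G ↦ g • o) (f := L.incl) (1 : L.Carrier)
      ((smooth_orbit (E := E) (F := F) o).mdiff _) (L.contMDiff.mdiff _), map_one]
    rfl
  constructor
  · rintro ⟨z, hz⟩
    exact ⟨_, ⟨z, rfl⟩, (h1 z).symm.trans hz⟩
  · rintro ⟨X, ⟨z, rfl⟩, rfl⟩
    exact ⟨z, h1 z⟩

end LieSubgroup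

/-! ### The orbit of a canonically embedded subalgebra -/

section OrbitSlices

variable {E : Type*} [NormedAddCommGroup E] [NormedSpace ℝ E] [FiniteDimensional ℝ E]
  {G : Type*} [TopologicalSpace G] [ChartedSpace E G] [Group G] [LieGroup 𝓘(ℝ, E) ∞ G] [T2Space G]
  {F : Type*} [NormedAddCommGroup F] [NormedSpace ℝ F] [FiniteDimensional ℝ F]
  {M : Type*} [TopologicalSpace M] [ChartedSpace F M] [IsManifold 𝓘(ℝ, F) ∞ M]
  [MulAction G M] [ContMDiffSMul 𝓘(ℝ, E) 𝓘(ℝ, F) ∞ G M]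
  [T2Space M] [SecondCountableTopology G] [MulAction.IsPretransitive G M] {o : M}
  {S : Submodule ℝ E}

/-- Elements of the subgroup near the identity split as `exp (u_𝔭) * exp (u_𝔨)` with `u` in the
subalgebra, by the inverse function theorem in the subalgebra. -/
theorem eventually_exists_product (hS : ∀ X ∈ S, ∀ Y ∈ S, lieBL E G X Y ∈ S) (pr : E →L[ℝ] E)
    (hpr : ∀ X ∈ S, pr X ∈ S) {U : Set E} (hU : U ∈ 𝓝 (0 : E)) :
    ∀ᶠ m in 𝓝 (0 : E), m ∈ S → ∃ u ∈ S, u ∈ U ∧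
      lieExp G m = lieExp G (pr u) * lieExp G (u - pr u) := by
  obtain ⟨p, hp, hp'⟩ := S.exists_clm_projection
  let q : E →L[ℝ] S := p.codRestrict S hp
  have hq : ∀ x (hx : x ∈ S), q x = ⟨x, hx⟩ := fun x hx ↦ Subtype.ext (hp' x hx)
  let μ : E × E → E := fun a ↦ lieLog E (lieExp G a.1 * lieExp G a.2)
  let B : S →L[ℝ] E × E := (pr.prod (ContinuousLinearMap.id ℝ E - pr)) ∘L S.subtypeL
  have hB0 : B 0 = 0 := map_zero B
  have hB : Tendsto B (𝓝 0) (𝓝 0) := B.continuous.tendsto' _ _ hB0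
  have hgood := hB.eventually (eventually_isGoodPair (G := G) hS)
  have hμ0 : μ 0 = 0 := by simp [μ, lieExp_zero, lieLog_one]
  obtain ⟨g, hg0, -, hg, hgs⟩ := exists_smooth_localInverse (f := fun u : S ↦ q (μ (B u))) (a := 0)
    (by
      filter_upwards [hgood] with u hu
      exact q.contDiff.contDiffAt.comp u (ContDiffAt.comp (g := μ) u hu.smooth B.contDiff.contDiffAt))
    (ContinuousLinearEquiv.refl ℝ S) (by
      have h1 : HasFDerivAt (𝕜 := ℝ) μ
          (ContinuousLinearMap.fst ℝ E E + ContinuousLinearMap.snd ℝ E E) (B 0) := by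
        rw [hB0]; exact hasFDerivAt_lieLog_mul E G
      refine (q.hasFDerivAt.comp (0 : S) (h1.comp (0 : S) B.hasFDerivAt)).congr_fderiv ?_
      refine ContinuousLinearMap.ext fun u ↦ ?_
      show q (pr u + ((u : E) - pr u)) = u
      rw [add_sub_cancel, hq _ u.2])
  have e0 : q (μ (B 0)) = 0 := by rw [hB0, hμ0, map_zero]
  rw [e0] at hg0 hg hgs
  have hgc : Tendsto g (𝓝 0) (𝓝 0) := by
    have := hgs.self_of_nhds.continuousAt.tendsto
    rwa [hg0] at this
  have hU' : ∀ᶠ u : S in 𝓝 0, (u : E) ∈ U :=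
    (continuous_subtype_val.tendsto' (0 : S) (0 : E) rfl).eventually hU
  have hall := hg.and (hgc.eventually (hgood.and hU'))
  rw [nhds_induced] at hall
  obtain ⟨T, hT, hTS⟩ := hall
  filter_upwards [hT] with m hm hmS
  obtain ⟨h1, h2, h3⟩ := hTS (show (⟨m, hmS⟩ : S) ∈ Subtype.val ⁻¹' T from hm)
  set u := g ⟨m, hmS⟩
  refine ⟨u, u.2, h3, ?_⟩
  have h4 : μ (B u) ∈ S := h2.mem (hpr _ u.2) (S.sub_mem u.2 (hpr _ u.2))
  have h5 : μ (B u) = m := by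
    rw [hq _ h4] at h1; exact congrArg Subtype.val h1
  rw [← h5]
  exact h2.exp_log

/-- The orbit of `o` under a subgroup, to be given a topology finer than the subspace topology. -/
def LeafOrbit (H : Subgroup G) (o : M) : Type _ := {x : M // ∃ h : LeafGroup H, LeafGroup.incl H h • o = x}

namespace LeafOrbit

/-- The inclusion of the orbit into the manifold. -/
def incl (H : Subgroup G) (o : M) : LeafOrbit H o → M := Subtype.val

/-- The orbit map. -/
def mk (H : Subgroup G) (o : M) (h : LeafGroup H) : LeafOrbit H o := ⟨LeafGroup.incl H h • o, h, rfl⟩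

theorem incl_mk (H : Subgroup G) (o : M) (h : LeafGroup H) :
    incl H o (mk H o h) = LeafGroup.incl H h • o := rfl

theorem incl_injective (H : Subgroup G) (o : M) : Function.Injective (incl H o) :=
  Subtype.val_injective

theorem mk_surjective (H : Subgroup G) (o : M) : Function.Surjective (mk H o) := by
  rintro ⟨x, h, rfl⟩; exact ⟨h, rfl⟩

end LeafOrbit

/-- Conditions on a point of `E` close to the origin, relative to a local inverse `l` of
`v ↦ exp (J v) • o`. -/
structure IsGoodOrbitPoint (d : ReductiveDecomposition E G o) (F : Type*) [NormedAddCommGroup F]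
    [NormedSpace ℝ F] [FiniteDimensional ℝ F] [ChartedSpace F M] [IsManifold 𝓘(ℝ, F) ∞ M]
    [ContMDiffSMul 𝓘(ℝ, E) 𝓘(ℝ, F) ∞ G M] (S : Submodule ℝ E) (l : M → F) (x : E) : Prop where
  mem : x ∈ S → d.jE F (l (lieExp G x • o)) ∈ S
  exp_log : lieExp G (d.jE F (l (lieExp G x • o))) • o = lieExp G x • o
  log_exp : x ∈ d.pE → d.jE F (l (lieExp G x • o)) = x
  smooth : ContMDiffAt 𝓘(ℝ, F) 𝓘(ℝ, F) ∞ l (lieExp G x • o)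

theorem exists_eventually_isGoodOrbitPoint (d : ReductiveDecomposition E G o)
    (hS : ∀ X ∈ S, ∀ Y ∈ S, lieBL E G X Y ∈ S) (hp : ∀ X ∈ S, d.prP X ∈ S) :
    ∃ l : M → F, l o = 0 ∧ ∀ᶠ x in 𝓝 (0 : E), IsGoodOrbitPoint d F S l x := by
  obtain ⟨l, hl0, hl1, hl2, hl3⟩ := d.exists_logM F
  have hc : Continuous (fun x : E ↦ lieExp G x • o) :=
    (smooth_orbit (E := E) (F := F) o).continuous.comp contMDiff_lieExp.continuous
  have hc0 : Tendsto (fun x : E ↦ lieExp G x • o) (𝓝 0) (𝓝 o) :=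
    hc.tendsto' _ _ (by rw [lieExp_zero, one_smul])
  have h1 : ∀ᶠ u in 𝓝 (0 : E), d.jE F (l (lieExp G (d.prP u) • o)) = d.prP u := by
    filter_upwards [((fundE E F G o).continuous.tendsto' 0 0 (map_zero _)).eventually hl1] with u hu
    rw [d.jE_fundE] at hu
    rw [hu, d.jE_fundE]
  refine ⟨l, hl0, ?_⟩
  filter_upwards [eventually_exists_product hS d.prP hp h1, hc0.eventually hl2, hc0.eventually hl3,
    h1] with x h2 h3 h4 h5
  refine ⟨fun hx ↦ ?_, h3, fun hx ↦ ?_, h4⟩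
  · obtain ⟨u, hu, h6, h7⟩ := h2 hx
    have h8 : lieExp G x • o = lieExp G (d.prP u) • o := by
      rw [h7, mul_smul, d.exp_smul_of_mem_kE F]
      have := d.prK_add_prP u
      rw [← eq_sub_iff_add_eq] at this
      rw [← this]; exact d.prK_mem u
    have h9 : d.jE F (l (lieExp G (d.prP u) • o)) = d.prP u := h6
    rw [h8, h9]
    exact hp u hu
  · rwa [d.prP_of_mem hx] at h5

variable {V : Type*} [NormedAddCommGroup V] [NormedSpace ℝ V] {i : V →L[ℝ] E} {j : E →L[ℝ] V}

/-- The maps `v ↦ h exp (i v) • o`, for `h` in the subgroup, are slices of the orbit. -/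
theorem LeafOrbit.exists_isSliceFamily (d : ReductiveDecomposition E G o)
    (hS : ∀ X ∈ S, ∀ Y ∈ S, lieBL E G X Y ∈ S) (hp : ∀ X ∈ S, d.prP X ∈ S)
    (hi : ∀ v, i v ∈ S) (hi' : ∀ v, i v ∈ d.pE)
    (hji : ∀ v, j (i v) = v) (hij : ∀ x ∈ S, x ∈ d.pE → i (j x) = x) :
    ∃ (l : M → F) (r : ℝ), l o = 0 ∧ (∀ᶠ x in 𝓝 (0 : E), IsGoodOrbitPoint d F S l x) ∧
      IsSliceFamily F (incl (expSubgroup G S) o) (fun h v ↦ mk _ o (h * LeafGroup.exp i hi v))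
      (fun (h : LeafGroup (expSubgroup G S)) y ↦ j (d.jE F (l ((LeafGroup.incl _ h)⁻¹ • y)))) r := by
  obtain ⟨l, hl0, hl⟩ := exists_eventually_isGoodOrbitPoint (F := F) d hS hp
  obtain ⟨r, hr, hball⟩ := Metric.eventually_nhds_iff_ball.1
    ((i.continuous.tendsto' 0 0 (map_zero i)).eventually
      ((eventually_isGoodPoint (G := G) hS).and hl.eventually_nhds))
  have hc : ∀ (h : LeafGroup (expSubgroup G S)) (v : V), (LeafGroup.incl _ h)⁻¹ •
      incl (expSubgroup G S) o (mk _ o (h * LeafGroup.exp i hi v)) = lieExp G (i v) • o := by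
    intro h v
    rw [incl_mk, map_mul, LeafGroup.incl_exp, mul_smul, inv_smul_smul]
  have hsm : ContMDiff 𝓘(ℝ, E) 𝓘(ℝ, F) ∞ (fun x : E ↦ lieExp G x • o) :=
    (smooth_orbit (E := E) (F := F) o).comp contMDiff_lieExp
  refine ⟨l, r, hl0, hl, hr, fun x ↦ ?_, fun h v hv ↦ ?_, ?_, fun h v hv ↦ ?_, fun h v hv ↦ ?_⟩
  · obtain ⟨h, rfl⟩ := mk_surjective _ o x
    exact ⟨h, by rw [LeafGroup.exp_zero, mul_one]⟩
  · simp only [hc, (hball v hv).2.self_of_nhds.log_exp (hi' v), hji]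
  · intro a b v hv w hw e
    have e' : LeafGroup.incl _ a • lieExp G (i v) • o = LeafGroup.incl _ b • lieExp G (i w) • o := by
      simpa only [incl_mk, map_mul, LeafGroup.incl_exp, mul_smul] using congrArg (incl _ o) e
    -- `k` is the isotropy element that relates the two slices at their common point
    set k : G := (lieExp G (i w))⁻¹ * (LeafGroup.incl _ b)⁻¹ * LeafGroup.incl _ a * lieExp G (i v)
      with hk
    have hkH : k ∈ expSubgroup G S := by
      rw [hk, ← lieExp_neg]
      exact mul_mem (mul_mem (mul_mem (lieExp_mem_expSubgroup (S.neg_mem (hi w)))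
        (inv_mem (LeafGroup.incl_mem b))) (LeafGroup.incl_mem a)) (lieExp_mem_expSubgroup (hi v))
    have hko : k • o = o := by
      simp only [hk, mul_smul, e', inv_smul_smul]
    have hz := (hball v hv).1.tendsto_diff.comp i.continuous.continuousAt
    have hz' := ((adE E k).continuous.tendsto' 0 0 (map_zero _)).comp hz
    have hm := (hball w hw).1.tendsto_mul.comp hz'
    have hlw : ContinuousAt (fun m : E ↦ j (d.jE F (l (lieExp G m • o)))) (i w) := by
      have h1 := (hball w hw).2.self_of_nhds.smooth.continuousAt
      have h2 := ContinuousAt.comp (g := l) (f := fun m : E ↦ lieExp G m • o) h1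
        hsm.continuous.continuousAt
      exact (j.continuous.comp (d.jE F).continuous).continuousAt.comp h2
    have hw' : ∀ᶠ m in 𝓝 (i w), j (d.jE F (l (lieExp G m • o))) ∈ Metric.ball 0 r := by
      refine hlw.eventually (Metric.isOpen_ball.mem_nhds ?_)
      show j (d.jE F (l (lieExp G (i w) • o))) ∈ Metric.ball 0 r
      rwa [(hball w hw).2.self_of_nhds.log_exp (hi' w), hji]
    filter_upwards [i.continuous.continuousAt.eventually (hball v hv).1.eventually_diff,
      hz'.eventually (hball w hw).1.eventually_right, hm.eventually (hball w hw).2,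
      hm.eventually hw'] with v' h1 h2 h3 h4
    simp only [Function.comp_apply] at h2 h3 h4
    set z := lieLog E (lieExp G (-i v) * lieExp G (i v')) with hzdef
    set m := lieLog E (lieExp G (i w) * lieExp G (adE E k z)) with hmdef
    have h5 : incl (expSubgroup G S) o (mk _ o (a * LeafGroup.exp i hi v')) =
        LeafGroup.incl _ b • lieExp G m • o := by
      have e1 : lieExp G (i v') = lieExp G (i v) * lieExp G z := by
        rw [h1.exp_log, lieExp_neg, mul_inv_cancel_left]
      have e2 : k⁻¹ • o = o := by rw [inv_smul_eq_iff, hko]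
      rw [h2.exp_log, lieExp_adE, incl_mk, map_mul, LeafGroup.incl_exp, e1]
      simp only [mul_smul, e2]
      simp only [← mul_smul]
      congr 1
      rw [hk]; group
    have h6 : m ∈ S := h2.mem (hi w)
      (adE_mem_of_mem_expSubgroup hS hkH _ (h1.mem (S.neg_mem (hi v)) (hi v')))
    rw [h5, inv_smul_smul]
    refine ⟨h4, incl_injective _ _ ?_⟩
    rw [h5, incl_mk, map_mul, LeafGroup.incl_exp, hij _ (h3.mem h6) (d.jE_mem _), mul_smul,
      h3.exp_log]
  · simp only [incl_mk, map_mul, LeafGroup.incl_exp, mul_smul]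
    exact ((smooth_smul E (LeafGroup.incl _ h)).comp (hsm.comp i.contDiff.contMDiff)).contMDiffAt
  · have h1 := (hball v hv).2.self_of_nhds.smooth
    rw [← hc h v] at h1
    have h2 := ContMDiffAt.comp (I' := 𝓘(ℝ, F)) (g := l)
      (f := fun y ↦ (LeafGroup.incl _ h)⁻¹ • y)
      _ h1 (smooth_smul E (LeafGroup.incl _ h)⁻¹).contMDiffAt
    exact ContMDiffAt.comp (I' := 𝓘(ℝ, F)) (g := fun x ↦ j (d.jE F x)) _
      (j.contDiff.comp (d.jE F).contDiff).contMDiff.contMDiffAt h2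

end OrbitSlices

section LocalGeodesics

variable {F : Type*} [NormedAddCommGroup F] [NormedSpace ℝ F] [FiniteDimensional ℝ F]
  {M : Type*} [TopologicalSpace M] [ChartedSpace F M] [IsManifold 𝓘(ℝ, F) ∞ M]
  [RiemannianBundle (fun x : M ↦ TangentSpace 𝓘(ℝ, F) x)]
  [IsContMDiffRiemannianBundle 𝓘(ℝ, F) ∞ F (fun x : M ↦ TangentSpace 𝓘(ℝ, F) x)]
  {H : Type*} [NormedAddCommGroup H] [NormedSpace ℝ H] [FiniteDimensional ℝ H]
  {N : Type*} [TopologicalSpace N] [ChartedSpace H N] [IsManifold 𝓘(ℝ, H) ∞ N]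

theorem IsGeodesicOn.of_eventuallyEq {f : N → M} (hf : ContMDiff 𝓘(ℝ, H) 𝓘(ℝ, F) ∞ f)
    {γ : ℝ → N} {J : Set ℝ} (hJ : IsOpen J)
    (h : ∀ t ∈ J, ∃ σ : ℝ → N, IsGeodesicOn (metricOf F H f) σ univ ∧ γ =ᶠ[𝓝 t] σ) :
    IsGeodesicOn (metricOf F H f) γ J := by
  rw [isGeodesicOn_iff hf hJ]
  intro t ht
  obtain ⟨σ, hσ, e⟩ := h t ht
  obtain ⟨h1, h2⟩ := (isGeodesicOn_iff hf isOpen_univ).1 hσ t trivial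
  refine ⟨h1.congr_of_eventuallyEq e, ?_⟩
  rw [e.self_of_nhds]
  exact h2.congr e.symm

end LocalGeodesics

section OrbitSubmanifold

variable {E : Type*} [NormedAddCommGroup E] [NormedSpace ℝ E] [FiniteDimensional ℝ E]
  {G : Type*} [TopologicalSpace G] [ChartedSpace E G] [Group G] [LieGroup 𝓘(ℝ, E) ∞ G] [T2Space G]
  {F : Type*} [NormedAddCommGroup F] [NormedSpace ℝ F] [FiniteDimensional ℝ F]
  {M : Type*} [TopologicalSpace M] [ChartedSpace F M] [IsManifold 𝓘(ℝ, F) ∞ M]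
  [MulAction G M] [ContMDiffSMul 𝓘(ℝ, E) 𝓘(ℝ, F) ∞ G M]
  [T2Space M] [SecondCountableTopology G] [MulAction.IsPretransitive G M] {o : M}
  {S : Submodule ℝ E}

/-- The element of the subgroup given by `g`. -/
def LeafGroup.ofMem {H : Subgroup G} {g : G} (hg : g ∈ H) : LeafGroup H := ⟨g, hg⟩

theorem LeafGroup.incl_ofMem {H : Subgroup G} {g : G} (hg : g ∈ H) :
    LeafGroup.incl H (LeafGroup.ofMem hg) = g := rfl

namespace LeafOrbit

variable {V : Type*} [NormedAddCommGroup V] [NormedSpace ℝ V]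

/-- The element of the orbit given by `g` in the subgroup. -/
def ofMem {H : Subgroup G} (o : M) {g : G} (hg : g ∈ H) : LeafOrbit H o := mk H o (LeafGroup.ofMem hg)

theorem incl_ofMem {H : Subgroup G} (o : M) {g : G} (hg : g ∈ H) :
    incl H o (ofMem o hg) = g • o := rfl

theorem exists_eq_ofMem {H : Subgroup G} (x : LeafOrbit H o) : ∃ g, ∃ hg : g ∈ H, x = ofMem o hg := by
  obtain ⟨h, rfl⟩ := mk_surjective H o x
  exact ⟨h.1, h.2, rfl⟩

/-- The manifold structure of the orbit comes from the slices `v ↦ h exp (i v) • o`, where `i`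
parametrises the intersection of the subalgebra with `𝔭`. -/
structure IsOrbitLeaf [TopologicalSpace (LeafOrbit (expSubgroup G S) o)]
    [ChartedSpace V (LeafOrbit (expSubgroup G S) o)] (d : ReductiveDecomposition E G o)
    (i : V →L[ℝ] E) (j : E →L[ℝ] V) (hi : ∀ v, i v ∈ S) (l : M → F) (r : ℝ) : Prop where
  mem_pE : ∀ v, i v ∈ d.pE
  right_inv : ∀ x ∈ S, x ∈ d.pE → i (j x) = x
  map_o : l o = 0
  good : ∀ᶠ x in 𝓝 (0 : E), IsGoodOrbitPoint d F S l x
  slices : IsSliceFamily F (incl (expSubgroup G S) o) (fun h v ↦ mk _ o (h * LeafGroup.exp i hi v))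
    (fun (h : LeafGroup (expSubgroup G S)) y ↦ j (d.jE F (l ((LeafGroup.incl _ h)⁻¹ • y)))) r
  leaf : IsLeaf (incl (expSubgroup G S) o) (fun h v ↦ mk _ o (h * LeafGroup.exp i hi v))
    (fun (h : LeafGroup (expSubgroup G S)) y ↦ j (d.jE F (l ((LeafGroup.incl _ h)⁻¹ • y)))) r

namespace IsOrbitLeaf

variable {i : V →L[ℝ] E} {j : E →L[ℝ] V}
  [TopologicalSpace (LeafOrbit (expSubgroup G S) o)] [ChartedSpace V (LeafOrbit (expSubgroup G S) o)]
  {l : M → F} {r : ℝ} {d : ReductiveDecomposition E G o} {hi : ∀ v, i v ∈ S}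

theorem smooth_param (hL : IsOrbitLeaf d i j hi l r) (h : LeafGroup (expSubgroup G S)) :
    ContMDiffAt 𝓘(ℝ, V) 𝓘(ℝ, V) ∞ (fun v ↦ LeafOrbit.mk _ o (h * LeafGroup.exp i hi v)) 0 :=
  hL.leaf.smooth_param h 0 (Metric.mem_ball_self hL.slices.pos)

/-- The orbit map of the Lie subgroup is continuous for the leaf topology. -/
theorem continuous_orbit (hL : IsOrbitLeaf d i j hi l r) (L : LieSubgroup E G) (hLS : L.lieE = S)
    {φ : L.Carrier → LeafOrbit (expSubgroup G S) o} [ConnectedSpace L.Carrier]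
    (hφ : ∀ s, incl _ o (φ s) = L.incl s • o) : Continuous φ := by
  have := LieGroup.isTopologicalGroup L.model L.Carrier
  rw [continuous_iff_continuousAt]
  intro s
  have hs : L.incl s ∈ expSubgroup G S := by
    rw [← hLS, ← SetLike.mem_coe, ← L.range_incl]; exact ⟨s, rfl⟩
  let h : LeafGroup (expSubgroup G S) := LeafGroup.ofMem hs
  obtain ⟨m, hmS, hm0, hm⟩ := L.exists_eventually_incl_eq s
  rw [hLS] at hmS
  have hf : Tendsto (fun x : E ↦ j (d.jE F (l (lieExp G x • o)))) (𝓝 0) (𝓝 0) := by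
    have h1 := hL.good.self_of_nhds.smooth.continuousAt
    have h2 := ContinuousAt.comp (g := l) (f := fun m : E ↦ lieExp G m • o) h1
      ((smooth_orbit (E := E) (F := F) o).comp contMDiff_lieExp).continuous.continuousAt
    have h3 := ((j.continuous.comp (d.jE F).continuous).continuousAt.comp h2).tendsto
    simpa [Function.comp_def, lieExp_zero, hL.map_o] using h3
  have h4 := (hL.smooth_param h).continuousAt.tendsto.comp (hf.comp hm0)
  have hval : ∀ᶠ s' in 𝓝 s, LeafOrbit.mk _ o (h * LeafGroup.exp i hi
      (j (d.jE F (l (lieExp G (m s') • o))))) = φ s' := by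
    filter_upwards [hm, hm0.eventually hL.good] with s' h1 h2
    apply incl_injective
    rw [hφ, incl_mk, map_mul, LeafGroup.incl_exp, hL.right_inv _ (h2.mem (hmS s')) (d.jE_mem _),
      mul_smul, h2.exp_log, h1, mul_smul]
    rfl
  have h5 := h4.congr' hval
  have h6 : LeafOrbit.mk _ o (h * LeafGroup.exp i hi 0) = φ s := by
    apply incl_injective
    rw [hφ, LeafGroup.exp_zero, mul_one]; rfl
  rwa [h6] at h5

/-- The curves `t ↦ g exp (tX) • o` are smooth in the orbit. -/
theorem smooth_line (hL : IsOrbitLeaf d i j hi l r) {g : G} (hg : g ∈ expSubgroup G S) {X : E}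
    (hX : X ∈ S) (hX' : X ∈ d.pE) : ContMDiff 𝓘(ℝ, ℝ) 𝓘(ℝ, V) ∞ (fun t : ℝ ↦
      ofMem o (mul_mem hg (lieExp_mem_expSubgroup (G := G) (S.smul_mem t hX)))) := by
  intro t
  have h1 : ContMDiffAt 𝓘(ℝ, ℝ) 𝓘(ℝ, V) ∞ (fun t' : ℝ ↦ (t' - t) • j X) t :=
    ((contDiff_id.sub contDiff_const).smul contDiff_const).contMDiff.contMDiffAt
  have h2 := ContMDiffAt.comp_of_eq
    (hL.smooth_param (LeafGroup.ofMem
    (mul_mem hg (lieExp_mem_expSubgroup (S.smul_mem t hX))))) h1 (by simp)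
  refine h2.congr_of_eventuallyEq (Eventually.of_forall fun t' ↦ ?_)
  apply incl_injective
  rw [incl_ofMem, Function.comp_apply, incl_mk, map_mul, LeafGroup.incl_exp, map_smul, LeafGroup.incl_ofMem,
    hL.right_inv X hX hX', mul_assoc, ← lieExp_add_smul]
  congr 4; ring

/-- The tangent space of the orbit at `g • o`. -/
theorem mem_range_md_iff (hL : IsOrbitLeaf d i j hi l r) {g : G} (hg : g ∈ expSubgroup G S) (u : F) :
    (∃ w, md V F (incl (expSubgroup G S) o) (ofMem o hg) w = u) ↔
      ∃ X ∈ S ⊓ d.pE, push F g o (fundE E F G o X) = u := by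
  have h1 := hL.leaf.mem_range_md_iff hL.slices (LeafGroup.ofMem hg) u
  simp only [LeafGroup.exp_zero, mul_one, incl_mk, map_mul, LeafGroup.incl_exp,
    LeafGroup.incl_ofMem] at h1
  refine Iff.trans h1 ?_
  have h2 : ∀ w, md V F (fun v ↦ (g * lieExp G (i v)) • o)
      0 w = push F g o (fundE E F G o (i w)) := by
    intro w
    rw [md_comp_apply (g := fun z ↦ (g * lieExp G z) • o)
      (f := i) 0 ((contMDiff_mul_exp_smul _ o).mdiff _) i.contDiff.contMDiff.contMDiffAt.mdiff,
      map_zero, md_mul_exp_smul_zero, md_eq_fderiv, ContinuousLinearMap.fderiv]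
  simp only [h2]
  constructor
  · rintro ⟨w, rfl⟩
    exact ⟨i w, ⟨hi w, hL.mem_pE w⟩, rfl⟩
  · rintro ⟨X, hX, rfl⟩
    exact ⟨j X, by rw [hL.right_inv X hX.1 hX.2]⟩

variable [FiniteDimensional ℝ V] [IsManifold 𝓘(ℝ, V) ∞ (LeafOrbit (expSubgroup G S) o)]
  [RiemannianBundle (fun x : M ↦ TangentSpace 𝓘(ℝ, F) x)]
  [IsContMDiffRiemannianBundle 𝓘(ℝ, F) ∞ F (fun x : M ↦ TangentSpace 𝓘(ℝ, F) x)]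

theorem isGeodesicOn_line (hL : IsOrbitLeaf d i j hi l r) (hiso : ActsIsometrically F G M)
    (hd : d.IsNaturallyReductive F) {g : G} (hg : g ∈ expSubgroup G S) {X : E}
    (hX : X ∈ S) (hX' : X ∈ d.pE) :
    IsGeodesicOn (metricOf F V (incl (expSubgroup G S) o)) (fun t : ℝ ↦
      ofMem o (mul_mem hg (lieExp_mem_expSubgroup (G := G) (S.smul_mem t hX)))) univ :=
  IsGeodesicOn.of_comp (hL.leaf.contMDiff hL.slices) isOpen_univ
    (fun t _ ↦ hL.smooth_line hg hX hX' t) (isGeodesicOn_exp hiso d hd g hX')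

/-- Every tangent vector of the orbit at `g • o` is the velocity, at any prescribed time, of one of
the geodesics `t ↦ g' exp (tX) • o`. -/
theorem exists_line (hL : IsOrbitLeaf d i j hi l r) (x : LeafOrbit (expSubgroup G S) o) (v : V)
    (t₀ : ℝ) : ∃ g, ∃ hg : g ∈ expSubgroup G S, ∃ X, ∃ hX : X ∈ S, X ∈ d.pE ∧
      ofMem o (mul_mem hg (lieExp_mem_expSubgroup (G := G) (S.smul_mem t₀ hX))) = x ∧
      md ℝ V (fun t : ℝ ↦ ofMem o
        (mul_mem hg (lieExp_mem_expSubgroup (G := G) (S.smul_mem t hX)))) t₀ 1 = v := by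
  obtain ⟨g, hg, rfl⟩ := exists_eq_ofMem x
  obtain ⟨X, hX, h1⟩ := (hL.mem_range_md_iff hg _).1 ⟨v, rfl⟩
  have hx : (g * lieExp G (t₀ • (-X))) * lieExp G (t₀ • X) = g := by
    rw [mul_assoc, smul_neg, lieExp_neg, inv_mul_cancel, mul_one]
  have hg' := mul_mem hg (lieExp_mem_expSubgroup (G := G) (S.smul_mem t₀ (S.neg_mem hX.1)))
  have hpt : ofMem o (mul_mem hg' (lieExp_mem_expSubgroup (G := G) (S.smul_mem t₀ hX.1))) =
      ofMem o hg := by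
    apply incl_injective
    rw [incl_ofMem, incl_ofMem, hx]
  refine ⟨_, hg', X, hX.1, hX.2, hpt, ?_⟩
  apply hL.leaf.injective_md hL.slices (ofMem o hg)
  have h2 := md_comp_apply (g := incl (expSubgroup G S) o) (f := fun t : ℝ ↦ ofMem o
        (mul_mem hg' (lieExp_mem_expSubgroup (G := G) (S.smul_mem t hX.1)))) t₀
    (hL.leaf.contMDiff hL.slices _).mdiff (hL.smooth_line hg' hX.1 hX.2 t₀).mdiff 1
  have h3 := md_mul_exp_line_smul (F := F) (g * lieExp G (t₀ • (-X))) X o t₀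
  rw [hx] at h3
  rw [hpt] at h2
  rw [← h1, ← h3]
  exact h2.symm

end IsOrbitLeaf

end LeafOrbit

theorem ImmersedSubmanifold.gaussMap_eq_iff {N : ImmersedSubmanifold F M} {p : N.Carrier} {x : M}
    {U : Submodule ℝ (TangentSpace 𝓘(ℝ, F) x)} :
    N.gaussMap p = ⟨x, U⟩ ↔ N.toFun p = x ∧ ∀ u : F,
      (∃ w, md (EuclideanSpace ℝ (Fin N.dim)) F N.toFun p w = u) ↔ u ∈ U := by
  constructor
  · intro h
    rw [gaussMap, Sigma.mk.injEq] at h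
    obtain ⟨rfl, h2⟩ := h
    exact ⟨rfl, fun u ↦ (Submodule.ext_iff.1 (eq_of_heq h2)) u⟩
  · rintro ⟨rfl, h⟩
    exact congrArg (Sigma.mk _) (Submodule.ext h)

variable [RiemannianBundle (fun x : M ↦ TangentSpace 𝓘(ℝ, F) x)]
  [IsContMDiffRiemannianBundle 𝓘(ℝ, F) ∞ F (fun x : M ↦ TangentSpace 𝓘(ℝ, F) x)]

/-- In a naturally reductive space the orbit of a canonically embedded subalgebra is a complete,
`D`-invariant, totally geodesic submanifold, whose geodesics are the curves `t ↦ g exp (tX) • o`. -/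
theorem exists_orbit_submanifold (hiso : ActsIsometrically F G M) (d : ReductiveDecomposition E G o)
    (hd : d.IsNaturallyReductive F) (hS : ∀ X ∈ S, ∀ Y ∈ S, lieBL E G X Y ∈ S)
    (hp : ∀ X ∈ S, d.prP X ∈ S) {U : Submodule ℝ (TangentSpace 𝓘(ℝ, F) o)}
    (hU : ∀ u : F, u ∈ U ↔ ∃ X ∈ S ⊓ d.pE, fundE E F G o X = u) :
    ∃ N : ImmersedSubmanifold F M, ConnectedSpace N.Carrier ∧
      Function.Injective N.toFun ∧ N.IsComplete ∧ N.IsTotallyGeodesic ∧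
      (∀ p, d.IsDInvariant (N.toFun p) (N.tangentSpace p)) ∧ ∃ p, N.gaussMap p = ⟨o, U⟩ := by
  obtain ⟨n, i, j, hi, hji, hij⟩ := (S ⊓ d.pE).exists_euclidean_param
  have hi1 : ∀ v, i v ∈ S := fun v ↦ (hi v).1
  obtain ⟨l, r, hl0, hl, hs⟩ := LeafOrbit.exists_isSliceFamily (F := F) d hS hp hi1
    (fun v ↦ (hi v).2) hji (fun x h1 h2 ↦ hij x ⟨h1, h2⟩)
  obtain ⟨top, cs, hm, hleaf⟩ := hs.exists_isLeaf
  have hL : LeafOrbit.IsOrbitLeaf d i j hi1 l r :=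
    ⟨fun v ↦ (hi v).2, fun x h1 h2 ↦ hij x ⟨h1, h2⟩, hl0, hl, hs, hleaf⟩
  obtain ⟨L, hLc, hLS⟩ := exists_lieSubgroup (G := G) hS
  have hLS' : L.lieE = S := Submodule.ext hLS
  have hrange : range L.incl = expSubgroup G S := by rw [L.range_incl, hLS']
  let φ : L.Carrier → LeafOrbit (expSubgroup G S) o := fun s ↦
    LeafOrbit.ofMem o (g := L.incl s) (by rw [← SetLike.mem_coe, ← hrange]; exact ⟨s, rfl⟩)
  have hφc : Continuous φ := hL.continuous_orbit L hLS' (fun s ↦ rfl)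
  have hφs : Function.Surjective φ := by
    intro x
    obtain ⟨g, hg, rfl⟩ := LeafOrbit.exists_eq_ofMem x
    have hg' : g ∈ range L.incl := by rw [hrange]; exact hg
    obtain ⟨s, rfl⟩ := hg'
    exact ⟨s, rfl⟩
  have hconn : ConnectedSpace (LeafOrbit (expSubgroup G S) o) := hφs.connectedSpace hφc
  -- The orbit is a continuous image of the Lie subgroup, which is connected and σ-compact.
  have hsig : SigmaCompactSpace (LeafOrbit (expSubgroup G S) o) := by
    have := sigmaCompactSpace_of_lieGroup L.model L.Carrier
    rw [← isSigmaCompact_univ_iff, ← hφs.range_eq]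
    exact isSigmaCompact_range hφc
  have hsc : SecondCountableTopology (LeafOrbit (expSubgroup G S) o) :=
    ChartedSpace.secondCountable_of_sigmaCompact (EuclideanSpace ℝ (Fin n)) _
  have ht2 := hleaf.t2Space hs (LeafOrbit.incl_injective _ _)
  have hf := hleaf.contMDiff hs
  have hinj := hleaf.injective_md hs
  have htan := fun {g : G} (hg : g ∈ expSubgroup G S) ↦ hL.mem_range_md_iff hg
  refine ⟨{ Carrier := LeafOrbit (expSubgroup G S) o, dim := n, toFun := LeafOrbit.incl _ o
            contMDiff := hf, injective_mfderiv := hinj }, hconn, LeafOrbit.incl_injective _ _,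
    ?_, ?_, ?_, ?_⟩
  · -- Completeness: every tangent vector is the velocity of a line `t ↦ g exp(tX) • o`.
    intro x v
    obtain ⟨g, hg, X, hX, hX', h1, h2⟩ := hL.exists_line x v 0
    refine ⟨_, hL.isGeodesicOn_line hiso hd hg hX hX', ?_⟩
    subst h1
    exact congrArg (fun w : EuclideanSpace ℝ (Fin n) ↦ (⟨LeafOrbit.ofMem o _, w⟩ :
      TangentBundle (𝓡 n) (LeafOrbit (expSubgroup G S) o))) h2
  · -- Geodesics of the orbit are locally such lines, which are geodesics of `M`.
    intro γ J hJ _ hγ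
    have hid : ContMDiff 𝓘(ℝ, F) 𝓘(ℝ, F) ∞ (fun x : M ↦ x) := contMDiff_id
    rw [← metricOf_id]
    refine IsGeodesicOn.of_eventuallyEq hid hJ fun t ht ↦ ?_
    obtain ⟨g, hg, X, hX, hX', h1, h2⟩ := hL.exists_line (γ t)
      (md ℝ (EuclideanSpace ℝ (Fin n)) γ t 1) t
    refine ⟨_, isGeodesicOn_exp hiso d hd g hX', ?_⟩
    have hσ := hL.isGeodesicOn_line hiso hd hg hX hX'
    have h3 := IsGeodesicOn.eventuallyEq hf hinj hJ (γ := γ) hγ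
      ((isGeodesicOn_iff hf hJ).2 fun t _ ↦ (isGeodesicOn_iff hf isOpen_univ).1 hσ t trivial)
      ht h1.symm h2.symm
    filter_upwards [h3] with s hs
    exact congrArg (LeafOrbit.incl _ o) hs
  · intro p
    obtain ⟨g, hg, rfl⟩ := LeafOrbit.exists_eq_ofMem p
    refine (isDInvariant_iff hiso d hd g (W := S ⊓ d.pE) inf_le_right (htan hg)).2 ?_
    exact fun X hX Y hY ↦ ⟨hp _ (hS X hX.1 Y hY.1), d.prP_mem _⟩
  · refine ⟨LeafOrbit.ofMem o (one_mem _), ImmersedSubmanifold.gaussMap_eq_iff.2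
      ⟨one_smul G o, fun u ↦ (htan (one_mem _) u).trans ?_⟩⟩
    rw [hU]
    simp only [push_one, ContinuousLinearMap.id_apply]

end OrbitSubmanifold

/-! ### Totally geodesic immersions near a point -/

section Retraction

variable {F : Type*} [NormedAddCommGroup F] [NormedSpace ℝ F] [FiniteDimensional ℝ F]
  {M : Type*} [TopologicalSpace M] [ChartedSpace F M] [IsManifold 𝓘(ℝ, F) ∞ M]
  {H : Type*} [NormedAddCommGroup H] [NormedSpace ℝ H] [FiniteDimensional ℝ H]
  {N : Type*} [TopologicalSpace N] [ChartedSpace H N] [IsManifold 𝓘(ℝ, H) ∞ N]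

/-- `ρ` is a smooth left inverse of `f` near `q`, on neighbourhoods `U` and `B` that are respected
by `ρ`. -/
structure IsRetraction (F H : Type*) [NormedAddCommGroup F] [NormedSpace ℝ F]
    [NormedAddCommGroup H] [NormedSpace ℝ H] {M : Type*} [TopologicalSpace M] [ChartedSpace F M]
    {N : Type*} [TopologicalSpace N] [ChartedSpace H N]
    (f : N → M) (q : N) (ρ : M → N) (U : Set N) (B : Set M) : Prop where
  isOpen_left : IsOpen U
  mem_left : q ∈ U
  isOpen_right : IsOpen B
  mem_right : f q ∈ B
  left_inv : ∀ p ∈ U, ρ (f p) = p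
  smooth : ∀ x ∈ B, ContMDiffAt 𝓘(ℝ, F) 𝓘(ℝ, H) ∞ ρ x
  mapsTo : ∀ x ∈ B, ρ x ∈ U

/-- In charts, `f` composed with a linear left inverse `A'` of its derivative is a local
diffeomorphism. -/
theorem exists_isRetraction {f : N → M} (hf : ContMDiff 𝓘(ℝ, H) 𝓘(ℝ, F) ∞ f) {q : N}
    (hi : Function.Injective (md H F f q)) : ∃ ρ U B, IsRetraction F H f q ρ U B := by
  obtain ⟨A', hA'⟩ : ∃ A' : F →L[ℝ] H, A' ∘L md H F f q = ContinuousLinearMap.id ℝ H := by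
    obtain ⟨B, hB⟩ := (md H F f q).toLinearMap.exists_leftInverse_of_injective
      (LinearMap.ker_eq_bot.2 hi)
    exact ⟨B.toContinuousLinearMap, ContinuousLinearMap.ext fun x ↦ DFunLike.congr_fun hB x⟩
  set φ := extChartAt 𝓘(ℝ, H) q with hφ
  set χ := extChartAt 𝓘(ℝ, F) (f q) with hχ
  have hφq : φ.symm (φ q) = q := extChartAt_to_inv q
  have hsymm : ∀ᶠ y in 𝓝 (φ q), ContMDiffAt 𝓘(ℝ, H) 𝓘(ℝ, H) ∞ φ.symm y := by
    filter_upwards [extChartAt_target_mem_nhds q] with y hy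
    exact contMDiffAt_extChartAt_symm_of_mem hy
  have hχs : ∀ᶠ x in 𝓝 (f q), ContMDiffAt 𝓘(ℝ, F) 𝓘(ℝ, F) ∞ χ x := by
    filter_upwards [extChartAt_source_mem_nhds (I := 𝓘(ℝ, F)) (f q)] with x hx
    exact contMDiffAt_extChartAt_of_mem hx
  have hcont : Tendsto (fun y ↦ f (φ.symm y)) (𝓝 (φ q)) (𝓝 (f q)) := by
    have h1 := hsymm.self_of_nhds.continuousAt.tendsto
    rw [hφq] at h1
    exact hf.continuous.continuousAt.tendsto.comp h1
  have hβ : ∀ x, ContMDiffAt 𝓘(ℝ, F) 𝓘(ℝ, F) ∞ χ x →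
      ContMDiffAt 𝓘(ℝ, F) 𝓘(ℝ, H) ∞ (fun x ↦ A' (χ x)) x := fun x hx ↦
    ContMDiffAt.comp (I' := 𝓘(ℝ, F)) (g := A') x A'.contDiff.contMDiff.contMDiffAt hx
  have hu : ∀ᶠ y in 𝓝 (φ q), ContDiffAt ℝ ∞ (fun y ↦ A' (χ (f (φ.symm y)))) y := by
    filter_upwards [hsymm, hcont.eventually hχs] with y h1 h2
    rw [← contMDiffAt_iff_contDiffAt]
    exact ContMDiffAt.comp (I' := 𝓘(ℝ, F)) (g := fun x ↦ A' (χ x)) (f := fun y ↦ f (φ.symm y)) y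
      (hβ _ h2) (hf.contMDiffAt.comp y h1)
  have hd : HasFDerivAt (fun y ↦ A' (χ (f (φ.symm y))))
      (ContinuousLinearEquiv.refl ℝ H : H →L[ℝ] H) (φ q) := by
    refine (hu.self_of_nhds.differentiableAt (by simp)).hasFDerivAt.congr_fderiv ?_
    rw [← md_eq_fderiv]
    refine ContinuousLinearMap.ext fun w ↦ ?_
    have h1 := md_comp_apply (g := fun x ↦ A' (χ x)) (f := fun y ↦ f (φ.symm y)) (φ q)
      (by rw [hφq]; exact (hβ _ hχs.self_of_nhds).mdiff)
      (hf.contMDiffAt.comp _ hsymm.self_of_nhds).mdiff w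
    have h2 := md_comp_apply (g := f) (f := φ.symm) (φ q) (hf.mdiff _) hsymm.self_of_nhds.mdiff w
    have h3 : md H H φ.symm (φ q) = ContinuousLinearMap.id ℝ H := md_extChartAt_symm_self q
    have h4 := md_comp_apply (g := A') (f := χ) (f q) A'.contDiff.contMDiff.contMDiffAt.mdiff
      hχs.self_of_nhds.mdiff
    have h5 : md F F χ (f q) = ContinuousLinearMap.id ℝ F := md_extChartAt_self (f q)
    simp only [hφq, h3, h5, md_eq_fderiv, ContinuousLinearMap.fderiv,
      ContinuousLinearMap.id_apply] at h1 h2 h4 ⊢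
    rw [h1, h2, h4]
    exact DFunLike.congr_fun hA' w
  obtain ⟨g, hg0, hg1, -, hg3⟩ := exists_smooth_localInverse hu _ hd
  rw [hφq] at hg0 hg3
  have hρ : ∀ᶠ x in 𝓝 (f q), ContMDiffAt 𝓘(ℝ, F) 𝓘(ℝ, H) ∞ (fun x ↦ φ.symm (g (A' (χ x)))) x := by
    have h1 : Tendsto (fun x ↦ A' (χ x)) (𝓝 (f q)) (𝓝 (A' (χ (f q)))) :=
      (hβ _ hχs.self_of_nhds).continuousAt.tendsto
    have h2 := hg3.self_of_nhds.continuousAt.tendsto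
    rw [hg0] at h2
    filter_upwards [hχs, h1.eventually hg3, (h2.comp h1).eventually hsymm] with x e1 e2 e3
    exact ContMDiffAt.comp (I' := 𝓘(ℝ, H)) (g := φ.symm) (f := fun x ↦ g (A' (χ x))) x e3
      (ContMDiffAt.comp (I' := 𝓘(ℝ, H)) (g := g) (f := fun x ↦ A' (χ x)) x e2.contMDiffAt (hβ x e1))
  have hleft : ∀ᶠ p in 𝓝 q, φ.symm (g (A' (χ (f p)))) = p := by
    have h1 : Tendsto φ (𝓝 q) (𝓝 (φ q)) := (continuousAt_extChartAt q).tendsto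
    filter_upwards [h1.eventually hg1, extChartAt_source_mem_nhds (I := 𝓘(ℝ, H)) q] with p h2 h3
    rw [φ.left_inv h3] at h2
    rw [h2, φ.left_inv h3]
  obtain ⟨U, hU, hUo, hqU⟩ := eventually_nhds_iff.1 hleft
  have hmaps : ∀ᶠ x in 𝓝 (f q), φ.symm (g (A' (χ x))) ∈ U := by
    refine hρ.self_of_nhds.continuousAt.eventually (hUo.mem_nhds ?_)
    show φ.symm (g (A' (χ (f q)))) ∈ U
    rw [hleft.self_of_nhds]; exact hqU
  obtain ⟨B, hB, hBo, hqB⟩ := eventually_nhds_iff.1 (hρ.and hmaps)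
  exact ⟨_, U, B, hUo, hqU, hBo, hqB, hU, fun x hx ↦ (hB x hx).1, fun x hx ↦ (hB x hx).2⟩

end Retraction

section TangentialExponential

variable {E : Type*} [NormedAddCommGroup E] [NormedSpace ℝ E] [FiniteDimensional ℝ E]
  {G : Type*} [TopologicalSpace G] [ChartedSpace E G] [Group G] [LieGroup 𝓘(ℝ, E) ∞ G] [T2Space G]
  {F : Type*} [NormedAddCommGroup F] [NormedSpace ℝ F] [FiniteDimensional ℝ F]
  {M : Type*} [TopologicalSpace M] [ChartedSpace F M] [IsManifold 𝓘(ℝ, F) ∞ M]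
  [MulAction G M] [ContMDiffSMul 𝓘(ℝ, E) 𝓘(ℝ, F) ∞ G M]
  [T2Space M] [SecondCountableTopology G] [MulAction.IsPretransitive G M] {o : M}
  {H : Type*} [NormedAddCommGroup H] [NormedSpace ℝ H] [FiniteDimensional ℝ H]
  {N : Type*} [TopologicalSpace N] [ChartedSpace H N] [IsManifold 𝓘(ℝ, H) ∞ N] [T2Space N]

/-- The vector `X` of `𝔭` is tangent to `f` at `q`, where `f q = g • o` and `𝔭` is identified with
the tangent space at `g • o` by means of `g`. -/
def IsTangent (H : Type*) [NormedAddCommGroup H] [NormedSpace ℝ H] [ChartedSpace H N]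
    (F : Type*) [NormedAddCommGroup F] [NormedSpace ℝ F] [ChartedSpace F M]
    (d : ReductiveDecomposition E G o) (f : N → M) (q : N) (g : G) (X : E) : Prop :=
  X ∈ d.pE ∧ ∃ w, md H F f q w = push F g o (fundE E F G o X)

/-- The vectors tangent to `f` at `q`, as a subspace of `𝔭`. -/
def tangentSubmodule (H : Type*) [NormedAddCommGroup H] [NormedSpace ℝ H] [ChartedSpace H N]
    (F : Type*) [NormedAddCommGroup F] [NormedSpace ℝ F] [ChartedSpace F M]
    (d : ReductiveDecomposition E G o) (f : N → M) (q : N) (g : G) : Submodule ℝ E where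
  carrier := {X | IsTangent H F d f q g X}
  zero_mem' := ⟨d.pE.zero_mem, 0, by simp⟩
  add_mem' := by
    rintro X Y ⟨hX, v, hv⟩ ⟨hY, w, hw⟩
    exact ⟨d.pE.add_mem hX hY, v + w, by rw [map_add, map_add, map_add, hv, hw]⟩
  smul_mem' := by
    rintro c X ⟨hX, v, hv⟩
    exact ⟨d.pE.smul_mem c hX, c • v, by rw [map_smul, map_smul, map_smul, hv]⟩

/-- Every geodesic `t ↦ g exp (tX) • o` that starts tangentially to `f` lifts to the source of
`f`. -/
def LiftsGeodesics (H : Type*) [NormedAddCommGroup H] [NormedSpace ℝ H] [ChartedSpace H N]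
    (F : Type*) [NormedAddCommGroup F] [NormedSpace ℝ F] [ChartedSpace F M]
    (d : ReductiveDecomposition E G o) (f : N → M) : Prop :=
  ∀ (q : N) (g : G) (X : E), f q = g • o → IsTangent H F d f q g X →
    ∃ γ : ℝ → N, Continuous γ ∧ γ 0 = q ∧ ∀ t : ℝ, f (γ t) = (g * lieExp G (t • X)) • o

variable {d : ReductiveDecomposition E G o} {f : N → M} {q q' : N} {ρ : M → N} {U : Set N}
  {B : Set M} {g : G} {X Y : E}

namespace IsRetraction

/-- Tangential geodesics that stay close to `f q` lie in the image of `f`. -/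
theorem apply_exp (hr : IsRetraction F H f q ρ U B) (hl : LiftsGeodesics H F d f)
    (hq : q' ∈ U) (hg : f q' = g • o) (hX : IsTangent H F d f q' g X)
    (hB : ∀ s ∈ Icc (0 : ℝ) 1, (g * lieExp G (s • X)) • o ∈ B) :
    f (ρ ((g * lieExp G X) • o)) = (g * lieExp G X) • o := by
  obtain ⟨γ, hγ, h0, h1⟩ := hl q' g X hg hX
  have hc : Continuous (fun t : ℝ ↦ (g * lieExp G (t • X)) • o) :=
    (contMDiff_mul_exp_line_smul F g X o).continuous
  have hρ : ContinuousOn (fun t : ℝ ↦ ρ ((g * lieExp G (t • X)) • o)) (Icc 0 1) := fun t ht ↦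
    (ContinuousAt.comp (g := ρ) (f := fun t : ℝ ↦ (g * lieExp G (t • X)) • o) (hr.smooth _ (hB t ht)).continuousAt
      hc.continuousAt).continuousWithinAt
  have hA : Icc (0 : ℝ) 1 ⊆ {t | γ t = ρ ((g * lieExp G (t • X)) • o)} := by
    refine IsClosed.Icc_subset_of_forall_mem_nhdsWithin ?_ ?_ ?_
    · have h2 : IsClosed {t : Icc (0 : ℝ) 1 | γ t = ρ ((g * lieExp G ((t : ℝ) • X)) • o)} :=
        isClosed_eq (hγ.comp continuous_subtype_val) hρ.domRestrict
      have h4 := (isClosed_Icc (a := (0 : ℝ)) (b := 1)).isClosedEmbedding_subtypeVal.isClosedMap _ h2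
      convert h4 using 1
      ext t
      simp only [mem_inter_iff, mem_ofPred_eq, mem_image, Subtype.exists]
      constructor
      · rintro ⟨h5, h6⟩; exact ⟨t, h6, h5, rfl⟩
      · rintro ⟨t', h6, h5, rfl⟩; exact ⟨h5, h6⟩
    · show γ 0 = _
      rw [zero_smul, lieExp_zero, mul_one, h0, ← hg, hr.left_inv _ hq]
    · rintro t ⟨ht, ht'⟩
      have ht2 : γ t ∈ U := by
        rw [show γ t = _ from ht]
        exact hr.mapsTo _ (hB t ⟨ht'.1, ht'.2.le⟩)
      refine mem_nhdsWithin_of_mem_nhds ?_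
      filter_upwards [hγ.continuousAt.eventually (hr.isOpen_left.mem_nhds ht2)] with s hs
      show γ s = _
      rw [← h1, hr.left_inv _ hs]
  have h2 : γ 1 = _ := hA (right_mem_Icc.2 zero_le_one)
  rw [one_smul] at h2
  rw [← h2, h1, one_smul]

/-- The derivative of the tangential exponential map is tangent to `f`. -/
theorem isTangent_lder (hr : IsRetraction F H f q ρ U B) (hl : LiftsGeodesics H F d f)
    (hf : ContMDiff 𝓘(ℝ, H) 𝓘(ℝ, F) ∞ f) (hq : q' ∈ U) (hg : f q' = g • o)
    (hX : IsTangent H F d f q' g X) (hY : IsTangent H F d f q' g Y)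
    (hB : ∀ s ∈ Icc (0 : ℝ) 1, (g * lieExp G (s • X)) • o ∈ B) :
    IsTangent H F d f (ρ ((g * lieExp G X) • o)) (g * lieExp G X)
      (d.prP (lder (lieExp G) X Y)) := by
  refine ⟨d.prP_mem _, ?_⟩
  rw [d.fundE_prP]
  have hc : ContMDiff 𝓘(ℝ, ℝ) 𝓘(ℝ, E) ∞ (fun σ : ℝ ↦ g * lieExp G (X + σ • Y)) := by
    have h1 : ContDiff ℝ ∞ (fun σ : ℝ ↦ X + σ • Y) := by fun_prop
    exact (contMDiff_mul_exp (E := E) g).comp h1.contMDiff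
  have hB' : ∀ᶠ σ : ℝ in 𝓝 0, ∀ s ∈ Icc (0 : ℝ) 1, (g * lieExp G (s • (X + σ • Y))) • o ∈ B := by
    have h1 : Continuous (fun x : ℝ × ℝ ↦ (g * lieExp G (x.2 • (X + x.1 • Y))) • o) :=
      (contMDiff_mul_exp_smul (E := E) (F := F) g o).continuous.comp (by fun_prop)
    have h2 := (isCompact_Icc (a := (0 : ℝ)) (b := 1)).eventually_forall_of_forall_eventually
      (x₀ := (0 : ℝ)) (P := fun σ s ↦ (g * lieExp G (s • (X + σ • Y))) • o ∈ B) (fun s hs ↦ by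
        refine h1.continuousAt.eventually (hr.isOpen_right.mem_nhds ?_)
        simpa using hB s hs)
    exact h2
  have hx : (g * lieExp G X) • o ∈ B := by simpa using hB 1 (right_mem_Icc.2 zero_le_one)
  -- Neighbouring tangent vectors `X + σY` have geodesics in the image of `f`; differentiate at `σ =
  -- 0`.
  have h3 : ∀ᶠ σ : ℝ in 𝓝 0, f (ρ ((g * lieExp G (X + σ • Y)) • o)) =
      (g * lieExp G (X + σ • Y)) • o := by
    filter_upwards [hB'] with σ hσ
    exact hr.apply_exp hl hq hg ((tangentSubmodule H F d f q' g).add_mem hX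
      ((tangentSubmodule H F d f q' g).smul_mem σ hY)) hσ
  have hc' : ContMDiff 𝓘(ℝ, ℝ) 𝓘(ℝ, F) ∞ (fun σ : ℝ ↦ (g * lieExp G (X + σ • Y)) • o) :=
    (smooth_orbit (E := E) (F := F) o).comp hc
  have e0 : (g * lieExp G (X + (0 : ℝ) • Y)) • o = (g * lieExp G X) • o := by simp
  have hρc : ContMDiffAt 𝓘(ℝ, ℝ) 𝓘(ℝ, H) ∞ (fun σ : ℝ ↦ ρ ((g * lieExp G (X + σ • Y)) • o)) 0 :=
    ContMDiffAt.comp_of_eq (hr.smooth _ hx) hc'.contMDiffAt e0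
  refine ⟨md ℝ H (fun σ : ℝ ↦ ρ ((g * lieExp G (X + σ • Y)) • o)) 0 1, ?_⟩
  have h4 := md_comp_apply (g := f) (f := fun σ : ℝ ↦ ρ ((g * lieExp G (X + σ • Y)) • o)) 0
    (hf.mdiff _) hρc.mdiff 1
  rw [md_congr h3, md_smul_orbit (hc 0)] at h4
  have h5 : lder (E := E) (fun σ : ℝ ↦ g * lieExp G (X + σ • Y)) 0 1 = lder (lieExp G) X Y := by
    have h6 : HasFDerivAt (fun σ : ℝ ↦ X + σ • Y) ((1 : ℝ →L[ℝ] ℝ).smulRight Y) 0 := by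
      have := ((hasDerivAt_id (0 : ℝ)).smul_const Y).const_add X
      exact (by simpa using this : HasDerivAt (fun σ : ℝ ↦ X + σ • Y) Y 0).hasFDerivAt
    rw [lder_mul_left g (fun σ : ℝ ↦ lieExp G (X + σ • Y)),
      lder_comp (φ := (lieExp G : E → G)) (f := fun σ : ℝ ↦ X + σ • Y) 0
      contMDiff_lieExp.contMDiffAt h6.differentiableAt, h6.fderiv]
    simp
  rw [h5] at h4
  simp only [zero_smul, add_zero] at h4
  exact h4.symm

end IsRetraction

end TangentialExponential

/-! ### Second order properties of totally geodesic immersions -/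

section TotallyGeodesic

variable {E : Type*} [NormedAddCommGroup E] [NormedSpace ℝ E] [FiniteDimensional ℝ E]
  {G : Type*} [TopologicalSpace G] [ChartedSpace E G] [Group G] [LieGroup 𝓘(ℝ, E) ∞ G] [T2Space G]
  {F : Type*} [NormedAddCommGroup F] [NormedSpace ℝ F] [FiniteDimensional ℝ F]
  {M : Type*} [TopologicalSpace M] [ChartedSpace F M] [IsManifold 𝓘(ℝ, F) ∞ M]
  [MulAction G M] [ContMDiffSMul 𝓘(ℝ, E) 𝓘(ℝ, F) ∞ G M]
  [T2Space M] [SecondCountableTopology G] [MulAction.IsPretransitive G M] {o : M}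

/-- The second order Taylor expansion at `0` of the logarithmic derivative of the exponential map
along a line, `1 - (t / 2) ad X + (t² / 6) (ad X)²`. -/
theorem lder_lieExp_taylor (X : E) : ∃ p₁ : ℝ → E →L[ℝ] E,
    (∀ t, HasDerivAt (fun t : ℝ ↦ lder (E := E) (lieExp G) (t • X)) (p₁ t) t) ∧
    p₁ 0 = -(1 / 2 : ℝ) • lieBL E G X ∧
    HasDerivAt p₁ ((1 / 3 : ℝ) • (lieBL E G X ∘L lieBL E G X)) 0 := by
  set a : E →L[ℝ] E := lieBL E G X
  set p : ℝ → E →L[ℝ] E := fun t ↦ lder (lieExp G) (t • X)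
  have hp : ContDiff ℝ ∞ p := (contDiff_lder_lieExp (E := E) (G := G)).comp (by fun_prop)
  have hp0 : p 0 = ContinuousLinearMap.id ℝ E := by
    simp only [p, zero_smul]; exact lder_lieExp_zero
  have hp1 : ContDiff ℝ ∞ (deriv p) := (contDiff_infty_iff_deriv.1 hp).2
  have hp2 : ContDiff ℝ ∞ (deriv (deriv p)) := (contDiff_infty_iff_deriv.1 hp1).2
  have d0 : ∀ t, HasDerivAt p (deriv p t) t := fun t ↦ (hp.differentiable (by simp) t).hasDerivAt
  have d1 : ∀ t, HasDerivAt (deriv p) (deriv (deriv p) t) t :=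
    fun t ↦ (hp1.differentiable (by simp) t).hasDerivAt
  have d2 := (hp2.differentiable (by simp) (0 : ℝ)).hasDerivAt
  have e1 : ∀ t, p t + t • deriv p t = ContinuousLinearMap.id ℝ E - t • (a ∘L p t) := by
    intro t
    refine ContinuousLinearMap.ext fun Z ↦ ?_
    have h1 := ((hasDerivAt_id t).smul (d0 t)).clm_apply (hasDerivAt_const t Z)
    have h2 := h1.unique (hasDerivAt_smul_lder (G := G) X Z t)
    simp only [add_apply, smul_apply, id_eq, one_smul, map_zero, add_zero, map_smul] at h2
    show p t Z + t • deriv p t Z = Z - t • a (p t Z)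
    rw [add_comm, h2]
  have dc : ∀ {u : ℝ → E →L[ℝ] E} {u' t}, HasDerivAt u u' t →
      HasDerivAt (fun t ↦ t • (a ∘L u t)) (t • (a ∘L u') + a ∘L u t) t := by
    intro u u' t h
    exact ((hasDerivAt_id t).smul ((hasDerivAt_const t a).clm_comp h)).congr_deriv (by simp)
  have dm : ∀ {u : ℝ → E →L[ℝ] E} {u' t}, HasDerivAt u u' t →
      HasDerivAt (fun t ↦ t • u t) (t • u' + u t) t := by
    intro u u' t h
    exact ((hasDerivAt_id t).smul h).congr_deriv (by simp)
  have e2 : ∀ t, deriv p t + (t • deriv (deriv p) t + deriv p t) =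
      -(t • (a ∘L deriv p t) + a ∘L p t) := by
    intro t
    have h1 := (d0 t).add (dm (d1 t))
    have h2 := (dc (d0 t)).const_sub (ContinuousLinearMap.id ℝ E)
    exact h1.unique (h2.congr_of_eventuallyEq (Eventually.of_forall e1))
  have f1 : deriv p 0 = -(1 / 2 : ℝ) • a := by
    have h := e2 0
    rw [zero_smul, zero_smul, zero_add, zero_add, hp0, ContinuousLinearMap.comp_id,
      ← two_smul ℝ] at h
    rw [neg_smul, ← smul_neg, ← h, smul_smul]; norm_num
  refine ⟨deriv p, d0, f1, ?_⟩
  have h1 := (d1 0).add ((dm d2).add (d1 0))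
  have h2 := ((dc (d1 0)).add ((hasDerivAt_const 0 a).clm_comp (d0 0))).neg
  have h3 := h1.unique (h2.congr_of_eventuallyEq (Eventually.of_forall e2))
  have f2 : deriv (deriv p) 0 = (1 / 3 : ℝ) • (a ∘L a) := by
    simp only [zero_smul, zero_add, ContinuousLinearMap.zero_comp, f1] at h3
    have h4 : (3 : ℝ) • deriv (deriv p) 0 = a ∘L a := by
      calc (3 : ℝ) • deriv (deriv p) 0 = deriv (deriv p) 0 +
            (deriv (deriv p) 0 + deriv (deriv p) 0) := by module
        _ = _ := h3
        _ = a ∘L a := by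
          rw [ContinuousLinearMap.comp_smul]; module
    rw [← h4, smul_smul]; norm_num
  rw [← f2]; exact d1 0

namespace ReductiveDecomposition

variable (d : ReductiveDecomposition E G o) {W : Submodule ℝ E} (F)

include F

theorem lieBL_prK_mem_pE {X : E} (hX : X ∈ d.pE) (Y : E) :
    lieBL E G X (d.prK Y) ∈ d.pE := by
  rw [lieBL_skew]
  exact d.pE.neg_mem (d.lieBL_mem_pE F (d.prK_mem Y) hX)

theorem prP_lieBL {X : E} (hX : X ∈ d.pE) (Y : E) :
    d.prP (lieBL E G X Y) = lieBL E G X (d.prK Y) + d.prP (lieBL E G X (d.prP Y)) := by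
  conv_lhs => rw [← d.prK_add_prP Y]
  rw [map_add, map_add, d.prP_of_mem (d.lieBL_prK_mem_pE F hX Y)]

/-- If tangent spaces are carried along a short geodesic with initial velocity `X` and back again by
the derivatives of the exponential map, then the second order term of this round trip shows that
`[X, [X, Y]_𝔨]` is tangent. -/
theorem lieBL_prK_mem_of_roundTrip (hW : W ≤ d.pE)
    (hD : ∀ X ∈ W, ∀ Y ∈ W, d.prP (lieBL E G X Y) ∈ W) {X Y : E} (hX : X ∈ W) (hY : Y ∈ W)
    (h : ∀ᶠ t : ℝ in 𝓝 0, d.prP (lder (lieExp G) ((-t) • X)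
      (d.prP (lder (lieExp G) (t • X) Y))) ∈ W) :
    lieBL E G X (d.prK (lieBL E G X Y)) ∈ W := by
  obtain ⟨p₁, h1, h2, h3⟩ := lder_lieExp_taylor (G := G) X
  set p : ℝ → E →L[ℝ] E := fun t ↦ lder (lieExp G) (t • X)
  set a := lieBL E G X
  have hp0 : p 0 = ContinuousLinearMap.id ℝ E := by
    simp only [p, zero_smul]; exact lder_lieExp_zero
  set y : ℝ → E := fun t ↦ d.prP (p t Y)
  set y₁ : ℝ → E := fun t ↦ d.prP (p₁ t Y)
  have hy : ∀ t, HasDerivAt y (y₁ t) t := fun t ↦ d.prP.hasFDerivAt.comp_hasDerivAt t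
    (((h1 t).clm_apply (hasDerivAt_const t Y)).congr_deriv (by simp))
  have hy₁ : HasDerivAt y₁ (d.prP (((1 / 3 : ℝ) • (a ∘L a)) Y)) 0 :=
    d.prP.hasFDerivAt.comp_hasDerivAt 0
      ((h3.clm_apply (hasDerivAt_const 0 Y)).congr_deriv (by simp))
  set n : ℝ → E →L[ℝ] E := fun t ↦ p (-t)
  set n₁ : ℝ → E →L[ℝ] E := fun t ↦ -p₁ (-t)
  have hn : ∀ t, HasDerivAt n (n₁ t) t := fun t ↦
    ((h1 (-t)).scomp t (hasDerivAt_neg t)).congr_deriv (by simp [n₁])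
  have hn₁ : HasDerivAt n₁ ((1 / 3 : ℝ) • (a ∘L a)) 0 := by
    have h4 : HasDerivAt p₁ ((1 / 3 : ℝ) • (a ∘L a)) (-0) := by rwa [neg_zero]
    exact ((h4.scomp 0 (hasDerivAt_neg 0)).neg).congr_deriv (by simp)
  have hF' : ∀ᶠ t : ℝ in 𝓝 0, d.prP (n₁ t (y t) + n t (y₁ t)) ∈ W := by
    filter_upwards [h.eventually_nhds] with t ht
    exact mem_of_hasDerivAt W
      (d.prP.hasFDerivAt.comp_hasDerivAt t ((hn t).clm_apply (hy t))) ht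
  have hF2 := d.prP.hasFDerivAt.comp_hasDerivAt 0
    ((hn₁.clm_apply (hy 0)).add ((hn 0).clm_apply hy₁))
  have hF3 := mem_of_hasDerivAt W hF2 hF'
  have en : n 0 = ContinuousLinearMap.id ℝ E := by simp only [n, neg_zero]; exact hp0
  have en₁ : n₁ 0 = (1 / 2 : ℝ) • a := by simp only [n₁, neg_zero, h2, neg_smul, neg_neg]
  have ey : y 0 = Y := by simp only [y, hp0, ContinuousLinearMap.id_apply, d.prP_of_mem (hW hY)]
  have ey₁ : y₁ 0 = -(1 / 2 : ℝ) • d.prP (a Y) := by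
    simp only [y₁, h2, smul_apply, map_smul]
  simp only [en, en₁, ey, ey₁, ContinuousLinearMap.id_apply, map_add, smul_apply, map_smul,
    ContinuousLinearMap.comp_apply, d.prP_of_mem (d.prP_mem _)] at hF3
  have h5 := hD X hX _ (hD X hX Y hY)
  have h6 : d.prP (a (a Y)) ∈ W := by
    have h7 := W.smul_mem (3 / 2 : ℝ) (W.add_mem hF3 (W.smul_mem (1 / 2 : ℝ) h5))
    convert h7 using 1
    module
  rw [d.prP_lieBL F (hW hX)] at h6
  exact (W.add_mem_iff_left h5).1 h6

/-- Polarisation: modulo `W` the map `(X, Y, Z) ↦ [X, [Y, Z]_𝔨]` is alternating, so the Jacobi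
identity forces three times it to vanish. -/
theorem lieBL_prK_mem_of_polarization (hW : W ≤ d.pE)
    (hD : ∀ X ∈ W, ∀ Y ∈ W, d.prP (lieBL E G X Y) ∈ W)
    (h : ∀ X ∈ W, ∀ Y ∈ W, lieBL E G X (d.prK (lieBL E G X Y)) ∈ W)
    {X Y Z : E} (hX : X ∈ W) (hY : Y ∈ W) (hZ : Z ∈ W) :
    lieBL E G (d.prK (lieBL E G X Y)) Z ∈ W := by
  have s1 : ∀ X ∈ W, ∀ Y ∈ W, ∀ Z ∈ W,
      lieBL E G X (d.prK (lieBL E G Y Z)) + lieBL E G Y (d.prK (lieBL E G X Z)) ∈ W := by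
    intro X hX Y hY Z hZ
    have h1 := h _ (W.add_mem hX hY) Z hZ
    simp only [map_add, add_apply] at h1
    have h2 := W.sub_mem (W.sub_mem h1 (h X hX Z hZ)) (h Y hY Z hZ)
    convert h2 using 1
    abel
  have s3 : ∀ X ∈ W, ∀ Y ∈ W, ∀ Z ∈ W,
      d.prP (lieBL E G X (lieBL E G Y Z)) - lieBL E G X (d.prK (lieBL E G Y Z)) ∈ W := by
    intro X hX Y hY Z hZ
    rw [d.prP_lieBL F (hW hX), add_sub_cancel_left]
    exact hD X hX _ (hD Y hY Z hZ)
  have j1 := congrArg d.prP (lieBL_jacobi (G := G) Z X Y)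
  rw [map_add, lieBL_skew (lieBL E G Z X) Y, map_neg] at j1
  have k1 := s3 Z hZ X hX Y hY
  have k2 := s3 Y hY Z hZ X hX
  have k3 := s3 X hX Z hZ Y hY
  have k4 := s1 X hX Z hZ Y hY
  have k5 := s1 Y hY Z hZ X hX
  have e1 : lieBL E G Z (d.prK (lieBL E G Y X)) = - lieBL E G Z (d.prK (lieBL E G X Y)) := by
    rw [lieBL_skew Y X, map_neg, map_neg]
  rw [e1] at k5
  have k6 : (-(1 / 3) : ℝ) • (((d.prP (lieBL E G Z (lieBL E G X Y)) -
      lieBL E G Z (d.prK (lieBL E G X Y))) + (d.prP (lieBL E G Y (lieBL E G Z X)) -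
      lieBL E G Y (d.prK (lieBL E G Z X))) - (d.prP (lieBL E G X (lieBL E G Z Y)) -
      lieBL E G X (d.prK (lieBL E G Z Y)))) - (lieBL E G X (d.prK (lieBL E G Z Y)) +
      lieBL E G Z (d.prK (lieBL E G X Y))) + (lieBL E G Y (d.prK (lieBL E G Z X)) +
      -lieBL E G Z (d.prK (lieBL E G X Y)))) ∈ W :=
    W.smul_mem _ (W.add_mem (W.sub_mem (W.sub_mem (W.add_mem k1 k2) k3) k4) k5)
  rw [lieBL_skew, ← W.neg_mem_iff, neg_neg]
  rw [j1] at k6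
  convert k6 using 1
  module

end ReductiveDecomposition

variable {H : Type*} [NormedAddCommGroup H] [NormedSpace ℝ H] [FiniteDimensional ℝ H]
  {N : Type*} [TopologicalSpace N] [ChartedSpace H N] [IsManifold 𝓘(ℝ, H) ∞ N] [T2Space N]
  {d : ReductiveDecomposition E G o} {f : N → M} {q : N} {ρ : M → N} {U : Set N} {B : Set M} {g : G}

theorem IsRetraction.exists_radius (hr : IsRetraction F H f q ρ U B) (hg : f q = g • o) :
    ∃ δ > 0, ∀ X : E, ‖X‖ < δ → ∀ s ∈ Icc (0 : ℝ) 1, (g * lieExp G (s • X)) • o ∈ B := by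
  have h1 := (tendsto_mul_exp_smul (E := E) F g o).eventually
    (hr.isOpen_right.mem_nhds (by rw [← hg]; exact hr.mem_right))
  obtain ⟨δ, hδ, h2⟩ := Metric.eventually_nhds_iff_ball.1 h1
  refine ⟨δ, hδ, fun X hX s hs ↦ h2 _ ?_⟩
  rw [mem_ball_zero_iff, norm_smul, Real.norm_of_nonneg hs.1]
  exact (mul_le_of_le_one_left (norm_nonneg _) hs.2).trans_lt hX

/-- A totally geodesic immersion that lifts geodesics satisfies the round trip condition. -/
theorem eventually_roundTrip (hf : ContMDiff 𝓘(ℝ, H) 𝓘(ℝ, F) ∞ f)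
    (hi : Function.Injective (md H F f q)) (hl : LiftsGeodesics H F d f) (hq : f q = o)
    {X Y : E} (hX : IsTangent H F d f q 1 X) (hY : IsTangent H F d f q 1 Y) :
    ∀ᶠ t : ℝ in 𝓝 0, IsTangent H F d f q 1 (d.prP (lder (lieExp G) ((-t) • X)
      (d.prP (lder (lieExp G) (t • X) Y)))) := by
  obtain ⟨ρ, U, B, hr⟩ := exists_isRetraction hf hi
  have hq1 : f q = (1 : G) • o := by rw [hq, one_smul]
  obtain ⟨δ, hδ, hB⟩ := hr.exists_radius (E := E) hq1
  have hsmall : ∀ᶠ t : ℝ in 𝓝 0, ‖t • X‖ < δ := by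
    have : Tendsto (fun t : ℝ ↦ ‖t • X‖) (𝓝 0) (𝓝 0) :=
      (by fun_prop : Continuous fun t : ℝ ↦ ‖t • X‖).tendsto' _ _ (by simp)
    exact this.eventually (gt_mem_nhds hδ)
  filter_upwards [hsmall] with t ht
  have hXt := (tangentSubmodule H F d f q 1).smul_mem t hX
  have hB1 := hB _ ht
  have a1 := hr.apply_exp hl hr.mem_left hq1 hXt hB1
  have a2 := hr.isTangent_lder hl hf hr.mem_left hq1 hXt hY hB1
  have a3 := hr.isTangent_lder hl hf hr.mem_left hq1 hXt hX hB1
  rw [lder_lieExp_smul_self, d.prP_of_mem hX.1] at a3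
  have a4 := (tangentSubmodule H F d f _ _).smul_mem (-t) a3
  have hmem : ρ ((1 * lieExp G (t • X)) • o) ∈ U :=
    hr.mapsTo _ (by simpa using hB1 1 (right_mem_Icc.2 zero_le_one))
  have hB2 : ∀ s ∈ Icc (0 : ℝ) 1, ((1 * lieExp G (t • X)) * lieExp G (s • (-t) • X)) • o ∈ B := by
    intro s hs
    have h1 := hB1 (1 - s) ⟨by linarith [hs.2], by linarith [hs.1]⟩
    have h2 : (1 * lieExp G (t • X)) * lieExp G (s • (-t) • X) =
        1 * lieExp G ((1 - s) • t • X) := by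
      rw [mul_assoc, smul_smul, ← lieExp_add_smul, smul_smul]
      congr 3; ring
    rwa [h2]
  have a5 := hr.isTangent_lder hl hf hmem a1 a4 a2 hB2
  have e : (1 * lieExp G (t • X)) * lieExp G ((-t) • X) = (1 : G) := by
    rw [one_mul, neg_smul, lieExp_neg, mul_inv_cancel]
  rw [e, ← hq1, hr.left_inv _ hr.mem_left] at a5
  exact a5

variable [RiemannianBundle (fun x : M ↦ TangentSpace 𝓘(ℝ, F) x)]
  [IsContMDiffRiemannianBundle 𝓘(ℝ, F) ∞ F (fun x : M ↦ TangentSpace 𝓘(ℝ, F) x)]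

/-- A complete totally geodesic immersion into a naturally reductive space lifts the geodesics
`t ↦ g exp (tX) • o`. -/
theorem liftsGeodesics (hiso : ActsIsometrically F G M) (hd : d.IsNaturallyReductive F)
    (hc : IsGeodesicallyComplete (metricOf F H f))
    (htg : ∀ γ : ℝ → N, IsGeodesicOn (metricOf F H f) γ univ →
      IsGeodesicOn (metricOf F F (fun x : M ↦ x)) (fun t ↦ f (γ t)) univ)
    (hf : ContMDiff 𝓘(ℝ, H) 𝓘(ℝ, F) ∞ f) : LiftsGeodesics H F d f := by
  rintro q g X hg ⟨hX, w, hw⟩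
  obtain ⟨γ, hγ, h0⟩ := hc q w
  have hid : ContMDiff 𝓘(ℝ, F) 𝓘(ℝ, F) ∞ (fun x : M ↦ x) := contMDiff_id
  have hγs := fun t ↦ ((isGeodesicOn_iff hf isOpen_univ).1 hγ t trivial).1
  have h1 : γ 0 = q := congrArg (fun z : TangentBundle 𝓘(ℝ, H) N ↦ z.1) h0
  subst h1
  have h2 : md ℝ H γ 0 1 = w := by
    injection h0
  refine ⟨γ, continuous_iff_continuousAt.2 fun t ↦ (hγs t).continuousAt, rfl, fun t ↦ ?_⟩
  refine congrFun (IsGeodesicOn.eq_of_univ hid (fun p ↦ ?_) (htg γ hγ)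
    (isGeodesicOn_exp hiso d hd g hX) (t₀ := 0) ?_ ?_) t
  · rw [md_id]; exact fun _ _ h ↦ h
  · rw [hg, zero_smul, lieExp_zero, mul_one]
  · rw [md_mul_exp_line_smul, zero_smul, lieExp_zero, mul_one,
      md_comp_apply (g := f) (f := γ) 0 (hf.mdiff _) (hγs 0).mdiff, h2, hw]

end TotallyGeodesic

/-! ### Uniqueness of totally geodesic submanifolds -/

section Uniqueness

variable {E : Type*} [NormedAddCommGroup E] [NormedSpace ℝ E] [FiniteDimensional ℝ E]
  {G : Type*} [TopologicalSpace G] [ChartedSpace E G] [Group G] [LieGroup 𝓘(ℝ, E) ∞ G] [T2Space G]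
  {F : Type*} [NormedAddCommGroup F] [NormedSpace ℝ F] [FiniteDimensional ℝ F]
  {M : Type*} [TopologicalSpace M] [ChartedSpace F M] [IsManifold 𝓘(ℝ, F) ∞ M]
  [MulAction G M] [ContMDiffSMul 𝓘(ℝ, E) 𝓘(ℝ, F) ∞ G M]
  [T2Space M] [SecondCountableTopology G] [MulAction.IsPretransitive G M] {o : M}
  {H : Type*} [NormedAddCommGroup H] [NormedSpace ℝ H] [FiniteDimensional ℝ H]
  {N : Type*} [TopologicalSpace N] [ChartedSpace H N] [IsManifold 𝓘(ℝ, H) ∞ N] [T2Space N]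
  {d : ReductiveDecomposition E G o} {f : N → M} {q q' : N} {ρ : M → N} {U : Set N} {B : Set M}
  {g h k : G} {X Y : E} {S : Submodule ℝ E}

theorem lder_lieExp_adE (k : G) (X Y : E) :
    lder (lieExp G) (adE E k X) (adE E k Y) = adE E k (lder (lieExp G) X Y) := by
  have h1 : lder (E := E) (fun Z : E ↦ lieExp G (adE E k Z)) X Y =
      lder (lieExp G) (adE E k X) (adE E k Y) := by
    rw [lder_comp (φ := (lieExp G : E → G)) (f := adE E k) X contMDiff_lieExp.contMDiffAt
      (adE E k).differentiableAt, ContinuousLinearMap.fderiv]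
    rfl
  have h2 : (fun Z : E ↦ lieExp G (adE E k Z)) = fun Z ↦ (k * lieExp G Z) * k⁻¹ :=
    funext fun Z ↦ lieExp_adE k Z
  rw [← h1, h2, lder_conj (fun Z : E ↦ k * lieExp G Z) X k⁻¹ (contMDiff_mul_exp k X) Y, inv_inv,
    lder_mul_left]

/-- The tangent space of `f` at `q`, transported to `𝔭` by means of `g`. -/
noncomputable def tangentCoord (H F : Type*) [NormedAddCommGroup H] [NormedSpace ℝ H]
    [ChartedSpace H N] [NormedAddCommGroup F] [NormedSpace ℝ F] [FiniteDimensional ℝ F]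
    [ChartedSpace F M] [IsManifold 𝓘(ℝ, F) ∞ M] [ContMDiffSMul 𝓘(ℝ, E) 𝓘(ℝ, F) ∞ G M]
    (d : ReductiveDecomposition E G o) (f : N → M) (q : N) (g : G) : H →L[ℝ] E :=
  d.jE F ∘L push F g⁻¹ (g • o) ∘L md H F f q

theorem push_fundE_tangentCoord (w : H) :
    push F g o (fundE E F G o (tangentCoord H F d f q g w)) = md H F f q w := by
  simp only [tangentCoord, ContinuousLinearMap.comp_apply, d.fundE_jE, push_push_inv E]

theorem isTangent_tangentCoord (w : H) : IsTangent H F d f q g (tangentCoord H F d f q g w) :=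
  ⟨d.jE_mem _, w, (push_fundE_tangentCoord w).symm⟩

theorem range_tangentCoord :
    (tangentCoord H F d f q g).toLinearMap.range = tangentSubmodule H F d f q g := by
  ext X
  constructor
  · rintro ⟨w, rfl⟩; exact isTangent_tangentCoord w
  · rintro ⟨hX, w, hw⟩
    refine ⟨w, ?_⟩
    show d.jE F (push F g⁻¹ (g • o) (md H F f q w)) = X
    rw [hw, push_inv_push E, d.jE_fundE, d.prP_of_mem hX]

/-- Tangent spaces seen in `𝔭` have the dimension of the source. -/
theorem finrank_tangentSubmodule (hi : Function.Injective (md H F f q)) (g : G) :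
    Module.finrank ℝ (tangentSubmodule H F d f q g) = Module.finrank ℝ H := by
  rw [← range_tangentCoord, LinearMap.finrank_range_of_inj]
  intro v w hvw
  have h1 : tangentCoord H F d f q g v = tangentCoord H F d f q g w := hvw
  apply hi
  rw [← push_fundE_tangentCoord (d := d) (g := g) v, h1, push_fundE_tangentCoord]

/-- Nearby points of the source of `f` are reached by the tangential exponential map. -/
theorem IsRetraction.eventually_exists_exp (hr : IsRetraction F H f q ρ U B)
    (hf : ContMDiff 𝓘(ℝ, H) 𝓘(ℝ, F) ∞ f) (hg : f q = g • o) {𝒱 : Set E} (h𝒱 : 𝒱 ∈ 𝓝 (0 : E)) :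
    ∀ᶠ q' in 𝓝 q, ∃ X ∈ 𝒱, IsTangent H F d f q g X ∧ ρ ((g * lieExp G X) • o) = q' := by
  set φ := extChartAt 𝓘(ℝ, H) q with hφ
  set T := tangentCoord H F d f q g
  set e : H → M := fun v ↦ (g * lieExp G (T v)) • o
  have he : ContMDiff 𝓘(ℝ, H) 𝓘(ℝ, F) ∞ e :=
    (contMDiff_mul_exp_smul (E := E) (F := F) g o).comp T.contDiff.contMDiff
  have he0 : e 0 = f q := by simp only [e, map_zero, lieExp_zero, mul_one, hg]
  have hρq : ρ (f q) = q := hr.left_inv _ hr.mem_left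
  have heB : ∀ᶠ v in 𝓝 (0 : H), e v ∈ B :=
    he.continuous.continuousAt.eventually (hr.isOpen_right.mem_nhds (he0 ▸ hr.mem_right))
  have hρe : ∀ v, e v ∈ B → ContMDiffAt 𝓘(ℝ, H) 𝓘(ℝ, H) ∞ (fun v ↦ ρ (e v)) v := fun v hv ↦
    ContMDiffAt.comp (I' := 𝓘(ℝ, F)) (g := ρ) (f := e) v (hr.smooth _ hv) (he v)
  have hsrc : ∀ᶠ v in 𝓝 (0 : H), ρ (e v) ∈ φ.source := by
    refine (hρe 0 heB.self_of_nhds).continuousAt.eventually ?_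
    show ∀ᶠ x in 𝓝 (ρ (e 0)), x ∈ φ.source
    rw [he0, hρq]; exact extChartAt_source_mem_nhds q
  have hu : ∀ᶠ v in 𝓝 (0 : H), ContDiffAt ℝ ∞ (fun v ↦ φ (ρ (e v))) v := by
    filter_upwards [heB, hsrc] with v h1 h2
    rw [← contMDiffAt_iff_contDiffAt]
    exact ContMDiffAt.comp (I' := 𝓘(ℝ, H)) (g := φ) (f := fun v ↦ ρ (e v)) v
      (contMDiffAt_extChartAt_of_mem h2) (hρe v h1)
  have hd : HasFDerivAt (fun v ↦ φ (ρ (e v))) (ContinuousLinearEquiv.refl ℝ H : H →L[ℝ] H) 0 := by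
    refine (hu.self_of_nhds.differentiableAt (by simp)).hasFDerivAt.congr_fderiv ?_
    rw [← md_eq_fderiv]
    refine ContinuousLinearMap.ext fun w ↦ ?_
    have a1 := md_comp_apply (g := φ) (f := fun v ↦ ρ (e v)) 0
      (contMDiffAt_extChartAt_of_mem hsrc.self_of_nhds).mdiff (hρe 0 heB.self_of_nhds).mdiff w
    have a2 := md_comp_apply (g := ρ) (f := e) 0 (hr.smooth _ heB.self_of_nhds).mdiff
      (he 0).mdiff w
    have a3 := md_comp_apply (g := fun z : E ↦ (g * lieExp G z) • o) (f := T) 0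
      ((contMDiff_mul_exp_smul (E := E) (F := F) g o).mdiff _) T.contDiff.contMDiff.contMDiffAt.mdiff w
    have a4 : md H E T 0 = T := by rw [md_eq_fderiv, ContinuousLinearMap.fderiv]
    rw [a4, map_zero, md_mul_exp_smul_zero, push_fundE_tangentCoord] at a3
    have a5 : md H H (fun p ↦ ρ (f p)) q = ContinuousLinearMap.id ℝ H := by
      rw [md_congr (g := fun p ↦ p), md_id]
      filter_upwards [hr.isOpen_left.mem_nhds hr.mem_left] with p hp
      exact hr.left_inv p hp
    have a6 := md_comp_apply (g := ρ) (f := f) q (hr.smooth _ hr.mem_right).mdiff (hf.mdiff _) w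
    rw [a5] at a6
    have a7 : md H H φ q = ContinuousLinearMap.id ℝ H := md_extChartAt_self q
    simp only [he0, hρq] at a1 a2
    rw [a1, a2, a7]
    have a8 : md H F e 0 w = md H F f q w := a3
    rw [a8, ← a6]; rfl
  obtain ⟨ψ, hψ0, -, hψ2, hψ3⟩ := exists_smooth_localInverse hu _ hd
  simp only [he0, hρq] at hψ0 hψ2 hψ3
  have hφt : Tendsto φ (𝓝 q) (𝓝 (φ q)) := (continuousAt_extChartAt q).tendsto
  have hψt : Tendsto (fun q' ↦ ψ (φ q')) (𝓝 q) (𝓝 0) := by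
    have h1 := hψ3.self_of_nhds.continuousAt.tendsto
    rw [hψ0] at h1
    exact h1.comp hφt
  have hTt : Tendsto (fun q' ↦ T (ψ (φ q'))) (𝓝 q) (𝓝 0) :=
    (T.continuous.tendsto' 0 0 (map_zero _)).comp hψt
  filter_upwards [hφt.eventually hψ2, hψt.eventually hsrc, hTt.eventually h𝒱,
    extChartAt_source_mem_nhds (I := 𝓘(ℝ, H)) q] with q' h1 h2 h3 h4
  exact ⟨_, h3, isTangent_tangentCoord _, φ.injOn h2 h4 h1⟩

/-- Near `0`, the `𝔭`-component of the derivative of the exponential map is injective on `𝔭`. -/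
theorem eventually_injOn_prP_lder (d : ReductiveDecomposition E G o) : ∀ᶠ X in 𝓝 (0 : E),
    ∀ Y ∈ d.pE, d.prP (lder (lieExp G) X Y) = 0 → Y = 0 := by
  have hc : Continuous (fun X : E ↦ d.prP ∘L lder (E := E) (lieExp G) X ∘L d.prP +
      (ContinuousLinearMap.id ℝ E - d.prP)) :=
    (continuous_const.clm_comp ((contDiff_lder_lieExp (E := E) (G := G)).continuous.clm_comp
      continuous_const)).add continuous_const
  have h0 : d.prP ∘L lder (E := E) (lieExp G) 0 ∘L d.prP + (ContinuousLinearMap.id ℝ E - d.prP) =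
      (ContinuousLinearEquiv.refl ℝ E : E →L[ℝ] E) := by
    ext Y
    simp [lder_lieExp_zero, d.prP_of_mem (d.prP_mem Y)]
  have h1 := (hc.tendsto' 0 _ h0).eventually (ContinuousLinearEquiv.nhds _)
  filter_upwards [h1] with X ⟨A, hA⟩ Y hY h2
  apply A.injective
  have h3 := DFunLike.congr_fun hA Y
  simp only [add_apply, sub_apply, ContinuousLinearMap.comp_apply, d.prP_of_mem hY, h2,
    ContinuousLinearMap.id_apply, sub_self, add_zero] at h3
  rw [map_zero]; exact h3

/-- Along a short tangential geodesic `t ↦ h exp (tX) • o` the transported tangent space stays equal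
to `S ⊓ 𝔭`. -/
theorem IsRetraction.tangentSubmodule_eq (hr : IsRetraction F H f q ρ U B)
    (hl : LiftsGeodesics H F d f) (hf : ContMDiff 𝓘(ℝ, H) 𝓘(ℝ, F) ∞ f)
    (hi : ∀ p, Function.Injective (md H F f p))
    (hS : ∀ X ∈ S, ∀ Y ∈ S, lieBL E G X Y ∈ S) (hp : ∀ X ∈ S, d.prP X ∈ S)
    (hq : q' ∈ U) (hg : f q' = h • o) (hT : tangentSubmodule H F d f q' h = S ⊓ d.pE)
    (hX : X ∈ S ⊓ d.pE) (hB : ∀ s ∈ Icc (0 : ℝ) 1, (h * lieExp G (s • X)) • o ∈ B)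
    (hinj : ∀ Y ∈ d.pE, d.prP (lder (lieExp G) X Y) = 0 → Y = 0) :
    tangentSubmodule H F d f (ρ ((h * lieExp G X) • o)) (h * lieExp G X) = S ⊓ d.pE := by
  have hT' : ∀ Y ∈ S ⊓ d.pE, IsTangent H F d f q' h Y := fun Y hY ↦ by rw [← hT] at hY; exact hY
  symm
  let A : ↥(S ⊓ d.pE) →ₗ[ℝ] ↥(S ⊓ d.pE) :=
    (d.prP ∘L lder (E := E) (lieExp G) X).toLinearMap.restrict fun Y hY ↦
      ⟨hp _ (lder_lieExp_mem hS hX.1 hY.1), d.prP_mem _⟩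
  have hA : Function.Injective A := by
    rw [injective_iff_map_eq_zero]
    intro Y hY
    exact Subtype.ext (hinj Y Y.2.2 (congrArg Subtype.val hY))
  refine Submodule.eq_of_le_of_finrank_eq (fun Y hY ↦ ?_) ?_
  · obtain ⟨Z, hZ⟩ := LinearMap.injective_iff_surjective.1 hA ⟨Y, hY⟩
    have hZ' : d.prP (lder (lieExp G) X Z) = Y := congrArg Subtype.val hZ
    rw [← hZ']
    exact hr.isTangent_lder hl hf hq hg (hT' X hX) (hT' Z Z.2) hB
  · rw [finrank_tangentSubmodule (hi _), ← hT, finrank_tangentSubmodule (hi _)]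

/-- For an isotropy element `k` of the group generated by `S`, the subspace `S ⊓ 𝔭` is invariant
under `Ad k`. -/
theorem adE_mem_inf_iff (hS : ∀ X ∈ S, ∀ Y ∈ S, lieBL E G X Y ∈ S) (hk : k ∈ expSubgroup G S)
    (hko : k • o = o) : adE E k X ∈ S ⊓ d.pE ↔ X ∈ S ⊓ d.pE := by
  have key : ∀ k ∈ expSubgroup G S, k • o = o → ∀ X ∈ S ⊓ d.pE, adE E k X ∈ S ⊓ d.pE :=
    fun k hk hko X hX ↦ ⟨adE_mem_of_mem_expSubgroup hS hk X hX.1, d.adE_mem_pE hko hX.2⟩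
  refine ⟨fun h ↦ ?_, key k hk hko X⟩
  have h1 := key k⁻¹ (inv_mem hk) (by rw [inv_smul_eq_iff, hko]) _ h
  rwa [adE_inv_adE] at h1

/-- Changing the frame at a point by an isotropy element `k` acts on tangent vectors by `Ad k`. -/
theorem isTangent_mul_iff (hko : k • o = o) :
    IsTangent H F d f q (h * k) X ↔ IsTangent H F d f q h (adE E k X) := by
  have h1 : push F (h * k) o (fundE E F G o X) = push F h o (fundE E F G o (adE E k X)) := by
    have h2 := fundE_adE (F := F) k o X
    rw [hko] at h2
    rw [push_mul_apply E, hko, h2]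
  have h3 : adE E k X ∈ d.pE ↔ X ∈ d.pE := by
    refine ⟨fun h ↦ ?_, d.adE_mem_pE hko⟩
    have := d.adE_mem_pE (k := k⁻¹) (by rw [inv_smul_eq_iff, hko]) h
    rwa [adE_inv_adE] at this
  rw [IsTangent, IsTangent, h1, h3]

/-- The transported tangent space does not depend on the choice of the group element. -/
theorem tangentSubmodule_eq_of_smul_eq (hS : ∀ X ∈ S, ∀ Y ∈ S, lieBL E G X Y ∈ S)
    (hh : h ∈ expSubgroup G S) (hT : tangentSubmodule H F d f q h = S ⊓ d.pE)
    (hg : g ∈ expSubgroup G S) (hgh : g • o = h • o) :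
    tangentSubmodule H F d f q g = S ⊓ d.pE := by
  have hko : (h⁻¹ * g) • o = o := by rw [mul_smul, hgh, inv_smul_smul]
  ext X
  rw [← adE_mem_inf_iff (o := o) hS (mul_mem (inv_mem hh) hg) hko, ← hT]
  have := isTangent_mul_iff (H := H) (F := F) (d := d) (f := f) (q := q) (h := h) (X := X) hko
  rwa [mul_inv_cancel_left] at this

variable (hf : ContMDiff 𝓘(ℝ, H) 𝓘(ℝ, F) ∞ f) (hi : ∀ p, Function.Injective (md H F f p))
  (hl : LiftsGeodesics H F d f) (hS : ∀ X ∈ S, ∀ Y ∈ S, lieBL E G X Y ∈ S)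
  (hp : ∀ X ∈ S, d.prP X ∈ S)
include hf hi hl hS hp

/-- An immersion that lifts geodesics and is tangent to the orbit of `o` at one point stays in this
orbit and is tangent to it everywhere. -/
theorem exists_mem_expSubgroup_tangentSubmodule_eq [PreconnectedSpace N] (hq : f q = o)
    (hT : tangentSubmodule H F d f q 1 = S ⊓ d.pE) (p : N) :
    ∃ h ∈ expSubgroup G S, f p = h • o ∧ tangentSubmodule H F d f p h = S ⊓ d.pE := by
  set A : Set N := {p | ∃ h ∈ expSubgroup G S, f p = h • o ∧
    tangentSubmodule H F d f p h = S ⊓ d.pE}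
  -- Nearby points are reached by the tangential exponential map, whose derivative carries tangent
  -- spaces along.
  have hopen : IsOpen A := by
    rw [isOpen_iff_mem_nhds]
    rintro p ⟨h, hh, hp1, hp2⟩
    obtain ⟨ρ, U, B, hr⟩ := exists_isRetraction hf (hi p)
    obtain ⟨δ, hδ, hB⟩ := hr.exists_radius (E := E) hp1
    filter_upwards [hr.eventually_exists_exp (d := d) hf hp1 (inter_mem (Metric.ball_mem_nhds 0 hδ)
      (eventually_injOn_prP_lder d))] with p' ⟨X, ⟨hXδ, hXi⟩, hX, hp'⟩
    have hXS : X ∈ S ⊓ d.pE := hp2 ▸ hX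
    have hXB := hB X (by simpa using hXδ)
    refine ⟨h * lieExp G X, mul_mem hh (lieExp_mem_expSubgroup hXS.1), ?_, ?_⟩
    · rw [← hp']; exact hr.apply_exp hl hr.mem_left hp1 hX hXB
    · rw [← hp']
      exact hr.tangentSubmodule_eq hl hf hi hS hp hr.mem_left hp1 hp2 hXS hXB hXi
  -- From a limit point `p`, step to some `p' ∈ A` and return along the same geodesic, now expressed
  -- through the element `h` that belongs to `p'`.
  have hclosed : IsClosed A := by
    rw [isClosed_iff_frequently]
    intro p hpA
    obtain ⟨g, hg⟩ := MulAction.exists_smul_eq G o (f p)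
    obtain ⟨ρ, U, B, hr⟩ := exists_isRetraction hf (hi p)
    obtain ⟨δ, hδ, hB⟩ := hr.exists_radius (E := E) hg.symm
    have hneg : Tendsto (fun X : E ↦ -X) (𝓝 0) (𝓝 0) := continuous_neg.tendsto' _ _ neg_zero
    obtain ⟨p', ⟨h, hh, hp1, hp2⟩, X, ⟨hXδ, hXi⟩, hX, hp'⟩ := (hpA.and_eventually
      (hr.eventually_exists_exp (d := d) hf hg.symm (inter_mem (Metric.ball_mem_nhds 0 hδ)
        (hneg.eventually (eventually_injOn_prP_lder d))))).exists
    have hXB := hB X (by simpa using hXδ)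
    have hp'U : p' ∈ U := by
      rw [← hp']; exact hr.mapsTo _ (by simpa using hXB 1 (right_mem_Icc.2 zero_le_one))
    have e1 : f p' = (g * lieExp G X) • o := by
      rw [← hp']; exact hr.apply_exp hl hr.mem_left hg.symm hX hXB
    have hX' : IsTangent H F d f p' (g * lieExp G X) X := by
      have h1 := hr.isTangent_lder hl hf hr.mem_left hg.symm hX hX hXB
      rwa [lder_lieExp_self, d.prP_of_mem hX.1, hp'] at h1
    -- the element of the isotropy group which compares the two descriptions of `f p'`
    set k := h⁻¹ * (g * lieExp G X) with hk
    have hhk : h * k = g * lieExp G X := mul_inv_cancel_left _ _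
    have hko : k • o = o := by rw [hk, mul_smul, ← e1, hp1, inv_smul_smul]
    have hW : adE E k (-X) ∈ S ⊓ d.pE := by
      rw [← hhk] at hX'
      rw [← hp2]
      exact (isTangent_mul_iff hko).1 (((tangentSubmodule H F d f p' (h * k)).neg_mem hX' :))
    have hexp : ∀ s : ℝ, (h * lieExp G (s • adE E k (-X))) • o =
        (g * lieExp G ((1 - s) • X)) • o := by
      intro s
      rw [← map_smul, lieExp_adE, smul_neg, ← neg_smul]
      have : h * (k * lieExp G (-s • X) * k⁻¹) = g * lieExp G ((1 - s) • X) * k⁻¹ := by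
        rw [sub_eq_add_neg, lieExp_add_smul, one_smul, ← mul_assoc g, ← hhk]; group
      rw [this, mul_smul, inv_smul_eq_iff.2 hko.symm]
    have hend : (h * lieExp G (adE E k (-X))) • o = f p := by
      have := hexp 1
      rwa [one_smul, sub_self, zero_smul, lieExp_zero, mul_one, hg] at this
    have hres := hr.tangentSubmodule_eq hl hf hi hS hp hp'U hp1 hp2 hW
      (fun s hs ↦ by
        rw [hexp]
        exact hXB _ ⟨by linarith [hs.2], by linarith [hs.1]⟩)
      (fun Y hY hY0 ↦ by
        have hY1 := hXi (adE E k⁻¹ Y) (d.adE_mem_pE (by rw [inv_smul_eq_iff, hko]) hY) (by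
          rw [← adE_inv_adE k (d.prP _), ← d.prP_adE F hko, ← lder_lieExp_adE, adE_adE_inv, hY0,
            map_zero])
        rw [← adE_adE_inv k Y, hY1, map_zero])
    rw [hend, hr.left_inv _ hr.mem_left] at hres
    exact ⟨_, mul_mem hh (lieExp_mem_expSubgroup hW.1), hend.symm, hres⟩
  have huniv : A = univ := IsClopen.eq_univ ⟨hclosed, hopen⟩
    ⟨q, 1, one_mem _, by rw [hq, one_smul], hT⟩
  have : p ∈ A := huniv ▸ mem_univ p
  exact this

/-- Two points with the same image have the same tangent space, that of the orbit. -/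
theorem injective_of_compatible [PreconnectedSpace N] (hq : f q = o)
    (hT : tangentSubmodule H F d f q 1 = S ⊓ d.pE)
    (hc : ∀ p p', f p = f p' →
      (∀ u, (∃ w, md H F f p w = u) ↔ ∃ w, md H F f p' w = u) → p = p') :
    Function.Injective f := by
  intro p p' hpp
  obtain ⟨h, hh, hp1, hp2⟩ :=
    exists_mem_expSubgroup_tangentSubmodule_eq hf hi hl hS hp hq hT p
  obtain ⟨h', hh', hp1', hp2'⟩ :=
    exists_mem_expSubgroup_tangentSubmodule_eq hf hi hl hS hp hq hT p'
  have hp3 := tangentSubmodule_eq_of_smul_eq hS hh' hp2' hh (by rw [← hp1, hpp, hp1'])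
  have key : ∀ {p₁ p₂ : N}, tangentSubmodule H F d f p₁ h = S ⊓ d.pE →
      tangentSubmodule H F d f p₂ h = S ⊓ d.pE → ∀ w, ∃ w', md H F f p₂ w' = md H F f p₁ w := by
    intro p₁ p₂ h1 h2 w
    have h3 : tangentCoord H F d f p₁ h w ∈ tangentSubmodule H F d f p₂ h :=
      h2 ▸ h1 ▸ isTangent_tangentCoord w
    obtain ⟨-, w', hw'⟩ := h3
    exact ⟨w', by rw [hw', push_fundE_tangentCoord]⟩
  refine hc p p' hpp fun u ↦ ⟨?_, ?_⟩
  · rintro ⟨w, rfl⟩; exact key hp2 hp3 w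
  · rintro ⟨w, rfl⟩; exact key hp3 hp2 w

/-- The image lies in the orbit, and contains it because lifted geodesics reach all short steps `h
exp(X) • o` with `X ∈ S ∩ 𝔭`. -/
theorem range_eq_orbit [PreconnectedSpace N] (hq : f q = o)
    (hT : tangentSubmodule H F d f q 1 = S ⊓ d.pE) :
    range f = {x | ∃ h ∈ expSubgroup G S, h • o = x} := by
  have hA := exists_mem_expSubgroup_tangentSubmodule_eq hf hi hl hS hp hq hT
  refine Subset.antisymm ?_ ?_
  · rintro _ ⟨p, rfl⟩
    obtain ⟨h, hh, h1, -⟩ := hA p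
    exact ⟨h, hh, h1.symm⟩
  -- the range is stable under short steps, hence under all steps
  have step1 : ∀ h ∈ expSubgroup G S, h • o ∈ range f → ∀ X ∈ S ⊓ d.pE,
      (h * lieExp G X) • o ∈ range f := by
    rintro h hh ⟨p, hpo⟩ X hX
    obtain ⟨h', hh', h1, h2⟩ := hA p
    have h3 := tangentSubmodule_eq_of_smul_eq hS hh' h2 hh (by rw [← h1, hpo])
    obtain ⟨γ, -, -, h4⟩ := hl p h X hpo (by rw [← h3] at hX; exact hX)
    exact ⟨γ 1, by rw [h4, one_smul]⟩
  obtain ⟨δ, hδ, hprod⟩ := Metric.eventually_nhds_iff_ball.1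
    (eventually_exists_product (G := G) hS d.prP hp univ_mem)
  have step2 : ∀ h ∈ expSubgroup G S, h • o ∈ range f → ∀ X ∈ S, ‖X‖ < δ →
      (h * lieExp G X) • o ∈ range f := by
    intro h hh ho X hX hXδ
    obtain ⟨u, hu, -, hexp⟩ := hprod X (by simpa using hXδ) hX
    rw [hexp, ← mul_assoc, mul_smul _ (lieExp G (u - d.prP u)), d.exp_smul_of_mem_kE F]
    · exact step1 h hh ho _ ⟨hp u hu, d.prP_mem u⟩
    · rw [← eq_sub_of_add_eq (d.prK_add_prP u)]; exact d.prK_mem u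
  have step3 : ∀ h ∈ expSubgroup G S, h • o ∈ range f → ∀ X ∈ S,
      (h * lieExp G X) • o ∈ range f := by
    intro h hh ho X hX
    obtain ⟨n, hn⟩ := exists_nat_gt (‖X‖ / δ)
    have hn0 : (0 : ℝ) < n := lt_of_le_of_lt (by positivity) hn
    have hY : ‖(n : ℝ)⁻¹ • X‖ < δ := by
      rw [norm_smul, norm_inv, Real.norm_of_nonneg hn0.le, inv_mul_lt_iff₀ hn0]
      exact (div_lt_iff₀ hδ).1 hn
    have hYS := S.smul_mem (n : ℝ)⁻¹ hX
    have hm : ∀ m : ℕ, (h * lieExp G ((n : ℝ)⁻¹ • X) ^ m) • o ∈ range f := by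
      intro m
      induction m with
      | zero => simpa using ho
      | succ m ih =>
        rw [pow_succ, ← mul_assoc]
        exact step2 _ (mul_mem hh (pow_mem (lieExp_mem_expSubgroup hYS) m)) ih _ hYS hY
    have := hm n
    rwa [← lieExp_nsmul, smul_inv_smul₀ hn0.ne'] at this
  rintro _ ⟨h, hh, rfl⟩
  have hh' := hh
  rw [expSubgroup] at hh'
  induction hh' using Subgroup.closure_induction_right with
  | one => exact ⟨q, by rw [hq, one_smul]⟩
  | mul_right x hx y hy ih =>
    obtain ⟨X, hX, rfl⟩ := hy
    exact step3 x hx (ih hx) X hX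
  | mul_inv_cancel x hx y hy ih =>
    obtain ⟨X, hX, rfl⟩ := hy
    rw [← lieExp_neg]
    exact step3 x hx (ih hx) _ (S.neg_mem hX)

/-- The orbit map of a Lie subgroup with Lie algebra `S` factors smoothly through `f`. -/
theorem exists_smooth_lift [PreconnectedSpace N] (hq : f q = o)
    (hT : tangentSubmodule H F d f q 1 = S ⊓ d.pE) (hinj : Function.Injective f)
    (L : LieSubgroup E G) [ConnectedSpace L.Carrier] (hL : L.lieE = S) :
    ∃ φ : L.Carrier → N, ContMDiff 𝓘(ℝ, L.model) 𝓘(ℝ, H) ∞ φ ∧ ∀ s, f (φ s) = L.incl s • o := by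
  have hmem : ∀ s, L.incl s ∈ expSubgroup G S := fun s ↦ by
    rw [← hL, ← SetLike.mem_coe, ← L.range_incl]; exact ⟨s, rfl⟩
  have hex : ∀ s, ∃ p, f p = L.incl s • o := fun s ↦ by
    have h1 : L.incl s • o ∈ range f := by
      rw [range_eq_orbit hf hi hl hS hp hq hT]; exact ⟨_, hmem s, rfl⟩
    exact h1
  choose φ hφ using hex
  refine ⟨φ, fun s ↦ ?_, hφ⟩
  obtain ⟨ρ, U, B, hr⟩ := exists_isRetraction hf (hi (φ s))
  obtain ⟨δ, hδ, hB⟩ := hr.exists_radius (E := E) (hφ s)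
  obtain ⟨h', hh', h1, h2⟩ :=
    exists_mem_expSubgroup_tangentSubmodule_eq hf hi hl hS hp hq hT (φ s)
  have h3 := tangentSubmodule_eq_of_smul_eq hS hh' h2 (hmem s) (by rw [← h1, hφ])
  obtain ⟨m, hmS, hm0, hm⟩ := L.exists_eventually_incl_eq s
  rw [hL] at hmS
  have hsmall : {u : E | ‖d.prP u‖ < δ} ∈ 𝓝 (0 : E) :=
    (isOpen_lt d.prP.continuous.norm continuous_const).mem_nhds (by simpa using hδ)
  have hs := L.smooth_incl_smul (F := F) o
  have hloc : ∀ᶠ s' in 𝓝 s, φ s' = ρ (L.incl s' • o) := by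
    filter_upwards [hm, hm0.eventually (eventually_exists_product (G := G) hS d.prP hp hsmall)]
      with s' e1 e2
    obtain ⟨u, hu, huδ, hexp⟩ := e2 (hmS s')
    have e3 : L.incl s' • o = (L.incl s * lieExp G (d.prP u)) • o := by
      rw [e1, hexp, ← mul_assoc, mul_smul _ (lieExp G (u - d.prP u)), d.exp_smul_of_mem_kE F]
      rw [← eq_sub_of_add_eq (d.prK_add_prP u)]; exact d.prK_mem u
    have hW : d.prP u ∈ S ⊓ d.pE := ⟨hp u hu, d.prP_mem u⟩
    rw [← h3] at hW
    apply hinj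
    rw [hφ, e3]
    exact (hr.apply_exp hl hr.mem_left (hφ s) hW (hB _ huδ)).symm
  refine ContMDiffAt.congr_of_eventuallyEq (f := fun s' ↦ ρ (L.incl s' • o)) ?_ hloc
  exact ContMDiffAt.comp (I' := 𝓘(ℝ, F)) (g := ρ) (f := fun s' ↦ L.incl s' • o) s
    (hr.smooth _ (hφ s ▸ hr.mem_right)) (hs s)

end Uniqueness

/-! ### Invariant subspaces and the equivalent conditions -/

section InvariantSubspaces

variable {E : Type*} [NormedAddCommGroup E] [NormedSpace ℝ E] [FiniteDimensional ℝ E]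
  {G : Type*} [TopologicalSpace G] [ChartedSpace E G] [Group G] [LieGroup 𝓘(ℝ, E) ∞ G] [T2Space G]
  {F : Type*} [NormedAddCommGroup F] [NormedSpace ℝ F] [FiniteDimensional ℝ F]
  {M : Type*} [TopologicalSpace M] [ChartedSpace F M] [IsManifold 𝓘(ℝ, F) ∞ M]
  [MulAction G M] [ContMDiffSMul 𝓘(ℝ, E) 𝓘(ℝ, F) ∞ G M]
  [T2Space M] [SecondCountableTopology G] [MulAction.IsPretransitive G M] {o : M}
  {d : ReductiveDecomposition E G o} {W S : Submodule ℝ E}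

namespace ReductiveDecomposition

/-- The algebraic form of invariance under the difference tensor and the curvature tensor:
`[W, W]_𝔭 ⊆ W` and `[[W, W]_𝔨, W] ⊆ W`. -/
structure IsInvariantSubspace (d : ReductiveDecomposition E G o) (W : Submodule ℝ E) : Prop where
  prP_mem : ∀ X ∈ W, ∀ Y ∈ W, d.prP (lieBL E G X Y) ∈ W
  prK_mem : ∀ X ∈ W, ∀ Y ∈ W, ∀ Z ∈ W, lieBL E G (d.prK (lieBL E G X Y)) Z ∈ W

variable (G) in
/-- The span of the brackets of elements of `W`, on the model space. -/
def bracketSpanE (W : Submodule ℝ E) : Submodule ℝ E :=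
  Submodule.span ℝ {Z | ∃ X ∈ W, ∃ Y ∈ W, lieBL E G X Y = Z}

theorem bracketSpan_eq (W : Submodule ℝ (GroupLieAlgebra 𝓘(ℝ, E) G)) :
    bracketSpan W = bracketSpanE (E := E) G W := by
  have h : {Z : GroupLieAlgebra 𝓘(ℝ, E) G | ∃ X ∈ W, ∃ Y ∈ W, ⁅X, Y⁆ = Z} =
      {Z : E | ∃ X ∈ (W : Submodule ℝ E), ∃ Y ∈ (W : Submodule ℝ E), lieBL E G X Y = Z} := by
    ext Z
    constructor
    · rintro ⟨X, hX, Y, hY, rfl⟩; exact ⟨X, hX, Y, hY, lieBL_apply (E := E) (G := G) X Y⟩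
    · rintro ⟨X, hX, Y, hY, rfl⟩; exact ⟨X, hX, Y, hY, (lieBL_apply (E := E) (G := G) X Y).symm⟩
  exact congrArg (fun s : Set E ↦ Submodule.span ℝ s) h

theorem lieBL_mem_bracketSpanE {X Y : E} (hX : X ∈ W) (hY : Y ∈ W) :
    lieBL E G X Y ∈ bracketSpanE G W := Submodule.subset_span ⟨X, hX, Y, hY, rfl⟩

namespace IsInvariantSubspace

theorem prP_mem_of_mem (h : d.IsInvariantSubspace W) {X : E} (hX : X ∈ bracketSpanE G W) :
    d.prP X ∈ W := by
  have h1 : bracketSpanE G W ≤ W.comap d.prP.toLinearMap :=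
    Submodule.span_le.2 (by rintro _ ⟨Y, hY, Z, hZ, rfl⟩; exact h.prP_mem Y hY Z hZ)
  exact h1 hX

theorem lieBL_prK_mem (h : d.IsInvariantSubspace W) {X Y : E} (hX : X ∈ bracketSpanE G W)
    (hY : Y ∈ W) : lieBL E G (d.prK X) Y ∈ W := by
  have h1 : bracketSpanE G W ≤ W.comap (((lieBL E G).flip Y) ∘L d.prK).toLinearMap :=
    Submodule.span_le.2 (by rintro _ ⟨X, hX, Z, hZ, rfl⟩; exact h.prK_mem X hX Z hZ Y hY)
  exact h1 hX

/-- The `𝔭`-parts of brackets lie in `W`. -/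
theorem sup_eq (h : d.IsInvariantSubspace W) :
    bracketSpanE G W ⊔ W = (bracketSpanE G W).map d.prK.toLinearMap ⊔ W := by
  refine le_antisymm (sup_le (fun X hX ↦ ?_) le_sup_right) (sup_le ?_ le_sup_right)
  · rw [← d.prK_add_prP X]
    exact Submodule.add_mem_sup ⟨X, hX, rfl⟩ (h.prP_mem_of_mem hX)
  · rintro _ ⟨X, hX, rfl⟩
    show d.prK X ∈ _
    rw [eq_sub_of_add_eq (d.prK_add_prP X)]
    exact Submodule.sub_mem _ (Submodule.mem_sup_left hX)
      (Submodule.mem_sup_right (h.prP_mem_of_mem hX))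

/-- `[W, W] + W` is a subalgebra, because `ad A` is a derivation that preserves `W` for `A` in
`[W, W]_𝔨`. -/
theorem lieBL_mem (h : d.IsInvariantSubspace W) : ∀ X ∈ bracketSpanE G W ⊔ W,
    ∀ Y ∈ bracketSpanE G W ⊔ W, lieBL E G X Y ∈ bracketSpanE G W ⊔ W := by
  set S := bracketSpanE G W ⊔ W with hS
  have hder : ∀ A ∈ bracketSpanE G W, ∀ X ∈ bracketSpanE G W,
      lieBL E G (d.prK A) X ∈ bracketSpanE G W := by
    intro A hA
    have h1 : bracketSpanE G W ≤ (bracketSpanE G W).comap (lieBL E G (d.prK A)).toLinearMap :=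
      Submodule.span_le.2 (by
        rintro _ ⟨X, hX, Y, hY, rfl⟩
        show lieBL E G (d.prK A) (lieBL E G X Y) ∈ bracketSpanE G W
        rw [lieBL_jacobi]
        exact Submodule.add_mem _ (lieBL_mem_bracketSpanE (h.lieBL_prK_mem hA hX) hY)
          (lieBL_mem_bracketSpanE hX (h.lieBL_prK_mem hA hY)))
    exact h1
  have hK : ∀ A ∈ bracketSpanE G W, ∀ Y ∈ S, lieBL E G (d.prK A) Y ∈ S := by
    intro A hA Y hY
    obtain ⟨b, hb, w, hw, rfl⟩ := Submodule.mem_sup.1 hY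
    rw [map_add]
    exact Submodule.add_mem_sup (hder A hA b hb) (h.lieBL_prK_mem hA hw)
  have hsplit : ∀ X ∈ S, ∃ A ∈ bracketSpanE G W, ∃ w ∈ W, d.prK A + w = X := by
    intro X hX
    rw [hS, h.sup_eq] at hX
    obtain ⟨_, ⟨A, hA, rfl⟩, w, hw, rfl⟩ := Submodule.mem_sup.1 hX
    exact ⟨A, hA, w, hw, rfl⟩
  intro X hX Y hY
  obtain ⟨A, hA, w, hw, rfl⟩ := hsplit X hX
  obtain ⟨A', hA', w', hw', rfl⟩ := hsplit Y hY
  rw [map_add (lieBL E G), add_apply]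
  refine S.add_mem (hK A hA _ hY) ?_
  rw [map_add, lieBL_skew w]
  exact S.add_mem (S.neg_mem (hK A' hA' w (Submodule.mem_sup_right hw)))
    (Submodule.mem_sup_left (lieBL_mem_bracketSpanE hw hw'))

theorem prP_mem_sup (h : d.IsInvariantSubspace W) (hW : W ≤ d.pE) {X : E}
    (hX : X ∈ bracketSpanE G W ⊔ W) : d.prP X ∈ W := by
  obtain ⟨b, hb, w, hw, rfl⟩ := Submodule.mem_sup.1 hX
  rw [map_add, d.prP_of_mem (hW hw)]
  exact W.add_mem (h.prP_mem_of_mem hb) hw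

theorem sup_inf_pE (h : d.IsInvariantSubspace W) (hW : W ≤ d.pE) :
    (bracketSpanE G W ⊔ W) ⊓ d.pE = W := by
  refine le_antisymm ?_ (le_inf le_sup_right hW)
  rintro X ⟨hX, hX'⟩
  rw [← d.prP_of_mem hX']
  exact h.prP_mem_sup hW hX

end IsInvariantSubspace

variable (F) in
include F in
/-- The part in `𝔭` of a canonically embedded subalgebra is an invariant subspace. -/
theorem isInvariantSubspace_inf (hS : ∀ X ∈ S, ∀ Y ∈ S, lieBL E G X Y ∈ S)
    (hp : ∀ X ∈ S, d.prP X ∈ S) : d.IsInvariantSubspace (S ⊓ d.pE) where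
  prP_mem X hX Y hY := ⟨hp _ (hS X hX.1 Y hY.1), d.prP_mem _⟩
  prK_mem X hX Y hY Z hZ := by
    refine ⟨hS _ ?_ Z hZ.1, d.lieBL_mem_pE F (d.prK_mem _) hZ.2⟩
    rw [eq_sub_of_add_eq (d.prK_add_prP _)]
    exact S.sub_mem (hS X hX.1 Y hY.1) (hp _ (hS X hX.1 Y hY.1))

theorem isCanonicallyEmbedded_iff {𝔰 : Submodule ℝ (GroupLieAlgebra 𝓘(ℝ, E) G)} :
    d.IsCanonicallyEmbedded 𝔰 ↔ ∀ X : E, X ∈ 𝔰 → d.prP X ∈ 𝔰 := by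
  constructor
  · intro h X hX
    let S : Submodule ℝ E := 𝔰
    have h' : S = (S ⊓ d.kE) ⊔ (S ⊓ d.pE) := h
    obtain ⟨a, ha, b, hb, rfl⟩ := Submodule.mem_sup.1 (h'.le hX)
    rw [map_add, d.prP_of_mem_kE ha.2, d.prP_of_mem hb.2, zero_add]
    exact hb.1
  · intro h
    refine le_antisymm (fun X hX ↦ ?_) (sup_le inf_le_left inf_le_left)
    change E at X
    let S : Submodule ℝ E := 𝔰
    have h1 : d.prK X ∈ S := by
      rw [eq_sub_of_add_eq (d.prK_add_prP X)]; exact S.sub_mem hX (h X hX)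
    refine Submodule.mem_sup.2 ⟨d.prK X, ⟨h1, d.prK_mem X⟩, d.prP X, ⟨h X hX, d.prP_mem X⟩, ?_⟩
    exact d.prK_add_prP X

variable (F) in
include F in
theorem fundE_injOn {X Y : E} (hX : X ∈ d.pE) (hY : Y ∈ d.pE)
    (h : fundE E F G o X = fundE E F G o Y) : X = Y := by
  have h1 := congrArg (d.jE F) h
  rwa [d.jE_fundE, d.jE_fundE, d.prP_of_mem hX, d.prP_of_mem hY] at h1

end ReductiveDecomposition

namespace LieSubgroup

variable {L : LieSubgroup E G} {U : Submodule ℝ (TangentSpace 𝓘(ℝ, F) o)}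

/-- For a canonically embedded subalgebra, the tangent space of the orbit at `o` corresponds to the
intersection with `𝔭`. -/
theorem orbitTangentSpace_eq_iff (hp : ∀ X ∈ L.lieE, d.prP X ∈ L.lieE) (hW : W ≤ d.pE)
    (hU : ∀ u : F, u ∈ U ↔ ∃ X ∈ W, fundE E F G o X = u) :
    L.orbitTangentSpace o = U ↔ L.lieE ⊓ d.pE = W := by
  have h1 : ∀ u : F, u ∈ L.orbitTangentSpace o ↔ ∃ X ∈ L.lieE ⊓ d.pE, fundE E F G o X = u := by
    intro u
    rw [L.mem_orbitTangentSpace_iff o u]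
    constructor
    · rintro ⟨X, hX, rfl⟩; exact ⟨d.prP X, ⟨hp X hX, d.prP_mem X⟩, d.fundE_prP X⟩
    · rintro ⟨X, hX, rfl⟩; exact ⟨X, hX.1, rfl⟩
  constructor
  · intro h
    have h2 : ∀ u : F, (∃ X ∈ L.lieE ⊓ d.pE, fundE E F G o X = u) ↔
        ∃ X ∈ W, fundE E F G o X = u := fun u ↦ by rw [← h1, ← hU, h]
    ext X
    constructor
    · intro hX
      obtain ⟨Y, hY, hYX⟩ := (h2 _).1 ⟨X, hX, rfl⟩
      exact d.fundE_injOn F (hW hY) hX.2 hYX ▸ hY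
    · intro hX
      obtain ⟨Y, hY, hYX⟩ := (h2 _).2 ⟨X, hX, rfl⟩
      exact d.fundE_injOn F hY.2 (hW hX) hYX ▸ hY
  · intro h
    refine Submodule.ext fun (u : F) ↦ ?_
    exact (h1 u).trans (by rw [h]; exact (hU u).symm)

end LieSubgroup

section Riemannian

variable [RiemannianBundle (fun x : M ↦ TangentSpace 𝓘(ℝ, F) x)]
  [IsContMDiffRiemannianBundle 𝓘(ℝ, F) ∞ F (fun x : M ↦ TangentSpace 𝓘(ℝ, F) x)]
  {U : Submodule ℝ (TangentSpace 𝓘(ℝ, F) o)}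

theorem isDInvariant_iff_at_base (hiso : ActsIsometrically F G M) (hd : d.IsNaturallyReductive F)
    (hW : W ≤ d.pE) (hU : ∀ u : F, u ∈ U ↔ ∃ X ∈ W, fundE E F G o X = u) :
    d.IsDInvariant o U ↔ ∀ X ∈ W, ∀ Y ∈ W, d.prP (lieBL E G X Y) ∈ W := by
  have key : ∀ (x : M) (U : Submodule ℝ (TangentSpace 𝓘(ℝ, F) x)), (1 : G) • o = x →
      (∀ u : F, u ∈ U ↔ ∃ X ∈ W, fundE E F G o X = u) →
      (d.IsDInvariant x U ↔ ∀ X ∈ W, ∀ Y ∈ W, d.prP (lieBL E G X Y) ∈ W) := by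
    rintro _ U rfl hU
    refine isDInvariant_iff hiso d hd 1 hW fun u ↦ (hU u).trans ?_
    rw [push_one]; rfl
  exact key o U (one_smul G o) hU

/-- Invariance under the Riemannian curvature and `D`, in algebraic terms. -/
theorem leviCivita_and_isDInvariant_iff (hiso : ActsIsometrically F G M)
    (hd : d.IsNaturallyReductive F) (hW : W ≤ d.pE)
    (hU : ∀ u : F, u ∈ U ↔ ∃ X ∈ W, fundE E F G o X = u) :
    IsCurvatureInvariant (leviCivita F M) o U ∧ d.IsDInvariant o U ↔ d.IsInvariantSubspace W := by
  rw [isDInvariant_iff_at_base hiso hd hW hU]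
  constructor
  · rintro ⟨h1, h2⟩
    exact ⟨h2, (isCurvatureInvariant_leviCivita_iff hiso d hd hW hU h2).1 h1⟩
  · intro h
    exact ⟨(isCurvatureInvariant_leviCivita_iff hiso d hd hW hU h.prP_mem).2 h.prK_mem, h.prP_mem⟩

/-- Invariance under the canonical curvature and `D`, in algebraic terms. -/
theorem canonicalConnection_and_isDInvariant_iff (hiso : ActsIsometrically F G M)
    (hd : d.IsNaturallyReductive F) (hW : W ≤ d.pE)
    (hU : ∀ u : F, u ∈ U ↔ ∃ X ∈ W, fundE E F G o X = u) :
    IsCurvatureInvariant d.canonicalConnection o U ∧ d.IsDInvariant o U ↔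
      d.IsInvariantSubspace W := by
  rw [isDInvariant_iff_at_base hiso hd hW hU,
    isCurvatureInvariant_canonicalConnection_iff d hW hU]
  exact ⟨fun h ↦ ⟨h.2, h.1⟩, fun h ↦ ⟨h.prK_mem, h.prP_mem⟩⟩

namespace ImmersedSubmanifold

variable {N : ImmersedSubmanifold F M} {p : N.Carrier}

theorem tangentSubmodule_eq (hW : W ≤ d.pE)
    (hU : ∀ u : F, u ∈ U ↔ ∃ X ∈ W, fundE E F G o X = u) (h : N.gaussMap p = ⟨o, U⟩) :
    tangentSubmodule (EuclideanSpace ℝ (Fin N.dim)) F d N.toFun p 1 = W := by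
  have h1 := (gaussMap_eq_iff.1 h).2
  ext X
  constructor
  · rintro ⟨hX, hw⟩
    rw [push_one] at hw
    obtain ⟨Y, hY, hYX⟩ := (hU _).1 ((h1 _).1 hw)
    exact d.fundE_injOn F (hW hY) hX hYX ▸ hY
  · intro hX
    refine ⟨hW hX, ?_⟩
    rw [push_one]
    exact (h1 _).2 ((hU _).2 ⟨X, hX, rfl⟩)

theorem liftsGeodesics (hiso : ActsIsometrically F G M) (hd : d.IsNaturallyReductive F)
    (hc : N.IsComplete) (ht : N.IsTotallyGeodesic) :
    LiftsGeodesics (EuclideanSpace ℝ (Fin N.dim)) F d N.toFun := by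
  refine _root_.liftsGeodesics hiso hd hc (fun γ hγ ↦ ?_) N.contMDiff
  rw [metricOf_id]
  exact ht γ univ isOpen_univ ordConnected_univ hγ

/-- The tangent space of a complete, `D`-invariant totally geodesic submanifold is an invariant
subspace. -/
theorem isInvariantSubspace (hiso : ActsIsometrically F G M) (hd : d.IsNaturallyReductive F)
    (hW : W ≤ d.pE) (hU : ∀ u : F, u ∈ U ↔ ∃ X ∈ W, fundE E F G o X = u)
    (hc : N.IsComplete) (ht : N.IsTotallyGeodesic)
    (hD : d.IsDInvariant (N.toFun p) (N.tangentSpace p)) (h : N.gaussMap p = ⟨o, U⟩) :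
    d.IsInvariantSubspace W := by
  have hD' : d.IsDInvariant o U := by
    have key : ∀ z : Σ x : M, Submodule ℝ (TangentSpace 𝓘(ℝ, F) x), N.gaussMap p = z →
        d.IsDInvariant z.1 z.2 := by rintro _ rfl; exact hD
    exact key _ h
  have hD1 := (isDInvariant_iff_at_base hiso hd hW hU).1 hD'
  have hT := tangentSubmodule_eq hW hU h
  have hT' : ∀ X, X ∈ W ↔ IsTangent (EuclideanSpace ℝ (Fin N.dim)) F d N.toFun p 1 X := fun X ↦ by
    rw [← hT]; rfl
  refine ⟨hD1, fun X hX Y hY Z hZ ↦ d.lieBL_prK_mem_of_polarization F hW hD1 ?_ hX hY hZ⟩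
  intro X hX Y hY
  refine d.lieBL_prK_mem_of_roundTrip F hW hD1 hX hY ?_
  filter_upwards [eventually_roundTrip N.contMDiff (N.injective_mfderiv p)
    (N.liftsGeodesics hiso hd hc ht) (gaussMap_eq_iff.1 h).1 ((hT' X).1 hX) ((hT' Y).1 hY)]
    with t ht
  exact (hT' _).2 ht

/-- A complete, compatible totally geodesic submanifold that is tangent to an orbit is this
orbit. -/
theorem eq_orbit (hiso : ActsIsometrically F G M) (hd : d.IsNaturallyReductive F)
    (hU : ∀ u : F, u ∈ U ↔ ∃ X ∈ S ⊓ d.pE, fundE E F G o X = u)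
    (hS : ∀ X ∈ S, ∀ Y ∈ S, lieBL E G X Y ∈ S) (hp : ∀ X ∈ S, d.prP X ∈ S)
    [ConnectedSpace N.Carrier] (hcomp : N.IsCompatible)
    (hc : N.IsComplete) (ht : N.IsTotallyGeodesic) (h : N.gaussMap p = ⟨o, U⟩)
    (L : LieSubgroup E G) [ConnectedSpace L.Carrier] (hL : L.lieE = S) :
    Function.Injective N.toFun ∧ range N.toFun = range (fun s : L.Carrier ↦ L.incl s • o) ∧
      ∃ φ : L.Carrier → N.Carrier, ContMDiff (𝓡 L.dim) (𝓡 N.dim) ∞ φ ∧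
        ∀ s, N.toFun (φ s) = L.incl s • o := by
  have hl : LiftsGeodesics (EuclideanSpace ℝ (Fin N.dim)) F d N.toFun :=
    N.liftsGeodesics hiso hd hc ht
  have hq := (gaussMap_eq_iff.1 h).1
  have hT : tangentSubmodule (EuclideanSpace ℝ (Fin N.dim)) F d N.toFun p 1 = S ⊓ d.pE :=
    tangentSubmodule_eq inf_le_right hU h
  have hinj : Function.Injective N.toFun := by
    refine injective_of_compatible N.contMDiff N.injective_mfderiv hl hS hp hq hT ?_
    intro p p' h1 h2
    refine hcomp (gaussMap_eq_iff (x := N.toFun p') (U := N.tangentSpace p') |>.2 ⟨h1, fun u ↦ ?_⟩)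
    exact h2 u
  refine ⟨hinj, ?_, exists_smooth_lift N.contMDiff N.injective_mfderiv hl hS hp hq hT hinj L hL⟩
  rw [range_eq_orbit N.contMDiff N.injective_mfderiv hl hS hp hq hT]
  have hr : range L.incl = expSubgroup G S := by rw [L.range_incl, hL]
  ext x
  constructor
  · rintro ⟨g, hg, rfl⟩
    have hg' : g ∈ range L.incl := by rw [hr]; exact hg
    obtain ⟨s, rfl⟩ := hg'
    exact ⟨s, rfl⟩
  · rintro ⟨s, rfl⟩
    refine ⟨L.incl s, ?_, rfl⟩
    rw [← SetLike.mem_coe, ← hr]; exact ⟨s, rfl⟩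

end ImmersedSubmanifold

end Riemannian

end InvariantSubspaces

/-! ### The characterisation of the invariant totally geodesic submanifolds -/

theorem mainTheorem9
    {EG : Type*} [NormedAddCommGroup EG] [NormedSpace ℝ EG] [FiniteDimensional ℝ EG]
    {EM : Type*} [NormedAddCommGroup EM] [NormedSpace ℝ EM] [FiniteDimensional ℝ EM]
    {G : Type*} [TopologicalSpace G] [T2Space G] [SecondCountableTopology G] [ConnectedSpace G]
    [ChartedSpace EG G] [Group G] [LieGroup 𝓘(ℝ, EG) ∞ G]
    {M : Type*} [TopologicalSpace M] [T2Space M] [SecondCountableTopology M]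
    [ChartedSpace EM M] [IsManifold 𝓘(ℝ, EM) ∞ M]
    [RiemannianBundle (fun x : M ↦ TangentSpace 𝓘(ℝ, EM) x)]
    [IsContMDiffRiemannianBundle 𝓘(ℝ, EM) ∞ EM (fun x : M ↦ TangentSpace 𝓘(ℝ, EM) x)]
    [MulAction G M] [ContMDiffSMul 𝓘(ℝ, EG) 𝓘(ℝ, EM) ∞ G M] [MulAction.IsPretransitive G M]
    (isometric : ∀ (g : G) (x : M) (u v : TangentSpace 𝓘(ℝ, EM) x),
      (inner ℝ (mfderiv 𝓘(ℝ, EM) 𝓘(ℝ, EM) (fun y : M ↦ g • y) x u)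
        (mfderiv 𝓘(ℝ, EM) 𝓘(ℝ, EM) (fun y : M ↦ g • y) x v) : ℝ) = inner ℝ u v)
    (almostEffective : DiscreteTopology (⨅ p : M, MulAction.stabilizer G p : Subgroup G))
    (o : M) (d : ReductiveDecomposition EG G o) (naturallyReductive : d.IsNaturallyReductive EM)
    (𝔳 : Submodule ℝ (GroupLieAlgebra 𝓘(ℝ, EG) G)) (h𝔳 : 𝔳 ≤ d.𝔭)
    (V : Submodule ℝ (TangentSpace 𝓘(ℝ, EM) o))
    (hV : V = 𝔳.map (fundamentalMap EG G o).toLinearMap) :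
    List.TFAE [
      IsCurvatureInvariant (leviCivita EM M) o V ∧ d.IsDInvariant o V,
      IsCurvatureInvariant d.canonicalConnection o V ∧ d.IsDInvariant o V,
      ∃ S : LieSubgroup EG G, ConnectedSpace S.Carrier ∧
        d.IsCanonicallyEmbedded S.lieAlgebra ∧ S.orbitTangentSpace o = V,
      ∃ N : ImmersedSubmanifold EM M, ConnectedSpace N.Carrier ∧
        Function.Injective N.toFun ∧ N.IsComplete ∧ N.IsTotallyGeodesic ∧
        (∀ p, d.IsDInvariant (N.toFun p) (N.tangentSpace p)) ∧ ∃ p, N.gaussMap p = ⟨o, V⟩] ∧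
    (IsCurvatureInvariant (leviCivita EM M) o V ∧ d.IsDInvariant o V →
      bracketSpan 𝔳 ⊔ 𝔳 = (bracketSpan 𝔳).map d.proj𝔨 ⊔ 𝔳 ∧
      Disjoint ((bracketSpan 𝔳).map d.proj𝔨) 𝔳 ∧
      (∃ S : LieSubgroup EG G, ConnectedSpace S.Carrier ∧
        S.lieAlgebra = bracketSpan 𝔳 ⊔ 𝔳) ∧
      ∀ S : LieSubgroup EG G, ConnectedSpace S.Carrier →
        S.lieAlgebra = bracketSpan 𝔳 ⊔ 𝔳 →
        d.IsCanonicallyEmbedded S.lieAlgebra ∧ S.orbitTangentSpace o = V ∧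
        ∀ N : ImmersedSubmanifold EM M, ConnectedSpace N.Carrier → N.IsCompatible →
          N.IsComplete → N.IsTotallyGeodesic → (∃ p, N.gaussMap p = ⟨o, V⟩) →
          Function.Injective N.toFun ∧
          Set.range N.toFun = Set.range (fun s : S.Carrier ↦ S.incl s • o) ∧
          ∃ h : S.Carrier → N.Carrier, ContMDiff (𝓡 S.dim) (𝓡 N.dim) ∞ h ∧
            ∀ s, N.toFun (h s) = S.incl s • o) := by

  have hiso : ActsIsometrically EM G M := isometric
  let W : Submodule ℝ EG := 𝔳
  have hW : W ≤ d.pE := h𝔳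
  have hU : ∀ u : EM, u ∈ V ↔ ∃ X ∈ W, fundE EG EM G o X = u := fun u ↦ by subst hV; exact Iff.rfl
  have h1 := leviCivita_and_isDInvariant_iff hiso naturallyReductive hW hU
  have h2 := canonicalConnection_and_isDInvariant_iff hiso naturallyReductive hW hU
  set S : Submodule ℝ EG := ReductiveDecomposition.bracketSpanE G W ⊔ W with hSdef
  have hS : bracketSpan 𝔳 ⊔ 𝔳 = S :=
    congrArg (fun B : Submodule ℝ EG ↦ B ⊔ W) (ReductiveDecomposition.bracketSpan_eq 𝔳)
  -- the properties of the subgroups with Lie algebra `[𝔳, 𝔳] + 𝔳`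
  have hsub : d.IsInvariantSubspace W → ∀ L : LieSubgroup EG G, L.lieE = S →
      d.IsCanonicallyEmbedded L.lieAlgebra ∧ L.orbitTangentSpace o = V := by
    intro h L hL
    have hp : ∀ X ∈ L.lieE, d.prP X ∈ L.lieE := by
      rw [hL]; exact fun X hX ↦ Submodule.mem_sup_right (h.prP_mem_sup hW hX)
    refine ⟨ReductiveDecomposition.isCanonicallyEmbedded_iff.2 hp,
      (LieSubgroup.orbitTangentSpace_eq_iff hp hW hU).2 ?_⟩
    rw [hL]; exact h.sup_inf_pE hW
  have hex : d.IsInvariantSubspace W → ∃ L : LieSubgroup EG G, ConnectedSpace L.Carrier ∧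
      L.lieE = S := by
    intro h
    obtain ⟨L, hL, hLS⟩ := exists_lieSubgroup (G := G) h.lieBL_mem
    exact ⟨L, hL, Submodule.ext hLS⟩
  have hU' : d.IsInvariantSubspace W →
      ∀ u : EM, u ∈ V ↔ ∃ X ∈ S ⊓ d.pE, fundE EG EM G o X = u := by
    intro h; rw [hSdef, h.sup_inf_pE hW]; exact hU
  refine ⟨?_, fun h ↦ ?_⟩
  · tfae_have 1 ↔ 2 := h1.trans h2.symm
    tfae_have 2 → 3 := by
      intro h
      obtain ⟨L, hL, hLS⟩ := hex (h2.1 h)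
      exact ⟨L, hL, hsub (h2.1 h) L hLS⟩
    tfae_have 3 → 2 := by
      rintro ⟨L, hL, hcan, htan⟩
      have hp := ReductiveDecomposition.isCanonicallyEmbedded_iff.1 hcan
      have hLW : L.lieE ⊓ d.pE = W := (LieSubgroup.orbitTangentSpace_eq_iff hp hW hU).1 htan
      rw [h2, ← hLW]
      exact ReductiveDecomposition.isInvariantSubspace_inf EM (fun X hX Y hY ↦ L.lieBL_mem hX hY) hp
    tfae_have 2 → 4 := by
      intro h
      have h' := h2.1 h
      exact exists_orbit_submanifold hiso d naturallyReductive h'.lieBL_mem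
        (fun X hX ↦ Submodule.mem_sup_right (h'.prP_mem_sup hW hX)) (hU' h')
    tfae_have 4 → 2 := by
      rintro ⟨N, -, -, hc, ht, hD, p, hp⟩
      exact h2.2 (N.isInvariantSubspace hiso naturallyReductive hW hU hc ht (hD p) hp)
    tfae_finish
  · have h' := h1.1 h
    refine ⟨?_, ?_, ?_, ?_⟩
    · rw [hS, ReductiveDecomposition.bracketSpan_eq]; exact h'.sup_eq
    · refine Disjoint.mono (?_ : _ ≤ d.𝔨) h𝔳 d.isCompl.disjoint
      rintro _ ⟨X, -, rfl⟩
      exact d.prK_mem X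
    · obtain ⟨L, hL, hLS⟩ := hex h'
      exact ⟨L, hL, hLS.trans hS.symm⟩
    · intro L hL hLS
      have hLS' : L.lieE = S := hLS.trans hS
      refine ⟨(hsub h' L hLS').1, (hsub h' L hLS').2, ?_⟩
      rintro N hN hcomp hc ht ⟨p, hp⟩
      exact N.eq_orbit hiso naturallyReductive (hU' h') h'.lieBL_mem
        (fun X hX ↦ Submodule.mem_sup_right (h'.prP_mem_sup hW hX)) hcomp hc ht hp L hLS'
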